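/- **Setting.** Let $c,d$ be positive integers, $\alpha,\delta\in(0,1]$, and let $C_0\subseteq\mathbb F_2^d$ be a linear code with minimum distance $d_0$ (so $C_0\neq 0$). A $(c,d,\alpha,\delta)$-bipartite expander is a bipartite graph $G=(L\cup R,E)$ in which all left vertices have degree $c$, all right vertices have degree $d$, and $|N(S)|\ge\delta c|S|$ for all $S\subseteq L$ with $|S|\le\alpha|L|$. Let $L=[n]$, fix a total order on each $N(v)$, $v\in R$, and let $T(G,C_0)=\{x\in\mathbb F_2^n: x_{N(v)}\in C_0\text{ for all }v\in R\}$, where $x_{N(v)}\in\mathbb F_2^d$ is the restriction of $x$ to $N(v)$. Let $U(x)=\{v\in R:x_{N(v)}\notin C_0\}$. For $k>1$ let $f_\delta(k)$ be the infimum of $\frac1k\sum_{i\ge1}\beta_i$ over all sequences $\beta_i\ge0$ $(i\ge1)$ with $\sum_{i\ge1} i\beta_i=k$ and $\sum_{i\ge1}\bigl(1-(1-\frac1k)^i\bigr)\beta_i\ge\delta$, and let $f_\delta^{-1}$ be the inverse of $f_\delta:(1,\infty)\to\mathbb R$. **Flipping.** Put $t=d_0/2$. Given $x$, let $w_v\in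 C_0$ be the codeword closest to $x_{N(v)}$ (the lexicographically smallest one in case of ties). Start with $p_i=0$ for $i\in[n]$, and for each $v\in R$ with $1\le d_H(w_v,x_{N(v)})<t$ add $\frac{t-d_H(w_v,x_{N(v)})}{ct}$ to $p_i$, where $i$ is the first element of $N(v)$ at which $w_v$ and $x_{N(v)}$ differ. RandFlip$(x)$ flips each bit $x_i$ independently with probability $p_i$; DeterFlip$(x,q)$ flips all bits $x_i$ with $p_i=q$. **RandDecode$(x)$.** While $U(x)\ne\emptyset$, replace $x$ by RandFlip$(x)$; then return $x$. **MainDecode$(x)$ with expansion parameters $(a,b)$.** Put $W^*=\{\frac j{cd_0}:1\le j\le cd_0\}$, $\gamma=(1+\frac ct)^{-1}\frac{bd_0-1}{d_0-1}a$, $\rho=\frac{(t-1/b)\,b}{2ct^2}$, $s=\bigl\lceil\log\frac{bd_0-1}{2(d_0-1)}/\log(1-\rho)\bigr\rceil$, $r=\lceil\log\gamma/\log(1-\rho)\rceil$ and $r'=\lceil\log_2(\gamma n)\rceil+1$. DeepFlip$(x)$ goes in lexicographic order through all $(q_1,\dots,q_s)\in (W^*)^s$ and forms $x^{(0)}=x$,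 $x^{(i)}=$ DeterFlip$(x^{(i-1)},q_i)$, abandoning the sequence as soon as $|U(x^{(i)})|>c\gamma n$; among the words $x^{(s)}$ so reached it returns the first one with $|U(x^{(s)})|$ minimal, and $\bot$ if there is none. MainDecode$(x)$ goes in lexicographic order through all $(q_1,\dots,q_r)\in (W^*)^r$. For each of them it sets $\hat x\gets x$, then $\hat x\gets$ DeterFlip$(\hat x,q_i)$ for $i=1,\dots,r$, and then for $i=1,\dots,r'$ it sets $\hat x\gets$ DeepFlip$(\hat x)$ and abandons the sequence if $\hat x=\bot$ or $|U(\hat x)|>c2^{-i}\gamma n$. It returns $\hat x$ as soon as a sequence that is not abandoned ends with $|U(\hat x)|=0$ and $d_H(x,\hat x)\le an$. **Theorem.** Suppose $\delta d_0>2$, let $\epsilon\in(0,\delta-\frac2{d_0})$, and put $\delta'=\frac2{d_0}+\epsilon$. If $\delta<1$, there is exactly one $k>1$ with $f_\delta(k)=\delta'$, so that $k=f_\delta^{-1}(\delta')$ is well defined. Moreover, there are a constant $K$, a function $\eta(n)\to0$, a randomized RAM program implementing RandDecode and a deterministic RAM program implementing MainDecode with expansion parameters $(k\alpha,\delta')$,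 all depending only on $c,d,\alpha,\delta,\epsilon,C_0$, such that for all sufficiently large $n$, all $(c,d,\alpha,\delta)$-bipartite expanders $G$ with $n$ left vertices, and all $x\in\mathbb F_2^n$ and $y\in T(G,C_0)$ with $$d_H(x,y)\le f_\delta^{-1}\Bigl(\frac2{d_0}+\epsilon\Bigr)\alpha n,$$ the following hold on the input $(G,x)$: 1. the program for RandDecode outputs $y$ within $Kn$ steps with probability at least $1-\eta(n)$; 2. MainDecode outputs $y$, and its program does so within $Kn$ steps. (For $\delta=1$ the function $f_\delta$ is constant and $f_\delta^{-1}(\delta')$ is not defined, but then no such graph exists for large $n$ and the last assertion is void.) -/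

import Mathlib

open Filter Topology
open scoped ENNReal NNReal

noncomputable section

/-! ### Bipartite expanders and Tanner codes -/

/-- Words of length `n` over the field with two elements. -/
abbrev Word (n : ℕ) : Type := Fin n → ZMod 2

/-- A `(c, d)`-regular bipartite graph with left vertices `Fin n` and right vertices `Fin m`, given
by its adjacency lists. `right v i` is the `i`-th neighbour of `v` in the total order that is fixed
on the neighbourhood of the right vertex `v`. -/
structure TannerGraph (c d n m : ℕ) where
  left : Fin n → Fin c → Fin m
  right : Fin m → Fin d → Fin n
  left_injective : ∀ u, Function.Injective (left u)
  right_injective : ∀ v, Function.Injective (right v)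
  adj_iff : ∀ u v, (∃ j, left u j = v) ↔ (∃ i, right v i = u)

namespace TannerGraph

variable {c d n m : ℕ}

/-- The set `N(S)` of neighbours of a set `S` of left vertices. -/
def neighbors (G : TannerGraph c d n m) (S : Finset (Fin n)) : Finset (Fin m) :=
  S.biUnion fun u => Finset.univ.image (G.left u)

/-- `G` is a `(c, d, α, δ)`-bipartite expander. -/
def IsExpander (G : TannerGraph c d n m) (α δ : ℝ) : Prop :=
  ∀ S : Finset (Fin n), (S.card : ℝ) ≤ α * n → δ * c * S.card ≤ ((G.neighbors S).card : ℝ)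

/-- The local view `x_{N(v)}` of the word `x` at the right vertex `v`. -/
def localView (G : TannerGraph c d n m) (x : Word n) (v : Fin m) : Word d :=
  fun i => x (G.right v i)

/-- The Tanner code `T(G, C₀)`. -/
def tannerCode (G : TannerGraph c d n m) (C₀ : Submodule (ZMod 2) (Word d)) :
    Submodule (ZMod 2) (Word n) where
  carrier := {x | ∀ v, G.localView x v ∈ C₀}
  add_mem' := fun hx hy v => C₀.add_mem (hx v) (hy v)
  zero_mem' := fun _ => C₀.zero_mem
  smul_mem' := fun a _ hx v => C₀.smul_mem a (hx v)

open Classical in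
/-- The set `U(x)` of unsatisfied checks. -/
def unsat (G : TannerGraph c d n m) (C₀ : Submodule (ZMod 2) (Word d)) (x : Word n) :
    Finset (Fin m) :=
  Finset.univ.filter fun v => G.localView x v ∉ C₀

end TannerGraph

/-- `d₀` is the minimum distance of the code `C` (which then has two distinct codewords). -/
def IsMinDist {d : ℕ} (C : Submodule (ZMod 2) (Word d)) (d₀ : ℕ) : Prop :=
  IsLeast {k | ∃ x ∈ C, ∃ y ∈ C, x ≠ y ∧ hammingDist x y = k} d₀

/-! ### The size-expansion function -/

/-- The size-expansion function `f_δ(k)`: the value of the linear program in the variables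
`β₁, β₂, …`, where `β i` stands for the variable of index `i + 1`. -/
def sizeExpansion (δ k : ℝ) : ℝ :=
  sInf {v | ∃ β : ℕ → ℝ, (∀ i, 0 ≤ β i) ∧
    HasSum (fun i : ℕ => ((i : ℝ) + 1) * β i) k ∧
    δ ≤ ∑' i : ℕ, (1 - (1 - 1 / k) ^ (i + 1)) * β i ∧
    v = 1 / k * ∑' i : ℕ, β i}

/-- The inverse of the size-expansion function `f_δ : (1, ∞) → ℝ`. -/
def sizeExpansionInv (δ v : ℝ) : ℝ :=
  Function.invFunOn (sizeExpansion δ) (Set.Ioi 1) v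

/-! ### The randomized decoder -/

/-- All words of length `d`, in lexicographic order. -/
def lexWords : (d : ℕ) → List (Word d)
  | 0 => [Fin.elim0]
  | d + 1 => [0, 1].flatMap fun b => (lexWords d).map fun w => Fin.cons b w

open Classical in
/-- `Decode`: the codeword of `C₀` closest to `x`, the lexicographically smallest one in case of
ties (`List.argmin` returns the first minimizer). -/
def localDecode {d : ℕ} (C₀ : Submodule (ZMod 2) (Word d)) (x : Word d) : Word d :=
  (((lexWords d).filter fun w => w ∈ C₀).argmin fun w => hammingDist w x).getD 0

/-- The word `x` with its bit `u` flipped. -/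
def flipBit {n : ℕ} (x : Word n) (u : Fin n) : Word n :=
  Function.update x u (x u + 1)

/-- A coin that shows `true` with probability `min p 1` (with probability `0` if `p` is negative). -/
def coin (p : ℝ) : PMF Bool :=
  PMF.ofFintype
    (fun b => if b then min (ENNReal.ofReal p) 1 else 1 - min (ENNReal.ofReal p) 1) (by
      simp [add_tsub_cancel_of_le])

namespace TannerGraph

variable {c d n m : ℕ}

/-- The distance `d_H(w_v, x_{N(v)})`, where `w_v = Decode(x_{N(v)})`. -/
def localDist (G : TannerGraph c d n m) (C₀ : Submodule (ZMod 2) (Word d)) (x : Word n)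
    (v : Fin m) : ℕ :=
  hammingDist (localDecode C₀ (G.localView x v)) (G.localView x v)

/-- The smallest element of `N(v)`, in the order fixed on `N(v)`, at which `w_v` and `x_{N(v)}`
differ. -/
def voteTarget (G : TannerGraph c d n m) (C₀ : Submodule (ZMod 2) (Word d)) (x : Word n)
    (v : Fin m) : Option (Fin n) :=
  ((List.finRange d).find? fun i =>
    decide (localDecode C₀ (G.localView x v) i ≠ G.localView x v i)).map (G.right v)

open Classical in
/-- The number `p_u` computed by the flipping algorithms on the word `x`, with `t = d₀ / 2`. -/
def flipProb (G : TannerGraph c d n m) (C₀ : Submodule (ZMod 2) (Word d)) (d₀ : ℕ) (x : Word n)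
    (u : Fin n) : ℝ :=
  ∑ v : Fin m,
    if 1 ≤ G.localDist C₀ x v ∧ (G.localDist C₀ x v : ℝ) < (d₀ : ℝ) / 2 ∧
        G.voteTarget C₀ x v = some u then
      ((d₀ : ℝ) / 2 - G.localDist C₀ x v) / (c * ((d₀ : ℝ) / 2))
    else 0

/-- `RandFlip(x)`: the bits are flipped independently, the bit `u` with probability `p_u`.
(The truncation at `1` is never active, since `p_u` is a sum of at most `c` terms, each at most
`1 / c`.) -/
def randFlip (G : TannerGraph c d n m) (C₀ : Submodule (ZMod 2) (Word d)) (d₀ : ℕ) (x : Word n) :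
    PMF (Word n) :=
  (List.finRange n).foldlM
    (fun z u =>
      (coin (G.flipProb C₀ d₀ x u)).map
        fun b => if b then flipBit z u else z) x

/-- `RandDecode(x)`, interrupted (with the result `none`) when the loop condition has been tested
`T` times without success. -/
def randDecodeWithin (G : TannerGraph c d n m) (C₀ : Submodule (ZMod 2) (Word d)) (d₀ : ℕ) :
    ℕ → Word n → PMF (Option (Word n))
  | 0, _ => PMF.pure none
  | T + 1, x =>
    if 0 < (G.unsat C₀ x).card then
      (G.randFlip C₀ d₀ x).bind (randDecodeWithin G C₀ d₀ T)
    else PMF.pure (some x)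

/-- The probability that `RandDecode(x)` terminates and outputs `z`. -/
def randDecodeProb (G : TannerGraph c d n m) (C₀ : Submodule (ZMod 2) (Word d)) (d₀ : ℕ)
    (x z : Word n) : ℝ≥0∞ :=
  ⨆ T : ℕ, G.randDecodeWithin C₀ d₀ T x (some z)

/-! ### The deterministic decoder -/

open Classical in
/-- `DeterFlip(x, q)`. -/
def deterFlip (G : TannerGraph c d n m) (C₀ : Submodule (ZMod 2) (Word d)) (d₀ : ℕ) (x : Word n)
    (q : ℝ) : Word n :=
  fun u => if G.flipProb C₀ d₀ x u = q then x u + 1 else x u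

end TannerGraph

/-- All sequences of length `s` over `W \ {0} = {j / (c d₀) : 1 ≤ j ≤ c d₀}`, in lexicographic
order. -/
def guessSeqs (c d₀ : ℕ) : ℕ → List (List ℝ)
  | 0 => [[]]
  | s + 1 => (List.range (c * d₀)).flatMap fun j =>
      (guessSeqs c d₀ s).map fun l => (((j : ℝ) + 1) / ((c : ℝ) * d₀)) :: l

/-- The constant `γ = (1 + c / t)⁻¹ (δ d₀ - 1) / (d₀ - 1) α`, with `t = d₀ / 2`. -/
def gammaConst (c d₀ : ℕ) (α δ : ℝ) : ℝ :=
  (1 + c / ((d₀ : ℝ) / 2))⁻¹ * ((δ * d₀ - 1) / (d₀ - 1)) * α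

/-- The constant `ε₀ δ / (2 c t²)`, with `t = d₀ / 2` and `ε₀ = t - 1 / δ`. -/
def rateConst (c d₀ : ℕ) (δ : ℝ) : ℝ :=
  (((d₀ : ℝ) / 2 - 1 / δ) * δ) / (2 * c * ((d₀ : ℝ) / 2) ^ 2)

namespace TannerGraph

variable {c d n m : ℕ}

/-- One run of the inner loop of `DeepFlip`: the bits are flipped successively for the guesses in
the list; the result is `none` if more than `B` checks are unsatisfied at some point. -/
def deepBranch (G : TannerGraph c d n m) (C₀ : Submodule (ZMod 2) (Word d)) (d₀ : ℕ) (B : ℝ) :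
    List ℝ → Word n → Option (Word n)
  | [], x => some x
  | q :: qs, x =>
    if B < ((G.unsat C₀ (G.deterFlip C₀ d₀ x q)).card : ℝ) then none
    else deepBranch G C₀ d₀ B qs (G.deterFlip C₀ d₀ x q)

/-- `DeepFlip(x)`; the result `none` stands for `⊥`. The folded pair is `(k_min, x_min)`. -/
def deepFlip (G : TannerGraph c d n m) (C₀ : Submodule (ZMod 2) (Word d)) (d₀ : ℕ) (α δ : ℝ)
    (x : Word n) : Option (Word n) :=
  ((guessSeqs c d₀
      ⌈Real.log ((δ * d₀ - 1) / (2 * (d₀ - 1))) / Real.log (1 - rateConst c d₀ δ)⌉₊).foldl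
    (fun best qs =>
      match G.deepBranch C₀ d₀ (c * gammaConst c d₀ α δ * n) qs x with
      | none => best
      | some z => if (G.unsat C₀ z).card < best.1 then ((G.unsat C₀ z).card, some z) else best)
    ((m + 1, none) : ℕ × Option (Word n))).2

/-- The second inner loop of `MainDecode`: iterations number `i, i + 1, …, i + j - 1`. -/
def deepLoop (G : TannerGraph c d n m) (C₀ : Submodule (ZMod 2) (Word d)) (d₀ : ℕ) (α δ : ℝ) :
    (j i : ℕ) → Word n → Option (Word n)
  | 0, _, x => some x
  | j + 1, i, x =>
    match G.deepFlip C₀ d₀ α δ x with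
    | none => none
    | some z =>
      if c * (2 : ℝ)⁻¹ ^ i * gammaConst c d₀ α δ * n < ((G.unsat C₀ z).card : ℝ) then none
      else deepLoop G C₀ d₀ α δ j (i + 1) z

open Classical in
/-- `MainDecode(x)`, run with the expansion parameters `α` and `δ`; the result is `none` if no
sequence of guesses leads to an output. -/
def mainDecode (G : TannerGraph c d n m) (C₀ : Submodule (ZMod 2) (Word d)) (d₀ : ℕ) (α δ : ℝ)
    (x : Word n) : Option (Word n) :=
  (guessSeqs c d₀
      ⌈Real.log (gammaConst c d₀ α δ) / Real.log (1 - rateConst c d₀ δ)⌉₊).findSome? fun qs =>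
    match G.deepLoop C₀ d₀ α δ (⌈Real.logb 2 (gammaConst c d₀ α δ * n)⌉ + 1).toNat 1
        (qs.foldl (G.deterFlip C₀ d₀) x) with
    | none => none
    | some z =>
      if (G.unsat C₀ z).card = 0 ∧ (hammingDist x z : ℝ) ≤ α * n then some z else none

end TannerGraph

/-! ### A random access machine -/

/-- The state of the machine: registers, and random access arrays, all holding natural numbers. -/
structure RamState where
  reg : ℕ → ℕ
  arr : ℕ → ℕ → ℕ

/-- Programs of the random access machine. Registers and arrays are named by numbers that are fixed
in the program.
`const i k`: register `i` becomes `k`.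
`add i a b`, `sub i a b`: register `i` becomes the sum, the truncated difference, of registers
`a` and `b`.
`load i A a`: register `i` becomes the cell of array `A` whose address is in register `a`.
`store A a b`: this cell becomes the content of register `b`.
`rand i k`: register `i` becomes a uniformly random element of `{0, …, k}`.
`branch r a b p q` and `loop r a b p` test whether `r` times register `a` is at most register `b`,
for a real constant `r`. -/
inductive RamProg : Type where
  | skip : RamProg
  | const (i k : ℕ) : RamProg
  | add (i a b : ℕ) : RamProg
  | sub (i a b : ℕ) : RamProg
  | load (i A a : ℕ) : RamProg
  | store (A a b : ℕ) : RamProg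
  | rand (i k : ℕ) : RamProg
  | seq (p q : RamProg) : RamProg
  | branch (r : ℝ) (a b : ℕ) (p q : RamProg) : RamProg
  | loop (r : ℝ) (a b : ℕ) (p : RamProg) : RamProg

namespace RamState

def setReg (s : RamState) (i k : ℕ) : RamState :=
  { s with reg := Function.update s.reg i k }

def setCell (s : RamState) (A a k : ℕ) : RamState :=
  { s with arr := Function.update s.arr A (Function.update (s.arr A) a k) }

end RamState

namespace RamProg

/-- The program does not use randomness. -/
def Deterministic : RamProg → Prop
  | rand _ _ => False
  | seq p q => p.Deterministic ∧ q.Deterministic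
  | branch _ _ _ p q => p.Deterministic ∧ q.Deterministic
  | loop _ _ _ p => p.Deterministic
  | _ => True

open Classical in
/-- One time step. A configuration consists of the programs still to be executed, one after the
other, and the state; the machine has halted when nothing remains to be executed. -/
def step : List RamProg × RamState → PMF (List RamProg × RamState)
  | ([], s) => PMF.pure ([], s)
  | (skip :: l, s) => PMF.pure (l, s)
  | (const i k :: l, s) => PMF.pure (l, s.setReg i k)
  | (add i a b :: l, s) => PMF.pure (l, s.setReg i (s.reg a + s.reg b))
  | (sub i a b :: l, s) => PMF.pure (l, s.setReg i (s.reg a - s.reg b))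
  | (load i A a :: l, s) => PMF.pure (l, s.setReg i (s.arr A (s.reg a)))
  | (store A a b :: l, s) => PMF.pure (l, s.setCell A (s.reg a) (s.reg b))
  | (rand i k :: l, s) =>
      (PMF.uniformOfFintype (Fin (k + 1))).map fun j => (l, s.setReg i j)
  | (seq p q :: l, s) => PMF.pure (p :: q :: l, s)
  | (branch r a b p q :: l, s) =>
      PMF.pure ((if r * (s.reg a : ℝ) ≤ (s.reg b : ℝ) then p else q) :: l, s)
  | (loop r a b p :: l, s) =>
      PMF.pure (if r * (s.reg a : ℝ) ≤ (s.reg b : ℝ) then p :: loop r a b p :: l else l, s)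

/-- The distribution of the configuration after `T` time steps. -/
def run : ℕ → List RamProg × RamState → PMF (List RamProg × RamState)
  | 0, C => PMF.pure C
  | T + 1, C => (step C).bind (run T)

end RamProg

namespace TannerGraph

variable {c d n m : ℕ}

/-- The initial state on the input `(G, x)`. Registers `0` and `1` hold `n` and `m`. For `j < c`,
array `j` holds the `j`-th neighbours of the left vertices; for `i < d`, array `c + i` holds the
`i`-th neighbours of the right vertices; array `c + d` holds the word `x`. Everything else is
zero. -/
def initState (G : TannerGraph c d n m) (x : Word n) : RamState where
  reg := fun i => if i = 0 then n else if i = 1 then m else 0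
  arr := fun A a =>
    if h : A < c ∧ a < n then (G.left ⟨a, h.2⟩ ⟨A, h.1⟩ : ℕ)
    else if h : (c ≤ A ∧ A - c < d) ∧ a < m then (G.right ⟨a, h.2⟩ ⟨A - c, h.1.2⟩ : ℕ)
    else if h : A = c + d ∧ a < n then (x ⟨a, h.2⟩).val
    else 0

/-- The output of a configuration: `none` if the machine has not halted, `some none` if it has
halted with `0` in register `0` (no word is returned), and otherwise the word in array `c + d`. -/
def ramOutput (_G : TannerGraph c d n m) : List RamProg × RamState → Option (Option (Word n))
  | ([], s) => some (if s.reg 0 = 0 then none else some fun u => (s.arr (c + d) u : ZMod 2))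
  | (_ :: _, _) => none

/-- The probability that the program `P`, started on the input `(G, x)`, halts within `T` time
steps with the output `o`. -/
def ramProb (G : TannerGraph c d n m) (P : RamProg) (T : ℕ) (x : Word n) (o : Option (Word n)) :
    ℝ≥0∞ :=
  ((RamProg.run T ([P], G.initState x)).map G.ramOutput) (some o)

/-- The program `P` implements `RandDecode` on the graph `G`: on every input word it has the same
output distribution. -/
def ImplementsRandDecode (G : TannerGraph c d n m) (C₀ : Submodule (ZMod 2) (Word d)) (d₀ : ℕ)
    (P : RamProg) : Prop :=
  ∀ x z : Word n, ⨆ T : ℕ, G.ramProb P T x (some z) = G.randDecodeProb C₀ d₀ x z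

/-- The deterministic program `P` implements `MainDecode`, run with the expansion parameters `α` and
`δ`, on the graph `G`. -/
def ImplementsMainDecode (G : TannerGraph c d n m) (C₀ : Submodule (ZMod 2) (Word d)) (d₀ : ℕ)
    (α δ : ℝ) (P : RamProg) : Prop :=
  P.Deterministic ∧ ∀ x : Word n, ∃ T : ℕ, G.ramProb P T x (G.mainDecode C₀ d₀ α δ x) = 1

end TannerGraph

end

noncomputable section

/-! ### The size-expansion function -/

/-! Size expansion. Put p = 1/k and let S be a set of about kαn left vertices. A random subset T of
αn vertices of S meets N(v) with probability about 1 - (1 - p)^i if v has i neighbours in S. Since T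
has at least δcαn neighbours, averaging over T shows that the numbers of such v, divided by cαn,
satisfy the constraints of the linear program. Hence |N(S)| is at least f_δ(k) c|S|, up to a loss
that vanishes as n grows. The function i ↦ 1 - (1 - p)^i is concave, so an optimal solution lives on
two consecutive indices, and f_δ(k) = b becomes an explicit polynomial equation in 1 - 1/k
(`sizeExpansion_eq_iff`). The polynomial is strictly increasing for 0 < b < 1, which gives existence
and uniqueness of k. With a = kα, the graph is therefore an (a, b')-expander for every b' < δ' once
n is large (`isExpander_of_lt`).

Drift. Let F ≤ an be the number of corrupt bits. A check with e ≥ 1 corrupt neighbours casts at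
least d₀ - 2e votes net for corrupt bits, in units of 1/(c d₀) (`vote_signed_ge`). Summing over
N(corrupt), where the e add up to cF and there are at least b'cF checks, the flip probabilities of
the corrupt bits exceed those of the correct bits by κF in total, with κ = b' - 2/d₀ > 0
(`flipNum_drift`).

RandDecode. The flips are independent, so a round multiplies the mean of exp(κF/2) by at most
exp(-κ²F/4) (`expect_exp_randFlip`). Thus exp(κF/2 + κ²/4 · (sum of the previous F)) is a
supermartingale while F ≤ an. Outside an event of exponentially small probability, F stays below an
and the sum of all F is O(n). A round costs O(F), so the total time is linear
(`exists_ramProb_randProgram`).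

MainDecode. Sorting the bits by their flip probability, some single value q yields a fixed
proportional decrease of F (`exists_good_guess`), so some sequence of r guesses brings F below γn.
DeepFlip may follow bad guesses, but a sequence that keeps |U| ≤ cγn stays inside the range of
expansion, where |U| controls F. Hence the result with the fewest unsatisfied checks has at most F/2
corrupt bits (`deepFlip_spec`). After r' halvings no corrupt bit is left. No other codeword lies
within distance an of x (`eq_of_hammingDist_le`), so nothing but y can be returned
(`mainDecode_eq`). The decoder computes with δ' while only b' < δ' is available; the pigeonhole
argument gives almost twice the rate assumed by the decoder, which leaves room for this (`IsSlack`).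

Machine. The programs maintain a list of checks that covers U, so a round of flips costs O(|U| + 1)
and not O(n). A branch of DeepFlip is undone from a record of its flips; only the number of the best
branch is kept, and that branch is executed again. The tests of MainDecode bound |U| by c 2^(-i) γn
after iteration i, and the costs form a geometric series (`exists_mainProgram`). The randomized
program is compared with `randDecodeWithin` from both sides: an upper bound on halting probabilities
gives the exact output distribution, a lower one the running time. -/

/-- The polynomial `∑_{j < i} q ^ j + θ q ^ i`, where `1 / b = i + θ` with `i = ⌊1 / b⌋`. -/
def tangentSum (b q : ℝ) : ℝ :=
  ∑ j ∈ Finset.range ⌊1 / b⌋₊, q ^ j + (1 / b - ⌊1 / b⌋₊) * q ^ ⌊1 / b⌋₊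

/-- The slope of the chord of `j ↦ 1 - (1 - p) ^ j` between `i` and `i + 1`. -/
def chordSlope (i : ℕ) (p : ℝ) : ℝ := p * (1 - p) ^ i

/-- The intercept of the chord of `j ↦ 1 - (1 - p) ^ j` between `i` and `i + 1`. -/
def chordIntercept (i : ℕ) (p : ℝ) : ℝ := 1 - (1 - p) ^ i - i * (p * (1 - p) ^ i)

/-- Bernoulli for `1 + p` turns the left side into a power of `1 - p ^ 2`. This is the upper bound
on `(1 - p) ^ m` that the chord estimate needs to the left of the chord. -/
theorem pow_mul_one_add_le_one {p : ℝ} (h0 : 0 ≤ p) (h1 : p ≤ 1) (m : ℕ) :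
    (1 - p) ^ m * (1 + m * p) ≤ 1 := by
  have h2 : 1 + m * p ≤ (1 + p) ^ m := one_add_mul_le_pow (by linarith) m
  calc (1 - p) ^ m * (1 + m * p) ≤ (1 - p) ^ m * (1 + p) ^ m := by
        gcongr
    _ = (1 - p ^ 2) ^ m := by rw [← mul_pow]; ring
    _ ≤ 1 := pow_le_one₀ (by nlinarith) (by nlinarith)

theorem one_le_floor_one_div {b : ℝ} (hb : 0 < b) (hb1 : b ≤ 1) : 1 ≤ ⌊1 / b⌋₊ :=
  Nat.le_floor (by rw [Nat.cast_one, le_div_iff₀ hb]; linarith)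

/-- Concavity: the line through two consecutive points of a concave sequence lies above all others.
This line is the dual solution of the linear program, and it also linearizes the averaging argument
for large sets. -/
theorem one_sub_pow_le_chord {p : ℝ} (h0 : 0 ≤ p) (h1 : p ≤ 1) (i j : ℕ) :
    1 - (1 - p) ^ j ≤ chordIntercept i p + chordSlope i p * j := by
  unfold chordIntercept chordSlope
  have hq : 0 ≤ (1 - p) := by linarith
  rcases le_total i j with h | h
  · obtain ⟨k, rfl⟩ := Nat.exists_eq_add_of_le h
    have h2 : 1 + (k : ℝ) * (-p) ≤ (1 + -p) ^ k := one_add_mul_le_pow (by linarith) k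
    have h3 := mul_le_mul_of_nonneg_left h2 (pow_nonneg hq i)
    rw [pow_add]
    push_cast
    have : (1 + -p) = 1 - p := by ring
    rw [this] at h3
    nlinarith
  · obtain ⟨k, rfl⟩ := Nat.exists_eq_add_of_le h
    have h2 := pow_mul_one_add_le_one h0 h1 k
    have h3 := mul_le_mul_of_nonneg_left h2 (pow_nonneg hq j)
    rw [pow_add]
    push_cast
    nlinarith

/-- The intercept equals `p ^ 2` at `i = 1` and does not decrease in `i`. Positivity allows dividing
by it; the explicit bound controls the relative error in the averaging argument uniformly in `i`. -/
theorem sq_le_chordIntercept {p : ℝ} (_ : 0 ≤ p) (h1 : p ≤ 1) {i : ℕ} (hi : 1 ≤ i) :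
    p ^ 2 ≤ chordIntercept i p := by
  unfold chordIntercept
  suffices h : (1 - p) ^ i * (1 + i * p) ≤ 1 - p ^ 2 by nlinarith
  induction i, hi using Nat.le_induction with
  | base => simp; nlinarith
  | succ i hi ih =>
    refine le_trans ?_ ih
    rw [pow_succ, mul_assoc]
    apply mul_le_mul_of_nonneg_left _ (pow_nonneg (by linarith) _)
    push_cast
    have : (0 : ℝ) ≤ i := by positivity
    nlinarith [mul_nonneg this (sq_nonneg p)]

/-- The height of the chord at the (in general fractional) point `1 / b` is a geometric sum with an
interpolated last term. -/
theorem chord_eq_tangentSum {b p : ℝ} (hb : 0 < b) :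
    b * chordIntercept ⌊1 / b⌋₊ p + chordSlope ⌊1 / b⌋₊ p = p * (b * tangentSum b (1 - p)) := by
  unfold tangentSum chordIntercept chordSlope
  have h := geom_sum_mul_neg (1 - p) ⌊1 / b⌋₊
  have h2 : (∑ j ∈ Finset.range ⌊1 / b⌋₊, (1 - p) ^ j) * p = 1 - (1 - p) ^ ⌊1 / b⌋₊ := by
    rw [← h]; ring
  have h3 : b * (1 / b) = 1 := by field_simp
  linear_combination b * (-h2) - p * (1 - p) ^ ⌊1 / b⌋₊ * h3

/-- Feasibility of a value in the linear program. -/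
def IsFeasible (δ k v : ℝ) : Prop :=
  ∃ β : ℕ → ℝ, (∀ i, 0 ≤ β i) ∧
    HasSum (fun i : ℕ => ((i : ℝ) + 1) * β i) k ∧
    δ ≤ ∑' i : ℕ, (1 - (1 - 1 / k) ^ (i + 1)) * β i ∧
    v = 1 / k * ∑' i : ℕ, β i

theorem IsFeasible.nonneg {δ k v : ℝ} (hk : 1 < k) (h : IsFeasible δ k v) : 0 ≤ v := by
  obtain ⟨β, h0, -, -, rfl⟩ := h
  exact mul_nonneg (by positivity) (tsum_nonneg h0)

/-- Weak duality: weight the chord inequality with `β` and sum. The slope meets `∑ i β_i = k`, the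
intercept meets the objective. -/
theorem IsFeasible.le {δ k v : ℝ} (hk : 1 < k) (h : IsFeasible δ k v) (i : ℕ) :
    δ ≤ k * (chordIntercept i (1 / k) * v + chordSlope i (1 / k)) := by
  obtain ⟨β, h0, h1, h2, rfl⟩ := h
  have hp0 : 0 ≤ 1 / k := by positivity
  have hp1 : 1 / k ≤ 1 := by rw [div_le_one (by linarith)]; linarith
  have hs : Summable β := by
    refine Summable.of_nonneg_of_le h0 (fun i => ?_) h1.summable
    nlinarith [h0 i, mul_nonneg (Nat.cast_nonneg (α := ℝ) i) (h0 i)]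
  have h3 : HasSum (fun j : ℕ => chordIntercept i (1 / k) * β j
      + chordSlope i (1 / k) * (((j : ℝ) + 1) * β j))
      (chordIntercept i (1 / k) * (∑' j, β j) + chordSlope i (1 / k) * k) :=
    (hs.hasSum.mul_left _).add (h1.mul_left _)
  have hle : ∀ j : ℕ, (1 - (1 - 1 / k) ^ (j + 1)) * β j ≤ chordIntercept i (1 / k) * β j
      + chordSlope i (1 / k) * (((j : ℝ) + 1) * β j) := by
    intro j
    have := mul_le_mul_of_nonneg_right (one_sub_pow_le_chord hp0 hp1 i (j + 1)) (h0 j)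
    push_cast at this
    linarith
  have hnn : ∀ j : ℕ, 0 ≤ (1 - (1 - 1 / k) ^ (j + 1)) * β j := fun j =>
    mul_nonneg (sub_nonneg.2 (pow_le_one₀ (by linarith) (by linarith))) (h0 j)
  have h4 := (Summable.of_nonneg_of_le hnn hle h3.summable).tsum_le_tsum hle h3.summable
  rw [h3.tsum_eq] at h4
  have hk0 : k ≠ 0 := by linarith
  calc δ ≤ _ := h2
    _ ≤ _ := h4
    _ = _ := by field_simp

/-- The matching primal solution sits on the two ends of the chord. The bounds on `v` say that the
mean index `1 / v` lies between them, which makes both weights nonnegative. -/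
theorem isFeasible_of_le {δ k v : ℝ} (hk : 1 < k) {i : ℕ} (hi : 1 ≤ i) (h1 : i * v ≤ 1)
    (h2 : 1 ≤ (i + 1) * v)
    (h : δ ≤ k * (chordIntercept i (1 / k) * v + chordSlope i (1 / k))) : IsFeasible δ k v := by
  obtain ⟨i, rfl⟩ := Nat.exists_eq_add_of_le' hi
  have hk0 : k ≠ 0 := by linarith
  -- Since `β j` is the variable of index `j + 1`, the support is the pair of indices `i + 1`, `i +
  -- 2`. The weights solve `∑ j β_j = k` and `∑ β_j = k v`.
  set β : ℕ → ℝ := fun j => if j = i then k * (v * (i + 2) - 1) else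
    if j = i + 1 then k * (1 - (i + 1) * v) else 0 with hβ
  have hsum : ∀ f : ℕ → ℝ, HasSum (fun j => f j * β j)
      (f i * (k * (v * (i + 2) - 1)) + f (i + 1) * (k * (1 - (i + 1) * v))) := by
    intro f
    have := hasSum_sum_of_ne_finset_zero (L := SummationFilter.unconditional ℕ)
      (f := fun j => f j * β j) (s := {i, i + 1}) (by
      intro j hj
      simp only [Finset.mem_insert, Finset.mem_singleton, not_or] at hj
      simp [hβ, hj.1, hj.2])
    rw [Finset.sum_pair (by omega)] at this
    simpa [hβ] using this
  push_cast at h1 h2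
  refine ⟨β, ?_, ?_, ?_, ?_⟩
  · intro j
    simp only [hβ]
    split_ifs
    · exact mul_nonneg (by linarith) (by nlinarith)
    · exact mul_nonneg (by linarith) (by nlinarith)
    · exact le_rfl
  · convert hsum (fun j => (j : ℝ) + 1) using 1
    push_cast
    ring
  · rw [(hsum (fun j => 1 - (1 - 1 / k) ^ (j + 1))).tsum_eq]
    refine h.trans (le_of_eq ?_)
    unfold chordIntercept chordSlope
    push_cast
    have : k * (1 / k) = 1 := by field_simp
    have h3 : (1 - 1 / k) ^ (i + 1 + 1) = (1 - 1 / k) ^ (i + 1) * (1 - 1 / k) := pow_succ _ _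
    rw [h3]
    ring
  · have := (hsum (fun _ => 1)).tsum_eq
    simp only [one_mul] at this
    rw [this]
    field_simp
    ring

/-- For `i = ⌊1 / b⌋` the primal and the dual bound meet at `b`, so the optimum is `b` exactly if
the constraint with `δ` is tight on this chord. -/
theorem sizeExpansion_eq_iff {δ b k : ℝ} (hb : 0 < b) (hb1 : b ≤ 1) (hk : 1 < k) :
    sizeExpansion δ k = b ↔ b * tangentSum b (1 - 1 / k) = δ := by
  have hk0 : k ≠ 0 := by linarith
  have hp0 : 0 < 1 / k := by positivity
  have hp1 : 1 / k ≤ 1 := by rw [div_le_one (by linarith)]; linarith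
  set i := ⌊1 / b⌋₊ with hi
  have hi1 : 1 ≤ i := one_le_floor_one_div hb (by linarith)
  have hib : i * b ≤ 1 := by
    have := Nat.floor_le (a := 1 / b) (by positivity)
    rwa [le_div_iff₀ hb] at this
  have hib2 : 1 < (i + 1) * b := by
    have := Nat.lt_floor_add_one (1 / b)
    rwa [div_lt_iff₀ hb] at this
  have hA : 0 < chordIntercept i (1 / k) :=
    lt_of_lt_of_le (by positivity) (sq_le_chordIntercept hp0.le hp1 hi1)
  have hkey : k * (chordIntercept i (1 / k) * b + chordSlope i (1 / k))
      = b * tangentSum b (1 - 1 / k) := by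
    have := chord_eq_tangentSum (p := 1 / k) hb
    rw [mul_comm (chordIntercept i (1 / k)), this]
    field_simp
  rw [← hkey]
  have hset : sizeExpansion δ k = sInf {v | IsFeasible δ k v} := rfl
  have hbdd : BddBelow {v | IsFeasible δ k v} := ⟨0, fun v hv => hv.nonneg hk⟩
  have hlow : ∀ v, IsFeasible δ k v → (δ / k - chordSlope i (1 / k)) / chordIntercept i (1 / k) ≤ v := by
    intro v hv
    have := hv.le hk i
    rw [div_le_iff₀ hA, sub_le_iff_le_add, div_le_iff₀ (by linarith)]
    linarith
  constructor
  · intro h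
    -- An infeasible program would have the infimum `0` by convention, which `0 < b` excludes.
    have hne : {v | IsFeasible δ k v}.Nonempty := by
      by_contra hne
      rw [Set.not_nonempty_iff_eq_empty] at hne
      rw [hset, hne, Real.sInf_empty] at h
      linarith
    have h1 := le_csInf hne hlow
    rw [← hset, h, div_le_iff₀ hA, sub_le_iff_le_add, div_le_iff₀ (by linarith)] at h1
    by_contra hcon
    have hlt : δ < k * (chordIntercept i (1 / k) * b + chordSlope i (1 / k)) :=
      lt_of_le_of_ne (by linarith) (Ne.symm hcon)
    -- If the constraint were slack, values slightly below `b` would be feasible on the same chord: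
    -- the floor gives the strict inequality `1 < (i + 1) * b`, which survives a small decrease.
    have hev : ∀ᶠ v in 𝓝[<] b, δ < k * (chordIntercept i (1 / k) * v + chordSlope i (1 / k)) ∧
        1 < (i + 1) * v := by
      apply Filter.Eventually.filter_mono nhdsWithin_le_nhds
      exact ((by fun_prop : Continuous fun v => k * (chordIntercept i (1 / k) * v
        + chordSlope i (1 / k))).continuousAt.eventually_const_lt hlt).and
        ((by fun_prop : Continuous fun v : ℝ => ((i : ℝ) + 1) * v).continuousAt.eventually_const_lt
          hib2)
    obtain ⟨v, ⟨hv1, hv2⟩, hv3⟩ := (hev.and self_mem_nhdsWithin).exists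
    have hv3 : v < b := hv3
    have := csInf_le hbdd (isFeasible_of_le hk hi1
      ((mul_le_mul_of_nonneg_left hv3.le (by positivity)).trans hib) hv2.le hv1.le)
    rw [← hset, h] at this
    linarith
  · intro h
    have hf : IsFeasible δ k b := isFeasible_of_le hk hi1 hib hib2.le h.ge
    rw [hset]
    refine IsLeast.csInf_eq ⟨hf, fun v hv => ?_⟩
    have h1 := hlow v hv
    rw [← h] at h1
    rwa [mul_div_cancel_left₀ _ hk0, add_sub_cancel_right, mul_div_cancel_left₀ _ hA.ne'] at h1

theorem continuous_tangentSum (b : ℝ) : Continuous (tangentSum b) := by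
  unfold tangentSum
  fun_prop

theorem tangentSum_mono {b : ℝ} (hb : 0 < b) {q r : ℝ} (hq : 0 ≤ q) (h : q ≤ r) :
    tangentSum b q ≤ tangentSum b r := by
  unfold tangentSum
  have := Nat.floor_le (a := 1 / b) (by positivity)
  have : 0 ≤ 1 / b - ⌊1 / b⌋₊ := by linarith
  gcongr

theorem tangentSum_strictMono {b : ℝ} (hb : 0 < b) (hb1 : b < 1) {q r : ℝ} (hq : 0 ≤ q)
    (h : q < r) : tangentSum b q < tangentSum b r := by
  unfold tangentSum
  have hf := Nat.floor_le (a := 1 / b) (by positivity)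
  have hi1 : 1 ≤ ⌊1 / b⌋₊ := one_le_floor_one_div hb (by linarith)
  rcases Nat.lt_or_ge 1 ⌊1 / b⌋₊ with h2 | h2
  · apply add_lt_add_of_lt_of_le
    · refine Finset.sum_lt_sum (fun j _ => by gcongr) ⟨1, by simpa using h2, by simpa using h⟩
    · have : 0 ≤ 1 / b - ⌊1 / b⌋₊ := by linarith
      gcongr
  -- Here only the interpolated term depends on `q`, with the coefficient `1 / b - 1`; this is where
  -- `b < 1` is used.
  · have h3 : ⌊1 / b⌋₊ = 1 := by omega
    have h4 : 1 < 1 / b := by rw [lt_div_iff₀ hb]; linarith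
    rw [h3]
    simp only [Finset.range_one, Finset.sum_singleton, pow_zero, Nat.cast_one, pow_one]
    nlinarith

/-- In `q = 1 - 1 / k` the equation is `b * tangentSum b q = δ`. The left side increases strictly
from `b` at `q = 0` to `1` at `q = 1`, and `δ` lies in between. -/
theorem existsUnique_sizeExpansion {δ b : ℝ} (hb : 0 < b) (hbδ : b < δ) (hδ : δ < 1) :
    ∃! k : ℝ, 1 < k ∧ sizeExpansion δ k = b := by
  have hi1 : 1 ≤ ⌊1 / b⌋₊ := one_le_floor_one_div hb (by linarith)
  have h0 : tangentSum b 0 = 1 := by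
    unfold tangentSum
    obtain ⟨i, hi⟩ := Nat.exists_eq_add_of_le' hi1
    rw [hi, Finset.sum_range_succ']
    simp
  have h1 : tangentSum b 1 = 1 / b := by
    unfold tangentSum
    simp
  have hc : ContinuousOn (fun q => b * tangentSum b q) (Set.Icc 0 1) :=
    ((continuous_tangentSum b).const_mul b |>.continuousOn)
  have hmem : δ ∈ Set.Ioo (b * tangentSum b 0) (b * tangentSum b 1) := by
    rw [h0, h1]
    constructor
    · linarith
    · have : b * (1 / b) = 1 := by field_simp
      linarith
  obtain ⟨q, ⟨hq0, hq1⟩, hq⟩ := intermediate_value_Ioo zero_le_one hc hmem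
  have hk : 1 < 1 / (1 - q) := by rw [lt_div_iff₀ (by linarith)]; linarith
  refine ⟨1 / (1 - q), ⟨hk, ?_⟩, ?_⟩
  · rw [sizeExpansion_eq_iff hb (by linarith) hk]
    simpa using hq
  · rintro k ⟨hk1, hk2⟩
    rw [sizeExpansion_eq_iff hb (by linarith) hk1] at hk2
    have hk3 : 1 / k < 1 := by rw [div_lt_one (by linarith)]; exact hk1
    have heq : 1 - 1 / k = q := by
      rcases lt_trichotomy (1 - 1 / k) q with h | h | h
      · have := mul_lt_mul_of_pos_left (tangentSum_strictMono hb (by linarith) (by linarith) h) hb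
        simp only at hq
        linarith
      · exact h
      · have := mul_lt_mul_of_pos_left (tangentSum_strictMono hb (by linarith) hq0.le h) hb
        simp only at hq
        linarith
    have : k ≠ 0 := by linarith
    rw [← heq]
    field_simp
    ring

theorem sizeExpansionInv_spec {δ b : ℝ} (hb : 0 < b) (hbδ : b < δ) (hδ : δ < 1) :
    1 < sizeExpansionInv δ b ∧
      b * tangentSum b (1 - 1 / sizeExpansionInv δ b) = δ := by
  obtain ⟨k, ⟨hk1, hk2⟩, -⟩ := existsUnique_sizeExpansion hb hbδ hδ
  have hex : ∃ k ∈ Set.Ioi (1 : ℝ), sizeExpansion δ k = b := ⟨k, hk1, hk2⟩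
  have h1 : 1 < sizeExpansionInv δ b := Function.invFunOn_mem hex
  exact ⟨h1, (sizeExpansion_eq_iff hb (by linarith) h1).1 (Function.invFunOn_eq hex)⟩


/-! ### Expansion of larger sets -/

/-- The proportion of the `τ`-subsets of an `s`-set that avoid `i` given points. -/
theorem pow_sub_le_choose_ratio {s τ d : ℕ} (hτ : τ ≤ s) (hd : d < s) (i : ℕ) (hi : i ≤ d) :
    ((1 - τ / s : ℝ) ^ i - i * (d / (s - d))) * s.choose τ ≤ (s - i).choose τ := by
  have hs : (0 : ℝ) < s := by exact_mod_cast (by omega : 0 < s)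
  have hds : (0 : ℝ) < s - d := by rw [sub_pos]; exact_mod_cast hd
  have hp1 : (τ / s : ℝ) ≤ 1 := by rw [div_le_one hs]; exact_mod_cast hτ
  have hp0 : (0 : ℝ) ≤ τ / s := by positivity
  induction i with
  | zero => simp
  | succ i ih =>
    have ih := ih (by omega)
    rcases Nat.lt_or_ge (s - i) τ with h | h
    -- Too few points are left for a `τ`-subset. The induction hypothesis then makes the factor on
    -- the left nonpositive, and it stays so for `i + 1`.
    · have h1 : (s - i).choose τ = 0 := Nat.choose_eq_zero_of_lt h
      rw [h1] at ih
      have hchoose : (0 : ℝ) < s.choose τ := by exact_mod_cast Nat.choose_pos hτ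
      have h2 : ((1 - τ / s : ℝ) ^ i - i * (d / (s - d))) ≤ 0 := by
        by_contra hcon
        push Not at hcon
        have := mul_pos hcon hchoose
        simp only [Nat.cast_zero] at ih
        linarith
      have h3 : ((1 - τ / s : ℝ) ^ (i + 1) - (i + 1 : ℕ) * (d / (s - d))) ≤ 0 := by
        have : (1 - τ / s : ℝ) ^ (i + 1) ≤ (1 - τ / s : ℝ) ^ i :=
          pow_le_pow_of_le_one (by linarith) (by linarith) (by omega)
        have h4 : (0 : ℝ) ≤ d / (s - d) := by positivity
        push_cast
        linarith
      exact (mul_nonpos_of_nonpos_of_nonneg h3 hchoose.le).trans (by positivity)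
    · have hrec : ((s - (i + 1)).choose τ : ℝ) * (s - i) = (s - i).choose τ * (s - i - τ) := by
        have := Nat.choose_mul_succ_eq (s - (i + 1)) τ
        have h1 : s - (i + 1) + 1 = s - i := by omega
        rw [h1] at this
        have h2 : ((s - i : ℕ) : ℝ) = s - i := by rw [Nat.cast_sub (by omega)]
        have h3 : ((s - i - τ : ℕ) : ℝ) = s - i - τ := by rw [Nat.cast_sub h, h2]
        rw [← h3, ← h2]
        exact_mod_cast this
      have hsi : (0 : ℝ) < s - i := by rw [sub_pos]; exact_mod_cast (by omega : i < s)
      -- The conditional probability that one more point is avoided. It falls short of `1 - τ / s`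
      -- by at most `d / (s - d)`, because `i ≤ d`, and these errors add up.
      set f : ℝ := (s - i - τ) / (s - i) with hf
      have hrec2 : ((s - (i + 1)).choose τ : ℝ) = f * (s - i).choose τ := by
        rw [hf]; field_simp; linarith
      have hτi : (τ : ℝ) ≤ s - i := by
        rw [← Nat.cast_sub (by omega)]; exact_mod_cast h
      have hf0 : 0 ≤ f := div_nonneg (by linarith) hsi.le
      have hf1 : f ≤ 1 := by
        rw [hf, div_le_one hsi]
        have : (0 : ℝ) ≤ τ := by positivity
        linarith
      have hω : (1 - τ / s : ℝ) - d / (s - d) ≤ f := by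
        have h1 : f = 1 - τ / (s - i) := by rw [hf]; field_simp
        have hid : (i : ℝ) ≤ d := by exact_mod_cast (by omega : i ≤ d)
        have h2 : (τ : ℝ) / (s - i) - τ / s ≤ d / (s - d) := by
          have h3 : (τ : ℝ) / (s - i) - τ / s = (τ / s) * (i / (s - i)) := by
            field_simp
            ring
          rw [h3]
          calc (τ / s : ℝ) * (i / (s - i)) ≤ 1 * (d / (s - d)) := by
                gcongr
            _ = _ := one_mul _
        linarith
      set q : ℝ := 1 - τ / s with hq
      have hq0 : 0 ≤ q := by linarith
      have hq1 : q ≤ 1 := by linarith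
      set ω : ℝ := d / (s - d) with hωdef
      have hω0 : 0 ≤ ω := by positivity
      rw [hrec2]
      have hchoose : (0 : ℝ) ≤ s.choose τ := by positivity
      calc (q ^ (i + 1) - (i + 1 : ℕ) * ω) * s.choose τ
          ≤ (f * (q ^ i - i * ω)) * s.choose τ := by
            apply mul_le_mul_of_nonneg_right _ hchoose
            push_cast
            have h1 : q ^ i ≤ 1 := pow_le_one₀ hq0 hq1
            have h2 : 0 ≤ q ^ i := pow_nonneg hq0 i
            have h3 : 0 ≤ i * ω := by positivity
            rw [pow_succ]
            nlinarith [mul_nonneg h2 (sub_nonneg.2 hω), mul_nonneg h3 (sub_nonneg.2 hf1),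
              mul_nonneg hω0 (sub_nonneg.2 h1)]
        _ = f * ((q ^ i - i * ω) * s.choose τ) := by ring
        _ ≤ _ := mul_le_mul_of_nonneg_left ih hf0

/-! ### Counting edges and neighbours; expansion of sets beyond size αn -/

namespace TannerGraph

variable {c d n m : ℕ}

/-- The neighbourhood of a right vertex. -/
def nbhd (G : TannerGraph c d n m) (v : Fin m) : Finset (Fin n) := Finset.univ.image (G.right v)

theorem mem_nbhd {G : TannerGraph c d n m} {v : Fin m} {u : Fin n} :
    u ∈ G.nbhd v ↔ ∃ i, G.right v i = u := by simp [nbhd]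

theorem card_nbhd (G : TannerGraph c d n m) (v : Fin m) : (G.nbhd v).card = d := by
  rw [nbhd, Finset.card_image_of_injective _ (G.right_injective v), Finset.card_fin]

theorem mem_neighbors {G : TannerGraph c d n m} {S : Finset (Fin n)} {v : Fin m} :
    v ∈ G.neighbors S ↔ (S ∩ G.nbhd v).Nonempty := by
  simp only [neighbors, Finset.mem_biUnion, Finset.mem_image, Finset.mem_univ, true_and,
    Finset.Nonempty, Finset.mem_inter, mem_nbhd, G.adj_iff]

theorem neighbors_mono (G : TannerGraph c d n m) {S T : Finset (Fin n)} (h : S ⊆ T) :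
    G.neighbors S ⊆ G.neighbors T := Finset.biUnion_subset_biUnion_of_subset_left _ h

theorem sum_card_inter_nbhd (G : TannerGraph c d n m) (S : Finset (Fin n)) :
    ∑ v, (S ∩ G.nbhd v).card = c * S.card := by
  have h : ∀ u ∈ S, (Finset.univ.filter fun v => u ∈ G.nbhd v).card = c := by
    intro u _
    have : (Finset.univ.filter fun v => u ∈ G.nbhd v) = Finset.univ.image (G.left u) := by
      ext v
      simp only [Finset.mem_filter, Finset.mem_univ, true_and, mem_nbhd, ← G.adj_iff,
        Finset.mem_image]
    rw [this, Finset.card_image_of_injective _ (G.left_injective u), Finset.card_fin]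
  calc ∑ v, (S ∩ G.nbhd v).card = ∑ v, ∑ u ∈ S, if u ∈ G.nbhd v then 1 else 0 := by
        refine Finset.sum_congr rfl fun v _ => ?_
        rw [← Finset.filter_mem_eq_inter, Finset.card_filter]
    _ = ∑ u ∈ S, ∑ v, if u ∈ G.nbhd v then 1 else 0 := Finset.sum_comm
    _ = ∑ u ∈ S, c := by
        refine Finset.sum_congr rfl fun u hu => ?_
        rw [← Finset.card_filter, h u hu]
    _ = c * S.card := by rw [Finset.sum_const, smul_eq_mul, mul_comm]

theorem sum_neighbors_card_inter_nbhd (G : TannerGraph c d n m) (S : Finset (Fin n)) :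
    ∑ v ∈ G.neighbors S, (S ∩ G.nbhd v).card = c * S.card := by
  rw [← G.sum_card_inter_nbhd S]
  refine Finset.sum_subset (Finset.subset_univ _) fun v _ hv => ?_
  rw [mem_neighbors, Finset.not_nonempty_iff_eq_empty] at hv
  rw [hv, Finset.card_empty]

theorem card_neighbors_le (G : TannerGraph c d n m) (S : Finset (Fin n)) :
    (G.neighbors S).card ≤ c * S.card := by
  rw [← G.sum_neighbors_card_inter_nbhd S, Finset.card_eq_sum_ones]
  exact Finset.sum_le_sum fun v hv => Finset.card_pos.2 (mem_neighbors.1 hv)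

theorem mul_right_eq (G : TannerGraph c d n m) : d * m = c * n := by
  have := G.sum_card_inter_nbhd Finset.univ
  simpa [card_nbhd, mul_comm] using this

/-- Double counting of the pairs `(T, v)` with `v ∈ N(T)`: the `τ`-subsets of `S` that miss `v` are
those of `S \ N(v)`. -/
theorem sum_card_neighbors (G : TannerGraph c d n m) (S : Finset (Fin n)) (τ : ℕ) :
    ∑ T ∈ S.powersetCard τ, ((G.neighbors T).card : ℝ) =
      ∑ v ∈ G.neighbors S, ((S.card.choose τ : ℝ) - (S.card - (S ∩ G.nbhd v).card).choose τ) := by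
  have h1 : ∀ T ∈ S.powersetCard τ, ((G.neighbors T).card : ℝ) =
      ∑ v ∈ G.neighbors S, if (T ∩ G.nbhd v).Nonempty then 1 else 0 := by
    intro T hT
    rw [Finset.mem_powersetCard] at hT
    have : G.neighbors T = (G.neighbors S).filter fun v => (T ∩ G.nbhd v).Nonempty := by
      ext v
      rw [Finset.mem_filter, ← mem_neighbors]
      exact ⟨fun h => ⟨G.neighbors_mono hT.1 h, h⟩, fun h => h.2⟩
    rw [this, Finset.card_filter]
    push_cast
    rfl
  rw [Finset.sum_congr rfl h1, Finset.sum_comm]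
  refine Finset.sum_congr rfl fun v _ => ?_
  have h2 : ((S.powersetCard τ).filter fun T => ¬ (T ∩ G.nbhd v).Nonempty)
      = (S \ G.nbhd v).powersetCard τ := by
    ext T
    simp only [Finset.mem_filter, Finset.mem_powersetCard, Finset.not_nonempty_iff_eq_empty,
      ← Finset.disjoint_iff_inter_eq_empty, Finset.subset_sdiff]
    tauto
  have h3 := Finset.card_filter_add_card_filter_not (s := S.powersetCard τ)
    (fun T => (T ∩ G.nbhd v).Nonempty)
  rw [h2, Finset.card_powersetCard, Finset.card_powersetCard, Finset.card_sdiff,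
    Finset.inter_comm (G.nbhd v)] at h3
  rw [← h3, Finset.sum_boole]
  push_cast
  ring

/-- The averaging argument: expansion of the `τ`-subsets of `S` passes on to `S`. -/
theorem card_neighbors_ge_of_subsets {G : TannerGraph c d n m} {S : Finset (Fin n)} {τ : ℕ}
    {b δ : ℝ} (hb : 0 < b) (hb1 : b ≤ 1)
    (hexp : ∀ T ∈ S.powersetCard τ, δ * c * τ ≤ ((G.neighbors T).card : ℝ))
    (hτ0 : 0 < τ) (hτ : τ ≤ S.card) (hd : d < S.card)
    (hδ : b * tangentSum b (1 - τ / S.card) ≤ δ) :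
    b * (c * S.card) * (τ / S.card) ^ 2 ≤
      ((G.neighbors S).card : ℝ) * ((τ / S.card) ^ 2 + d * (d / (S.card - d))) := by
  set s := S.card with hs
  have hs0 : (0 : ℝ) < s := by exact_mod_cast (by omega : 0 < s)
  have hds : (0 : ℝ) < s - d := by rw [sub_pos]; exact_mod_cast hd
  set p : ℝ := τ / s with hp
  have hp1 : p ≤ 1 := by rw [hp, div_le_one hs0]; exact_mod_cast hτ
  have hp0 : 0 < p := by rw [hp]; have : (0 : ℝ) < τ := by exact_mod_cast hτ0
                         positivity
  set ω : ℝ := d / (s - d) with hω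
  have hω0 : 0 ≤ ω := by positivity
  set i := ⌊1 / b⌋₊ with hi
  have hi1 : 1 ≤ i := one_le_floor_one_div hb hb1
  have hA := sq_le_chordIntercept hp0.le hp1 hi1
  have hchoose : (0 : ℝ) < s.choose τ := by exact_mod_cast Nat.choose_pos hτ
  have h1 : (δ * c * τ) * s.choose τ ≤ ∑ T ∈ S.powersetCard τ, ((G.neighbors T).card : ℝ) := by
    calc (δ * c * τ) * s.choose τ = ∑ T ∈ S.powersetCard τ, δ * c * τ := by
          rw [Finset.sum_const, Finset.card_powersetCard, nsmul_eq_mul, mul_comm]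
      _ ≤ _ := Finset.sum_le_sum hexp
  rw [sum_card_neighbors] at h1
  -- Once the hitting probability is replaced by the chord, the bound is linear in `|S ∩ N(v)|`. The
  -- sum over `v` then involves only `|N(S)|` and the number `c |S|` of edges.
  have h2 : ∀ v ∈ G.neighbors S,
      ((s.choose τ : ℝ) - (s - (S ∩ G.nbhd v).card).choose τ) ≤
      (chordIntercept i p + chordSlope i p * (S ∩ G.nbhd v).card + d * ω) * s.choose τ := by
    intro v _
    set e := (S ∩ G.nbhd v).card with he
    have hed : e ≤ d := by
      have := Finset.card_le_card (Finset.inter_subset_right (s₁ := S) (s₂ := G.nbhd v))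
      rwa [G.card_nbhd v] at this
    have h3 := pow_sub_le_choose_ratio hτ hd e hed
    have h4 := one_sub_pow_le_chord hp0.le hp1 i e
    have h5 : (e : ℝ) * ω ≤ d * ω := by gcongr
    calc ((s.choose τ : ℝ) - (s - e).choose τ)
        ≤ s.choose τ - ((1 - p) ^ e - e * ω) * s.choose τ := by linarith
      _ = (1 - (1 - p) ^ e + e * ω) * s.choose τ := by ring
      _ ≤ _ := by gcongr
  have h3 := h1.trans (Finset.sum_le_sum h2)
  rw [← Finset.sum_mul] at h3
  have h4 := le_of_mul_le_mul_right h3 hchoose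
  simp only [Finset.sum_add_distrib, ← Finset.mul_sum, Finset.sum_const, nsmul_eq_mul] at h4
  rw [← Nat.cast_sum, sum_neighbors_card_inter_nbhd, ← hs] at h4
  push_cast at h4
  set N : ℝ := ((G.neighbors S).card : ℝ) with hN
  have hN1 : N ≤ c * s := by rw [hN, hs]; exact_mod_cast G.card_neighbors_le S
  have h5 := chord_eq_tangentSum (p := p) hb
  rw [← hi] at h5
  have h6 : p * (b * tangentSum b (1 - p)) ≤ p * δ := mul_le_mul_of_nonneg_left hδ hp0.le
  have hτs : (τ : ℝ) = p * s := by rw [hp]; field_simp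
  have hN0 : 0 ≤ N := Nat.cast_nonneg _
  clear_value p ω s N
  clear hp
  have hcs : (0 : ℝ) ≤ c * s := by positivity
  -- The slope contributes `c * s` times itself on both sides and cancels.
  have h7 : b * (c * s) * chordIntercept i p ≤ N * (chordIntercept i p + d * ω) := by
    have h8 := mul_le_mul_of_nonneg_left h6 hcs
    rw [← h5] at h8
    rw [hτs] at h4
    linarith
  -- The intercept is at least `p ^ 2`, so the relative sampling error is bounded by one that does
  -- not depend on `i`.
  have h9 : b * (c * s) * p ^ 2 * (chordIntercept i p) ≤
      N * (p ^ 2 + d * ω) * chordIntercept i p := by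
    have hdω : 0 ≤ N * (d * ω) := by positivity
    have := mul_le_mul_of_nonneg_left h7 (sq_nonneg p)
    have := mul_le_mul_of_nonneg_left hA hdω
    nlinarith
  exact le_of_mul_le_mul_right h9 (lt_of_lt_of_le (by positivity) hA)

/-- Larger sets in an expander expand as the size-expansion function predicts, up to an arbitrarily
small loss. -/
theorem isExpander_of_lt {c d : ℕ} {α δ b b' : ℝ} (hα : 0 < α) (hb' : 0 < b') (hbb : b' < b)
    (hbδ : b < δ) (hδ : δ < 1) :
    ∃ n₀ : ℕ, ∀ n m : ℕ, n₀ ≤ n → ∀ G : TannerGraph c d n m, G.IsExpander α δ →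
      G.IsExpander (sizeExpansionInv δ b * α) b' := by
  have hb : 0 < b := hb'.trans hbb
  obtain ⟨hk1, hk2⟩ := sizeExpansionInv_spec hb hbδ hδ
  set k := sizeExpansionInv δ b with hk
  -- This many vertices are removed from a large `S`. With `τ = ⌊α n⌋` one has `|S| ≤ k α n < k (τ +
  -- 1)`, so the rest has at most `k τ` elements and `τ` is at least the fraction `1 / k` of it.
  set e := ⌈k⌉₊ with he
  have hke : k ≤ e := Nat.le_ceil k
  have hnat : Tendsto (fun n : ℕ => α * (n : ℝ)) atTop atTop :=
    tendsto_natCast_atTop_atTop.const_mul_atTop hα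
  -- The two losses are the removed vertices and the error of sampling without replacement. Both
  -- vanish in the limit, so the gap between `b'` and `b` eventually pays for them.
  have hlim : Tendsto (fun x : ℝ => b * (1 - e / x) - b' * (1 + k ^ 2 * (d * (d / (x - d)))))
      atTop (𝓝 (b * (1 - 0) - b' * (1 + k ^ 2 * (d * 0)))) := by
    refine (tendsto_const_nhds.mul (tendsto_const_nhds.sub ?_)).sub
      (tendsto_const_nhds.mul (tendsto_const_nhds.add (tendsto_const_nhds.mul
        (tendsto_const_nhds.mul ?_))))
    · exact tendsto_const_nhds.div_atTop tendsto_id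
    · exact tendsto_const_nhds.div_atTop (tendsto_atTop_add_const_right _ _ tendsto_id)
  have hev : ∀ᶠ n : ℕ in atTop, 0 < b * (1 - e / (α * n)) -
        b' * (1 + k ^ 2 * (d * (d / (α * n - d)))) ∧ (d : ℝ) + e + 1 < α * n := by
    refine ((hlim.comp hnat).eventually_const_lt ?_).and (hnat.eventually_gt_atTop _)
    simp
    linarith
  obtain ⟨n₀, hn₀⟩ := eventually_atTop.1 hev
  refine ⟨n₀, fun n m hn G hG S hS => ?_⟩
  obtain ⟨h1, h2⟩ := hn₀ n hn
  have hd0 : (0 : ℝ) ≤ d := by positivity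
  have he0 : (0 : ℝ) ≤ e := by positivity
  have hαn : 0 < α * n := by linarith
  have small : ∀ T : Finset (Fin n), (T.card : ℝ) ≤ α * n →
      b * c * T.card ≤ ((G.neighbors T).card : ℝ) := by
    intro T hT
    refine le_trans ?_ (hG T hT)
    gcongr
  rcases le_or_gt (S.card : ℝ) (α * n) with hS1 | hS1
  · refine le_trans ?_ (small S hS1)
    gcongr
  have hes : e ≤ S.card := by
    have : (e : ℝ) ≤ S.card := by linarith
    exact_mod_cast this
  obtain ⟨S', hS', hcard⟩ := Finset.exists_subset_card_eq (show S.card - e ≤ S.card by omega)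
  have hcard' : (S'.card : ℝ) = S.card - e := by rw [hcard, Nat.cast_sub hes]
  have hN : ((G.neighbors S').card : ℝ) ≤ (G.neighbors S).card := by
    exact_mod_cast Finset.card_le_card (G.neighbors_mono hS')
  refine le_trans ?_ hN
  have hω0 : 0 ≤ (d : ℝ) / (α * n - d) := div_nonneg hd0 (by linarith)
  have hkω : 0 ≤ k ^ 2 * (d * (d / (α * n - d))) := by positivity
  have hs : (1 - e / (α * n)) * S.card ≤ S'.card := by
    rw [hcard']
    have : (e : ℝ) ≤ e / (α * n) * S.card := by
      rw [div_mul_eq_mul_div, le_div_iff₀ hαn]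
      gcongr
    linarith
  have key : b * c * S'.card ≤
      (G.neighbors S').card * (1 + k ^ 2 * (d * (d / (α * n - d)))) := by
    rcases le_or_gt (S'.card : ℝ) (α * n) with hS2 | hS2
    · exact (small S' hS2).trans (le_mul_of_one_le_right (by positivity) (by linarith))
    · set τ := ⌊α * n⌋₊ with hτ
      have hτ1 : (τ : ℝ) ≤ α * n := Nat.floor_le hαn.le
      have hτ2 : α * n < τ + 1 := Nat.lt_floor_add_one _
      have hτ0 : 0 < τ := by
        have : (0 : ℝ) < τ := by linarith
        exact_mod_cast this
      have hτs : τ ≤ S'.card := by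
        have : (τ : ℝ) ≤ S'.card := by linarith
        exact_mod_cast this
      have hds : d < S'.card := by
        have : (d : ℝ) < S'.card := by linarith
        exact_mod_cast this
      have hs0 : (0 : ℝ) < S'.card := by linarith
      have hp : 1 / k ≤ τ / S'.card := by
        rw [div_le_div_iff₀ (by linarith) hs0]
        have : k * (α * n) < k * (τ + 1) := by gcongr
        rw [hcard']
        linarith
      have hp1 : (τ / S'.card : ℝ) ≤ 1 := by rw [div_le_one hs0]; exact_mod_cast hτs
      have hmain := card_neighbors_ge_of_subsets (G := G) (S := S') (τ := τ) (δ := δ) hb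
        (by linarith) (by
          intro T hT
          rw [Finset.mem_powersetCard] at hT
          rw [← hT.2]
          exact hG T (by rw [hT.2]; exact hτ1)) hτ0 hτs hds (by
          rw [← hk2]
          exact mul_le_mul_of_nonneg_left (tangentSum_mono hb (by linarith) (by linarith)) hb.le)
      set p : ℝ := τ / S'.card
      have hp0 : 0 < p := lt_of_lt_of_le (by positivity) hp
      have hω : (d : ℝ) / (S'.card - d) ≤ d / (α * n - d) :=
        div_le_div_of_nonneg_left hd0 (by linarith) (by linarith)
      have hpk : 1 ≤ k ^ 2 * p ^ 2 := by
        rw [← mul_pow]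
        apply one_le_pow₀
        rw [div_le_iff₀ (by linarith)] at hp
        linarith
      have h5 : (d : ℝ) * (d / (S'.card - d)) ≤ p ^ 2 * (k ^ 2 * (d * (d / (α * n - d)))) := by
        calc (d : ℝ) * (d / (S'.card - d)) ≤ 1 * (d * (d / (α * n - d))) := by
              rw [one_mul]; gcongr
          _ ≤ (k ^ 2 * p ^ 2) * (d * (d / (α * n - d))) := by gcongr
          _ = _ := by ring
      have h6 : b * c * S'.card * p ^ 2 ≤ (G.neighbors S').card *
          (1 + k ^ 2 * (d * (d / (α * n - d)))) * p ^ 2 := by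
        have := mul_le_mul_of_nonneg_left h5 (Nat.cast_nonneg (α := ℝ) (G.neighbors S').card)
        nlinarith
      exact le_of_mul_le_mul_right h6 (by positivity)
  have hfin : b' * c * S.card * (1 + k ^ 2 * (d * (d / (α * n - d)))) ≤
      (G.neighbors S').card * (1 + k ^ 2 * (d * (d / (α * n - d)))) := by
    refine le_trans ?_ key
    have hcS : (0 : ℝ) ≤ c * S.card := by positivity
    have h7 := mul_le_mul_of_nonneg_left hs (by positivity : 0 ≤ b * c)
    nlinarith
  exact le_of_mul_le_mul_right hfin (by linarith)

/-- In a large graph, expansion by a factor greater than `1 / d` is only possible for sets that do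
not contain all vertices. -/
theorem IsExpander.lt_one {G : TannerGraph c d n m} {a b : ℝ} (hc : 0 < c) (hn : 0 < n)
    (hbd : 1 < b * d) (hG : G.IsExpander a b) : a < 1 := by
  by_contra hcon
  push Not at hcon
  -- All left vertices together would need `b c n` neighbours, but there are only `m = c n / d`
  -- right vertices, and `b d > 1`.
  have h := hG Finset.univ (by
    rw [Finset.card_fin]
    exact le_mul_of_one_le_left (by positivity) hcon)
  rw [Finset.card_fin] at h
  have h1 : ((G.neighbors Finset.univ).card : ℝ) ≤ m := by
    exact_mod_cast (Finset.card_le_univ _).trans (by simp)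
  have h2 : (d : ℝ) * m = c * n := by exact_mod_cast G.mul_right_eq
  have hcn : (0 : ℝ) < c * n := by positivity
  have hd0 : (0 : ℝ) ≤ d := by positivity
  have := mul_le_mul_of_nonneg_left (h.trans h1) hd0
  nlinarith

/-- There are no large lossless expanders. -/
theorem not_isExpander_one (G : TannerGraph c d n m) {α : ℝ} (hc : 0 < c) (hd : 1 < d)
    (hn : 2 ≤ α * n) (hn0 : 0 < n) : ¬ G.IsExpander α 1 := by
  intro hG
  -- Two left vertices with a common check `v` have fewer than `2 c` neighbours.
  set v := G.left ⟨0, hn0⟩ ⟨0, hc⟩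
  set u₁ := G.right v ⟨0, by omega⟩
  set u₂ := G.right v ⟨1, hd⟩
  have hne : u₁ ≠ u₂ := fun h => by
    have := G.right_injective v h
    simp at this
  have h1 := hG {u₁, u₂} (by rw [Finset.card_pair hne]; exact_mod_cast hn)
  rw [Finset.card_pair hne] at h1
  have h2 := G.sum_neighbors_card_inter_nbhd {u₁, u₂}
  rw [Finset.card_pair hne] at h2
  have hv : ({u₁, u₂} ∩ G.nbhd v) = {u₁, u₂} := by
    apply Finset.inter_eq_left.2
    intro u hu
    rw [Finset.mem_insert, Finset.mem_singleton] at hu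
    rcases hu with rfl | rfl
    · exact mem_nbhd.2 ⟨_, rfl⟩
    · exact mem_nbhd.2 ⟨_, rfl⟩
  have hvm : v ∈ G.neighbors {u₁, u₂} := by
    rw [mem_neighbors, hv]
    exact ⟨u₁, by simp⟩
  have h3 : (G.neighbors {u₁, u₂}).card < ∑ w ∈ G.neighbors {u₁, u₂},
      (({u₁, u₂} : Finset (Fin n)) ∩ G.nbhd w).card := by
    rw [Finset.card_eq_sum_ones]
    refine Finset.sum_lt_sum (fun w hw => Finset.card_pos.2 (mem_neighbors.1 hw)) ⟨v, hvm, ?_⟩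
    rw [hv, Finset.card_pair hne]
    omega
  rw [h2] at h3
  have h4 : ((G.neighbors {u₁, u₂}).card : ℝ) < c * 2 := by exact_mod_cast h3
  push_cast at h1
  linarith

end TannerGraph


/-! ### Local decoding and the votes of the checks -/

theorem mem_lexWords {d : ℕ} (w : Word d) : w ∈ lexWords d := by
  induction d with
  | zero => simp [lexWords]; exact Subsingleton.elim _ _
  | succ d ih =>
    simp only [lexWords, List.mem_flatMap, List.mem_map]
    refine ⟨w 0, ?_, Fin.tail w, ih _, Fin.cons_self_tail w⟩
    have h : ∀ b : ZMod 2, b ∈ [0, 1] := by decide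
    exact h _

theorem localDecode_spec {d : ℕ} (C₀ : Submodule (ZMod 2) (Word d)) (x : Word d) :
    localDecode C₀ x ∈ C₀ ∧ ∀ z ∈ C₀, hammingDist (localDecode C₀ x) x ≤ hammingDist z x := by
  classical
  unfold localDecode
  set l := (lexWords d).filter fun w => w ∈ C₀ with hl
  have hmem : ∀ z, z ∈ l ↔ z ∈ C₀ := by
    intro z
    simp [hl, mem_lexWords]
  rcases h : l.argmin fun w => hammingDist w x with _ | w
  -- The default value in `localDecode` is never taken, because `0` belongs to the code and hence to
  -- the list.
  · rw [List.argmin_eq_none] at h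
    have := (hmem 0).2 C₀.zero_mem
    simp [h] at this
  · have hw : w ∈ l.argmin fun w => hammingDist w x := h
    exact ⟨(hmem w).1 (List.argmin_mem hw), fun z hz => List.le_of_mem_argmin ((hmem z).2 hz) hw⟩

theorem localDecode_eq_self {d : ℕ} {C₀ : Submodule (ZMod 2) (Word d)} {x : Word d} (h : x ∈ C₀) :
    localDecode C₀ x = x := by
  have := (localDecode_spec C₀ x).2 x h
  rw [hammingDist_self] at this
  exact eq_of_hammingDist_eq_zero (by omega)

theorem IsMinDist.le {d d₀ : ℕ} {C : Submodule (ZMod 2) (Word d)} (h : IsMinDist C d₀)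
    {x y : Word d} (hx : x ∈ C) (hy : y ∈ C) (hxy : x ≠ y) : d₀ ≤ hammingDist x y :=
  h.2 ⟨x, hx, y, hy, hxy, rfl⟩

theorem IsMinDist.le_length {d d₀ : ℕ} {C : Submodule (ZMod 2) (Word d)} (h : IsMinDist C d₀) :
    d₀ ≤ d := by
  obtain ⟨x, -, y, -, -, h⟩ := h.1
  rw [← h]
  exact hammingDist_le_card_fintype.trans (by simp)

/-- The weight of the vote of a check with the local view `w`, in units of `1 / (c d₀)`. -/
def voteWeight {d : ℕ} (C₀ : Submodule (ZMod 2) (Word d)) (d₀ : ℕ) (w : Word d) : ℕ :=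
  if 1 ≤ hammingDist (localDecode C₀ w) w ∧ 2 * hammingDist (localDecode C₀ w) w < d₀ then
    d₀ - 2 * hammingDist (localDecode C₀ w) w
  else 0

/-- The position for which a check with the local view `w` votes. -/
def voteIndex {d : ℕ} (C₀ : Submodule (ZMod 2) (Word d)) (w : Word d) : Option (Fin d) :=
  (List.finRange d).find? fun i => decide (localDecode C₀ w i ≠ w i)

theorem voteWeight_le {d : ℕ} (C₀ : Submodule (ZMod 2) (Word d)) (d₀ : ℕ) (w : Word d) :
    voteWeight C₀ d₀ w ≤ d₀ := by
  unfold voteWeight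
  split_ifs <;> omega

theorem voteWeight_eq_zero {d : ℕ} {C₀ : Submodule (ZMod 2) (Word d)} (d₀ : ℕ) {w : Word d}
    (h : w ∈ C₀) : voteWeight C₀ d₀ w = 0 := by
  unfold voteWeight
  rw [localDecode_eq_self h, hammingDist_self]
  simp

theorem exists_voteIndex_of_voteWeight_pos {d : ℕ} {C₀ : Submodule (ZMod 2) (Word d)} {d₀ : ℕ}
    {w : Word d} (h : 0 < voteWeight C₀ d₀ w) :
    ∃ i, voteIndex C₀ w = some i ∧ localDecode C₀ w i ≠ w i := by
  unfold voteWeight at h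
  split_ifs at h with h1
  · have hne : localDecode C₀ w ≠ w := fun hcon => by
      rw [hcon, hammingDist_self] at h1
      omega
    obtain ⟨j, hj⟩ := Function.ne_iff.1 hne
    have hsome : (voteIndex C₀ w).isSome := by
      unfold voteIndex
      rw [List.find?_isSome]
      exact ⟨j, List.mem_finRange j, by simpa using hj⟩
    obtain ⟨i, hi⟩ := Option.isSome_iff_exists.1 hsome
    refine ⟨i, hi, ?_⟩
    have := List.find?_some hi
    simpa using this
  · omega

/-! ### Votes, corrupt bits and unsatisfied checks -/

namespace TannerGraph

variable {c d n m : ℕ}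

/-- The contribution of the check `v` to the bit `u`, in units of `1 / (c d₀)`. -/
def vote (G : TannerGraph c d n m) (C₀ : Submodule (ZMod 2) (Word d)) (d₀ : ℕ) (x : Word n)
    (v : Fin m) (u : Fin n) : ℕ :=
  if G.voteTarget C₀ x v = some u then voteWeight C₀ d₀ (G.localView x v) else 0

/-- The number `c d₀ p_u`. -/
def flipNum (G : TannerGraph c d n m) (C₀ : Submodule (ZMod 2) (Word d)) (d₀ : ℕ) (x : Word n)
    (u : Fin n) : ℕ := ∑ v, G.vote C₀ d₀ x v u

/-- The set of corrupt bits. -/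
def corrupt (x y : Word n) : Finset (Fin n) := Finset.univ.filter fun u => x u ≠ y u

theorem card_corrupt (x y : Word n) : (corrupt x y).card = hammingDist x y := rfl

theorem voteTarget_eq (G : TannerGraph c d n m) (C₀ : Submodule (ZMod 2) (Word d)) (x : Word n)
    (v : Fin m) : G.voteTarget C₀ x v = (voteIndex C₀ (G.localView x v)).map (G.right v) := rfl

theorem vote_eq (G : TannerGraph c d n m) (C₀ : Submodule (ZMod 2) (Word d)) (d₀ : ℕ) (x : Word n)
    (v : Fin m) (u : Fin n) : G.vote C₀ d₀ x v u =
      if (voteIndex C₀ (G.localView x v)).map (G.right v) = some u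
        then voteWeight C₀ d₀ (G.localView x v) else 0 := rfl

/-- In units of `1 / (c d₀)` all votes are natural numbers. Guesses become integers from `1` to `c
d₀`, and the machine can count votes exactly. -/
theorem flipProb_eq (G : TannerGraph c d n m) (C₀ : Submodule (ZMod 2) (Word d)) {d₀ : ℕ}
    (hd₀ : 0 < d₀) (x : Word n) (u : Fin n) :
    G.flipProb C₀ d₀ x u = G.flipNum C₀ d₀ x u / ((c : ℝ) * d₀) := by
  unfold flipProb flipNum vote voteWeight localDist
  push_cast
  rw [Finset.sum_div]
  refine Finset.sum_congr rfl fun v _ => ?_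
  set e := hammingDist (localDecode C₀ (G.localView x v)) (G.localView x v)
  have hiff : ((e : ℝ) < (d₀ : ℝ) / 2) ↔ 2 * e < d₀ := by
    rw [lt_div_iff₀ (by norm_num), mul_comm]
    exact_mod_cast Iff.rfl
  have h0 : (d₀ : ℝ) ≠ 0 := by positivity
  simp only [hiff]
  by_cases h1 : 1 ≤ e <;> by_cases h2 : 2 * e < d₀ <;>
    by_cases h3 : G.voteTarget C₀ x v = some u <;> simp [h1, h2, h3]
  rw [Nat.cast_sub h2.le]
  push_cast
  rcases eq_or_ne (c : ℝ) 0 with hc | hc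
  · simp [hc]
  · field_simp

theorem vote_pos_mem_nbhd {G : TannerGraph c d n m} {C₀ : Submodule (ZMod 2) (Word d)} {d₀ : ℕ}
    {x : Word n} {v : Fin m} {u : Fin n} (h : 0 < G.vote C₀ d₀ x v u) : u ∈ G.nbhd v := by
  rw [vote_eq] at h
  split_ifs at h with h1
  · rw [Option.map_eq_some_iff] at h1
    obtain ⟨i, -, hi⟩ := h1
    exact mem_nbhd.2 ⟨i, hi⟩
  · omega

theorem sum_vote_le (G : TannerGraph c d n m) (C₀ : Submodule (ZMod 2) (Word d)) (d₀ : ℕ)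
    (x : Word n) (v : Fin m) (S : Finset (Fin n)) :
    ∑ u ∈ S, G.vote C₀ d₀ x v u ≤ voteWeight C₀ d₀ (G.localView x v) := by
  unfold vote
  rcases h : G.voteTarget C₀ x v with _ | w
  · simp
  · simp only [Option.some.injEq]
    rw [Finset.sum_ite_eq]
    split_ifs <;> omega

/-- Only the `c` neighbours of `u` can vote for it, each with weight at most `d₀`. This is why flip
probabilities never exceed `1`. -/
theorem flipNum_le (G : TannerGraph c d n m) (C₀ : Submodule (ZMod 2) (Word d)) (d₀ : ℕ)
    (x : Word n) (u : Fin n) : G.flipNum C₀ d₀ x u ≤ c * d₀ := by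
  have h := G.sum_card_inter_nbhd {u}
  rw [Finset.card_singleton, mul_one] at h
  refine le_of_le_of_eq ?_ (congrArg (· * d₀) h)
  simp only [Finset.sum_mul]
  refine Finset.sum_le_sum fun v _ => ?_
  rcases Nat.eq_zero_or_pos (G.vote C₀ d₀ x v u) with h0 | h0
  · rw [h0]; exact Nat.zero_le _
  · have : ({u} ∩ G.nbhd v) = {u} :=
      Finset.inter_eq_left.2 (Finset.singleton_subset_iff.2 (vote_pos_mem_nbhd h0))
    rw [this, Finset.card_singleton, one_mul]
    unfold vote
    split_ifs
    · exact voteWeight_le _ _ _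
    · exact Nat.zero_le _

theorem mem_unsat {G : TannerGraph c d n m} {C₀ : Submodule (ZMod 2) (Word d)} {x : Word n}
    {v : Fin m} : v ∈ G.unsat C₀ x ↔ G.localView x v ∉ C₀ := by
  simp [unsat]

theorem sum_flipNum_le (G : TannerGraph c d n m) (C₀ : Submodule (ZMod 2) (Word d)) (d₀ : ℕ)
    (x : Word n) : ∑ u, G.flipNum C₀ d₀ x u ≤ d₀ * (G.unsat C₀ x).card := by
  unfold flipNum
  rw [Finset.sum_comm]
  have h : ∑ v, ∑ u, G.vote C₀ d₀ x v u ≤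
      ∑ v, if v ∈ G.unsat C₀ x then d₀ else 0 := by
    refine Finset.sum_le_sum fun v _ => (G.sum_vote_le C₀ d₀ x v _).trans ?_
    split_ifs with h
    · exact voteWeight_le _ _ _
    · rw [mem_unsat, not_not] at h
      rw [voteWeight_eq_zero d₀ h]
  refine h.trans ?_
  rw [Finset.sum_ite_mem, Finset.univ_inter, Finset.sum_const, smul_eq_mul, mul_comm]

theorem card_corrupt_inter_nbhd (G : TannerGraph c d n m) (x y : Word n) (v : Fin m) :
    (corrupt x y ∩ G.nbhd v).card = hammingDist (G.localView x v) (G.localView y v) := by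
  unfold hammingDist localView
  have : corrupt x y ∩ G.nbhd v = (Finset.univ.filter fun i =>
      x (G.right v i) ≠ y (G.right v i)).image (G.right v) := by
    ext u
    simp only [corrupt, Finset.mem_inter, Finset.mem_filter, Finset.mem_univ, true_and, mem_nbhd,
      Finset.mem_image]
    constructor
    · rintro ⟨h, i, rfl⟩
      exact ⟨i, h, rfl⟩
    · rintro ⟨i, h, rfl⟩
      exact ⟨h, i, rfl⟩
  rw [this, Finset.card_image_of_injective _ (G.right_injective v)]

theorem unsat_subset_neighbors {G : TannerGraph c d n m} {C₀ : Submodule (ZMod 2) (Word d)}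
    {x y : Word n} (hy : y ∈ G.tannerCode C₀) : G.unsat C₀ x ⊆ G.neighbors (corrupt x y) := by
  intro v hv
  rw [mem_unsat] at hv
  rw [mem_neighbors, ← Finset.card_pos, card_corrupt_inter_nbhd]
  refine hammingDist_pos.2 fun h => hv ?_
  rw [h]
  exact hy v

theorem card_unsat_le {G : TannerGraph c d n m} {C₀ : Submodule (ZMod 2) (Word d)}
    {x y : Word n} (hy : y ∈ G.tannerCode C₀) : (G.unsat C₀ x).card ≤ c * hammingDist x y :=
  (Finset.card_le_card (unsat_subset_neighbors hy)).trans (G.card_neighbors_le _)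

theorem mem_tannerCode_iff {G : TannerGraph c d n m} {C₀ : Submodule (ZMod 2) (Word d)}
    {x : Word n} : x ∈ G.tannerCode C₀ ↔ (G.unsat C₀ x).card = 0 := by
  rw [Finset.card_eq_zero, Finset.eq_empty_iff_forall_notMem]
  simp only [mem_unsat, not_not]
  rfl

/-- Many corrupt bits cause many unsatisfied checks. -/
theorem mul_card_unsat_ge {G : TannerGraph c d n m} {C₀ : Submodule (ZMod 2) (Word d)} {d₀ : ℕ}
    (hd₀ : IsMinDist C₀ d₀) {x y : Word n} (hy : y ∈ G.tannerCode C₀) :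
    (d₀ : ℝ) * (G.neighbors (corrupt x y)).card - c * hammingDist x y ≤
      (d₀ - 1) * (G.unsat C₀ x).card := by
  have h := G.sum_neighbors_card_inter_nbhd (corrupt x y)
  rw [card_corrupt] at h
  -- A satisfied check next to a corrupt bit sees two different codewords, hence at least `d₀`
  -- corrupt bits; an unsatisfied one in the neighbourhood sees at least one. The sum counts the
  -- edges at the corrupt bits.
  have h1 : ∑ v ∈ G.neighbors (corrupt x y), ((d₀ : ℤ) - if v ∈ G.unsat C₀ x then ((d₀ : ℤ) - 1)
      else 0) ≤ ∑ v ∈ G.neighbors (corrupt x y), ((corrupt x y ∩ G.nbhd v).card : ℤ) := by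
    refine Finset.sum_le_sum fun v hv => ?_
    rw [mem_neighbors, ← Finset.card_pos] at hv
    split_ifs with hu
    · omega
    · rw [mem_unsat, not_not] at hu
      rw [card_corrupt_inter_nbhd] at hv ⊢
      have := hd₀.le hu (hy v) (hammingDist_pos.1 hv)
      omega
  rw [Finset.sum_sub_distrib, Finset.sum_const, Finset.sum_ite_mem,
    Finset.inter_eq_right.2 (unsat_subset_neighbors hy), Finset.sum_const, ← Nat.cast_sum, h] at h1
  simp only [nsmul_eq_mul] at h1
  have h2 : ((G.neighbors (corrupt x y)).card : ℝ) * d₀ - (G.unsat C₀ x).card * (d₀ - 1) ≤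
      ((c * hammingDist x y : ℕ) : ℝ) := by exact_mod_cast h1
  push_cast at h2
  linarith

/-- Let `e` be the number of corrupt neighbours. If `2 e < d₀`, local decoding finds the view of
`y`, and the vote of weight `d₀ - 2 e` goes to a corrupt bit. Otherwise a vote can only come from
decoding to another codeword, at distance at least `d₀ - e`, so its weight is at most `2 e - d₀`
even if it is misdirected. A misdirected vote has positive weight, which forces `2 e > d₀`. -/
theorem vote_signed_ge {G : TannerGraph c d n m} {C₀ : Submodule (ZMod 2) (Word d)} {d₀ : ℕ}
    (hd₀ : IsMinDist C₀ d₀) {x y : Word n} (hy : y ∈ G.tannerCode C₀) (v : Fin m)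
    (hv : v ∈ G.neighbors (corrupt x y)) :
    (d₀ : ℤ) - 2 * (corrupt x y ∩ G.nbhd v).card ≤
      ∑ u ∈ corrupt x y, (G.vote C₀ d₀ x v u : ℤ) - ∑ u ∈ (corrupt x y)ᶜ, (G.vote C₀ d₀ x v u : ℤ) ∧
    (0 < ∑ u ∈ (corrupt x y)ᶜ, G.vote C₀ d₀ x v u →
      d₀ + 1 ≤ 2 * (corrupt x y ∩ G.nbhd v).card) := by
  rw [mem_neighbors, ← Finset.card_pos] at hv
  rw [card_corrupt_inter_nbhd] at hv ⊢
  set w := G.localView x v with hw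
  set w' := G.localView y v with hw'
  set e := hammingDist w w' with he
  obtain ⟨hdec, hmin⟩ := localDecode_spec C₀ w
  have hyv : w' ∈ C₀ := hy v
  have hle := hmin w' hyv
  rw [hammingDist_comm w' w, ← he] at hle
  have htri := hammingDist_triangle (localDecode C₀ w) w w'
  rw [← he] at htri
  rcases Nat.lt_or_ge (2 * e) d₀ with hlt | hge
  · have heq : localDecode C₀ w = w' := by
      by_contra hcon
      have := hd₀.le hdec hyv hcon
      omega
    have hwt : voteWeight C₀ d₀ w = d₀ - 2 * e := by
      unfold voteWeight
      rw [heq, hammingDist_comm, ← he, if_pos ⟨by omega, hlt⟩]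
    obtain ⟨i, hi, hne⟩ := exists_voteIndex_of_voteWeight_pos (w := w) (C₀ := C₀) (d₀ := d₀)
      (by omega)
    have htgt : G.voteTarget C₀ x v = some (G.right v i) := by
      rw [voteTarget_eq, ← hw, hi, Option.map_some]
    have hcor : G.right v i ∈ corrupt x y := by
      rw [heq] at hne
      simp only [corrupt, Finset.mem_filter, Finset.mem_univ, true_and]
      exact fun h => hne h.symm
    have h1 : ∑ u ∈ corrupt x y, (G.vote C₀ d₀ x v u : ℤ) = d₀ - 2 * e := by
      unfold vote
      rw [htgt, ← hw, hwt]
      simp only [Option.some.injEq, Nat.cast_ite, Nat.cast_zero]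
      rw [Finset.sum_ite_eq, if_pos hcor]
      omega
    have h2 : ∑ u ∈ (corrupt x y)ᶜ, G.vote C₀ d₀ x v u = 0 := by
      refine Finset.sum_eq_zero fun u hu => ?_
      unfold vote
      rw [htgt, if_neg]
      intro h
      rw [Option.some.injEq] at h
      rw [Finset.mem_compl] at hu
      exact hu (h ▸ hcor)
    rw [h1, ← Nat.cast_sum, h2]
    constructor <;> simp
  · have hwt : 0 < voteWeight C₀ d₀ w → voteWeight C₀ d₀ w + d₀ ≤ 2 * e ∧ d₀ + 1 ≤ 2 * e := by
      intro hpos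
      unfold voteWeight at hpos ⊢
      split_ifs at hpos ⊢ with h1
      · have hne : localDecode C₀ w ≠ w' := by
          intro hcon
          rw [hcon, hammingDist_comm, ← he] at h1
          omega
        have := hd₀.le hdec hyv hne
        omega
      · omega
    have h1 := G.sum_vote_le C₀ d₀ x v (corrupt x y)ᶜ
    rw [← hw] at h1
    have h2 : (0 : ℤ) ≤ ∑ u ∈ corrupt x y, (G.vote C₀ d₀ x v u : ℤ) := by positivity
    constructor
    · rw [← Nat.cast_sum (corrupt x y)ᶜ]
      rcases Nat.eq_zero_or_pos (voteWeight C₀ d₀ w) with h0 | h0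
      · omega
      · have := hwt h0
        omega
    · intro h
      exact (hwt (by omega)).2

theorem vote_eq_zero_of_notMem {G : TannerGraph c d n m} {C₀ : Submodule (ZMod 2) (Word d)}
    (d₀ : ℕ) {x : Word n} {v : Fin m} (hv : v ∉ G.unsat C₀ x) (u : Fin n) :
    G.vote C₀ d₀ x v u = 0 := by
  rw [mem_unsat, not_not] at hv
  rw [vote_eq, voteWeight_eq_zero d₀ hv, ite_self]

theorem flipNum_eq_sum_neighbors {G : TannerGraph c d n m} {C₀ : Submodule (ZMod 2) (Word d)}
    (d₀ : ℕ) {x y : Word n} (hy : y ∈ G.tannerCode C₀) (u : Fin n) :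
    G.flipNum C₀ d₀ x u = ∑ v ∈ G.neighbors (corrupt x y), G.vote C₀ d₀ x v u := by
  symm
  refine Finset.sum_subset (Finset.subset_univ _) fun v _ hv => ?_
  exact vote_eq_zero_of_notMem d₀ (fun h => hv (unsat_subset_neighbors hy h)) u

/-- The drift of the flipping algorithms. -/
theorem flipNum_drift {G : TannerGraph c d n m} {C₀ : Submodule (ZMod 2) (Word d)} {d₀ : ℕ}
    (hd₀ : IsMinDist C₀ d₀) {x y : Word n} (hy : y ∈ G.tannerCode C₀) :
    (d₀ : ℝ) * (G.neighbors (corrupt x y)).card - 2 * c * hammingDist x y ≤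
      ∑ u ∈ corrupt x y, (G.flipNum C₀ d₀ x u : ℝ) -
        ∑ u ∈ (corrupt x y)ᶜ, (G.flipNum C₀ d₀ x u : ℝ) := by
  -- Summing over the neighbours of the corrupt bits loses no vote, since all other checks are
  -- satisfied and silent.
  have h1 := Finset.sum_le_sum fun v hv => (vote_signed_ge (x := x) hd₀ hy v hv).1
  rw [Finset.sum_sub_distrib, Finset.sum_sub_distrib, Finset.sum_comm, Finset.sum_comm (t := (corrupt x y)ᶜ),
    Finset.sum_const, ← Finset.mul_sum, ← Nat.cast_sum, sum_neighbors_card_inter_nbhd,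
    card_corrupt] at h1
  simp only [← Nat.cast_sum, ← flipNum_eq_sum_neighbors d₀ hy, nsmul_eq_mul] at h1
  simp only [← Nat.cast_sum]
  have h2 : ((G.neighbors (corrupt x y)).card : ℝ) * d₀ - 2 * ((c * hammingDist x y : ℕ) : ℝ) ≤
      ((∑ u ∈ corrupt x y, G.flipNum C₀ d₀ x u : ℕ) : ℝ) -
      ((∑ u ∈ (corrupt x y)ᶜ, G.flipNum C₀ d₀ x u : ℕ) : ℝ) := by exact_mod_cast h1
  push_cast at h2 ⊢
  linarith

/-- Few correct bits can be flipped. -/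
theorem card_flipNum_pos_le {G : TannerGraph c d n m} {C₀ : Submodule (ZMod 2) (Word d)} {d₀ : ℕ}
    (hd₀ : IsMinDist C₀ d₀) {x y : Word n} (hy : y ∈ G.tannerCode C₀) :
    (d₀ + 1) * ((corrupt x y)ᶜ.filter fun u => 0 < G.flipNum C₀ d₀ x u).card ≤
      2 * (c * hammingDist x y) := by
  classical
  set N := G.neighbors (corrupt x y)
  -- The checks that may vote for a correct bit. Each votes for at most one bit and absorbs more
  -- than `d₀ / 2` of the `c F` edges at the `F` corrupt bits.
  set B := N.filter fun v => d₀ + 1 ≤ 2 * (corrupt x y ∩ G.nbhd v).card with hB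
  have h1 : ((corrupt x y)ᶜ.filter fun u => 0 < G.flipNum C₀ d₀ x u).card ≤ B.card := by
    have hex : ∀ u ∈ (corrupt x y)ᶜ.filter fun u => 0 < G.flipNum C₀ d₀ x u,
        ∃ v ∈ B, G.voteTarget C₀ x v = some u := by
      intro u hu
      rw [Finset.mem_filter] at hu
      obtain ⟨hu1, hu2⟩ := hu
      rw [flipNum_eq_sum_neighbors d₀ hy] at hu2
      obtain ⟨v, hv, hpos⟩ := Finset.exists_ne_zero_of_sum_ne_zero hu2.ne'
      refine ⟨v, ?_, ?_⟩
      · rw [hB, Finset.mem_filter]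
        refine ⟨hv, (vote_signed_ge hd₀ hy v hv).2 ?_⟩
        exact lt_of_lt_of_le (Nat.pos_of_ne_zero hpos)
          (Finset.single_le_sum (f := fun u => G.vote C₀ d₀ x v u) (fun _ _ => Nat.zero_le _) hu1)
      · unfold vote at hpos
        by_contra hcon
        rw [if_neg hcon] at hpos
        exact hpos rfl
    rw [← Finset.card_image_of_injective _ (Option.some_injective (Fin n))]
    refine (Finset.card_le_card ?_).trans (Finset.card_image_le (f := G.voteTarget C₀ x) (s := B))
    intro o ho
    rw [Finset.mem_image] at ho
    obtain ⟨u, hu, rfl⟩ := ho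
    obtain ⟨v, hv, hvt⟩ := hex u hu
    exact Finset.mem_image.2 ⟨v, hv, hvt⟩
  calc (d₀ + 1) * _ ≤ (d₀ + 1) * B.card := Nat.mul_le_mul_left _ h1
    _ = ∑ v ∈ B, (d₀ + 1) := by rw [Finset.sum_const, smul_eq_mul, mul_comm]
    _ ≤ ∑ v ∈ B, 2 * (corrupt x y ∩ G.nbhd v).card :=
        Finset.sum_le_sum fun v hv => (Finset.mem_filter.1 hv).2
    _ ≤ ∑ v ∈ N, 2 * (corrupt x y ∩ G.nbhd v).card :=
        Finset.sum_le_sum_of_subset (Finset.filter_subset _ _)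
    _ = _ := by rw [← Finset.mul_sum, sum_neighbors_card_inter_nbhd, card_corrupt]

end TannerGraph


/-! ### Expectations over discrete distributions -/

/-- The expectation of a nonnegative function. -/
def expect {A : Type*} (μ : PMF A) (f : A → ℝ≥0∞) : ℝ≥0∞ := ∑' a, μ a * f a

theorem expect_pure {A : Type*} (a : A) (f : A → ℝ≥0∞) : expect (PMF.pure a) f = f a := by
  classical
  unfold expect
  rw [tsum_eq_single a]
  · simp
  · intro b hb
    simp [PMF.pure_apply, hb]

theorem expect_bind {A B : Type*} (μ : PMF A) (κ : A → PMF B) (f : B → ℝ≥0∞) :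
    expect (μ.bind κ) f = expect μ fun a => expect (κ a) f := by
  unfold expect
  simp only [PMF.bind_apply, ← ENNReal.tsum_mul_right, ← ENNReal.tsum_mul_left]
  rw [ENNReal.tsum_comm]
  simp only [mul_assoc]

theorem expect_map {A B : Type*} (μ : PMF A) (g : A → B) (f : B → ℝ≥0∞) :
    expect (μ.map g) f = expect μ (f ∘ g) := by
  rw [← PMF.bind_pure_comp, expect_bind]
  simp only [Function.comp_apply, expect_pure]
  rfl

theorem expect_mono {A : Type*} {μ : PMF A} {f g : A → ℝ≥0∞} (h : ∀ a ∈ μ.support, f a ≤ g a) :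
    expect μ f ≤ expect μ g := by
  refine ENNReal.tsum_le_tsum fun a => ?_
  by_cases ha : a ∈ μ.support
  · exact mul_le_mul_right (h a ha) _
  · rw [PMF.mem_support_iff, not_not] at ha
    simp [ha]

theorem expect_const {A : Type*} (μ : PMF A) (r : ℝ≥0∞) : expect μ (fun _ => r) = r := by
  unfold expect
  rw [ENNReal.tsum_mul_right, PMF.tsum_coe, one_mul]

theorem expect_add {A : Type*} (μ : PMF A) (f g : A → ℝ≥0∞) :
    expect μ (fun a => f a + g a) = expect μ f + expect μ g := by
  unfold expect
  simp only [mul_add, ENNReal.tsum_add]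

theorem expect_mul_const {A : Type*} (μ : PMF A) (f : A → ℝ≥0∞) (r : ℝ≥0∞) :
    expect μ (fun a => f a * r) = expect μ f * r := by
  unfold expect
  simp only [← mul_assoc, ENNReal.tsum_mul_right]

theorem bind_apply_eq_expect {A B : Type*} (μ : PMF A) (κ : A → PMF B) (b : B) :
    μ.bind κ b = expect μ fun a => κ a b := rfl

theorem pmf_foldlM_nil {A B : Type} (f : B → A → PMF B) (b : B) :
    ([] : List A).foldlM f b = PMF.pure b := rfl

theorem pmf_foldlM_cons {A B : Type} (f : B → A → PMF B) (b : B) (a : A) (l : List A) :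
    (a :: l).foldlM f b = (f b a).bind fun z => l.foldlM f z := rfl

theorem expect_coin {p : ℝ} (h0 : 0 ≤ p) (h1 : p ≤ 1) (f : Bool → ℝ≥0∞) :
    expect (coin p) f = ENNReal.ofReal p * f true + ENNReal.ofReal (1 - p) * f false := by
  have hmin : min (ENNReal.ofReal p) 1 = ENNReal.ofReal p :=
    min_eq_left (by rw [← ENNReal.ofReal_one]; exact ENNReal.ofReal_le_ofReal h1)
  unfold expect coin
  rw [tsum_fintype, Fintype.sum_bool]
  simp only [PMF.ofFintype_apply, hmin, if_true, Bool.false_eq_true, if_false]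
  rw [ENNReal.ofReal_sub _ h0, ENNReal.ofReal_one]

/-! ### Concentration of `RandFlip` -/

theorem flipBit_flipBit {n : ℕ} (x : Word n) (u : Fin n) : flipBit (flipBit x u) u = x := by
  unfold flipBit
  rw [Function.update_self, Function.update_idem, add_assoc, CharTwo.add_self_eq_zero, add_zero,
    Function.update_eq_self]

theorem hammingDist_flipBit_of_ne {n : ℕ} {x y : Word n} {u : Fin n} (h : x u ≠ y u) :
    hammingDist (flipBit x u) y + 1 = hammingDist x y := by
  have h1 : x u + 1 = y u := by
    have : ∀ a b : ZMod 2, a ≠ b → a + 1 = b := by decide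
    exact this _ _ h
  unfold hammingDist
  have h2 : (Finset.univ.filter fun i => flipBit x u i ≠ y i) =
      (Finset.univ.filter fun i => x i ≠ y i).erase u := by
    ext i
    unfold flipBit
    rcases eq_or_ne i u with rfl | hi
    · simp [h1]
    · simp [hi]
  rw [h2, Finset.card_erase_add_one]
  simpa using h

theorem hammingDist_flipBit_of_eq {n : ℕ} {x y : Word n} {u : Fin n} (h : x u = y u) :
    hammingDist (flipBit x u) y = hammingDist x y + 1 := by
  have h1 : flipBit x u u ≠ y u := by
    have : ∀ a : ZMod 2, a + 1 ≠ a := by decide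
    rw [flipBit, Function.update_self, h]
    exact this _
  rw [← hammingDist_flipBit_of_ne h1, flipBit_flipBit]

/-- The exponent by which a flip with probability `p` of the bit `u` is accounted for. -/
def flipExponent {n : ℕ} (t : ℝ) (p : Fin n → ℝ) (x y : Word n) (u : Fin n) : ℝ :=
  if x u = y u then p u * (Real.exp t - 1) else - (p u * (1 - Real.exp (-t)))

/-- A coin multiplies the exponential moment by `1 + p (exp (±t) - 1)`, which is at most the
exponential of `flipExponent`. The current word still agrees with `x` on the bits not yet treated,
so the sign for each bit is known beforehand. -/
theorem expect_exp_foldlM {n : ℕ} (t : ℝ) {p : Fin n → ℝ} (h0 : ∀ u, 0 ≤ p u) (h1 : ∀ u, p u ≤ 1)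
    (x y : Word n) (l : List (Fin n)) (hl : l.Nodup) (z : Word n) (hz : ∀ u ∈ l, z u = x u) :
    expect (l.foldlM (fun z u => (coin (p u)).map fun b => if b then flipBit z u else z) z)
      (fun z => ENNReal.ofReal (Real.exp (t * hammingDist z y))) ≤
    ENNReal.ofReal (Real.exp (t * hammingDist z y + (l.map (flipExponent t p x y)).sum)) := by
  induction l generalizing z with
  | nil => simp [pmf_foldlM_nil, expect_pure, -List.foldlM_nil]
  | cons u l ih =>
    rw [List.nodup_cons] at hl
    have hzu : z u = x u := hz u (by simp)
    have ihz := ih hl.2 z fun w hw => hz w (by simp [hw])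
    have ihf := ih hl.2 (flipBit z u) fun w hw => by
      rw [flipBit, Function.update_of_ne (by rintro rfl; exact hl.1 hw)]
      exact hz w (by simp [hw])
    rw [pmf_foldlM_cons, expect_bind, expect_map,
      expect_coin (h0 u) (h1 u)]
    simp only [Function.comp_apply, if_true, Bool.false_eq_true, if_false, List.map_cons,
      List.sum_cons]
    set S := (l.map (flipExponent t p x y)).sum
    set D : ℝ := (hammingDist z y : ℝ) with hD
    have hsub : 0 ≤ 1 - p u := sub_nonneg.2 (h1 u)
    refine (add_le_add (mul_le_mul_right ihf _) (mul_le_mul_right ihz _)).trans ?_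
    rw [← ENNReal.ofReal_mul (h0 u), ← ENNReal.ofReal_mul hsub,
      ← ENNReal.ofReal_add (mul_nonneg (h0 u) (Real.exp_nonneg _))
        (mul_nonneg hsub (Real.exp_nonneg _))]
    apply ENNReal.ofReal_le_ofReal
    have hexp : Real.exp (t * D + (flipExponent t p x y u + S)) =
        Real.exp (t * D + S) * Real.exp (flipExponent t p x y u) := by
      rw [← Real.exp_add]; ring_nf
    rw [hexp]
    have hpos := Real.exp_pos (t * D + S)
    have hone := Real.add_one_le_exp (flipExponent t p x y u)
    unfold flipExponent at hone ⊢
    split_ifs at hone ⊢ with h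
    · have hd : (hammingDist (flipBit z u) y : ℝ) = D + 1 := by
        rw [hammingDist_flipBit_of_eq (by rw [hzu, h])]; push_cast; rfl
      have h2 : Real.exp (t * (D + 1) + S) = Real.exp (t * D + S) * Real.exp t := by
        rw [← Real.exp_add]; ring_nf
      rw [hd, h2]
      nlinarith
    · have hd : (hammingDist (flipBit z u) y : ℝ) = D - 1 := by
        rw [hD, ← hammingDist_flipBit_of_ne (x := z) (by rw [hzu]; exact h)]; push_cast; ring
      have h2 : Real.exp (t * (D - 1) + S) = Real.exp (t * D + S) * Real.exp (-t) := by
        rw [← Real.exp_add]; ring_nf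
      rw [hd, h2]
      nlinarith

namespace TannerGraph

variable {c d n m : ℕ}

/-- The exponential moment of the number of corrupt bits decreases in every round. -/
theorem expect_exp_randFlip {G : TannerGraph c d n m} {C₀ : Submodule (ZMod 2) (Word d)} {d₀ : ℕ}
    {a b κ : ℝ} (hc : 0 < c) (hd₀ : IsMinDist C₀ d₀) (hd₀' : 0 < d₀) (hG : G.IsExpander a b)
    (hκ0 : 0 < κ) (hκ1 : κ ≤ 1) (hκ : κ = b - 2 / d₀) {x y : Word n} (hy : y ∈ G.tannerCode C₀)
    (hxy : (hammingDist x y : ℝ) ≤ a * n) :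
    expect (G.randFlip C₀ d₀ x) (fun z => ENNReal.ofReal (Real.exp (κ / 2 * hammingDist z y))) ≤
      ENNReal.ofReal (Real.exp (κ / 2 * hammingDist x y - κ ^ 2 / 4 * hammingDist x y)) := by
  have hcd : (0 : ℝ) < c * d₀ := by positivity
  have hp0 : ∀ u, 0 ≤ G.flipProb C₀ d₀ x u := fun u => by
    rw [flipProb_eq G C₀ hd₀']; positivity
  have hp1 : ∀ u, G.flipProb C₀ d₀ x u ≤ 1 := fun u => by
    rw [flipProb_eq G C₀ hd₀', div_le_one hcd]
    exact_mod_cast G.flipNum_le C₀ d₀ x u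
  refine (expect_exp_foldlM (κ / 2) hp0 hp1 x y (List.finRange n) (List.nodup_finRange n) x
    (fun _ _ => rfl)).trans ?_
  apply ENNReal.ofReal_le_ofReal
  rw [Real.exp_le_exp]
  have hsum : ((List.finRange n).map (flipExponent (κ / 2) (G.flipProb C₀ d₀ x) x y)).sum =
      ∑ u, flipExponent (κ / 2) (G.flipProb C₀ d₀ x) x y u := by
    rw [Fin.sum_univ_def]
  rw [hsum]
  set Pin := ∑ u ∈ corrupt x y, G.flipProb C₀ d₀ x u with hPin
  set Pout := ∑ u ∈ (corrupt x y)ᶜ, G.flipProb C₀ d₀ x u with hPout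
  have hsplit : ∑ u, flipExponent (κ / 2) (G.flipProb C₀ d₀ x) x y u =
      - (Pin * (1 - Real.exp (-(κ / 2)))) + Pout * (Real.exp (κ / 2) - 1) := by
    rw [← Finset.sum_add_sum_compl (corrupt x y), hPin, hPout, Finset.sum_mul, Finset.sum_mul,
      ← Finset.sum_neg_distrib]
    congr 1
    · refine Finset.sum_congr rfl fun u hu => ?_
      rw [flipExponent, if_neg (Finset.mem_filter.1 hu).2]
    · refine Finset.sum_congr rfl fun u hu => ?_
      rw [flipExponent, if_pos]
      simpa [corrupt] using hu
  rw [hsplit]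
  have hdrift := flipNum_drift hd₀ (x := x) hy
  have hN := hG (corrupt x y) hxy
  rw [card_corrupt] at hN
  set F : ℝ := (hammingDist x y : ℝ)
  have hF0 : 0 ≤ F := Nat.cast_nonneg _
  have h1 : κ * F ≤ Pin - Pout := by
    rw [hPin, hPout]
    simp only [flipProb_eq G C₀ hd₀']
    rw [← Finset.sum_div, ← Finset.sum_div, ← sub_div, le_div_iff₀ hcd, hκ]
    refine le_trans (le_of_eq ?_) ((sub_le_sub_right (mul_le_mul_of_nonneg_left hN
      (Nat.cast_nonneg d₀)) _).trans hdrift)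
    field_simp
  -- The total weight of votes is at most `d₀ |U|`, and `|U| ≤ c F`. This bounds the second-order
  -- term below.
  have h2 : Pin + Pout ≤ F := by
    rw [hPin, hPout, Finset.sum_add_sum_compl]
    simp only [flipProb_eq G C₀ hd₀']
    rw [← Finset.sum_div, div_le_iff₀ hcd]
    have h3 := (G.sum_flipNum_le C₀ d₀ x).trans (Nat.mul_le_mul_left d₀ (card_unsat_le (x := x) hy))
    have h4 : ∑ u, (G.flipNum C₀ d₀ x u : ℝ) ≤ d₀ * (c * (hammingDist x y : ℝ)) := by
      exact_mod_cast h3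
    change _ ≤ (d₀ : ℝ) * (c * F) at h4
    linarith
  have hPin0 : 0 ≤ Pin := Finset.sum_nonneg fun u _ => hp0 u
  have hPout0 : 0 ≤ Pout := Finset.sum_nonneg fun u _ => hp0 u
  -- For `t = κ / 2` the exponentials are `1 ± t` up to `t ^ 2`. The exponent is at most `-t (Pin -
  -- Pout) + t ^ 2 (Pin + Pout) ≤ (-κ ^ 2 / 2 + κ ^ 2 / 4) F`; the choice of `t` makes the first
  -- term win.
  have hb1 := Real.abs_exp_sub_one_sub_id_le (x := κ / 2) (by rw [abs_of_pos] <;> linarith)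
  have hb2 := Real.abs_exp_sub_one_sub_id_le (x := -(κ / 2)) (by
    rw [abs_neg, abs_of_pos] <;> linarith)
  have hb1 := (abs_le.1 hb1).2
  have hb2 := (abs_le.1 hb2).2
  have e1 : Pin * (κ / 2 - (κ / 2) ^ 2) ≤ Pin * (1 - Real.exp (-(κ / 2))) := by
    refine mul_le_mul_of_nonneg_left ?_ hPin0
    nlinarith
  have e2 : Pout * (Real.exp (κ / 2) - 1) ≤ Pout * (κ / 2 + (κ / 2) ^ 2) := by
    refine mul_le_mul_of_nonneg_left ?_ hPout0
    linarith
  have e3 := mul_le_mul_of_nonneg_left h1 (by positivity : 0 ≤ κ / 2)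
  have e4 := mul_le_mul_of_nonneg_left h2 (by positivity : 0 ≤ (κ / 2) ^ 2)
  nlinarith

end TannerGraph


/-! ### Correctness of `MainDecode` -/

/-- The factor by which a good guess reduces the number of corrupt bits. -/
def guessRate (c d₀ : ℕ) (b : ℝ) : ℝ := 2 * (b - 2 / d₀) / (c * d₀ + 1)

/-- The expansion `b'` is so close to `b` that `MainDecode` with the parameter `b` still works. -/
structure IsSlack (c d₀ : ℕ) (b b' : ℝ) : Prop where
  pos : 0 < c
  two_lt : 2 < b' * d₀
  lt : b' < b
  le_one : b ≤ 1
  rate_lt : rateConst c d₀ b < guessRate c d₀ b'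
  rate_mul : (1 - guessRate c d₀ b') * (b * d₀ - 1) ≤ (1 - rateConst c d₀ b) * (b' * d₀ - 1)
  growth : (1 + 2 * c / (d₀ + 1)) * (b * d₀ - 1) ≤ (1 + 2 * c / d₀) * (b' * d₀ - 1)

theorem three_le_of_two_lt {d₀ : ℕ} {b : ℝ} (hb1 : b ≤ 1) (h : 2 < b * d₀) : 3 ≤ d₀ := by
  have h1 : (2 : ℝ) < d₀ := h.trans_le (mul_le_of_le_one_left (Nat.cast_nonneg _) hb1)
  exact_mod_cast h1

/-- In this form the rate of the decoder is the drift shared evenly among the `c d₀` guesses.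
Weighting the guess `j` by `j` improves it to `guessRate`, almost by a factor of two. -/
theorem rateConst_eq {c d₀ : ℕ} {b : ℝ} (hc : 0 < c) (hd : 0 < d₀) (hb : 0 < b) :
    rateConst c d₀ b = (b - 2 / d₀) / (c * d₀) := by
  unfold rateConst
  have : (c : ℝ) ≠ 0 := by positivity
  have : (d₀ : ℝ) ≠ 0 := by positivity
  field_simp

/-- All conditions hold strictly at `b' = b`, because `2 / (c d₀ + 1) > 1 / (c d₀)` and `2 c / (d₀ +
1) < 2 c / d₀`. By continuity they persist slightly below `b`. -/
theorem exists_isSlack {c d₀ : ℕ} {b : ℝ} (hc : 0 < c) (hb1 : b ≤ 1) (h2 : 2 < b * d₀) :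
    ∃ b', IsSlack c d₀ b b' := by
  have hd3 := three_le_of_two_lt hb1 h2
  have hd : (3 : ℝ) ≤ d₀ := by exact_mod_cast hd3
  have hd0 : (0 : ℝ) < d₀ := by linarith
  have hc1 : (1 : ℝ) ≤ c := by exact_mod_cast hc
  have hb : 0 < b := by
    by_contra h
    nlinarith
  have hcd : 3 ≤ (c : ℝ) * d₀ := by nlinarith
  have hgap : 0 < b - 2 / d₀ := by
    rw [sub_pos, div_lt_iff₀ hd0]
    exact h2
  have hrate : rateConst c d₀ b < guessRate c d₀ b := by
    rw [rateConst_eq hc (by omega) hb, guessRate, div_lt_div_iff₀ (by linarith) (by linarith)]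
    nlinarith
  have e1 : ∀ᶠ b' : ℝ in 𝓝 b, 2 < b' * d₀ :=
    (by fun_prop : Continuous fun b' : ℝ => b' * d₀).continuousAt.eventually_const_lt h2
  have hgc : Continuous (guessRate c d₀) := by
    unfold guessRate
    fun_prop
  have e2 : ∀ᶠ b' : ℝ in 𝓝 b, rateConst c d₀ b < guessRate c d₀ b' :=
    hgc.continuousAt.eventually_const_lt hrate
  have e3 : ∀ᶠ b' : ℝ in 𝓝 b, 0 < (1 - rateConst c d₀ b) * (b' * d₀ - 1) -
      (1 - guessRate c d₀ b') * (b * d₀ - 1) := by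
    refine ((by fun_prop : Continuous fun b' => (1 - rateConst c d₀ b) * (b' * d₀ - 1) -
      (1 - guessRate c d₀ b') * (b * d₀ - 1)).continuousAt).eventually_const_lt ?_
    nlinarith
  have e4 : ∀ᶠ b' : ℝ in 𝓝 b, 0 < (1 + 2 * c / d₀) * (b' * d₀ - 1) -
      (1 + 2 * c / (d₀ + 1)) * (b * d₀ - 1) := by
    refine ((by fun_prop : Continuous fun b' : ℝ => (1 + 2 * (c : ℝ) / d₀) * (b' * d₀ - 1) -
      (1 + 2 * c / (d₀ + 1)) * (b * d₀ - 1)).continuousAt).eventually_const_lt ?_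
    have : 2 * (c : ℝ) / (d₀ + 1) < 2 * c / d₀ := by gcongr; linarith
    nlinarith
  have hall := ((e1.and e2).and (e3.and e4)).filter_mono (nhdsWithin_le_nhds (s := Set.Iio b))
  obtain ⟨b', ⟨⟨h1, h2⟩, h3, h4⟩, h5⟩ := (hall.and self_mem_nhdsWithin).exists
  exact ⟨b', hc, h1, h5, hb1, h2, by linarith, by linarith⟩

namespace IsSlack

variable {c d₀ : ℕ} {b b' : ℝ}

theorem three_le (h : IsSlack c d₀ b b') : 3 ≤ d₀ :=
  three_le_of_two_lt (h.lt.le.trans h.le_one) h.two_lt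

theorem three_le_cast (h : IsSlack c d₀ b b') : (3 : ℝ) ≤ d₀ := by exact_mod_cast h.three_le

theorem pos' (h : IsSlack c d₀ b b') : 0 < b' := by
  have := h.two_lt
  have := h.three_le_cast
  by_contra hcon
  nlinarith

theorem gap_pos (h : IsSlack c d₀ b b') : 0 < b' - 2 / d₀ := by
  have := h.three_le_cast
  rw [sub_pos, div_lt_iff₀ (by linarith)]
  exact h.two_lt

theorem guessRate_pos (h : IsSlack c d₀ b b') : 0 < guessRate c d₀ b' :=
  div_pos (mul_pos two_pos h.gap_pos) (by positivity)

theorem guessRate_lt_one (h : IsSlack c d₀ b b') : guessRate c d₀ b' < 1 := by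
  have h3 := h.three_le_cast
  have hc1 : (1 : ℝ) ≤ c := by exact_mod_cast h.pos
  have : (0 : ℝ) ≤ 2 / d₀ := by positivity
  have := h.lt
  have := h.le_one
  rw [guessRate, div_lt_one (by positivity)]
  nlinarith

theorem rateConst_pos (h : IsSlack c d₀ b b') : 0 < rateConst c d₀ b := by
  have h3 := h.three_le_cast
  have hc1 : (1 : ℝ) ≤ c := by exact_mod_cast h.pos
  rw [rateConst_eq h.pos (by have := h.three_le; omega) (h.pos'.trans h.lt)]
  have := h.gap_pos
  have := h.lt
  exact div_pos (by linarith) (by positivity)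

theorem rateConst_lt_one (h : IsSlack c d₀ b b') : rateConst c d₀ b < 1 :=
  h.rate_lt.trans h.guessRate_lt_one

theorem gammaConst_pos (h : IsSlack c d₀ b b') {a : ℝ} (ha : 0 < a) : 0 < gammaConst c d₀ a b := by
  have h3 := h.three_le_cast
  have h2 := h.two_lt
  have h4 : b' * d₀ ≤ b * d₀ := by gcongr; exact h.lt.le
  unfold gammaConst
  have : 0 < (b * d₀ - 1) / (d₀ - 1) := div_pos (by linarith) (by linarith)
  positivity

theorem ratio_le_one (h : IsSlack c d₀ b b') : (b * d₀ - 1) / (d₀ - 1) ≤ 1 := by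
  have h3 := h.three_le_cast
  rw [div_le_one (by linarith)]
  have := h.le_one
  nlinarith

theorem gammaConst_le (h : IsSlack c d₀ b b') {a : ℝ} (ha : 0 < a) : gammaConst c d₀ a b ≤ a := by
  have h3 := h.three_le_cast
  have h2 := h.two_lt
  have h4 : b' * d₀ ≤ b * d₀ := by gcongr; exact h.lt.le
  have h5 := h.ratio_le_one
  have h6 : 0 ≤ (b * d₀ - 1) / (d₀ - 1) := div_nonneg (by linarith) (by linarith)
  unfold gammaConst
  have h7 : (1 + c / ((d₀ : ℝ) / 2))⁻¹ ≤ 1 := inv_le_one_of_one_le₀ (by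
    have : 0 ≤ c / ((d₀ : ℝ) / 2) := by positivity
    linarith)
  calc _ ≤ 1 * 1 * a := by gcongr
    _ = a := by ring

end IsSlack

theorem pow_ceil_log_le {ρ X : ℝ} (h0 : 0 < ρ) (h1 : ρ < 1) (hX : 0 < X) :
    (1 - ρ) ^ ⌈Real.log X / Real.log (1 - ρ)⌉₊ ≤ X := by
  have hlog : Real.log (1 - ρ) < 0 := Real.log_neg (by linarith) (by linarith)
  have h := Nat.le_ceil (Real.log X / Real.log (1 - ρ))
  rw [div_le_iff_of_neg hlog, ← Real.log_pow] at h
  exact (Real.log_le_log_iff (pow_pos (by linarith) _) hX).1 h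

theorem guessSeqs_succ (c d₀ s : ℕ) : guessSeqs c d₀ (s + 1) =
    (List.range (c * d₀)).flatMap fun j : ℕ => (guessSeqs c d₀ s).map fun l =>
      (((j : ℝ) + 1) / ((c : ℝ) * d₀)) :: l := by
  rw [guessSeqs]
  simp [List.flatMap_assoc]

theorem cons_mem_guessSeqs {c d₀ s j : ℕ} (hj : j < c * d₀) {l : List ℝ} (hl : l ∈ guessSeqs c d₀ s) :
    (((j : ℝ) + 1) / ((c : ℝ) * d₀)) :: l ∈ guessSeqs c d₀ (s + 1) := by
  rw [guessSeqs_succ]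
  exact List.mem_flatMap.2 ⟨j, List.mem_range.2 hj, List.mem_map.2 ⟨l, hl, rfl⟩⟩

/-- One step of the search for a minimal result: the pair holds the best value and result so far. -/
def keepMin {A Z : Type*} (f : A → Option Z) (U : Z → ℕ) (best : ℕ × Option Z) (qs : A) :
    ℕ × Option Z :=
  match f qs with
  | none => best
  | some z => if U z < best.1 then (U z, some z) else best

/-- Taking the minimum over the results of a list of attempts. -/
theorem foldl_min_spec {A Z : Type*} (f : A → Option Z) (U : Z → ℕ) (L : List A) (k : ℕ)
    (o : Option Z) :
    let R := L.foldl (keepMin f U) (k, o)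
    R.1 ≤ k ∧ (∀ qs ∈ L, ∀ z, f qs = some z → R.1 ≤ U z) ∧
      (R = (k, o) ∨ ∃ qs ∈ L, ∃ z, f qs = some z ∧ R = (U z, some z)) := by
  induction L generalizing k o with
  | nil => simp
  | cons q L ih =>
    simp only [List.foldl_cons]
    rcases hq : f q with _ | z
    · rw [show keepMin f U (k, o) q = (k, o) by simp [keepMin, hq]]
      obtain ⟨h1, h2, h3⟩ := ih k o
      refine ⟨h1, ?_, ?_⟩
      · intro qs hqs z hz
        rcases List.mem_cons.1 hqs with rfl | hqs
        · rw [hq] at hz; cases hz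
        · exact h2 qs hqs z hz
      · rcases h3 with h3 | ⟨qs, hqs, h3⟩
        · exact Or.inl h3
        · exact Or.inr ⟨qs, List.mem_cons_of_mem _ hqs, h3⟩
    · by_cases hlt : U z < k
      · rw [show keepMin f U (k, o) q = (U z, some z) by simp [keepMin, hq, hlt]]
        obtain ⟨h1, h2, h3⟩ := ih (U z) (some z)
        refine ⟨by omega, ?_, ?_⟩
        · intro qs hqs z' hz'
          rcases List.mem_cons.1 hqs with rfl | hqs
          · rw [hq] at hz'; cases hz'; exact h1
          · exact h2 qs hqs z' hz'
        · rcases h3 with h3 | ⟨qs, hqs, h3⟩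
          · exact Or.inr ⟨q, by simp, z, hq, h3⟩
          · exact Or.inr ⟨qs, List.mem_cons_of_mem _ hqs, h3⟩
      · rw [show keepMin f U (k, o) q = (k, o) by simp [keepMin, hq, hlt]]
        obtain ⟨h1, h2, h3⟩ := ih k o
        refine ⟨h1, ?_, ?_⟩
        · intro qs hqs z' hz'
          rcases List.mem_cons.1 hqs with rfl | hqs
          · rw [hq] at hz'; cases hz'; omega
          · exact h2 qs hqs z' hz'
        · rcases h3 with h3 | ⟨qs, hqs, h3⟩
          · exact Or.inl h3
          · exact Or.inr ⟨qs, List.mem_cons_of_mem _ hqs, h3⟩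

theorem findSome?_eq_of_forall {A B : Type*} {f : A → Option B} {l : List A} {b : B}
    (h1 : ∃ a ∈ l, f a = some b) (h2 : ∀ a ∈ l, ∀ b', f a = some b' → b' = b) :
    l.findSome? f = some b := by
  rcases h : l.findSome? f with _ | b'
  · rw [List.findSome?_eq_none_iff] at h
    obtain ⟨a, ha, hab⟩ := h1
    rw [h a ha] at hab
    cases hab
  · obtain ⟨a, ha, hab⟩ := List.exists_of_findSome?_eq_some h
    rw [h2 a ha b' hab]

/-! ### Good guesses, halving by DeepFlip, and uniqueness of the output -/

namespace TannerGraph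

variable {c d n m : ℕ} {G : TannerGraph c d n m} {C₀ : Submodule (ZMod 2) (Word d)} {d₀ : ℕ}
  {a b b' : ℝ}

theorem deterFlip_guess_apply (hc : 0 < c) (hd : 0 < d₀) (x : Word n) (j : ℕ) (u : Fin n) :
    G.deterFlip C₀ d₀ x (((j : ℝ) + 1) / ((c : ℝ) * d₀)) u =
      if G.flipNum C₀ d₀ x u = j + 1 then x u + 1 else x u := by
  have hcd : (c : ℝ) * d₀ ≠ 0 := by positivity
  have : G.flipProb C₀ d₀ x u = ((j : ℝ) + 1) / ((c : ℝ) * d₀) ↔ G.flipNum C₀ d₀ x u = j + 1 := by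
    rw [flipProb_eq G C₀ hd, div_left_inj' hcd]
    exact_mod_cast Iff.rfl
  unfold deterFlip
  simp only [this]

theorem hammingDist_flip (P : Fin n → Prop) [DecidablePred P] (x y z : Word n)
    (hz : ∀ u, z u = if P u then x u + 1 else x u) :
    (hammingDist z y : ℝ) = hammingDist x y - ∑ u ∈ corrupt x y, (if P u then 1 else 0) +
      ∑ u ∈ (corrupt x y)ᶜ, (if P u then 1 else 0) := by
  have h : ∀ w : Word n, (hammingDist w y : ℝ) = ∑ u, if w u ≠ y u then (1 : ℝ) else 0 := by
    intro w
    unfold hammingDist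
    rw [Finset.sum_boole]
  rw [h z, h x, ← Finset.sum_add_sum_compl (corrupt x y), ← Finset.sum_add_sum_compl (corrupt x y)
    (fun u => if x u ≠ y u then (1 : ℝ) else 0)]
  have e1 : ∑ u ∈ corrupt x y, (if z u ≠ y u then (1 : ℝ) else 0) =
      ∑ u ∈ corrupt x y, (if x u ≠ y u then (1 : ℝ) else 0) -
        ∑ u ∈ corrupt x y, (if P u then 1 else 0) := by
    rw [← Finset.sum_sub_distrib]
    refine Finset.sum_congr rfl fun u hu => ?_
    have hu : x u ≠ y u := (Finset.mem_filter.1 hu).2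
    rw [hz]
    have : ∀ p q : ZMod 2, p ≠ q → p + 1 = q := by decide
    by_cases hP : P u <;> simp [hP, hu, this _ _ hu]
  have e2 : ∑ u ∈ (corrupt x y)ᶜ, (if z u ≠ y u then (1 : ℝ) else 0) =
      ∑ u ∈ (corrupt x y)ᶜ, (if x u ≠ y u then (1 : ℝ) else 0) +
        ∑ u ∈ (corrupt x y)ᶜ, (if P u then 1 else 0) := by
    rw [← Finset.sum_add_distrib]
    refine Finset.sum_congr rfl fun u hu => ?_
    have hu : x u = y u := by simpa [corrupt] using hu
    rw [hz]
    by_cases hP : P u <;> simp [hP, hu]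
  rw [e1, e2]
  ring

/-- Let `D j` be the net decrease of errors when the bits with `j + 1` units of votes are flipped.
Then `∑ (j + 1) D j` is the drift, at least `c d₀ (b' - 2 / d₀) F`, while `∑ (j + 1) = c d₀ (c d₀ +
1) / 2`. Hence some `D j` reaches the quotient times `F`. -/
theorem exists_good_guess (hs : IsSlack c d₀ b b') (hd₀ : IsMinDist C₀ d₀)
    (hG : G.IsExpander a b') {x y : Word n} (hy : y ∈ G.tannerCode C₀)
    (hxy : (hammingDist x y : ℝ) ≤ a * n) :
    ∃ j < c * d₀, (hammingDist (G.deterFlip C₀ d₀ x (((j : ℝ) + 1) / ((c : ℝ) * d₀))) y : ℝ) ≤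
      (1 - guessRate c d₀ b') * hammingDist x y := by
  have hd3 := hs.three_le
  have hcd : 0 < c * d₀ := Nat.mul_pos hs.pos (by omega)
  set D : ℕ → ℝ := fun j => ∑ u ∈ corrupt x y, (if G.flipNum C₀ d₀ x u = j + 1 then 1 else 0) -
    ∑ u ∈ (corrupt x y)ᶜ, (if G.flipNum C₀ d₀ x u = j + 1 then 1 else 0) with hD
  have hnum : ∀ u, ∑ j ∈ Finset.range (c * d₀), ((j : ℝ) + 1) *
      (if G.flipNum C₀ d₀ x u = j + 1 then 1 else 0) = G.flipNum C₀ d₀ x u := by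
    intro u
    have hle := G.flipNum_le C₀ d₀ x u
    rcases Nat.eq_zero_or_pos (G.flipNum C₀ d₀ x u) with h0 | h0
    · rw [h0]
      simp
    · obtain ⟨k, hk⟩ := Nat.exists_eq_add_of_le' h0
      rw [hk, Finset.sum_eq_single k]
      · simp
      · intro j _ hj
        rw [if_neg (by omega), mul_zero]
      · intro h
        rw [Finset.mem_range] at h
        omega
  have hsum : ∑ j ∈ Finset.range (c * d₀), ((j : ℝ) + 1) * D j =
      ∑ u ∈ corrupt x y, (G.flipNum C₀ d₀ x u : ℝ) -
        ∑ u ∈ (corrupt x y)ᶜ, (G.flipNum C₀ d₀ x u : ℝ) := by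
    simp only [hD, mul_sub, Finset.sum_sub_distrib, Finset.mul_sum (s := corrupt x y),
      Finset.mul_sum (s := (corrupt x y)ᶜ)]
    rw [Finset.sum_comm, Finset.sum_comm (t := (corrupt x y)ᶜ)]
    simp only [hnum]
  have hdrift := flipNum_drift hd₀ (x := x) hy
  have hN := hG (corrupt x y) hxy
  rw [card_corrupt] at hN
  rw [← hsum] at hdrift
  set F : ℝ := (hammingDist x y : ℝ) with hF
  have hF0 : 0 ≤ F := Nat.cast_nonneg _
  have hd3' := hs.three_le_cast
  have hgauss : ∑ j ∈ Finset.range (c * d₀), ((j : ℝ) + 1) = (c * d₀) * (c * d₀ + 1) / 2 := by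
    have : ∀ N : ℕ, ∑ j ∈ Finset.range N, ((j : ℝ) + 1) = N * (N + 1) / 2 := by
      intro N
      induction N with
      | zero => simp
      | succ N ih => rw [Finset.sum_range_succ, ih]; push_cast; ring
    rw [this]
    push_cast
    ring
  have hex : ∃ j ∈ Finset.range (c * d₀),
      ((j : ℝ) + 1) * (guessRate c d₀ b' * F) ≤ ((j : ℝ) + 1) * D j := by
    apply Finset.exists_le_of_sum_le (Finset.nonempty_range_iff.2 hcd.ne')
    rw [← Finset.sum_mul, hgauss]
    refine le_trans (le_of_eq ?_) ((sub_le_sub_right (mul_le_mul_of_nonneg_left hN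
      (Nat.cast_nonneg d₀)) _).trans hdrift)
    unfold guessRate
    have : (c : ℝ) * d₀ + 1 ≠ 0 := by positivity
    field_simp
  obtain ⟨j, hj, hle⟩ := hex
  refine ⟨j, Finset.mem_range.1 hj, ?_⟩
  have hle := le_of_mul_le_mul_left hle (by positivity)
  rw [hammingDist_flip (fun u => G.flipNum C₀ d₀ x u = j + 1) x y _
    (deterFlip_guess_apply hs.pos (by omega) x j)]
  simp only [hD] at hle
  linarith

theorem hammingDist_le_of_le_rate (hs : IsSlack c d₀ b b') {F F' : ℝ} (hF : 0 ≤ F)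
    (h : F' ≤ (1 - guessRate c d₀ b') * F) : F' ≤ F := by
  have := hs.guessRate_pos
  nlinarith

theorem exists_guess_foldl (hs : IsSlack c d₀ b b') (hd₀ : IsMinDist C₀ d₀)
    (hG : G.IsExpander a b') {y : Word n} (hy : y ∈ G.tannerCode C₀) (r : ℕ) (x : Word n)
    (hxy : (hammingDist x y : ℝ) ≤ a * n) :
    ∃ qs ∈ guessSeqs c d₀ r, (hammingDist (qs.foldl (G.deterFlip C₀ d₀) x) y : ℝ) ≤
      (1 - guessRate c d₀ b') ^ r * hammingDist x y := by
  induction r generalizing x with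
  | zero => exact ⟨[], by simp [guessSeqs], by simp⟩
  | succ r ih =>
    obtain ⟨j, hj, h⟩ := exists_good_guess hs hd₀ hG hy hxy
    have h' := hammingDist_le_of_le_rate hs (Nat.cast_nonneg _) h
    obtain ⟨qs, hqs, h1⟩ := ih _ (h'.trans hxy)
    refine ⟨_ :: qs, cons_mem_guessSeqs hj hqs, ?_⟩
    rw [List.foldl_cons, pow_succ, mul_assoc]
    have := hs.guessRate_lt_one
    exact h1.trans (mul_le_mul_of_nonneg_left h (pow_nonneg (by linarith) _))

/-- Along good guesses the number of corrupt bits never grows, so `|U| ≤ c F` stays below the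
threshold and the branch is not abandoned. -/
theorem exists_guess_deepBranch (hs : IsSlack c d₀ b b') (hd₀ : IsMinDist C₀ d₀)
    (hG : G.IsExpander a b') {y : Word n} (hy : y ∈ G.tannerCode C₀) {B : ℝ} (r : ℕ) (x : Word n)
    (hxy : (hammingDist x y : ℝ) ≤ a * n) (hB : c * (hammingDist x y : ℝ) ≤ B) :
    ∃ qs ∈ guessSeqs c d₀ r, ∃ z, G.deepBranch C₀ d₀ B qs x = some z ∧ (hammingDist z y : ℝ) ≤
      (1 - guessRate c d₀ b') ^ r * hammingDist x y := by
  induction r generalizing x with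
  | zero => exact ⟨[], by simp [guessSeqs], x, rfl, by simp⟩
  | succ r ih =>
    obtain ⟨j, hj, h⟩ := exists_good_guess hs hd₀ hG hy hxy
    have h' := hammingDist_le_of_le_rate hs (Nat.cast_nonneg _) h
    have hB' : c * (hammingDist (G.deterFlip C₀ d₀ x (((j : ℝ) + 1) / ((c : ℝ) * d₀))) y : ℝ) ≤ B :=
      (mul_le_mul_of_nonneg_left h' (Nat.cast_nonneg c)).trans hB
    obtain ⟨qs, hqs, z, hz, h1⟩ := ih _ (h'.trans hxy) hB'
    refine ⟨_ :: qs, cons_mem_guessSeqs hj hqs, z, ?_, ?_⟩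
    · rw [deepBranch, if_neg, hz]
      rw [not_lt]
      refine le_trans ?_ hB'
      exact_mod_cast card_unsat_le hy
    · rw [pow_succ, mul_assoc]
      have := hs.guessRate_lt_one
      exact h1.trans (mul_le_mul_of_nonneg_left h (pow_nonneg (by linarith) _))

/-- The converse of `card_unsat_le`: within the range of expansion, few unsatisfied checks force few
corrupt bits. The decoder sees only the former. -/
theorem mul_hammingDist_le (hd₀ : IsMinDist C₀ d₀) (hG : G.IsExpander a b') {x y : Word n}
    (hy : y ∈ G.tannerCode C₀) (hxy : (hammingDist x y : ℝ) ≤ a * n) :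
    (b' * d₀ - 1) * (c * hammingDist x y) ≤ (d₀ - 1) * (G.unsat C₀ x).card := by
  have h1 := mul_card_unsat_ge hd₀ (x := x) hy
  have h2 := hG (corrupt x y) hxy
  rw [card_corrupt] at h2
  have := mul_le_mul_of_nonneg_left h2 (Nat.cast_nonneg (α := ℝ) d₀)
  linarith

/-- Even a bad guess corrupts only correct bits that received votes, and these are few. Positivity
of `q` matters: the value `0` would flip all bits without votes. -/
theorem hammingDist_deterFlip_le (hd₀ : IsMinDist C₀ d₀) (hd : 0 < d₀) {x y : Word n}
    (hy : y ∈ G.tannerCode C₀) {q : ℝ} (hq : 0 < q) :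
    (hammingDist (G.deterFlip C₀ d₀ x q) y : ℝ) ≤ (1 + 2 * c / (d₀ + 1)) * hammingDist x y := by
  classical
  rw [hammingDist_flip (fun u => G.flipProb C₀ d₀ x u = q) x y (G.deterFlip C₀ d₀ x q) (fun u => by
    simp only [deterFlip])]
  have h0 : (0 : ℝ) ≤ ∑ u ∈ corrupt x y, (if G.flipProb C₀ d₀ x u = q then 1 else 0) :=
    Finset.sum_nonneg fun u _ => by split_ifs <;> norm_num
  have h1 : ∑ u ∈ (corrupt x y)ᶜ, (if G.flipProb C₀ d₀ x u = q then (1 : ℝ) else 0) ≤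
      ((corrupt x y)ᶜ.filter fun u => 0 < G.flipNum C₀ d₀ x u).card := by
    rw [Finset.sum_boole]
    have : ((corrupt x y)ᶜ.filter fun u => G.flipProb C₀ d₀ x u = q).card ≤
        ((corrupt x y)ᶜ.filter fun u => 0 < G.flipNum C₀ d₀ x u).card := by
      refine Finset.card_le_card (Finset.monotone_filter_right _ fun u hu hu' => ?_)
      rw [flipProb_eq G C₀ hd] at hu'
      by_contra hcon
      rw [not_lt, Nat.le_zero] at hcon
      rw [hcon] at hu'
      simp at hu'
      exact hq.ne hu'
    exact_mod_cast this
  have h2 : ((d₀ : ℝ) + 1) * ((corrupt x y)ᶜ.filter fun u => 0 < G.flipNum C₀ d₀ x u).card ≤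
      2 * (c * hammingDist x y) := by exact_mod_cast card_flipNum_pos_le hd₀ hy
  have h3 : (((corrupt x y)ᶜ.filter fun u => 0 < G.flipNum C₀ d₀ x u).card : ℝ) ≤
      2 * c / (d₀ + 1) * hammingDist x y := by
    rw [div_mul_eq_mul_div, le_div_iff₀ (by positivity)]
    linarith
  linarith

theorem pos_of_mem_guessSeqs (hc : 0 < c) (hd : 0 < d₀) {s : ℕ} {qs : List ℝ}
    (h : qs ∈ guessSeqs c d₀ s) : ∀ q ∈ qs, 0 < q := by
  induction s generalizing qs with
  | zero => simp [guessSeqs] at h; simp [h]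
  | succ s ih =>
    rw [guessSeqs_succ] at h
    obtain ⟨j, -, h⟩ := List.mem_flatMap.1 h
    obtain ⟨l, hl, rfl⟩ := List.mem_map.1 h
    intro q hq
    rcases List.mem_cons.1 hq with rfl | hq
    · positivity
    · exact ih hl q hq

/-- One flip cannot leave the range of expansion when starting from at most `M` corrupt bits. There
the passed test `|U| ≤ B` brings the number back to at most `M`, so the invariant holds for
arbitrary positive guesses. -/
theorem hammingDist_deepBranch_le (hd₀ : IsMinDist C₀ d₀) (hd : 0 < d₀) (hG : G.IsExpander a b')
    {y : Word n} (hy : y ∈ G.tannerCode C₀) {B M : ℝ} (hc : 0 < c) (hb : 1 < b' * d₀) (hd1 : 1 ≤ d₀)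
    (hM1 : (1 + 2 * c / (d₀ + 1)) * M ≤ a * n) (hM2 : (d₀ - 1) * B ≤ (b' * d₀ - 1) * (c * M))
    (qs : List ℝ) (hqs : ∀ q ∈ qs, 0 < q) (x z : Word n) (hx : (hammingDist x y : ℝ) ≤ M)
    (hz : G.deepBranch C₀ d₀ B qs x = some z) : (hammingDist z y : ℝ) ≤ M := by
  induction qs generalizing x with
  | nil => rw [deepBranch, Option.some.injEq] at hz; rw [← hz]; exact hx
  | cons q qs ih =>
    rw [deepBranch] at hz
    split_ifs at hz with h
    refine ih (fun q' hq' => hqs q' (by simp [hq'])) _ ?_ hz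
    have h1 := hammingDist_deterFlip_le (x := x) hd₀ hd hy (hqs q (by simp))
    have h2 : (hammingDist (G.deterFlip C₀ d₀ x q) y : ℝ) ≤ a * n := by
      refine h1.trans (le_trans ?_ hM1)
      gcongr
    have h3 := mul_hammingDist_le hd₀ hG hy h2
    rw [not_lt] at h
    have hd1' : (1 : ℝ) ≤ d₀ := by exact_mod_cast hd1
    have h4 := h3.trans ((mul_le_mul_of_nonneg_left h (by linarith)).trans hM2)
    have h5 := le_of_mul_le_mul_left h4 (by linarith)
    exact le_of_mul_le_mul_left h5 (by exact_mod_cast hc)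

theorem deepFlip_eq (G : TannerGraph c d n m) (C₀ : Submodule (ZMod 2) (Word d)) (d₀ : ℕ) (a b : ℝ)
    (x : Word n) : G.deepFlip C₀ d₀ a b x = ((guessSeqs c d₀
      ⌈Real.log ((b * d₀ - 1) / (2 * (d₀ - 1))) / Real.log (1 - rateConst c d₀ b)⌉₊).foldl
    (keepMin (fun qs => G.deepBranch C₀ d₀ (c * gammaConst c d₀ a b * n) qs x)
      (fun z => (G.unsat C₀ z).card)) ((m + 1, none) : ℕ × Option (Word n))).2 := by
  rw [deepFlip]
  congr 2
  funext best qs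
  simp only [keepMin]
  rcases G.deepBranch C₀ d₀ (c * gammaConst c d₀ a b * n) qs x with _ | z <;> rfl

/-- A branch of good guesses has a small `|U|`, so the minimizer does too. The minimizer is still in
the range of expansion, and its small `|U|` bounds its corrupt bits. The length `s` is chosen so
that the factor lost in this conversion still leaves one half. -/
theorem deepFlip_spec (hs : IsSlack c d₀ b b') (hd₀ : IsMinDist C₀ d₀) (hG : G.IsExpander a b')
    (ha : 0 < a) {x y : Word n} (hy : y ∈ G.tannerCode C₀)
    (hxy : (hammingDist x y : ℝ) ≤ gammaConst c d₀ a b * n) :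
    ∃ z, G.deepFlip C₀ d₀ a b x = some z ∧ (hammingDist z y : ℝ) ≤ hammingDist x y / 2 := by
  have hd3 := hs.three_le
  have hd3' := hs.three_le_cast
  have hγ := hs.gammaConst_pos ha
  have hγa := hs.gammaConst_le ha
  have htwo := hs.two_lt
  have hn0 : (0 : ℝ) ≤ n := Nat.cast_nonneg n
  have hc1 : (1 : ℝ) ≤ c := by exact_mod_cast hs.pos
  have hbd : b' * d₀ ≤ b * d₀ := by gcongr; exact hs.lt.le
  set γ := gammaConst c d₀ a b with hγdef
  set s := ⌈Real.log ((b * d₀ - 1) / (2 * (d₀ - 1))) / Real.log (1 - rateConst c d₀ b)⌉₊ with hsdef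
  set B : ℝ := c * γ * n with hB
  -- The most corrupt bits that expansion `b'` permits with `B` unsatisfied checks.
  set M : ℝ := (d₀ - 1) / (b' * d₀ - 1) * (γ * n) with hM
  have hxa : (hammingDist x y : ℝ) ≤ a * n := hxy.trans (by gcongr)
  obtain ⟨qs₀, hqs₀, z₀, hz₀, hz₀y⟩ := exists_guess_deepBranch hs hd₀ hG hy (B := B) s x hxa (by
    rw [hB, mul_assoc]
    gcongr)
  have hratio : 1 ≤ (d₀ - 1) / (b' * d₀ - 1) := by
    rw [one_le_div (by linarith)]
    have := hs.le_one
    nlinarith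
  have hMx : (hammingDist x y : ℝ) ≤ M := hxy.trans (le_mul_of_one_le_left (by positivity) hratio)
  have hM2 : (d₀ - 1) * B ≤ (b' * d₀ - 1) * (c * M) := by
    rw [hB, hM]
    have : b' * d₀ - 1 ≠ 0 := by linarith
    generalize b' * d₀ - 1 = w at this ⊢
    exact le_of_eq (by field_simp)
  have hM1 : (1 + 2 * c / (d₀ + 1)) * M ≤ a * n := by
    rw [hM, hγdef, gammaConst]
    have h1 : (d₀ : ℝ) - 1 ≠ 0 := by linarith
    have h2 : 0 < b' * d₀ - 1 := by linarith
    have h3 : 0 < 1 + 2 * (c : ℝ) / d₀ := by positivity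
    have h4 : (c : ℝ) / (d₀ / 2) = 2 * c / d₀ := by field_simp
    rw [h4]
    have h5 : (1 + 2 * (c : ℝ) / (d₀ + 1)) * ((d₀ - 1) / (b' * d₀ - 1) *
        ((1 + 2 * (c : ℝ) / d₀)⁻¹ * ((b * d₀ - 1) / (d₀ - 1)) * a * n)) =
        ((1 + 2 * (c : ℝ) / (d₀ + 1)) * (b * d₀ - 1)) /
          ((1 + 2 * (c : ℝ) / d₀) * (b' * d₀ - 1)) * (a * n) := by
      field_simp
    rw [h5]
    refine mul_le_of_le_one_left (by positivity) ?_
    rw [div_le_one (by positivity)]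
    exact hs.growth
  have hfold := foldl_min_spec (fun qs => G.deepBranch C₀ d₀ B qs x)
    (fun z => (G.unsat C₀ z).card) (guessSeqs c d₀ s) (m + 1) none
  have hdef := G.deepFlip_eq C₀ d₀ a b x
  rw [← hsdef, ← hγdef, ← hB] at hdef
  rw [hdef]
  obtain ⟨-, hmin, hcase⟩ := hfold
  rcases hcase with hcase | ⟨qs, hqs, z, hz, hcase⟩
  -- The search starts with the value `m + 1`, larger than any number of unsatisfied checks, so a
  -- surviving branch always replaces `none`.
  · exfalso
    have h1 := hmin qs₀ hqs₀ z₀ hz₀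
    rw [hcase] at h1
    have h2 : (G.unsat C₀ z₀).card ≤ m := (Finset.card_le_univ _).trans (by simp)
    simp only at h1
    omega
  · refine ⟨z, congrArg Prod.snd hcase, ?_⟩
    have h1 := hmin qs₀ hqs₀ z₀ hz₀
    rw [hcase] at h1
    have h1 : (G.unsat C₀ z).card ≤ (G.unsat C₀ z₀).card := h1
    have h2 : ((G.unsat C₀ z).card : ℝ) ≤ c * hammingDist z₀ y := by
      exact_mod_cast h1.trans (card_unsat_le hy)
    have hzM : (hammingDist z y : ℝ) ≤ M := hammingDist_deepBranch_le hd₀ (by omega) hG hy hs.pos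
      (by linarith) (by omega) hM1 hM2 qs (pos_of_mem_guessSeqs hs.pos (by omega) hqs) x z hMx hz
    have hM0 : 0 ≤ M := (Nat.cast_nonneg _).trans hMx
    have hza : (hammingDist z y : ℝ) ≤ a * n := hzM.trans (le_trans (by
      refine le_mul_of_one_le_left hM0 ?_
      have : 0 ≤ 2 * (c : ℝ) / (d₀ + 1) := by positivity
      linarith) hM1)
    have h3 := mul_hammingDist_le hd₀ hG hy hza
    have hX : 0 < (b * d₀ - 1) / (2 * (d₀ - 1)) := div_pos (by linarith) (by linarith)
    have hpow := pow_ceil_log_le hs.rateConst_pos hs.rateConst_lt_one hX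
    rw [← hsdef] at hpow
    -- At least one factor of the power is available; `rate_mul` spends it to replace `b * d₀ - 1`
    -- by the smaller `b' * d₀ - 1`.
    have hs1 : 1 ≤ s := by
      by_contra hcon
      have : s = 0 := by omega
      rw [this, pow_zero, le_div_iff₀ (by linarith)] at hpow
      have := hs.le_one
      nlinarith
    have hr0 : 0 ≤ 1 - guessRate c d₀ b' := by have := hs.guessRate_lt_one; linarith
    have hr1 : 0 < 1 - rateConst c d₀ b := by have := hs.rateConst_lt_one; linarith
    have hrate : (1 - guessRate c d₀ b') ^ s * (2 * (d₀ - 1)) ≤ b' * d₀ - 1 := by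
      obtain ⟨s', hs'⟩ := Nat.exists_eq_add_of_le' hs1
      rw [hs'] at hpow ⊢
      have hmono : (1 - guessRate c d₀ b') ^ s' ≤ (1 - rateConst c d₀ b) ^ s' :=
        pow_le_pow_left₀ hr0 (by have := hs.rate_lt; linarith) _
      rw [le_div_iff₀ (by linarith)] at hpow
      have h5 := hs.rate_mul
      have h6 : (1 - guessRate c d₀ b') ^ (s' + 1) * (2 * (d₀ - 1)) * (1 - rateConst c d₀ b) ≤
          (b' * d₀ - 1) * (1 - rateConst c d₀ b) := by
        calc (1 - guessRate c d₀ b') ^ (s' + 1) * (2 * (d₀ - 1)) * (1 - rateConst c d₀ b)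
            = (1 - guessRate c d₀ b') * ((1 - guessRate c d₀ b') ^ s' * ((1 - rateConst c d₀ b) *
              (2 * (d₀ - 1)))) := by ring
          _ ≤ (1 - guessRate c d₀ b') * ((1 - rateConst c d₀ b) ^ s' * ((1 - rateConst c d₀ b) *
              (2 * (d₀ - 1)))) := by
              refine mul_le_mul_of_nonneg_left (mul_le_mul_of_nonneg_right hmono ?_) hr0
              exact mul_nonneg hr1.le (by linarith)
          _ = (1 - guessRate c d₀ b') * ((1 - rateConst c d₀ b) ^ (s' + 1) * (2 * (d₀ - 1))) := by
              ring
          _ ≤ (1 - guessRate c d₀ b') * (b * d₀ - 1) := by gcongr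
          _ ≤ _ := by linarith
      exact le_of_mul_le_mul_right h6 hr1
    have hF0 : (0 : ℝ) ≤ hammingDist x y := Nat.cast_nonneg _
    have h7 : (b' * d₀ - 1) * (c * hammingDist z y) ≤
        (b' * d₀ - 1) * (c * (hammingDist x y / 2)) := by
      calc (b' * d₀ - 1) * (c * (hammingDist z y : ℝ)) ≤ (d₀ - 1) * (G.unsat C₀ z).card := h3
        _ ≤ (d₀ - 1) * (c * ((1 - guessRate c d₀ b') ^ s * hammingDist x y)) := by
            refine mul_le_mul_of_nonneg_left (h2.trans ?_) (by linarith)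
            gcongr
        _ = ((1 - guessRate c d₀ b') ^ s * (2 * (d₀ - 1))) * (c * (hammingDist x y / 2)) := by ring
        _ ≤ _ := by gcongr
    exact le_of_mul_le_mul_left (le_of_mul_le_mul_left h7 (by linarith)) (by linarith)

/-- Each DeepFlip halves the errors, and `|U| ≤ c F` passes the test. The number of the iteration is
one ahead of the exponent, since the test follows the halving. -/
theorem deepLoop_spec (hs : IsSlack c d₀ b b') (hd₀ : IsMinDist C₀ d₀) (hG : G.IsExpander a b')
    (ha : 0 < a) {y : Word n} (hy : y ∈ G.tannerCode C₀) (j i : ℕ) (x : Word n)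
    (hxy : (hammingDist x y : ℝ) ≤ (2 : ℝ)⁻¹ ^ i * (gammaConst c d₀ a b * n)) :
    ∃ z, G.deepLoop C₀ d₀ a b j (i + 1) x = some z ∧
      (hammingDist z y : ℝ) ≤ (2 : ℝ)⁻¹ ^ (i + j) * (gammaConst c d₀ a b * n) := by
  induction j generalizing i x with
  | zero => exact ⟨x, rfl, by simpa using hxy⟩
  | succ j ih =>
    have hγ := hs.gammaConst_pos ha
    obtain ⟨z, hz, hzy⟩ := deepFlip_spec hs hd₀ hG ha hy (hxy.trans
      (mul_le_of_le_one_left (by positivity) (pow_le_one₀ (by norm_num) (by norm_num))))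
    have hzy' : (hammingDist z y : ℝ) ≤ (2 : ℝ)⁻¹ ^ (i + 1) * (gammaConst c d₀ a b * n) := by
      rw [pow_succ]
      linarith
    obtain ⟨w, hw, hwy⟩ := ih (i + 1) z hzy'
    refine ⟨w, ?_, ?_⟩
    · rw [deepLoop, hz]
      simp only
      rw [if_neg, hw]
      rw [not_lt]
      have h1 : ((G.unsat C₀ z).card : ℝ) ≤ c * hammingDist z y := by
        exact_mod_cast card_unsat_le hy
      refine h1.trans ((mul_le_mul_of_nonneg_left hzy' (Nat.cast_nonneg c)).trans (le_of_eq ?_))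
      ring
    · rw [show i + (j + 1) = i + 1 + j by ring]
      exact hwy

/-- The set where two codewords differ may exceed the range of expansion, but half of it does not.
That half already has more than `2 / d₀` neighbours per edge, whereas every check at the difference
of two codewords meets it at least `d₀` times. -/
theorem eq_of_hammingDist_le (hd₀ : IsMinDist C₀ d₀) (hG : G.IsExpander a b') (hc : 0 < c)
    (hb : 2 < b' * d₀) {x y z : Word n} (hy : y ∈ G.tannerCode C₀) (hz : z ∈ G.tannerCode C₀)
    (hxy : (hammingDist x y : ℝ) ≤ a * n) (hxz : (hammingDist x z : ℝ) ≤ a * n) : z = y := by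
  by_contra hne
  set S := corrupt z y with hS
  have hcard : S.card ≤ hammingDist x z + hammingDist x y := by
    rw [hS, card_corrupt, hammingDist_comm x z]
    exact hammingDist_triangle z x y
  have hpos : 0 < S.card := by rw [hS, card_corrupt]; exact hammingDist_pos.2 hne
  obtain ⟨S', hS', hcard'⟩ := Finset.exists_subset_card_eq (show (S.card + 1) / 2 ≤ S.card by omega)
  have h1 : (S'.card : ℝ) ≤ a * n := by
    rcases le_total (hammingDist x z) (hammingDist x y) with h | h
    · refine le_trans ?_ hxy
      exact_mod_cast (by omega : S'.card ≤ hammingDist x y)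
    · refine le_trans ?_ hxz
      exact_mod_cast (by omega : S'.card ≤ hammingDist x z)
  have h2 := hG S' h1
  have h3 : ((G.neighbors S').card : ℝ) ≤ (G.neighbors S).card := by
    exact_mod_cast Finset.card_le_card (G.neighbors_mono hS')
  have h4 := mul_card_unsat_ge hd₀ (x := z) hy
  rw [mem_tannerCode_iff.1 hz, Nat.cast_zero, mul_zero, ← hS] at h4
  have h5 : (S.card : ℝ) ≤ 2 * S'.card := by exact_mod_cast (by omega : S.card ≤ 2 * S'.card)
  rw [← card_corrupt, ← hS] at h4
  have hS0 : (0 : ℝ) < S'.card := by exact_mod_cast (by omega : 0 < S'.card)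
  have hc0 : (0 : ℝ) < c := by exact_mod_cast hc
  have h6 := mul_le_mul_of_nonneg_left (h2.trans h3) (Nat.cast_nonneg (α := ℝ) d₀)
  have h7 := mul_le_mul_of_nonneg_left h5 hc0.le
  have h8 : 0 < (b' * d₀ - 2) * (c * S'.card) := mul_pos (by linarith) (by positivity)
  nlinarith

/-- Some sequence of guesses succeeds, and every sequence that passes the final test yields `y` by
uniqueness, whichever comes first. -/
theorem mainDecode_eq (hs : IsSlack c d₀ b b') (hd₀ : IsMinDist C₀ d₀) (hG : G.IsExpander a b')
    (ha : 0 < a) (ha1 : a < 1) (hn : 0 < n) {x y : Word n} (hy : y ∈ G.tannerCode C₀)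
    (hxy : (hammingDist x y : ℝ) ≤ a * n) : G.mainDecode C₀ d₀ a b x = some y := by
  have hγ := hs.gammaConst_pos ha
  have hn0 : (0 : ℝ) < n := by exact_mod_cast hn
  unfold mainDecode
  set γ := gammaConst c d₀ a b with hγdef
  apply findSome?_eq_of_forall
  · obtain ⟨qs, hqs, hqy⟩ := exists_guess_foldl hs hd₀ hG hy
      ⌈Real.log γ / Real.log (1 - rateConst c d₀ b)⌉₊ x hxy
    have h1 : (hammingDist (qs.foldl (G.deterFlip C₀ d₀) x) y : ℝ) ≤ (2 : ℝ)⁻¹ ^ 0 * (γ * n) := by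
      have hg := hs.guessRate_lt_one
      have h2 : (1 - guessRate c d₀ b') ^ ⌈Real.log γ / Real.log (1 - rateConst c d₀ b)⌉₊ ≤ γ :=
        (pow_le_pow_left₀ (by linarith) (by have := hs.rate_lt; linarith) _).trans
          (pow_ceil_log_le hs.rateConst_pos hs.rateConst_lt_one hγ)
      rw [pow_zero, one_mul]
      refine hqy.trans (mul_le_mul h2 ?_ (Nat.cast_nonneg _) hγ.le)
      -- Since `a < 1`, there are at most `n` corrupt bits at the start, so the factor `γ` gives the
      -- absolute bound `γ n`.
      exact hxy.trans (mul_le_of_le_one_left hn0.le ha1.le)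
    obtain ⟨z, hz, hzy⟩ := deepLoop_spec hs hd₀ hG ha hy
      (⌈Real.logb 2 (γ * n)⌉ + 1).toNat 0 _ h1
    refine ⟨qs, hqs, ?_⟩
    have hzy0 : z = y := by
      rw [zero_add, ← hγdef] at hzy
      set r := (⌈Real.logb 2 (γ * n)⌉ + 1).toNat with hr
      have h3 : Real.logb 2 (γ * n) + 1 ≤ r := by
        have h4 : (⌈Real.logb 2 (γ * n)⌉ + 1 : ℤ) ≤ (r : ℤ) := Int.self_le_toNat _
        have h5 : ((⌈Real.logb 2 (γ * n)⌉ + 1 : ℤ) : ℝ) ≤ (r : ℝ) := by exact_mod_cast h4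
        push_cast at h5
        have := Int.le_ceil (Real.logb 2 (γ * n))
        linarith
      -- The extra iteration in `r'` makes the final bound at most one half, hence strictly below
      -- `1`.
      have h6 : 2 * (γ * n) ≤ 2 ^ r := by
        have h7 : Real.logb 2 (2 * (γ * n)) ≤ r := by
          rw [Real.logb_mul (by norm_num) (by positivity), Real.logb_self_eq_one (by norm_num)]
          linarith
        have h8 := (Real.logb_le_iff_le_rpow (by norm_num) (by positivity)).1 h7
        rwa [Real.rpow_natCast] at h8
      have h9 : (hammingDist z y : ℝ) < 1 := by
        refine hzy.trans_lt ?_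
        have h10 : (2 : ℝ)⁻¹ ^ r * 2 ^ r = 1 := by
          rw [← mul_pow]; norm_num
        have h11 : (0 : ℝ) < 2⁻¹ ^ r := by positivity
        nlinarith
      have h12 : hammingDist z y = 0 := by
        have : hammingDist z y < 1 := by exact_mod_cast h9
        omega
      exact eq_of_hammingDist_eq_zero h12
    subst hzy0
    rw [zero_add] at hz
    rw [hz]
    simp only
    rw [if_pos ⟨mem_tannerCode_iff.1 hy, hxy⟩]
  · intro qs _ w hw
    rcases h : G.deepLoop C₀ d₀ a b (⌈Real.logb 2 (γ * n)⌉ + 1).toNat 1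
        (qs.foldl (G.deterFlip C₀ d₀) x) with _ | z
    · rw [h] at hw
      cases hw
    · rw [h] at hw
      simp only at hw
      split_ifs at hw with hcond
      cases hw
      exact eq_of_hammingDist_le hd₀ hG hs.pos hs.two_lt hy (mem_tannerCode_iff.2 hcond.1) hxy
        hcond.2

end TannerGraph


/-! ### Reasoning about programs of the random access machine -/

namespace RamState

@[simp] theorem setReg_reg (s : RamState) (i k j : ℕ) :
    (s.setReg i k).reg j = if j = i then k else s.reg j := by
  simp [setReg, Function.update_apply]

@[simp] theorem setReg_arr (s : RamState) (i k : ℕ) : (s.setReg i k).arr = s.arr := rfl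

@[simp] theorem setCell_reg (s : RamState) (A a k : ℕ) : (s.setCell A a k).reg = s.reg := rfl

@[simp] theorem setCell_arr_self (s : RamState) (A a k : ℕ) :
    (s.setCell A a k).arr A = Function.update (s.arr A) a k := by
  simp [setCell]

theorem setCell_arr_of_ne (s : RamState) {A B : ℕ} (a k : ℕ) (h : B ≠ A) :
    (s.setCell A a k).arr B = s.arr B := by
  simp [setCell, h]

end RamState

namespace RamProg

/-- The programs in a list, executed one after the other. -/
def block : List RamProg → RamProg
  | [] => skip
  | p :: l => seq p (block l)

/-- While register `11` is positive, decrement it and execute `p`; register `2` must hold `1`. -/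
def forDown (p : RamProg) : RamProg := loop 1 2 11 (block [sub 11 11 2, p])

/-- The program `p`, started in the state `s`, halts within `τ` steps in a state with `Q`. -/
def Exec (p : RamProg) (s : RamState) (τ : ℕ) (Q : RamState → Prop) : Prop :=
  ∃ k ≤ τ, ∃ s', (∀ l T, run (T + k) (p :: l, s) = run T (l, s')) ∧ Q s'

theorem run_succ_of_step {C D : List RamProg × RamState} (h : step C = PMF.pure D) (T : ℕ) :
    run (T + 1) C = run T D := by
  rw [run, h, PMF.pure_bind]

theorem Exec.mono {p : RamProg} {s : RamState} {τ τ' : ℕ} {Q Q' : RamState → Prop}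
    (h : Exec p s τ Q) (hτ : τ ≤ τ') (hQ : ∀ s', Q s' → Q' s') : Exec p s τ' Q' := by
  obtain ⟨k, hk, s', h1, h2⟩ := h
  exact ⟨k, hk.trans hτ, s', h1, hQ _ h2⟩

theorem exec_of_step {p : RamProg} {s s' : RamState} {τ : ℕ} {Q : RamState → Prop}
    (h : ∀ l, step (p :: l, s) = PMF.pure (l, s')) (hQ : Q s') : Exec p s (τ + 1) Q :=
  ⟨1, by omega, s', fun l T => run_succ_of_step (h l) T, hQ⟩

theorem exec_skip {s : RamState} {τ : ℕ} {Q : RamState → Prop} (h : Q s) : Exec skip s (τ + 1) Q :=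
  exec_of_step (fun _ => rfl) h

theorem exec_const {s : RamState} {i k τ : ℕ} {Q : RamState → Prop} (h : Q (s.setReg i k)) :
    Exec (const i k) s (τ + 1) Q := exec_of_step (fun _ => rfl) h

theorem exec_add {s : RamState} {i a b τ : ℕ} {Q : RamState → Prop}
    (h : Q (s.setReg i (s.reg a + s.reg b))) : Exec (add i a b) s (τ + 1) Q :=
  exec_of_step (fun _ => rfl) h

theorem exec_sub {s : RamState} {i a b τ : ℕ} {Q : RamState → Prop}
    (h : Q (s.setReg i (s.reg a - s.reg b))) : Exec (sub i a b) s (τ + 1) Q :=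
  exec_of_step (fun _ => rfl) h

theorem exec_load {s : RamState} {i A a τ : ℕ} {Q : RamState → Prop}
    (h : Q (s.setReg i (s.arr A (s.reg a)))) : Exec (load i A a) s (τ + 1) Q :=
  exec_of_step (fun _ => rfl) h

theorem exec_store {s : RamState} {A a b τ : ℕ} {Q : RamState → Prop}
    (h : Q (s.setCell A (s.reg a) (s.reg b))) : Exec (store A a b) s (τ + 1) Q :=
  exec_of_step (fun _ => rfl) h

/-- `Exec` allows any programs to follow, so `q` may be among them while `p` runs. The additional
step unfolds the composition. -/
theorem exec_seq {p q : RamProg} {s : RamState} {τ₁ τ₂ : ℕ} {Q : RamState → Prop}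
    (h : Exec p s τ₁ fun s' => Exec q s' τ₂ Q) : Exec (seq p q) s (τ₁ + τ₂ + 1) Q := by
  obtain ⟨k₁, hk₁, s₁, h₁, k₂, hk₂, s₂, h₂, hQ⟩ := h
  refine ⟨k₂ + k₁ + 1, by omega, s₂, fun l T => ?_, hQ⟩
  rw [← add_assoc, ← add_assoc, run_succ_of_step (D := (p :: q :: l, s)) rfl, h₁, h₂]

theorem exec_block_nil {s : RamState} {τ : ℕ} {Q : RamState → Prop} (h : Q s) :
    Exec (block []) s (τ + 1) Q := exec_skip h

theorem exec_block_cons {p : RamProg} {l : List RamProg} {s : RamState} {τ₁ τ₂ : ℕ}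
    {Q : RamState → Prop} (h : Exec p s τ₁ fun s' => Exec (block l) s' τ₂ Q) :
    Exec (block (p :: l)) s (τ₁ + τ₂ + 1) Q := exec_seq h

/-- Two steps: the composition and the instruction. The remaining block is stated for the new state,
so straight-line code is treated by nesting such rules. -/
theorem exec_block_const {l : List RamProg} {s : RamState} {i k τ : ℕ} {Q : RamState → Prop}
    (h : Exec (block l) (s.setReg i k) τ Q) : Exec (block (const i k :: l)) s (τ + 2) Q :=
  (exec_block_cons (exec_const (τ := 0) h)).mono (by omega) fun _ => id

theorem exec_block_add {l : List RamProg} {s : RamState} {i a b τ : ℕ} {Q : RamState → Prop}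
    (h : Exec (block l) (s.setReg i (s.reg a + s.reg b)) τ Q) :
    Exec (block (add i a b :: l)) s (τ + 2) Q :=
  (exec_block_cons (exec_add (τ := 0) h)).mono (by omega) fun _ => id

theorem exec_block_sub {l : List RamProg} {s : RamState} {i a b τ : ℕ} {Q : RamState → Prop}
    (h : Exec (block l) (s.setReg i (s.reg a - s.reg b)) τ Q) :
    Exec (block (sub i a b :: l)) s (τ + 2) Q :=
  (exec_block_cons (exec_sub (τ := 0) h)).mono (by omega) fun _ => id

theorem exec_block_load {l : List RamProg} {s : RamState} {i A a τ : ℕ} {Q : RamState → Prop}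
    (h : Exec (block l) (s.setReg i (s.arr A (s.reg a))) τ Q) :
    Exec (block (load i A a :: l)) s (τ + 2) Q :=
  (exec_block_cons (exec_load (τ := 0) h)).mono (by omega) fun _ => id

theorem exec_block_store {l : List RamProg} {s : RamState} {A a b τ : ℕ} {Q : RamState → Prop}
    (h : Exec (block l) (s.setCell A (s.reg a) (s.reg b)) τ Q) :
    Exec (block (store A a b :: l)) s (τ + 2) Q :=
  (exec_block_cons (exec_store (τ := 0) h)).mono (by omega) fun _ => id

theorem exec_branch_of_le {r : ℝ} {a b : ℕ} {p q : RamProg} {s : RamState} {τ : ℕ}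
    {Q : RamState → Prop} (hr : r * (s.reg a : ℝ) ≤ (s.reg b : ℝ)) (h : Exec p s τ Q) :
    Exec (branch r a b p q) s (τ + 1) Q := by
  obtain ⟨k, hk, s', h1, hQ⟩ := h
  refine ⟨k + 1, by omega, s', fun l T => ?_, hQ⟩
  rw [← add_assoc, run_succ_of_step (D := (p :: l, s)) (by rw [step, if_pos hr]), h1]

theorem exec_branch_of_not_le {r : ℝ} {a b : ℕ} {p q : RamProg} {s : RamState} {τ : ℕ}
    {Q : RamState → Prop} (hr : ¬ r * (s.reg a : ℝ) ≤ (s.reg b : ℝ)) (h : Exec q s τ Q) :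
    Exec (branch r a b p q) s (τ + 1) Q := by
  obtain ⟨k, hk, s', h1, hQ⟩ := h
  refine ⟨k + 1, by omega, s', fun l T => ?_, hQ⟩
  rw [← add_assoc, run_succ_of_step (D := (q :: l, s)) (by rw [step, if_neg hr]), h1]

theorem one_mul_cast_le {a b : ℕ} : (1 : ℝ) * (a : ℝ) ≤ (b : ℝ) ↔ a ≤ b := by
  rw [one_mul, Nat.cast_le]

theorem exec_branch {a b : ℕ} {p q : RamProg} {s : RamState} {τ : ℕ} {Q : RamState → Prop}
    (hp : s.reg a ≤ s.reg b → Exec p s τ Q) (hq : s.reg b < s.reg a → Exec q s τ Q) :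
    Exec (branch 1 a b p q) s (τ + 1) Q := by
  rcases le_or_gt (s.reg a) (s.reg b) with h | h
  · exact exec_branch_of_le (one_mul_cast_le.2 h) (hp h)
  · exact exec_branch_of_not_le (by rw [one_mul_cast_le]; omega) (hq h)

/-- The rule for loops, with the time that is left as a potential. -/
theorem exec_loop {r : ℝ} {a b : ℕ} {p : RamProg} {Q : RamState → Prop}
    (I : ℕ → RamState → Prop)
    (h : ∀ τ s, I τ s →
      (r * (s.reg a : ℝ) ≤ (s.reg b : ℝ) ∧ ∃ τ₁ τ₂, τ₁ + τ₂ + 1 ≤ τ ∧ Exec p s τ₁ (I τ₂)) ∨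
      (¬ r * (s.reg a : ℝ) ≤ (s.reg b : ℝ) ∧ 1 ≤ τ ∧ Q s)) {τ : ℕ} {s : RamState} (hI : I τ s) :
    Exec (loop r a b p) s τ Q := by
  induction τ using Nat.strong_induction_on generalizing s with
  | _ τ ih =>
    rcases h τ s hI with ⟨hr, τ₁, τ₂, hτ, k, hk, s', h1, h2⟩ | ⟨hr, hτ, hQ⟩
    · obtain ⟨k', hk', s'', h1', hQ⟩ := ih τ₂ (by omega) h2
      refine ⟨k' + k + 1, by omega, s'', fun l T => ?_, hQ⟩
      rw [← add_assoc, ← add_assoc,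
        run_succ_of_step (D := (p :: loop r a b p :: l, s)) (by rw [step, if_pos hr]), h1, h1']
    · exact ⟨1, hτ, s, fun l T => run_succ_of_step (by rw [step, if_neg hr]) T, hQ⟩

theorem exec_loop_nat {a b : ℕ} {p : RamProg} (I : ℕ → RamState → Prop) (τ : ℕ)
    (hcond : ∀ k s, I k s → (s.reg a ≤ s.reg b ↔ 0 < k))
    (h : ∀ k s, I (k + 1) s → Exec p s τ (I k)) {N : ℕ} {s : RamState} (hI : I N s) :
    Exec (loop 1 a b p) s (N * (τ + 1) + 1) (I 0) := by
  refine exec_loop (fun t s => ∃ k, t = k * (τ + 1) + 1 ∧ I k s) ?_ ⟨N, rfl, hI⟩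
  rintro t s ⟨k, rfl, hk⟩
  rw [one_mul_cast_le, hcond k s hk]
  rcases k with _ | k
  · exact Or.inr ⟨by omega, by omega, hk⟩
  · refine Or.inl ⟨by omega, τ, k * (τ + 1) + 1, ?_, (h k s hk).mono le_rfl fun s' hs' => ⟨k, rfl, hs'⟩⟩
    rw [add_mul]
    omega

/-- The rule for loops that run through a list. -/
theorem exec_forDown {A : Type*} {p : RamProg} (I : List A → RamState → Prop) (τ : ℕ)
    (hcond : ∀ l s, I l s → s.reg 2 = 1 ∧ s.reg 11 = l.length)
    (h : ∀ a l s, I (a :: l) s → Exec p (s.setReg 11 l.length) τ (I l)) {L : List A}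
    {s : RamState} (hI : I L s) : Exec (forDown p) s (L.length * (τ + 5) + 1) (I []) := by
  refine (exec_loop_nat (fun k s => ∃ l, l.length = k ∧ I l s) (τ + 4) ?_ ?_
    ⟨L, rfl, hI⟩).mono le_rfl ?_
  · rintro k s ⟨l, rfl, hl⟩
    rw [(hcond l s hl).1, (hcond l s hl).2]
    exact Iff.rfl
  · rintro k s ⟨l, hk, hl⟩
    rcases l with _ | ⟨a, l⟩
    · simp at hk
    · have h2 := hcond _ s hl
      rw [List.length_cons] at h2 hk
      refine (exec_block_sub (exec_block_cons (τ₂ := 1) ?_)).mono le_rfl fun _ => id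
      have : s.reg 11 - s.reg 2 = l.length := by omega
      rw [this]
      exact (h a l s hl).mono le_rfl fun s' hs' => exec_block_nil ⟨l, by omega, hs'⟩
  · rintro s' ⟨l, hk, hl⟩
    rw [List.length_eq_zero_iff] at hk
    rwa [hk] at hl

/-- The rule for loops that run through `N - 1, …, 0`. -/
theorem exec_forDown_nat {p : RamProg} (I : ℕ → RamState → Prop) (τ : ℕ)
    (hcond : ∀ k s, I k s → s.reg 2 = 1 ∧ s.reg 11 = k)
    (h : ∀ k s, I (k + 1) s → Exec p (s.setReg 11 k) τ (I k)) {N : ℕ}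
    {s : RamState} (hI : I N s) : Exec (forDown p) s (N * (τ + 5) + 1) (I 0) := by
  refine exec_loop_nat I (τ + 4) ?_ ?_ hI
  · intro k s hk
    rw [(hcond k s hk).1, (hcond k s hk).2]
    exact Iff.rfl
  · intro k s hk
    have h2 := hcond _ s hk
    refine (exec_block_sub (exec_block_cons (τ₂ := 1) ?_)).mono le_rfl fun _ => id
    have : s.reg 11 - s.reg 2 = k := by omega
    rw [this]
    exact (h k s hk).mono le_rfl fun s' hs' => exec_block_nil hs'

/-- A case distinction by the bits that are stored in the array `e` at the addresses that are stored
in the arrays `A, …, A + k - 1` at the address in register `7`. -/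
def caseBits (e : ℕ) : (k A : ℕ) → (Word k → RamProg) → RamProg
  | 0, _, f => f Fin.elim0
  | k + 1, A, f => block [load 9 A 7, load 10 e 9,
      branch 1 2 10 (caseBits e k (A + 1) fun w => f (Fin.cons 1 w))
        (caseBits e k (A + 1) fun w => f (Fin.cons 0 w))]

/-- Two loads and a branch per bit fit into `7` steps. The local code enters only through the choice
of the leaves when the program is built, so a check is evaluated in time linear in `k`. -/
theorem exec_caseBits {e k A : ℕ} {f : Word k → RamProg} {s : RamState} {τ : ℕ}
    {Q : RamState → Prop} (w : Word k) (h2 : s.reg 2 = 1)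
    (hw : ∀ j : Fin k, s.arr e (s.arr (A + j) (s.reg 7)) = (w j).val)
    (h : ∀ s', s'.arr = s.arr → (∀ i, i ≠ 9 → i ≠ 10 → s'.reg i = s.reg i) → Exec (f w) s' τ Q) :
    Exec (caseBits e k A f) s (7 * k + τ) Q := by
  induction k generalizing A s with
  | zero =>
    have : w = Fin.elim0 := Subsingleton.elim _ _
    subst this
    exact (h s rfl fun _ _ _ => rfl).mono (by omega) fun _ => id
  | succ k ih =>
    unfold caseBits
    have h0 := hw 0
    rw [Fin.val_zero, add_zero] at h0
    refine Exec.mono (τ := (7 * k + τ) + 1 + 1 + 1 + 2 + 2) ?_ (by omega) fun _ => id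
    refine exec_block_load (exec_block_load (exec_block_cons (τ₁ := 7 * k + τ + 1) (τ₂ := 1) ?_))
    have hrec : ∀ b : ZMod 2, b = w 0 → Exec (caseBits e k (A + 1) fun w => f (Fin.cons b w))
        (((s.setReg 9 (s.arr A (s.reg 7))).setReg 10 ((s.setReg 9 (s.arr A (s.reg 7))).arr e
          ((s.setReg 9 (s.arr A (s.reg 7))).reg 9)))) (7 * k + τ) Q := by
      rintro b rfl
      refine ih (Fin.tail w) (by simpa using h2) ?_ ?_
      · intro j
        have := hw j.succ
        simp only [RamState.setReg_arr, RamState.setReg_reg]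
        rw [show A + 1 + (j : ℕ) = A + (j.succ : Fin (k + 1)) by simp; omega]
        simpa [Fin.tail] using this
      · intro s' hs1 hs2
        rw [Fin.cons_self_tail]
        refine h s' (by simpa using hs1) fun i hi9 hi10 => ?_
        rw [hs2 i hi9 hi10]
        simp [hi9, hi10]
    have hbit : ∀ b : ZMod 2, (1 ≤ b.val → (1 : ZMod 2) = b) ∧ (b.val < 1 → (0 : ZMod 2) = b) := by
      decide
    refine exec_branch (fun hle => ?_) fun hlt => ?_
    · refine (hrec 1 ((hbit (w 0)).1 ?_)).mono le_rfl fun s' hs' => exec_block_nil hs'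
      simpa [h2, h0] using hle
    · refine (hrec 0 ((hbit (w 0)).2 ?_)).mono le_rfl fun s' hs' => exec_block_nil hs'
      simpa [h2, h0] using hlt

end RamProg


/-! ### Data structures on the random access machine -/

/-- The stack `l` is stored in the array `f`, with its top at the address `l.length - 1`. -/
def Stack {k : ℕ} (f : ℕ → ℕ) : List (Fin k) → Prop
  | [] => True
  | a :: l => f l.length = a ∧ Stack f l

theorem Stack.update {k : ℕ} {f : ℕ → ℕ} {l : List (Fin k)} (h : Stack f l) {i : ℕ}
    (hi : l.length ≤ i) (a : ℕ) : Stack (Function.update f i a) l := by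
  induction l with
  | nil => trivial
  | cons b l ih =>
    rw [List.length_cons] at hi
    exact ⟨by rw [Function.update_of_ne (by omega)]; exact h.1, ih h.2 (by omega)⟩

theorem Stack.push {k : ℕ} {f : ℕ → ℕ} {l : List (Fin k)} (h : Stack f l) (a : Fin k) :
    Stack (Function.update f l.length a) (a :: l) :=
  ⟨Function.update_self _ _ _, h.update le_rfl _⟩

/-- The data on which the decoders work: the current word, a list of checks that contains all
unsatisfied ones, the bits that received votes with the numbers of their votes, the bits that have
been flipped, a copy of the input word, and the contents of the control registers. -/
structure DecoderData (n m : ℕ) where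
  word : Word n
  active : List (Fin m)
  cand : List (Fin n)
  votes : Fin n → ℕ
  trail : List (Fin n)
  saved : Word n
  ctl : ℕ → ℕ

namespace TannerGraph

variable {c d n m : ℕ}

/-- The state `s` of the machine represents the data `σ`. -/
structure Rep (G : TannerGraph c d n m) (σ : DecoderData n m) (s : RamState) : Prop where
  reg_n : s.reg 0 = n
  reg_m : s.reg 1 = m
  one : s.reg 2 = 1
  left : ∀ (j : Fin c) (u : Fin n), s.arr j u = G.left u j
  right : ∀ (i : Fin d) (v : Fin m), s.arr (c + i) v = G.right v i
  word : ∀ u : Fin n, s.arr (c + d) u = (σ.word u).val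
  active : Stack (s.arr (c + d + 1)) σ.active
  activeLen : s.reg 3 = σ.active.length
  mark : ∀ v : Fin m, s.arr (c + d + 2) v = if v ∈ σ.active then 1 else 0
  nodup : σ.active.Nodup
  votes : ∀ u : Fin n, s.arr (c + d + 3) u = σ.votes u
  cand : Stack (s.arr (c + d + 4)) σ.cand
  candLen : s.reg 4 = σ.cand.length
  trail : Stack (s.arr (c + d + 5)) σ.trail
  trailLen : s.reg 5 = σ.trail.length
  saved : ∀ u : Fin n, s.arr (c + d + 8) u = (σ.saved u).val
  ctl : ∀ i, 20 ≤ i → s.reg i = σ.ctl i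

variable {G : TannerGraph c d n m} {σ : DecoderData n m} {s : RamState}

/-- The registers from `6` to `19` are temporary and carry no represented data. -/
theorem Rep.of_eq {s' : RamState} (h : G.Rep σ s) (ha : s'.arr = s.arr)
    (hr : ∀ i, (i < 6 ∨ 20 ≤ i) → s'.reg i = s.reg i) : G.Rep σ s' := by
  constructor
  · rw [hr _ (by omega)]; exact h.reg_n
  · rw [hr _ (by omega)]; exact h.reg_m
  · rw [hr _ (by omega)]; exact h.one
  · rw [ha]; exact h.left
  · rw [ha]; exact h.right
  · rw [ha]; exact h.word
  · rw [ha]; exact h.active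
  · rw [hr _ (by omega)]; exact h.activeLen
  · rw [ha]; exact h.mark
  · exact h.nodup
  · rw [ha]; exact h.votes
  · rw [ha]; exact h.cand
  · rw [hr _ (by omega)]; exact h.candLen
  · rw [ha]; exact h.trail
  · rw [hr _ (by omega)]; exact h.trailLen
  · rw [ha]; exact h.saved
  · intro i hi
    rw [hr _ (by omega)]
    exact h.ctl i hi

theorem Rep.setTemp (h : G.Rep σ s) {i : ℕ} (k : ℕ) (h6 : 6 ≤ i) (h20 : i < 20) :
    G.Rep σ (s.setReg i k) :=
  h.of_eq rfl fun j hj => by rw [RamState.setReg_reg, if_neg (by omega)]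

theorem Rep.setCtl (h : G.Rep σ s) {i : ℕ} (k : ℕ) (hi : 20 ≤ i) :
    G.Rep { σ with ctl := Function.update σ.ctl i k } (s.setReg i k) := by
  refine { h with
    reg_n := ?_, reg_m := ?_, one := ?_, activeLen := ?_, candLen := ?_, trailLen := ?_, ctl := ?_ }
  all_goals try rw [RamState.setReg_reg, if_neg (by omega)]
  · exact h.reg_n
  · exact h.reg_m
  · exact h.one
  · exact h.activeLen
  · exact h.candLen
  · exact h.trailLen
  · intro j hj
    simp only [RamState.setReg_reg, Function.update_apply, h.ctl j hj]

theorem Rep.setCand (h : G.Rep σ s) (C : List (Fin n)) {k : ℕ} (hk : k = C.length)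
    (hC : Stack (s.arr (c + d + 4)) C) : G.Rep { σ with cand := C } (s.setReg 4 k) := by
  refine { h with
    reg_n := ?_, reg_m := ?_, one := ?_, activeLen := ?_, candLen := ?_, trailLen := ?_, ctl := ?_,
    cand := hC }
  · simpa using h.reg_n
  · simpa using h.reg_m
  · simpa using h.one
  · simpa using h.activeLen
  · simpa using hk
  · simpa using h.trailLen
  · intro j hj
    rw [RamState.setReg_reg, if_neg (by omega), h.ctl j hj]

theorem Rep.setTrail (h : G.Rep σ s) (C : List (Fin n)) {k : ℕ} (hk : k = C.length)
    (hC : Stack (s.arr (c + d + 5)) C) : G.Rep { σ with trail := C } (s.setReg 5 k) := by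
  refine { h with
    reg_n := ?_, reg_m := ?_, one := ?_, activeLen := ?_, candLen := ?_, trailLen := ?_, ctl := ?_,
    trail := hC }
  · simpa using h.reg_n
  · simpa using h.reg_m
  · simpa using h.one
  · simpa using h.activeLen
  · simpa using h.candLen
  · simpa using hk
  · intro j hj
    rw [RamState.setReg_reg, if_neg (by omega), h.ctl j hj]

theorem setCell_arr_graph {A : ℕ} (hA : c + d ≤ A) (a k : ℕ) :
    (∀ (j : Fin c), (s.setCell A a k).arr j = s.arr j) ∧
      ∀ (i : Fin d), (s.setCell A a k).arr (c + i) = s.arr (c + i) :=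
  ⟨fun j => RamState.setCell_arr_of_ne _ _ _ (by omega),
    fun i => RamState.setCell_arr_of_ne _ _ _ (by omega)⟩

theorem Rep.setScratch (h : G.Rep σ s) {A : ℕ} (hA : A = c + d + 6 ∨ A = c + d + 7) (a k : ℕ) :
    G.Rep σ (s.setCell A a k) := by
  obtain ⟨hl, hr⟩ := setCell_arr_graph (s := s) (c := c) (d := d) (A := A) (by omega) a k
  refine { h with
    left := ?_, right := ?_, word := ?_, active := ?_, mark := ?_, votes := ?_, cand := ?_,
    trail := ?_, saved := ?_ }
  all_goals try rw [RamState.setCell_arr_of_ne _ _ _ (by omega)]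
  · intro j u; rw [hl]; exact h.left j u
  · intro i v; rw [hr]; exact h.right i v
  · exact h.word
  · exact h.active
  · exact h.mark
  · exact h.votes
  · exact h.cand
  · exact h.trail
  · exact h.saved

theorem Rep.setVotes (h : G.Rep σ s) (u : Fin n) (k : ℕ) :
    G.Rep { σ with votes := Function.update σ.votes u k } (s.setCell (c + d + 3) u k) := by
  obtain ⟨hl, hr⟩ := setCell_arr_graph (s := s) (c := c) (d := d) (A := c + d + 3) (by omega) u k
  refine { h with
    left := ?_, right := ?_, word := ?_, active := ?_, mark := ?_, votes := ?_, cand := ?_,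
    trail := ?_, saved := ?_ }
  all_goals try rw [RamState.setCell_arr_of_ne _ _ _ (by omega)]
  · intro j u; rw [hl]; exact h.left j u
  · intro i v; rw [hr]; exact h.right i v
  · exact h.word
  · exact h.active
  · exact h.mark
  · intro w
    simp only [RamState.setCell_arr_self, Function.update_apply, h.votes, Fin.val_inj]
  · exact h.cand
  · exact h.trail
  · exact h.saved

theorem Rep.flip (h : G.Rep σ s) (u : Fin n) {k : ℕ} (hk : k = 1 - (σ.word u).val) :
    G.Rep { σ with word := flipBit σ.word u } (s.setCell (c + d) u k) := by
  obtain ⟨hl, hr⟩ := setCell_arr_graph (s := s) (c := c) (d := d) (A := c + d) (by omega) u k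
  refine { h with
    left := ?_, right := ?_, word := ?_, active := ?_, mark := ?_, votes := ?_, cand := ?_,
    trail := ?_, saved := ?_ }
  all_goals try rw [RamState.setCell_arr_of_ne _ _ _ (by omega)]
  · intro j u; rw [hl]; exact h.left j u
  · intro i v; rw [hr]; exact h.right i v
  · intro w
    rw [RamState.setCell_arr_self, Function.update_apply, h.word]
    simp only [flipBit, Function.update_apply, Fin.val_inj]
    have hbit : ∀ b : ZMod 2, 1 - b.val = (b + 1).val := by decide
    split_ifs with hw
    · rw [hk, hbit]
    · rfl
  · exact h.active
  · exact h.mark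
  · exact h.votes
  · exact h.cand
  · exact h.trail
  · exact h.saved

theorem Rep.setWord (h : G.Rep σ s) (u : Fin n) {k : ℕ} {b : ZMod 2} (hk : k = b.val) :
    G.Rep { σ with word := Function.update σ.word u b } (s.setCell (c + d) u k) := by
  obtain ⟨hl, hr⟩ := setCell_arr_graph (s := s) (c := c) (d := d) (A := c + d) (by omega) u k
  refine { h with
    left := ?_, right := ?_, word := ?_, active := ?_, mark := ?_, votes := ?_, cand := ?_,
    trail := ?_, saved := ?_ }
  all_goals try rw [RamState.setCell_arr_of_ne _ _ _ (by omega)]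
  · intro j u; rw [hl]; exact h.left j u
  · intro i v; rw [hr]; exact h.right i v
  · intro w
    rw [RamState.setCell_arr_self, Function.update_apply, h.word]
    simp only [Function.update_apply, Fin.val_inj]
    split_ifs with hw
    · exact hk
    · rfl
  · exact h.active
  · exact h.mark
  · exact h.votes
  · exact h.cand
  · exact h.trail
  · exact h.saved

theorem Rep.setSaved (h : G.Rep σ s) (u : Fin n) {k : ℕ} {b : ZMod 2} (hk : k = b.val) :
    G.Rep { σ with saved := Function.update σ.saved u b } (s.setCell (c + d + 8) u k) := by
  obtain ⟨hl, hr⟩ := setCell_arr_graph (s := s) (c := c) (d := d) (A := c + d + 8) (by omega) u k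
  refine { h with
    left := ?_, right := ?_, word := ?_, active := ?_, mark := ?_, votes := ?_, cand := ?_,
    trail := ?_, saved := ?_ }
  all_goals try rw [RamState.setCell_arr_of_ne _ _ _ (by omega)]
  · intro j u; rw [hl]; exact h.left j u
  · intro i v; rw [hr]; exact h.right i v
  · exact h.word
  · exact h.active
  · exact h.mark
  · exact h.votes
  · exact h.cand
  · exact h.trail
  · intro w
    rw [RamState.setCell_arr_self, Function.update_apply, h.saved]
    simp only [Function.update_apply, Fin.val_inj]
    split_ifs with hw
    · exact hk
    · rfl

theorem Rep.pushCand (h : G.Rep σ s) (u : Fin n) {k : ℕ} (hk : k = σ.cand.length + 1) :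
    G.Rep { σ with cand := u :: σ.cand } ((s.setCell (c + d + 4) (s.reg 4) u).setReg 4 k) := by
  obtain ⟨hl, hr⟩ := setCell_arr_graph (s := s) (c := c) (d := d) (A := c + d + 4) (by omega)
    (s.reg 4) u
  refine { h with
    reg_n := ?_, reg_m := ?_, one := ?_, activeLen := ?_, candLen := ?_, trailLen := ?_, ctl := ?_,
    left := ?_, right := ?_, word := ?_, active := ?_, mark := ?_, votes := ?_, cand := ?_,
    trail := ?_, saved := ?_ }
  all_goals try rw [RamState.setReg_arr]
  all_goals try rw [RamState.setCell_arr_of_ne _ _ _ (by omega)]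
  all_goals try rw [RamState.setReg_reg, if_neg (by omega)]
  · exact h.reg_n
  · exact h.reg_m
  · exact h.one
  · intro j u; rw [hl]; exact h.left j u
  · intro i v; rw [hr]; exact h.right i v
  · exact h.word
  · exact h.active
  · exact h.activeLen
  · exact h.mark
  · exact h.votes
  · rw [RamState.setCell_arr_self, h.candLen]
    exact h.cand.push u
  · simpa using hk
  · exact h.trail
  · exact h.trailLen
  · exact h.saved
  · intro j hj
    rw [RamState.setReg_reg, if_neg (by omega)]
    exact h.ctl j hj

theorem Rep.pushTrail (h : G.Rep σ s) (u : Fin n) {k : ℕ} (hk : k = σ.trail.length + 1) :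
    G.Rep { σ with trail := u :: σ.trail } ((s.setCell (c + d + 5) (s.reg 5) u).setReg 5 k) := by
  obtain ⟨hl, hr⟩ := setCell_arr_graph (s := s) (c := c) (d := d) (A := c + d + 5) (by omega)
    (s.reg 5) u
  refine { h with
    reg_n := ?_, reg_m := ?_, one := ?_, activeLen := ?_, candLen := ?_, trailLen := ?_, ctl := ?_,
    left := ?_, right := ?_, word := ?_, active := ?_, mark := ?_, votes := ?_, cand := ?_,
    trail := ?_, saved := ?_ }
  all_goals try rw [RamState.setReg_arr]
  all_goals try rw [RamState.setCell_arr_of_ne _ _ _ (by omega)]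
  all_goals try rw [RamState.setReg_reg, if_neg (by omega)]
  · exact h.reg_n
  · exact h.reg_m
  · exact h.one
  · intro j u; rw [hl]; exact h.left j u
  · intro i v; rw [hr]; exact h.right i v
  · exact h.word
  · exact h.active
  · exact h.activeLen
  · exact h.mark
  · exact h.votes
  · exact h.cand
  · exact h.candLen
  · rw [RamState.setCell_arr_self, h.trailLen]
    exact h.trail.push u
  · simpa using hk
  · exact h.saved
  · intro j hj
    rw [RamState.setReg_reg, if_neg (by omega)]
    exact h.ctl j hj

theorem Rep.pushActive (h : G.Rep σ s) (v : Fin m) (hv : v ∉ σ.active) {k : ℕ}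
    (hk : k = σ.active.length + 1) :
    G.Rep { σ with active := v :: σ.active }
      (((s.setCell (c + d + 1) (s.reg 3) v).setReg 3 k).setCell (c + d + 2) v 1) := by
  obtain ⟨hl, hr⟩ := setCell_arr_graph (s := s) (c := c) (d := d) (A := c + d + 1) (by omega)
    (s.reg 3) v
  obtain ⟨hl', hr'⟩ := setCell_arr_graph (s := (s.setCell (c + d + 1) (s.reg 3) v).setReg 3 k)
    (c := c) (d := d) (A := c + d + 2) (by omega) v 1
  refine { h with
    reg_n := ?_, reg_m := ?_, one := ?_, activeLen := ?_, candLen := ?_, trailLen := ?_, ctl := ?_,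
    left := ?_, right := ?_, word := ?_, active := ?_, mark := ?_, votes := ?_, cand := ?_,
    trail := ?_, saved := ?_, nodup := List.nodup_cons.2 ⟨hv, h.nodup⟩ }
  all_goals try rw [RamState.setCell_arr_of_ne _ _ _ (by omega)]
  all_goals try rw [RamState.setReg_arr]
  all_goals try rw [RamState.setCell_arr_of_ne _ _ _ (by omega)]
  all_goals try rw [RamState.setCell_reg]
  all_goals try rw [RamState.setReg_reg, if_neg (by omega)]
  · exact h.reg_n
  · exact h.reg_m
  · exact h.one
  · intro j u; rw [hl', RamState.setReg_arr, hl]; exact h.left j u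
  · intro i v; rw [hr', RamState.setReg_arr, hr]; exact h.right i v
  · exact h.word
  · rw [RamState.setCell_arr_self, h.activeLen]
    exact h.active.push v
  · simpa using hk
  · intro w
    rw [RamState.setCell_arr_self, Function.update_apply, RamState.setReg_arr,
      RamState.setCell_arr_of_ne _ _ _ (by omega), h.mark]
    simp only [Fin.val_inj, List.mem_cons]
    by_cases hw : w = v <;> simp [hw]
  · exact h.votes
  · exact h.cand
  · exact h.candLen
  · exact h.trail
  · exact h.trailLen
  · exact h.saved
  · intro j hj
    rw [RamState.setReg_reg, if_neg (by omega)]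
    exact h.ctl j hj

theorem Rep.popActive (h : G.Rep σ s) {v : Fin m} {l : List (Fin m)} (hv : σ.active = v :: l) {k : ℕ}
    (hk : k = l.length) :
    G.Rep { σ with active := l } ((s.setReg 3 k).setCell (c + d + 2) v 0) := by
  obtain ⟨hl, hr⟩ := setCell_arr_graph (s := s.setReg 3 k)
    (c := c) (d := d) (A := c + d + 2) (by omega) v 0
  have hst := h.active
  have hnd := h.nodup
  have hmk := h.mark
  rw [hv] at hst hnd hmk
  rw [List.nodup_cons] at hnd
  refine { h with
    reg_n := ?_, reg_m := ?_, one := ?_, activeLen := ?_, candLen := ?_, trailLen := ?_, ctl := ?_,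
    left := ?_, right := ?_, word := ?_, active := ?_, mark := ?_, votes := ?_, cand := ?_,
    trail := ?_, saved := ?_, nodup := hnd.2 }
  all_goals try rw [RamState.setCell_arr_of_ne _ _ _ (by omega)]
  all_goals try rw [RamState.setReg_arr]
  all_goals try rw [RamState.setCell_reg]
  all_goals try rw [RamState.setReg_reg, if_neg (by omega)]
  · exact h.reg_n
  · exact h.reg_m
  · exact h.one
  · intro j u; rw [hl]; exact h.left j u
  · intro i v; rw [hr]; exact h.right i v
  · exact h.word
  · exact hst.2
  · simpa using hk
  · intro w
    rw [RamState.setCell_arr_self, Function.update_apply, RamState.setReg_arr, hmk]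
    simp only [Fin.val_inj, List.mem_cons]
    by_cases hw : w = v <;> simp [hw, hnd.1]
  · exact h.votes
  · exact h.cand
  · exact h.candLen
  · exact h.trail
  · exact h.trailLen
  · exact h.saved
  · intro j hj
    rw [RamState.setReg_reg, if_neg (by omega)]
    exact h.ctl j hj

end TannerGraph


/-! ### Subroutines -/

theorem Stack.of_suffix {k : ℕ} {f : ℕ → ℕ} {l l' : List (Fin k)} (h : Stack f l) (hl : l' <:+ l) :
    Stack f l' := by
  obtain ⟨t, rfl⟩ := hl
  induction t with
  | nil => exact h
  | cons a t ih => exact ih h.2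

namespace RamProg

theorem Exec.intro_state {p : RamProg} {s : RamState} {τ : ℕ} {Q : RamState → Prop}
    (h : ∀ s', s' = s → Exec p s' τ Q) : Exec p s τ Q := h s rfl

theorem exec_block_cons' {p : RamProg} {l : List RamProg} {s : RamState} {τ : ℕ} (τ₁ τ₂ : ℕ)
    {Q : RamState → Prop} (hτ : τ₁ + τ₂ + 1 ≤ τ) (h : Exec p s τ₁ fun s' => Exec (block l) s' τ₂ Q) :
    Exec (block (p :: l)) s τ Q := (exec_block_cons h).mono hτ fun _ => id

/-- Push the check in register `7` to the list of active checks, unless it is marked. -/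
def pushCheck (c d : ℕ) : RamProg :=
  block [load 9 (c + d + 2) 7,
    branch 1 2 9 skip (block [store (c + d + 1) 3 7, add 3 3 2, store (c + d + 2) 7 2])]

/-- Push the `j`-th neighbours of the bit in register `8` to the list of active checks. -/
def pushNeighbors (c d : ℕ) (js : List (Fin c)) : RamProg :=
  block (js.map fun j => block [load 7 j 8, pushCheck c d])

/-- Flip the bit in register `8`. -/
def flipProg (c d : ℕ) : RamProg :=
  block [load 9 (c + d) 8, sub 9 2 9, store (c + d) 8 9, pushNeighbors c d (List.finRange c)]

/-- Flip the bit in register `8` and record it. -/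
def flipRecord (c d : ℕ) : RamProg :=
  block [flipProg c d, store (c + d + 5) 5 8, add 5 5 2]

/-- A case distinction by the local view of the check in register `7`. -/
def caseView (c d : ℕ) (f : Word d → RamProg) : RamProg := caseBits (c + d) d c f

open Classical in
/-- Keep only the unsatisfied ones among the active checks. -/
def compress (c : ℕ) {d : ℕ} (C₀ : Submodule (ZMod 2) (Word d)) : RamProg :=
  block [const 6 0, const 10 0, add 11 3 10,
    forDown (block [sub 3 3 2, load 7 (c + d + 1) 3, const 10 0, store (c + d + 2) 7 10,
      caseView c d fun w => if w ∈ C₀ then skip else block [store (c + d + 6) 6 7, add 6 6 2]]),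
    const 10 0, add 11 6 10,
    forDown (block [load 7 (c + d + 6) 11, pushCheck c d])]

/-- Undo the recorded flips. -/
def undoTrail (c d : ℕ) : RamProg :=
  block [const 10 0, add 11 5 10, forDown (block [load 8 (c + d + 5) 11, flipProg c d]), const 5 0]

end RamProg

open RamProg

/-- The registers `6`, `8`, `11` and the scratch arrays are unchanged. -/
structure Frame (c d : ℕ) (s s' : RamState) : Prop where
  reg6 : s'.reg 6 = s.reg 6
  reg8 : s'.reg 8 = s.reg 8
  reg11 : s'.reg 11 = s.reg 11
  arr6 : s'.arr (c + d + 6) = s.arr (c + d + 6)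
  arr7 : s'.arr (c + d + 7) = s.arr (c + d + 7)

theorem Frame.trans {c d : ℕ} {s s' s'' : RamState} (h : Frame c d s s') (h' : Frame c d s' s'') :
    Frame c d s s'' :=
  ⟨h'.reg6.trans h.reg6, h'.reg8.trans h.reg8, h'.reg11.trans h.reg11, h'.arr6.trans h.arr6,
    h'.arr7.trans h.arr7⟩

namespace TannerGraph

variable {c d n m : ℕ} {G : TannerGraph c d n m} {σ : DecoderData n m} {s : RamState}
  {C₀ : Submodule (ZMod 2) (Word d)}

/-- The array of marks answers the membership test in constant time and keeps the list free of
repetitions. -/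
theorem Rep.exec_pushCheck (h : G.Rep σ s) {v : Fin m} (hv : s.reg 7 = v) :
    Exec (pushCheck c d) s 12 fun s' =>
      G.Rep { σ with active := if v ∈ σ.active then σ.active else v :: σ.active } s' ∧
        Frame c d s s' := by
  unfold pushCheck
  refine exec_block_load (Exec.intro_state fun s₁ e₁ => ?_)
  have h₁ : G.Rep σ s₁ := e₁ ▸ h.setTemp _ (by omega) (by omega)
  have r7 : s₁.reg 7 = v := by simp [e₁, hv]
  have r9 : s₁.reg 9 = if v ∈ σ.active then 1 else 0 := by simp [e₁, hv, h.mark]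
  have f₁ : Frame c d s s₁ := by constructor <;> simp [e₁]
  refine exec_block_cons' 8 1 (by omega) (exec_branch (fun hle => ?_) fun hlt => ?_)
  · refine exec_skip (exec_block_nil ?_)
    rw [h₁.one, r9] at hle
    have hmem : v ∈ σ.active := by
      by_contra hcon
      rw [if_neg hcon] at hle
      omega
    rw [if_pos hmem]
    exact ⟨h₁, f₁⟩
  · rw [h₁.one, r9] at hlt
    have hmem : v ∉ σ.active := by
      intro hcon
      rw [if_pos hcon] at hlt
      omega
    rw [if_neg hmem]
    refine exec_block_store (exec_block_add (exec_block_store (exec_block_nil (exec_block_nil ?_))))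
    have h₂ := h₁.pushActive v hmem (k := σ.active.length + 1) rfl
    simp only [RamState.setCell_reg, RamState.setReg_reg, h₁.one, r7, h₁.activeLen] at h₂ ⊢
    refine ⟨h₂, f₁.trans ?_⟩
    constructor
    · simp
    · simp
    · simp
    · rw [RamState.setCell_arr_of_ne _ _ _ (by omega), RamState.setReg_arr,
        RamState.setCell_arr_of_ne _ _ _ (by omega)]
    · rw [RamState.setCell_arr_of_ne _ _ _ (by omega), RamState.setReg_arr,
        RamState.setCell_arr_of_ne _ _ _ (by omega)]

theorem Rep.exec_pushNeighbors (h : G.Rep σ s) {u : Fin n} (hu : s.reg 8 = u) (js : List (Fin c)) :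
    Exec (pushNeighbors c d js) s (js.length * 17 + 1) fun s' => ∃ A',
      G.Rep { σ with active := A' } s' ∧ Frame c d s s' ∧
        (∀ v, v ∈ A' ↔ v ∈ σ.active ∨ ∃ j ∈ js, G.left u j = v) ∧
        A'.length ≤ σ.active.length + js.length := by
  unfold pushNeighbors
  induction js generalizing s σ with
  | nil => exact exec_block_nil ⟨σ.active, h, ⟨rfl, rfl, rfl, rfl, rfl⟩, by simp, by simp⟩
  | cons j js ih =>
    refine exec_block_cons' 16 (js.length * 17 + 1) (by rw [List.length_cons, add_mul]; omega) ?_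
    refine exec_block_load (Exec.intro_state fun s₁ e₁ => ?_)
    have h₁ : G.Rep σ s₁ := e₁ ▸ h.setTemp _ (by omega) (by omega)
    have r7 : s₁.reg 7 = G.left u j := by simp [e₁, hu, h.left]
    have f₁ : Frame c d s s₁ := by constructor <;> simp [e₁]
    refine exec_block_cons' 12 1 (by omega) ((h₁.exec_pushCheck r7).mono le_rfl ?_)
    rintro s₂ ⟨h₂, f₂⟩
    refine exec_block_nil ((ih h₂ (by rw [f₂.reg8, f₁.reg8, hu])).mono le_rfl ?_)
    rintro s₃ ⟨A', h₃, f₃, hA, hlen⟩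
    refine ⟨A', h₃, f₁.trans (f₂.trans f₃), ?_, ?_⟩
    · intro v
      rw [hA]
      simp only [List.mem_cons, exists_eq_or_imp]
      split_ifs with hmem
      · constructor
        · tauto
        · rintro (h | h | h)
          · exact Or.inl h
          · exact Or.inl (h ▸ hmem)
          · exact Or.inr h
      · rw [List.mem_cons, eq_comm (a := v)]
        tauto
    · refine hlen.trans ?_
      simp only [List.length_cons]
      split_ifs
      · omega
      · rw [List.length_cons]; omega

/-- All unsatisfied checks are active. -/
def Covers (G : TannerGraph c d n m) (C₀ : Submodule (ZMod 2) (Word d)) (σ : DecoderData n m) :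
    Prop := ∀ v, G.localView σ.word v ∉ C₀ → v ∈ σ.active

/-- Only the neighbours of `u` change their local view, and all of them are pushed, so the list
still covers the unsatisfied checks. Superfluous entries are left to `compress`. -/
theorem Rep.exec_flipProg (h : G.Rep σ s) {u : Fin n} (hu : s.reg 8 = u) (hcov : G.Covers C₀ σ) :
    Exec (flipProg c d) s (c * 17 + 9) fun s' => ∃ A',
      G.Rep { σ with word := flipBit σ.word u, active := A' } s' ∧ Frame c d s s' ∧
        G.Covers C₀ { σ with word := flipBit σ.word u, active := A' } ∧
        A'.length ≤ σ.active.length + c := by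
  unfold flipProg
  refine exec_block_load (exec_block_sub (Exec.intro_state fun s₁ e₁ => ?_))
  have h₁ : G.Rep σ s₁ := e₁ ▸ (h.setTemp _ (by omega) (by omega)).setTemp _ (by omega) (by omega)
  have r8 : s₁.reg 8 = u := by simp [e₁, hu]
  have r9 : s₁.reg 9 = 1 - (σ.word u).val := by simp [e₁, hu, h.word, h.one]
  have f₁ : Frame c d s s₁ := by constructor <;> simp [e₁]
  refine exec_block_store (Exec.intro_state fun s₂ e₂ => ?_)
  rw [r8] at e₂
  have h₂ := h₁.flip u r9
  rw [← e₂] at h₂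
  have f₂ : Frame c d s₁ s₂ := by
    rw [e₂]
    constructor
    · simp
    · simp
    · simp
    · exact RamState.setCell_arr_of_ne _ _ _ (by omega)
    · exact RamState.setCell_arr_of_ne _ _ _ (by omega)
  refine exec_block_cons' (c * 17 + 1) 1 (by omega) ((h₂.exec_pushNeighbors (u := u)
    (by rw [f₂.reg8, r8]) (List.finRange c)).mono (by simp) ?_)
  rintro s₃ ⟨A', h₃, f₃, hA, hlen⟩
  refine exec_block_nil ⟨A', h₃, f₁.trans (f₂.trans f₃), ?_, by simpa using hlen⟩
  intro v hv
  rw [hA]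
  by_contra hcon
  push Not at hcon
  obtain ⟨hcon1, hcon2⟩ := hcon
  refine hv ?_
  have : G.localView (flipBit σ.word u) v = G.localView σ.word v := by
    funext i
    unfold localView flipBit
    rw [Function.update_of_ne]
    intro hi
    obtain ⟨j, hj⟩ := (G.adj_iff u v).2 ⟨i, hi⟩
    exact hcon2 j (List.mem_finRange j) hj
  rw [this]
  by_contra hcon3
  exact hcon1 (hcov v hcon3)

theorem Rep.exec_flipRecord (h : G.Rep σ s) {u : Fin n} (hu : s.reg 8 = u) (hcov : G.Covers C₀ σ) :
    Exec (flipRecord c d) s (c * 17 + 15) fun s' => ∃ A',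
      G.Rep { σ with word := flipBit σ.word u, active := A', trail := u :: σ.trail } s' ∧
        Frame c d s s' ∧
        G.Covers C₀ { σ with word := flipBit σ.word u, active := A', trail := u :: σ.trail } ∧
        A'.length ≤ σ.active.length + c := by
  unfold flipRecord
  refine exec_block_cons' (c * 17 + 9) 5 (by omega) ((h.exec_flipProg hu hcov).mono le_rfl ?_)
  rintro s₁ ⟨A', h₁, f₁, hcov', hlen⟩
  refine exec_block_store (exec_block_add (exec_block_nil ⟨A', ?_⟩))
  have h₂ := h₁.pushTrail u (k := σ.trail.length + 1) rfl
  have r8 : s₁.reg 8 = u := by rw [f₁.reg8, hu]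
  simp only [RamState.setCell_reg, r8, h₁.one, h₁.trailLen] at h₂ ⊢
  refine ⟨h₂, f₁.trans ?_, hcov', hlen⟩
  constructor
  · simp
  · simp
  · simp
  · rw [RamState.setReg_arr, RamState.setCell_arr_of_ne _ _ _ (by omega)]
  · rw [RamState.setReg_arr, RamState.setCell_arr_of_ne _ _ _ (by omega)]

theorem Rep.exec_caseView (h : G.Rep σ s) {v : Fin m} (hv : s.reg 7 = v) {f : Word d → RamProg}
    {τ : ℕ} {Q : RamState → Prop}
    (hf : ∀ s', G.Rep σ s' → s'.reg 7 = v → Frame c d s s' → s'.arr = s.arr →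
      Exec (f (G.localView σ.word v)) s' τ Q) :
    Exec (caseView c d f) s (7 * d + τ) Q := by
  refine exec_caseBits (G.localView σ.word v) h.one ?_ ?_
  · intro j
    rw [hv, h.right, h.word]
    rfl
  · intro s' ha hr
    refine hf s' (h.of_eq ha fun i hi => hr i (by omega) (by omega)) ?_ ?_ ha
    · rw [hr 7 (by omega) (by omega), hv]
    · exact ⟨hr _ (by omega) (by omega), hr _ (by omega) (by omega), hr _ (by omega) (by omega),
        by rw [ha], by rw [ha]⟩

/-- The first pass pops each active check, clears its mark and copies it to a scratch stack if it is
unsatisfied; the second pass pushes the copies back. The cost depends on the length of the list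
only. -/
theorem Rep.exec_compress (h : G.Rep σ s) (hcov : G.Covers C₀ σ) :
    Exec (compress c C₀) s (σ.active.length * (7 * d + 50) + 20) fun s' => ∃ A',
      G.Rep { σ with active := A' } s' ∧ (∀ v, v ∈ A' ↔ v ∈ G.unsat C₀ σ.word) ∧
        A'.length = (G.unsat C₀ σ.word).card := by
  classical
  unfold compress
  refine exec_block_const (exec_block_const (exec_block_add (Exec.intro_state fun s₁ e₁ => ?_)))
  have h₁ : G.Rep σ s₁ := e₁ ▸ ((h.setTemp _ (by omega) (by omega)).setTemp _ (by omega)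
    (by omega)).setTemp _ (by omega) (by omega)
  have r6 : s₁.reg 6 = 0 := by simp [e₁]
  have r11 : s₁.reg 11 = σ.active.length := by simp [e₁, h.activeLen]
  have hcard : ∀ B : List (Fin m), B.Nodup → (∀ v, v ∈ B ↔ v ∈ G.unsat C₀ σ.word) →
      B.length = (G.unsat C₀ σ.word).card := by
    intro B hB hB'
    rw [← List.toFinset_card_of_nodup hB]
    congr 1
    ext v
    rw [List.mem_toFinset, hB']
  refine exec_block_cons' (σ.active.length * (7 * d + 20) + 1) (σ.active.length * 21 + 11) (by
    rw [mul_add, mul_add]; omega) ?_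
  refine (exec_forDown (A := Fin m) (I := fun l s => G.Rep { σ with active := l } s ∧
    s.reg 11 = l.length ∧ ∃ B : List (Fin m), s.reg 6 = B.length ∧ Stack (s.arr (c + d + 6)) B ∧
      B.Nodup ∧ (∀ v, v ∈ B ↔ v ∈ σ.active ∧ v ∉ l ∧ v ∈ G.unsat C₀ σ.word) ∧
      B.length + l.length ≤ σ.active.length) (7 * d + 15) ?_ ?_
    ⟨h₁, r11, [], r6, trivial, List.nodup_nil, by simp; tauto, by simp⟩).mono
    (by rw [show 7 * d + 15 + 5 = 7 * d + 20 by omega]) ?_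
  · rintro l s ⟨h, h', -⟩
    exact ⟨h.one, h'⟩
  · rintro v l s ⟨h, h11, B, hB6, hBst, hBnd, hBmem, hBlen⟩
    have hnd := h.nodup
    simp only [List.nodup_cons] at hnd
    have h' := h.setTemp (i := 11) l.length (by omega) (by omega)
    refine exec_block_sub (exec_block_load (exec_block_const (exec_block_store
      (Exec.intro_state fun s₁ e₁ => ?_))))
    have hl3 : s.reg 3 = l.length + 1 := h.activeLen
    have hst : s.arr (c + d + 1) l.length = v := h.active.1
    have h₁ : G.Rep { σ with active := l } s₁ := by
      have := (((h'.setTemp (i := 7) v (by omega) (by omega)).setTemp (i := 10) 0 (by omega)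
        (by omega)).popActive (v := v) (l := l) rfl (k := l.length) rfl).of_eq (s' := s₁) ?_ ?_
      · exact this
      · rw [e₁]
        simp [hl3, h.one, hst, RamState.setCell]
      · intro i hi
        rw [e₁]
        simp [hl3, h.one]
        split_ifs <;> omega
    have r7 : s₁.reg 7 = v := by
      rw [e₁]
      simp [hl3, h.one, hst]
    have r11 : s₁.reg 11 = l.length := by
      rw [e₁]
      simp
    have r6 : s₁.reg 6 = B.length := by
      rw [e₁]
      simp [hB6]
    have a6 : s₁.arr (c + d + 6) = s.arr (c + d + 6) := by
      rw [e₁, RamState.setCell_arr_of_ne _ _ _ (by omega)]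
      rfl
    refine exec_block_cons' (7 * d + 5) 1 (by omega) (h₁.exec_caseView r7 ?_)
    intro s₂ h₂ r7' f₂ _
    split_ifs with hsat
    · refine exec_skip (exec_block_nil ⟨h₂, by rw [f₂.reg11, r11], B, by rw [f₂.reg6, r6],
        by rw [f₂.arr6, a6]; exact hBst, hBnd, ?_, by rw [List.length_cons] at hBlen; omega⟩)
      intro w
      rw [hBmem, List.mem_cons]
      by_cases hw : w = v
      · subst hw
        rw [mem_unsat]
        tauto
      · tauto
    · refine exec_block_store (exec_block_add (exec_block_nil (exec_block_nil ⟨?_, ?_, v :: B, ?_, ?_,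
        ?_, ?_, ?_⟩)))
      · exact (h₂.setScratch (Or.inl rfl) _ _).setTemp _ (by omega) (by omega)
      · simp [f₂.reg11, r11]
      · simp [f₂.reg6, r6, h₂.one]
      · rw [RamState.setReg_arr, RamState.setCell_arr_self, r7', f₂.reg6, r6, f₂.arr6, a6]
        exact hBst.push v
      · refine List.nodup_cons.2 ⟨fun hcon => ?_, hBnd⟩
        have := ((hBmem v).1 hcon).2.1
        simp at this
      · intro w
        rw [List.mem_cons, hBmem, List.mem_cons]
        have hvu : v ∈ G.unsat C₀ σ.word := mem_unsat.2 hsat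
        by_cases hw : w = v
        · subst hw
          have : w ∈ σ.active := hcov w hsat
          have := hnd.1
          tauto
        · tauto
      · simp only [List.length_cons] at hBlen ⊢
        omega
  · rintro s₂ ⟨h₂, -, B, hB6, hBst, hBnd, hBmem, hBlen⟩
    refine exec_block_const (exec_block_add (Exec.intro_state fun s₃ e₃ => ?_))
    have h₃ : G.Rep { σ with active := [] } s₃ :=
      e₃ ▸ (h₂.setTemp _ (by omega) (by omega)).setTemp _ (by omega) (by omega)
    have r11 : s₃.reg 11 = B.length := by simp [e₃, hB6]
    have a6 : s₃.arr (c + d + 6) = s₂.arr (c + d + 6) := by simp [e₃]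
    have hBmem' : ∀ v, v ∈ B ↔ v ∈ G.unsat C₀ σ.word := by
      intro v
      rw [hBmem]
      have : v ∈ G.unsat C₀ σ.word → v ∈ σ.active := fun h => hcov v (mem_unsat.1 h)
      simp only [List.not_mem_nil, not_false_eq_true, true_and]
      tauto
    refine exec_block_cons' (B.length * 21 + 1) 1 (by simp at hBlen; omega) ?_
    refine (exec_forDown (A := Fin m) (I := fun l s => s.reg 11 = l.length ∧
      Stack (s.arr (c + d + 6)) l ∧ ∃ A', G.Rep { σ with active := A' } s ∧
      (∀ v, v ∈ A' ∨ v ∈ l ↔ v ∈ B)) 16 ?_ ?_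
      ⟨r11, by rw [a6]; exact hBst, [], h₃, by simp⟩).mono (by omega) ?_
    · rintro l s ⟨h11, -, A', h, -⟩
      exact ⟨h.one, h11⟩
    · rintro v l s ⟨h11, hst, A', h, hmem⟩
      refine exec_block_load (Exec.intro_state fun s₄ e₄ => ?_)
      have h₄ : G.Rep { σ with active := A' } s₄ := e₄ ▸ (h.setTemp (i := 11) l.length (by omega)
        (by omega)).setTemp (i := 7) _ (by omega) (by omega)
      have r7 : s₄.reg 7 = v := by
        have := hst.1
        simp [e₄, this]
      have r11 : s₄.reg 11 = l.length := by simp [e₄]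
      have a6 : s₄.arr (c + d + 6) = s.arr (c + d + 6) := by simp [e₄]
      refine exec_block_cons' 12 1 (by omega) ((h₄.exec_pushCheck r7).mono le_rfl ?_)
      rintro s₅ ⟨h₅, f₅⟩
      refine exec_block_nil ⟨by rw [f₅.reg11, r11], by rw [f₅.arr6, a6]; exact hst.2, _, h₅, ?_⟩
      intro w
      rw [← hmem w]
      simp only [List.mem_cons]
      by_cases hw : w = v
      · subst hw
        split_ifs with hA <;> simp [hA]
      · split_ifs with hA <;> simp [hw]
    · rintro s₄ ⟨-, -, A', h₄, hmem⟩
      have hA : ∀ v, v ∈ A' ↔ v ∈ G.unsat C₀ σ.word := by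
        intro v
        rw [← hBmem' v, ← hmem v]
        simp
      exact exec_block_nil ⟨A', h₄, hA, hcard A' h₄.nodup hA⟩

/-- A flip is its own inverse, so flipping the recorded bits again restores the word. Each flip adds
at most `c` checks to the list. -/
theorem Rep.exec_undoTrail (h : G.Rep σ s) (hcov : G.Covers C₀ σ) :
    Exec (undoTrail c d) s (σ.trail.length * (c * 17 + 20) + 20) fun s' => ∃ A',
      G.Rep { σ with word := σ.trail.foldl flipBit σ.word, active := A', trail := [] } s' ∧
      G.Covers C₀ { σ with word := σ.trail.foldl flipBit σ.word, active := A', trail := [] } ∧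
      A'.length ≤ σ.active.length + c * σ.trail.length := by
  unfold undoTrail
  refine exec_block_const (exec_block_add (Exec.intro_state fun s₁ e₁ => ?_))
  have h₁ : G.Rep σ s₁ := e₁ ▸ (h.setTemp _ (by omega) (by omega)).setTemp _ (by omega) (by omega)
  have r11 : s₁.reg 11 = σ.trail.length := by simp [e₁, h.trailLen]
  refine exec_block_cons' (σ.trail.length * (c * 17 + 20) + 1) 3 (by omega) ?_
  refine (exec_forDown (A := Fin n) (I := fun l s => s.reg 11 = l.length ∧
    l <:+ σ.trail ∧ ∃ x A', G.Rep { σ with word := x, active := A' } s ∧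
      G.Covers C₀ { σ with word := x, active := A' } ∧
      l.foldl flipBit x = σ.trail.foldl flipBit σ.word ∧
      A'.length + c * l.length ≤ σ.active.length + c * σ.trail.length) (c * 17 + 15) ?_ ?_
    ⟨r11, List.suffix_rfl, σ.word, σ.active, h₁, hcov, rfl, le_rfl⟩).mono
    (by rw [show c * 17 + 15 + 5 = c * 17 + 20 by omega]) ?_
  · rintro l s ⟨h11, -, x, A', h, -⟩
    exact ⟨h.one, h11⟩
  · rintro u l s ⟨h11, hst, x, A', h, hc, hfold, hlen⟩
    refine exec_block_load (Exec.intro_state fun s₄ e₄ => ?_)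
    have h₄ : G.Rep { σ with word := x, active := A' } s₄ :=
      e₄ ▸ (h.setTemp _ (by omega) (by omega)).setTemp _ (by omega) (by omega)
    have r8 : s₄.reg 8 = u := by
      have := (h.trail.of_suffix hst).1
      simp [e₄, this]
    have r11 : s₄.reg 11 = l.length := by simp [e₄]
    refine exec_block_cons' (c * 17 + 9) 1 (by omega) ((h₄.exec_flipProg r8 hc).mono le_rfl ?_)
    rintro s₅ ⟨A'', h₅, f₅, hc₅, hlen₅⟩
    refine exec_block_nil ⟨by rw [f₅.reg11, r11], (List.suffix_cons u l).trans hst, _, A'', h₅, hc₅,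
      hfold, ?_⟩
    simp only [List.length_cons, mul_add] at hlen hlen₅
    omega
  · rintro s₂ ⟨-, -, x, A', h₂, hc₂, hfold, hlen⟩
    rw [List.foldl_nil] at hfold
    subst hfold
    exact exec_block_const (exec_block_nil ⟨A', h₂.setTrail [] rfl trivial, hc₂, by simpa using hlen⟩)

end TannerGraph

/-! ### Voting and flipping -/

namespace RamProg

open Classical in
/-- The vote of the check in register `7`, if its local view is `w`. -/
def voteLeaf (c : ℕ) {d : ℕ} (C₀ : Submodule (ZMod 2) (Word d)) (d₀ : ℕ) (w : Word d) : RamProg :=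
  match voteIndex C₀ w with
  | none => skip
  | some i => if voteWeight C₀ d₀ w = 0 then skip else
      block [load 8 (c + i) 7, load 9 (c + d + 3) 8,
        branch 1 2 9 skip (block [store (c + d + 4) 4 8, add 4 4 2]),
        const 10 (voteWeight C₀ d₀ w), add 9 9 10, store (c + d + 3) 8 9]

/-- Count the votes of the active checks. -/
def collectVotes (c : ℕ) {d : ℕ} (C₀ : Submodule (ZMod 2) (Word d)) (d₀ : ℕ) : RamProg :=
  block [const 10 0, add 11 3 10,
    forDown (block [load 7 (c + d + 1) 11, caseView c d (voteLeaf c C₀ d₀)])]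

/-- Flip those bits with votes for which the test `tst` succeeds, and delete the votes. -/
def flipCands (c d : ℕ) (tst : RamProg → RamProg) : RamProg :=
  block [const 10 0, add 11 4 10,
    forDown (block [load 8 (c + d + 4) 11, load 9 (c + d + 3) 8, const 10 0,
      store (c + d + 3) 8 10, tst (flipRecord c d)]),
    const 4 0]

/-- Test whether register `9` holds `j`. -/
def testEq (j : ℕ) (p : RamProg) : RamProg :=
  block [const 10 j, branch 1 9 10 (branch 1 10 9 p skip) skip]

/-- `DeterFlip` with the guess `j / (c d₀)`. -/
def deterRound (c : ℕ) {d : ℕ} (C₀ : Submodule (ZMod 2) (Word d)) (d₀ j : ℕ) : RamProg :=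
  block [collectVotes c C₀ d₀, flipCands c d (testEq j), compress c C₀]

end RamProg

/-- Flip the bits `u` in a list for which `φ (W u) i` holds, where `i` is the number of elements of
the list behind `u`. -/
def flipsBy {n : ℕ} (φ : ℕ → ℕ → Bool) (W : Fin n → ℕ) : List (Fin n) → Word n → Word n
  | [], x => x
  | u :: l, x => flipsBy φ W l (if φ (W u) l.length then flipBit x u else x)

/-- The test `tst` decides `φ` if the scratch array holds `F`. -/
def Decides (c d : ℕ) (φ : ℕ → ℕ → Bool) (F : ℕ → ℕ) (tst : RamProg → RamProg) : Prop :=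
  ∀ (s : RamState) (p : RamProg) (τ : ℕ) (Q : RamState → Prop), s.reg 2 = 1 →
    s.arr (c + d + 7) = F →
    (∀ s', s'.arr = s.arr → (∀ i, i ≠ 10 → s'.reg i = s.reg i) →
      Exec (if φ (s.reg 9) (s.reg 11) then p else skip) s' τ Q) →
    Exec (tst p) s (τ + 7) Q

theorem decides_testEq (c d j : ℕ) (F : ℕ → ℕ) :
    Decides c d (fun w _ => decide (w = j)) F (testEq j) := by
  intro s p τ Q _ _ h
  refine exec_block_const (exec_block_cons' (τ + 3) 1 (by omega) ?_)
  have h' := h (s.setReg 10 j) rfl fun i hi => by rw [RamState.setReg_reg, if_neg hi]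
  refine exec_branch (fun h1 => exec_branch (fun h2 => ?_) fun h2 => ?_) fun h1 => ?_
  · simp at h1 h2
    rw [if_pos (by simp; omega)] at h'
    exact h'.mono (by omega) fun _ => exec_block_nil
  · simp at h1 h2
    rw [if_neg (by simp; omega)] at h'
    exact h'.mono (by omega) fun _ => exec_block_nil
  · simp at h1
    rw [if_neg (by simp; omega)] at h'
    exact h'.mono (by omega) fun _ => exec_block_nil

namespace TannerGraph

variable {c d n m : ℕ} {G : TannerGraph c d n m} {σ : DecoderData n m} {s : RamState}
  {C₀ : Submodule (ZMod 2) (Word d)} {d₀ : ℕ}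

/-- The votes `W` have been cast for the candidates in the list `C`. -/
def Tallied (C : List (Fin n)) (W : Fin n → ℕ) : Prop := C.Nodup ∧ ∀ u, u ∈ C ↔ 0 < W u

/-- At a leaf the local view is known, so weight and position of the vote are constants of the
program. A bit becomes a candidate exactly when its count leaves zero. -/
theorem Rep.exec_voteLeaf (h : G.Rep σ s) {v : Fin m} (hv : s.reg 7 = v)
    (ht : Tallied σ.cand σ.votes) :
    Exec (voteLeaf c C₀ d₀ (G.localView σ.word v)) s 20 fun s' => ∃ C,
      G.Rep { σ with cand := C, votes := fun u => σ.votes u + G.vote C₀ d₀ σ.word v u } s' ∧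
        s'.reg 11 = s.reg 11 ∧ Tallied C (fun u => σ.votes u + G.vote C₀ d₀ σ.word v u) ∧
        C.length ≤ σ.cand.length + 1 := by
  have hzero : (∀ u, G.vote C₀ d₀ σ.word v u = 0) → Exec skip s 20 fun s' => ∃ C,
      G.Rep { σ with cand := C, votes := fun u => σ.votes u + G.vote C₀ d₀ σ.word v u } s' ∧
        s'.reg 11 = s.reg 11 ∧ Tallied C (fun u => σ.votes u + G.vote C₀ d₀ σ.word v u) ∧
        C.length ≤ σ.cand.length + 1 := by
    intro h0
    simp only [h0, add_zero]
    exact exec_skip ⟨σ.cand, h, rfl, ht, by omega⟩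
  unfold voteLeaf
  rcases hi : voteIndex C₀ (G.localView σ.word v) with _ | i
  · exact hzero fun u => by rw [vote_eq, hi]; simp
  simp only
  split_ifs with hw
  · exact hzero fun u => by rw [vote_eq, hw, ite_self]
  set w := voteWeight C₀ d₀ (G.localView σ.word v) with hwdef
  set u := G.right v i with hu
  have hvote : ∀ u', G.vote C₀ d₀ σ.word v u' = if u = u' then w else 0 := by
    intro u'
    rw [vote_eq, hi]
    simp [hu, hwdef]
  refine exec_block_load (exec_block_load (Exec.intro_state fun s₁ e₁ => ?_))
  have h₁ : G.Rep σ s₁ := e₁ ▸ (h.setTemp _ (by omega) (by omega)).setTemp _ (by omega) (by omega)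
  have r8 : s₁.reg 8 = u := by simp [e₁, hv, h.right, hu]
  have r9 : s₁.reg 9 = σ.votes u := by simp [e₁, hv, h.right, ← hu, h.votes]
  have r11 : s₁.reg 11 = s.reg 11 := by simp [e₁]
  refine exec_block_cons' 7 8 (by omega) ?_
  have key : ∀ s₂ C, G.Rep { σ with cand := C } s₂ → s₂.reg 8 = u → s₂.reg 9 = σ.votes u →
      s₂.reg 11 = s.reg 11 → C.Nodup → (∀ u', u' ∈ C ↔ 0 < σ.votes u' ∨ u' = u) →
      C.length ≤ σ.cand.length + 1 →
      Exec (block [const 10 w, add 9 9 10, store (c + d + 3) 8 9]) s₂ 8 fun s' => ∃ C,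
      G.Rep { σ with cand := C, votes := fun u => σ.votes u + G.vote C₀ d₀ σ.word v u } s' ∧
        s'.reg 11 = s.reg 11 ∧ Tallied C (fun u => σ.votes u + G.vote C₀ d₀ σ.word v u) ∧
        C.length ≤ σ.cand.length + 1 := by
    intro s₂ C h₂ r8 r9 r11 hC hC' hlen
    refine exec_block_const (exec_block_add (exec_block_store (exec_block_nil ⟨C, ?_, by simp [r11],
      ⟨hC, fun u' => ?_⟩, hlen⟩)))
    · have := ((h₂.setTemp (i := 10) w (by omega) (by omega)).setTemp (i := 9) (σ.votes u + w)
        (by omega) (by omega)).setVotes u (σ.votes u + w)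
      have hW : Function.update σ.votes u (σ.votes u + w) =
          fun u => σ.votes u + G.vote C₀ d₀ σ.word v u := by
        ext u'
        rw [hvote, Function.update_apply]
        by_cases huu : u' = u
        · subst huu
          simp
        · rw [if_neg huu, if_neg (Ne.symm huu), add_zero]
      rw [hW] at this
      simpa [r8, r9] using this
    · rw [hC']
      simp only [hvote]
      split_ifs with huu
      · exact ⟨fun _ => by omega, fun _ => Or.inr huu.symm⟩
      · rw [add_zero, or_iff_left (Ne.symm huu)]
  refine exec_branch (fun hle => ?_) fun hlt => ?_
  · rw [h₁.one, r9] at hle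
    refine exec_skip (key s₁ σ.cand h₁ r8 r9 r11 ht.1 (fun u' => ?_) (by omega))
    rw [ht.2]
    constructor
    · exact Or.inl
    · rintro (h | rfl)
      · exact h
      · exact hle
  · rw [h₁.one, r9] at hlt
    refine exec_block_store (exec_block_add (exec_block_nil ?_))
    refine key _ (u :: σ.cand) ?_ (by simp [r8]) (by simp [r9]) (by simp [r11]) ?_ ?_ (by simp)
    · have := h₁.pushCand u (k := σ.cand.length + 1) rfl
      simpa only [RamState.setCell_reg, r8, h₁.candLen, h₁.one] using this
    · refine List.nodup_cons.2 ⟨fun hcon => ?_, ht.1⟩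
      rw [ht.2] at hcon
      omega
    · intro u'
      rw [List.mem_cons, ht.2, or_comm]

/-- Satisfied checks cast no votes, so it suffices to poll a list that covers the unsatisfied ones.
-/
theorem sum_vote_active {x : Word n} {A : List (Fin m)} (hA : A.Nodup)
    (hcov : ∀ v, G.localView x v ∉ C₀ → v ∈ A) (u : Fin n) :
    (A.map fun v => G.vote C₀ d₀ x v u).sum = G.flipNum C₀ d₀ x u := by
  unfold flipNum
  rw [← List.sum_toFinset _ hA]
  refine Finset.sum_subset (Finset.subset_univ _) fun v _ hv => ?_
  refine vote_eq_zero_of_notMem d₀ (fun h => hv ?_) u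
  exact List.mem_toFinset.2 (hcov v (mem_unsat.1 h))

theorem Rep.exec_collectVotes (h : G.Rep σ s) (hcov : G.Covers C₀ σ) (hC : σ.cand = [])
    (hW : σ.votes = 0) :
    Exec (collectVotes c C₀ d₀) s (σ.active.length * (7 * d + 30) + 10) fun s' => ∃ C,
      G.Rep { σ with cand := C, votes := G.flipNum C₀ d₀ σ.word } s' ∧
        Tallied C (G.flipNum C₀ d₀ σ.word) ∧ C.length ≤ σ.active.length := by
  unfold collectVotes
  refine exec_block_const (exec_block_add (Exec.intro_state fun s₁ e₁ => ?_))
  have h₁ : G.Rep σ s₁ := e₁ ▸ (h.setTemp _ (by omega) (by omega)).setTemp _ (by omega) (by omega)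
  have r11 : s₁.reg 11 = σ.active.length := by simp [e₁, h.activeLen]
  have hsum := sum_vote_active (d₀ := d₀) h.nodup hcov
  refine exec_block_cons' (σ.active.length * (7 * d + 30) + 1) 1 (by omega) ?_
  -- The invariant: votes already cast plus those of the checks still to come give `flipNum`.
  refine (exec_forDown (A := Fin m) (I := fun l s => s.reg 11 = l.length ∧ l <:+ σ.active ∧
    ∃ C W, G.Rep { σ with cand := C, votes := W } s ∧ Tallied C W ∧
      (∀ u, W u + (l.map fun v => G.vote C₀ d₀ σ.word v u).sum = G.flipNum C₀ d₀ σ.word u) ∧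
      C.length + l.length ≤ σ.active.length) (7 * d + 25) ?_ ?_
    ⟨r11, List.suffix_rfl, σ.cand, σ.votes, h₁, ?_, fun u => by simp [hW, hsum], by simp [hC]⟩).mono
    (by rw [show 7 * d + 25 + 5 = 7 * d + 30 by omega]) ?_
  · rintro l s ⟨h11, -, C, W, h, -⟩
    exact ⟨h.one, h11⟩
  · rintro v l s ⟨h11, hst, C, W, h, ht, hs, hlen⟩
    refine exec_block_load (Exec.intro_state fun s₄ e₄ => ?_)
    have h₄ : G.Rep { σ with cand := C, votes := W } s₄ :=
      e₄ ▸ (h.setTemp (i := 11) _ (by omega) (by omega)).setTemp (i := 7) _ (by omega) (by omega)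
    have r7 : s₄.reg 7 = v := by
      have := (h.active.of_suffix hst).1
      simp [e₄, this]
    have r11 : s₄.reg 11 = l.length := by simp [e₄]
    refine exec_block_cons' (7 * d + 20) 1 (by omega) (h₄.exec_caseView r7 ?_)
    intro s₅ h₅ r7' f₅ _
    refine (h₅.exec_voteLeaf r7' ht).mono le_rfl ?_
    rintro s₆ ⟨C', h₆, r11', ht', hlen'⟩
    refine exec_block_nil ⟨by rw [r11', f₅.reg11, r11], (List.suffix_cons v l).trans hst, C', _, h₆,
      ht', fun u => ?_, ?_⟩
    · rw [← hs u]
      simp [add_assoc]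
    · simp only [List.length_cons] at hlen hlen'
      omega
  · rw [hC, hW]
    exact ⟨List.nodup_nil, by simp⟩
  · rintro s₂ ⟨-, -, C, W, h₂, ht, hs, hlen⟩
    have : W = G.flipNum C₀ d₀ σ.word := by
      ext u
      rw [← hs u]
      simp
    subst this
    exact exec_block_nil ⟨C, h₂, ht, by simpa using hlen⟩

/-- Votes are deleted during the pass, because clearing the whole array would cost `n` steps. The
last equation says that undoing the longer trail still leads to the same word. -/
theorem Rep.exec_flipCands (h : G.Rep σ s) (hcov : G.Covers C₀ σ) (ht : Tallied σ.cand σ.votes)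
    {φ : ℕ → ℕ → Bool} {F : ℕ → ℕ} {tst : RamProg → RamProg} (hF : s.arr (c + d + 7) = F)
    (htst : Decides c d φ F tst) :
    Exec (flipCands c d tst) s (σ.cand.length * (c * 17 + 40) + 20) fun s' => ∃ A T,
      let σ' : DecoderData n m := { σ with
        word := flipsBy φ σ.votes σ.cand σ.word, active := A, cand := [], votes := 0, trail := T }
      G.Rep σ' s' ∧ G.Covers C₀ σ' ∧ A.length ≤ σ.active.length + c * σ.cand.length ∧
        T.length ≤ σ.trail.length + σ.cand.length ∧
        T.foldl flipBit σ'.word = σ.trail.foldl flipBit σ.word := by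
  unfold flipCands
  refine exec_block_const (exec_block_add (Exec.intro_state fun s₁ e₁ => ?_))
  have h₁ : G.Rep σ s₁ := e₁ ▸ (h.setTemp _ (by omega) (by omega)).setTemp _ (by omega) (by omega)
  have r11 : s₁.reg 11 = σ.cand.length := by simp [e₁, h.candLen]
  have a7 : s₁.arr (c + d + 7) = F := by simp [e₁, hF]
  refine exec_block_cons' (σ.cand.length * (c * 17 + 40) + 1) 5 (by omega) ?_
  refine (exec_forDown (A := Fin n) (I := fun l s => s.reg 11 = l.length ∧ l <:+ σ.cand ∧
    s.arr (c + d + 7) = F ∧ ∃ x W A T,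
      let σ' : DecoderData n m := { σ with word := x, active := A, votes := W, trail := T }
      G.Rep σ' s ∧ G.Covers C₀ σ' ∧
      (∀ u, W u = if u ∈ l then σ.votes u else 0) ∧
      flipsBy φ σ.votes l x = flipsBy φ σ.votes σ.cand σ.word ∧
      A.length + c * l.length ≤ σ.active.length + c * σ.cand.length ∧
      T.length + l.length ≤ σ.trail.length + σ.cand.length ∧
      T.foldl flipBit x = σ.trail.foldl flipBit σ.word) (c * 17 + 35) ?_ ?_
    ⟨r11, List.suffix_rfl, a7, σ.word, σ.votes, σ.active, σ.trail, h₁, hcov, ?_, rfl, le_rfl, le_rfl,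
      rfl⟩).mono
    (by rw [show c * 17 + 35 + 5 = c * 17 + 40 by omega]) ?_
  · rintro l s ⟨h11, -, -, x, W, A, T, h, -⟩
    exact ⟨h.one, h11⟩
  · rintro u l s ⟨h11, hst, a7, x, W, A, T, h, hc, hW, hx, hA, hT, hfold⟩
    have hnd : (u :: l).Nodup := ht.1.sublist hst.sublist
    rw [List.nodup_cons] at hnd
    have hWu : W u = σ.votes u := by rw [hW]; simp
    refine exec_block_load (exec_block_load (exec_block_const (Exec.intro_state fun s₄ e₄ => ?_)))
    have hcand : s.arr (c + d + 4) l.length = u := (h.cand.of_suffix hst).1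
    have h₄ : G.Rep { σ with word := x, active := A, votes := W, trail := T } s₄ :=
      e₄ ▸ (((h.setTemp (i := 11) _ (by omega) (by omega)).setTemp (i := 8) _ (by omega)
        (by omega)).setTemp (i := 9) _ (by omega) (by omega)).setTemp (i := 10) _ (by omega) (by omega)
    have r8 : s₄.reg 8 = u := by simp [e₄, hcand]
    have r9 : s₄.reg 9 = σ.votes u := by simp [e₄, hcand, h.votes, hWu]
    have r10 : s₄.reg 10 = 0 := by simp [e₄]
    have r11 : s₄.reg 11 = l.length := by simp [e₄]
    have a7' : s₄.arr (c + d + 7) = F := by simp [e₄, a7]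
    refine exec_block_store (Exec.intro_state fun s₅ e₅ => ?_)
    rw [r8, r10] at e₅
    have h₅ : G.Rep { σ with
        word := x, active := A, votes := Function.update W u 0, trail := T } s₅ :=
      e₅ ▸ h₄.setVotes u 0
    have hW' : ∀ u', Function.update W u 0 u' = if u' ∈ l then σ.votes u' else 0 := by
      intro u'
      rw [Function.update_apply]
      by_cases huu : u' = u
      · subst huu
        simp [hnd.1]
      · rw [if_neg huu, hW]
        simp [huu]
    refine exec_block_cons' (c * 17 + 16 + 7) 1 (by omega) ?_
    refine htst s₅ _ _ _ h₅.one ?_ ?_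
    · rw [e₅, RamState.setCell_arr_of_ne _ _ _ (by omega), a7']
    intro s₆ ha hr
    have h₆ := h₅.of_eq ha fun i hi => hr i (by omega)
    have e9 : s₅.reg 9 = σ.votes u := by simp [e₅, r9]
    have e11 : s₅.reg 11 = l.length := by simp [e₅, r11]
    have a7'' : s₆.arr (c + d + 7) = F := by
      rw [ha, e₅, RamState.setCell_arr_of_ne _ _ _ (by omega), a7']
    rw [e9, e11]
    rw [flipsBy] at hx
    simp only [List.length_cons, mul_add] at hA hT
    split_ifs with hφ
    · rw [if_pos hφ] at hx
      refine (h₆.exec_flipRecord (u := u) (by rw [hr _ (by omega), e₅]; simpa using r8) hc).mono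
        (by omega) ?_
      rintro s₇ ⟨A', h₇, f₇, hc₇, hA₇⟩
      refine exec_block_nil ⟨by rw [f₇.reg11, hr _ (by omega), e11], (List.suffix_cons u l).trans hst,
        by rw [f₇.arr7, a7''], _, _, _, _, h₇, hc₇, hW', hx, ?_, ?_, ?_⟩
      · simp only at hA₇
        omega
      · simp only [List.length_cons]
        omega
      · rw [List.foldl_cons, flipBit_flipBit, hfold]
    · rw [if_neg hφ] at hx
      exact exec_skip (exec_block_nil ⟨by rw [hr _ (by omega), e11], (List.suffix_cons u l).trans hst,
        a7'', _, _, _, _, h₆, hc, hW', hx, by omega, by omega, hfold⟩)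
  · intro u
    split_ifs with hu
    · rfl
    · rw [ht.2] at hu
      omega
  · rintro s₂ ⟨-, -, -, x, W, A, T, h₂, hc₂, hW, hx, hA, hT, hfold⟩
    have : W = 0 := by
      ext u
      rw [hW]
      simp
    subst this
    rw [flipsBy] at hx
    subst hx
    exact exec_block_const (exec_block_nil ⟨A, T, h₂.setCand [] rfl trivial, hc₂, by simpa using hA,
      by simpa using hT, hfold⟩)

theorem flipsBy_apply {φ : ℕ → Bool} {W : Fin n → ℕ} {C : List (Fin n)} (hC : C.Nodup) (x : Word n)
    (u : Fin n) : flipsBy (fun w _ => φ w) W C x u = if u ∈ C ∧ φ (W u) then x u + 1 else x u := by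
  induction C generalizing x with
  | nil => simp [flipsBy]
  | cons a C ih =>
    rw [List.nodup_cons] at hC
    rw [flipsBy, ih hC.2]
    by_cases hu : u = a
    · subst hu
      simp only [hC.1, false_and, if_false, List.mem_cons, true_or, true_and]
      split_ifs <;> simp [flipBit]
    · simp only [List.mem_cons, hu, false_or]
      split_ifs <;> simp [flipBit, hu]

/-- No votes are stored and the active checks are the unsatisfied ones. -/
structure Settled (G : TannerGraph c d n m) (C₀ : Submodule (ZMod 2) (Word d))
    (σ : DecoderData n m) : Prop where
  cand : σ.cand = []
  votes : σ.votes = 0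
  active : ∀ v, v ∈ σ.active ↔ v ∈ G.unsat C₀ σ.word
  length : σ.active.length = (G.unsat C₀ σ.word).card

theorem Settled.covers (h : G.Settled C₀ σ) : G.Covers C₀ σ := fun v hv =>
  (h.active v).2 (mem_unsat.2 hv)

/-- There are at most as many candidates as active checks, and each flip activates at most `c`
checks. This gives both the linear cost and the growth factor `c + 1`. -/
theorem Rep.exec_deterRound (hc : 0 < c) (hd₀ : 0 < d₀) (h : G.Rep σ s) (hs : G.Settled C₀ σ)
    (j : ℕ) :
    Exec (deterRound c C₀ d₀ (j + 1)) s (((c + 1) * (14 * d + c * 17 + 130)) * (σ.active.length + 1))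
      fun s' => ∃ A T,
      let σ' : DecoderData n m := { σ with
        word := G.deterFlip C₀ d₀ σ.word (((j : ℝ) + 1) / ((c : ℝ) * d₀)), active := A, trail := T }
      G.Rep σ' s' ∧ G.Settled C₀ σ' ∧ A.length ≤ (c + 1) * σ.active.length ∧
        T.length ≤ σ.trail.length + σ.active.length ∧
        T.foldl flipBit σ'.word = σ.trail.foldl flipBit σ.word := by
  unfold deterRound
  set a := σ.active.length with ha
  refine exec_block_cons' (a * (7 * d + 30) + 10)
    (a * (c * 17 + 40) + 20 + ((a + c * a) * (7 * d + 50) + 20 + 2) + 1) (by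
      nlinarith [Nat.zero_le (a * c * c), Nat.zero_le (a * c * d), Nat.zero_le (a * c),
        Nat.zero_le (c * c), Nat.zero_le (c * d)]) ?_
  refine (h.exec_collectVotes hs.covers hs.cand hs.votes).mono le_rfl ?_
  rintro s₁ ⟨C, h₁, ht, hC⟩
  refine exec_block_cons' (a * (c * 17 + 40) + 20) ((a + c * a) * (7 * d + 50) + 20 + 2) le_rfl ?_
  have hca : c * C.length ≤ c * a := Nat.mul_le_mul_left c hC
  refine (h₁.exec_flipCands hs.covers ht rfl (decides_testEq c d (j + 1) _)).mono
    (by gcongr) ?_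
  rintro s₂ ⟨A, T, h₂, hc₂, hA, hT, hfold⟩
  refine exec_block_cons' ((a + c * a) * (7 * d + 50) + 20) 1 le_rfl
    ((h₂.exec_compress hc₂).mono ?_ ?_)
  · simp only at hA
    refine Nat.add_le_add_right (Nat.mul_le_mul_right _ (?_ : A.length ≤ a + c * a)) _
    omega
  rintro s₃ ⟨A', h₃, hA₃, hlen⟩
  have hword : flipsBy (fun w _ => decide (w = j + 1)) (G.flipNum C₀ d₀ σ.word) C σ.word =
      G.deterFlip C₀ d₀ σ.word (((j : ℝ) + 1) / ((c : ℝ) * d₀)) := by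
    ext u
    rw [flipsBy_apply ht.1, deterFlip_guess_apply hc hd₀]
    refine if_congr ?_ rfl rfl
    rw [ht.2, decide_eq_true_eq]
    omega
  have hsub : A' ⊆ A := fun v hv => hc₂ v (mem_unsat.1 ((hA₃ v).1 hv))
  -- The old list covers the unsatisfied checks, so compressing can only shorten it.
  have hle : A'.length ≤ A.length := (List.Nodup.subperm h₃.nodup hsub).length_le
  simp only [hword] at h₃ hA₃ hlen hfold
  refine exec_block_nil ⟨A', T, ?_, ⟨hs.cand, hs.votes, hA₃, hlen⟩, ?_, ?_, hfold⟩
  · have h1 := hs.cand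
    have h2 := hs.votes
    rcases σ
    simp only at h1 h2
    subst h1 h2
    exact h₃
  · simp only at hA
    rw [add_mul]
    omega
  · simp only at hT
    omega

end TannerGraph

/-! ### Execution of randomized programs -/

namespace RamProg

/-- Fill the first cells of the array `A` with random numbers; register `11` holds their number. -/
def fillRandom (A N : ℕ) : RamProg := forDown (block [rand 9 N, store A 11 9])

/-- Test whether the cell of the scratch array with the address in register `11` is less than
register `9`. -/
def testLess (c d : ℕ) (p : RamProg) : RamProg :=
  block [load 10 (c + d + 7) 11, add 10 10 2, branch 1 10 9 p skip]

/-- One round of `RandDecode`. -/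
def randRound (c : ℕ) {d : ℕ} (C₀ : Submodule (ZMod 2) (Word d)) (d₀ : ℕ) : RamProg :=
  block [collectVotes c C₀ d₀, const 10 0, add 11 4 10, fillRandom (c + d + 7) (c * d₀ - 1),
    flipCands c d (testLess c d), compress c C₀]

/-- The effect of `fillRandom` if the random numbers are given by `f`. -/
def fillState (A : ℕ) (f : ℕ → ℕ) : ℕ → RamState → RamState
  | 0, s => s
  | k + 1, s => fillState A f k (((s.setReg 11 k).setReg 9 (f k)).setCell A k (f k))

/-- Independent uniformly random numbers in `{0, …, N}`. -/
def draws (N : ℕ) : ℕ → PMF (ℕ → ℕ)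
  | 0 => PMF.pure 0
  | k + 1 => (PMF.uniformOfFintype (Fin (N + 1))).bind fun j =>
      (draws N k).map fun f => Function.update f k j

theorem fillState_congr {A k : ℕ} {f g : ℕ → ℕ} (h : ∀ i < k, f i = g i) (s : RamState) :
    fillState A f k s = fillState A g k s := by
  induction k generalizing s with
  | zero => rfl
  | succ k ih =>
    rw [fillState, fillState, h k (by omega), ih fun i hi => h i (by omega)]

theorem fillState_arr_of_le {A k : ℕ} (f : ℕ → ℕ) (s : RamState) {i : ℕ} (hi : k ≤ i) :
    (fillState A f k s).arr A i = s.arr A i := by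
  induction k generalizing s with
  | zero => rfl
  | succ k ih =>
    rw [fillState, ih _ (by omega), RamState.setCell_arr_self, Function.update_of_ne (by omega)]
    rfl

theorem fillState_arr {A k : ℕ} (f : ℕ → ℕ) (s : RamState) {i : ℕ} (hi : i < k) :
    (fillState A f k s).arr A i = f i := by
  induction k generalizing s with
  | zero => omega
  | succ k ih =>
    rw [fillState]
    rcases Nat.lt_succ_iff_lt_or_eq.1 hi with hi | rfl
    · exact ih _ hi
    · rw [fillState_arr_of_le _ _ le_rfl, RamState.setCell_arr_self, Function.update_self]

end RamProg

/-- A uniformly random number below `N + 1` simulates a coin. -/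
theorem uniform_map_lt (N w : ℕ) (hw : w ≤ N + 1) :
    (PMF.uniformOfFintype (Fin (N + 1))).map (fun j : Fin (N + 1) => decide ((j : ℕ) < w)) =
      coin ((w : ℝ) / (N + 1 : ℕ)) := by
  have hcard : (Finset.univ.filter fun j : Fin (N + 1) => (j : ℕ) < w).card = w := by
    rw [Fin.card_filter_val_lt, min_eq_right hw]
  have htrue : ((PMF.uniformOfFintype (Fin (N + 1))).map fun j : Fin (N + 1) => decide ((j : ℕ) < w)) true =
      coin ((w : ℝ) / (N + 1 : ℕ)) true := by
    rw [PMF.map_apply, tsum_fintype]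
    simp only [PMF.uniformOfFintype_apply, Fintype.card_fin, eq_comm (a := true), decide_eq_true_eq]
    rw [← Finset.sum_filter, Finset.sum_const, hcard]
    simp only [coin, PMF.ofFintype_apply, if_true]
    rw [ENNReal.ofReal_div_of_pos (by positivity), ENNReal.ofReal_natCast, ENNReal.ofReal_natCast,
      min_eq_left, nsmul_eq_mul, ENNReal.div_eq_inv_mul, mul_comm]
    exact ENNReal.div_le_of_le_mul (by rw [one_mul]; exact_mod_cast hw)
  have hbool : ∀ p : PMF Bool, p false = 1 - p true := by
    intro p
    have := p.tsum_coe
    rw [tsum_fintype, Fintype.sum_bool] at this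
    rw [← this, ENNReal.add_sub_cancel_left (p.apply_ne_top _)]
  ext b
  cases b
  · rw [hbool, hbool, htrue]
  · exact htrue

/-- The random flip of the bit `u`, with probability `p u`. -/
def coinFlip {n : ℕ} (p : Fin n → ℝ) (z : Word n) (u : Fin n) : PMF (Word n) :=
  (coin (p u)).map fun b => if b then flipBit z u else z

theorem flipsBy_congr {n : ℕ} {φ ψ : ℕ → ℕ → Bool} {W : Fin n → ℕ} {C : List (Fin n)}
    (h : ∀ w, ∀ i < C.length, φ w i = ψ w i) (x : Word n) : flipsBy φ W C x = flipsBy ψ W C x := by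
  induction C generalizing x with
  | nil => rfl
  | cons u l ih =>
    rw [flipsBy, flipsBy, h _ l.length (by simp), ih fun w i hi => h w i (by simp; omega)]

/-- Drawing all random numbers beforehand separates randomness from the deterministic code. The
candidate with `i` elements behind it uses the number at the address `i`, so every number is used
once. -/
theorem draws_map_flipsBy {n : ℕ} (N : ℕ) {W : Fin n → ℕ} (hW : ∀ u, W u ≤ N + 1)
    (C : List (Fin n)) (x : Word n) :
    (draws N C.length).map (fun f => flipsBy (fun w i => decide (f i < w)) W C x) =
      C.foldlM (coinFlip fun u => (W u : ℝ) / (N + 1 : ℕ)) x := by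
  induction C generalizing x with
  | nil => rw [pmf_foldlM_nil, List.length_nil, draws, PMF.pure_map]; rfl
  | cons u l ih =>
    rw [pmf_foldlM_cons, List.length_cons, draws, PMF.map_bind, coinFlip, ← uniform_map_lt N _ (hW u),
      PMF.map_comp, PMF.bind_map]
    refine congrArg _ (funext fun j => ?_)
    rw [PMF.map_comp, Function.comp_apply, Function.comp_apply, ← ih]
    refine congrArg (fun g => PMF.map g _) (funext fun f => ?_)
    rw [Function.comp_apply, flipsBy, Function.update_self]
    refine flipsBy_congr (fun w i hi => ?_) _
    rw [Function.update_of_ne (by omega)]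

theorem flipBit_comm {n : ℕ} (z : Word n) (u v : Fin n) :
    flipBit (flipBit z u) v = flipBit (flipBit z v) u := by
  by_cases h : u = v
  · rw [h]
  · unfold flipBit
    rw [Function.update_of_ne (Ne.symm h), Function.update_of_ne h, Function.update_comm h]

/-- RandFlip treats the bits by index, the machine in the order in which they received votes. The
flips are independent and commute, so the distributions agree. -/
theorem coinFlip_comm {n : ℕ} (p : Fin n → ℝ) (z : Word n) (u v : Fin n) :
    ((coinFlip p z u).bind fun z => coinFlip p z v) =
      (coinFlip p z v).bind fun z => coinFlip p z u := by
  unfold coinFlip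
  simp only [← PMF.bind_pure_comp, Function.comp_def, PMF.bind_bind, PMF.pure_bind]
  rw [PMF.bind_comm]
  refine congrArg _ (funext fun a => congrArg _ (funext fun b => ?_))
  cases a <;> cases b <;> simp [flipBit_comm z u v]

theorem foldlM_perm {n : ℕ} (p : Fin n → ℝ) {l l' : List (Fin n)} (h : l.Perm l') (z : Word n) :
    l.foldlM (coinFlip p) z = l'.foldlM (coinFlip p) z := by
  induction h generalizing z with
  | nil => rfl
  | cons a _ ih => simp only [pmf_foldlM_cons, ih]
  | swap a b l =>
    simp only [pmf_foldlM_cons]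
    rw [← PMF.bind_bind, coinFlip_comm, PMF.bind_bind]
  | trans _ _ ih₁ ih₂ => rw [ih₁, ih₂]

theorem coinFlip_zero {n : ℕ} {p : Fin n → ℝ} {u : Fin n} (h : p u = 0) (z : Word n) :
    coinFlip p z u = PMF.pure z := by
  have : coin 0 = PMF.pure false := by
    ext b
    cases b <;> simp [coin]
  rw [coinFlip, h, this, PMF.pure_map]
  rfl

theorem foldlM_eq_pure {n : ℕ} {p : Fin n → ℝ} {l : List (Fin n)} (h : ∀ u ∈ l, p u = 0)
    (z : Word n) : l.foldlM (coinFlip p) z = PMF.pure z := by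
  induction l with
  | nil => rfl
  | cons u l ih =>
    rw [pmf_foldlM_cons, coinFlip_zero (h u (by simp)), PMF.pure_bind,
      ih fun v hv => h v (by simp [hv])]

theorem pmf_foldlM_append {A B : Type} (f : B → A → PMF B) (b : B) (l l' : List A) :
    (l ++ l').foldlM f b = (l.foldlM f b).bind fun z => l'.foldlM f z := by
  induction l generalizing b with
  | nil => rw [List.nil_append, pmf_foldlM_nil, PMF.pure_bind]
  | cons a l ih => simp only [List.cons_append, pmf_foldlM_cons, ih, PMF.bind_bind]

/-- Bits outside `C` have coins of probability zero and can be omitted. This is what makes a random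
round cheap. -/
theorem foldlM_finRange {n : ℕ} {p : Fin n → ℝ} {C : List (Fin n)} (hC : C.Nodup)
    (h : ∀ u, u ∉ C → p u = 0) (z : Word n) :
    (List.finRange n).foldlM (coinFlip p) z = C.foldlM (coinFlip p) z := by
  have hperm : (List.finRange n).Perm (C ++ (List.finRange n).filter (fun u => u ∉ C)) := by
    refine (List.perm_ext_iff_of_nodup (List.nodup_finRange n) ?_).2 fun u => ?_
    · refine hC.append ((List.nodup_finRange n).filter _) ?_
      intro u hu hu'
      simp at hu'
      exact hu' hu
    · simp [em]
  rw [foldlM_perm p hperm, pmf_foldlM_append]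
  refine Eq.trans (congrArg _ (funext fun z => foldlM_eq_pure (fun u hu => h u ?_) z))
    (PMF.bind_pure _)
  simpa using hu

/-! ### Halting probabilities and randomized execution -/

namespace TannerGraph

variable {c d n m : ℕ} {G : TannerGraph c d n m} {σ : DecoderData n m} {s : RamState}
  {C₀ : Submodule (ZMod 2) (Word d)} {d₀ : ℕ}

/-- The probability that the output after `T` steps is `o`. -/
def haltProb (G : TannerGraph c d n m) (o : Option (Word n)) (T : ℕ)
    (C : List RamProg × RamState) : ℝ≥0∞ := ((run T C).map G.ramOutput) (some o)

theorem haltProb_succ (o : Option (Word n)) (T : ℕ) (C : List RamProg × RamState) :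
    G.haltProb o (T + 1) C = expect (step C) (G.haltProb o T) := by
  unfold haltProb
  rw [run, PMF.map_bind, bind_apply_eq_expect]

theorem haltProb_mono (o : Option (Word n)) {S T : ℕ} (h : S ≤ T) (C : List RamProg × RamState) :
    G.haltProb o S C ≤ G.haltProb o T C := by
  refine monotone_nat_of_le_succ (f := fun T => G.haltProb o T C) (fun T => ?_) h
  induction T generalizing C with
  | zero =>
    rw [haltProb_succ]
    rcases C with ⟨_ | ⟨p, l⟩, s⟩
    · rw [step, expect_pure]
    · simp [haltProb, run, PMF.pure_map, ramOutput]
  | succ T ih =>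
    rw [haltProb_succ, haltProb_succ]
    exact expect_mono fun C' _ => ih C'

theorem haltProb_zero (o : Option (Word n)) (p : RamProg) (l : List RamProg) (s : RamState) :
    G.haltProb o 0 (p :: l, s) = 0 := by
  simp [haltProb, run, PMF.pure_map, ramOutput]

theorem haltProb_le_one (o : Option (Word n)) (T : ℕ) (C : List RamProg × RamState) :
    G.haltProb o T C ≤ 1 := PMF.coe_le_one _ _

/-- Executing `p` first only delays the rest, by at most `τ` steps. The lower bound serves the
running time, the upper bound shows that no other output gains probability. -/
theorem haltProb_exec {p : RamProg} {τ : ℕ} {Q : RamState → Prop} (h : Exec p s τ Q) :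
    ∃ s', Q s' ∧ ∀ o l T, G.haltProb o T (l, s') ≤ G.haltProb o (T + τ) (p :: l, s) ∧
      G.haltProb o T (p :: l, s) ≤ G.haltProb o T (l, s') := by
  obtain ⟨k, hk, s', hrun, hQ⟩ := h
  have heq : ∀ o l T, G.haltProb o (T + k) (p :: l, s) = G.haltProb o T (l, s') := fun o l T => by
    unfold haltProb
    rw [hrun]
  refine ⟨s', hQ, fun o l T => ⟨?_, ?_⟩⟩
  · rw [← heq]
    exact haltProb_mono o (by omega) _
  · rw [← heq]
    exact haltProb_mono o (by omega) _

/-- The program `p`, started in the state `s`, halts within `τ` steps; for a random `a` with the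
distribution `μ`, it halts in a state with `Q a`. -/
def ExecRand {A : Type*} (G : TannerGraph c d n m) (p : RamProg) (s : RamState) (τ : ℕ) (μ : PMF A)
    (Q : A → RamState → Prop) : Prop :=
  ∃ f : A → RamState, (∀ a, Q a (f a)) ∧ ∀ o l T,
    expect μ (fun a => G.haltProb o T (l, f a)) ≤ G.haltProb o (T + τ) (p :: l, s) ∧
      G.haltProb o T (p :: l, s) ≤ expect μ fun a => G.haltProb o T (l, f a)

theorem haltProb_seq (o : Option (Word n)) (p q : RamProg) (l : List RamProg) (T : ℕ) :
    G.haltProb o (T + 1) (seq p q :: l, s) = G.haltProb o T (p :: q :: l, s) := by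
  rw [haltProb_succ, step, expect_pure]

theorem execRand_seq {A : Type*} {p q : RamProg} {τ₁ τ₂ : ℕ} {μ : PMF A}
    {Q : A → RamState → Prop} (h : Exec p s τ₁ fun s' => G.ExecRand q s' τ₂ μ Q) :
    G.ExecRand (seq p q) s (τ₁ + τ₂ + 1) μ Q := by
  obtain ⟨s', ⟨f, hf, hq⟩, hp⟩ := G.haltProb_exec h
  refine ⟨f, hf, fun o l T => ⟨?_, ?_⟩⟩
  · rw [show T + (τ₁ + τ₂ + 1) = T + τ₂ + τ₁ + 1 by omega, haltProb_seq]
    exact ((hq o l T).1).trans (hp o (q :: l) (T + τ₂)).1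
  · refine (haltProb_mono o (Nat.le_succ T) _).trans ?_
    rw [Nat.succ_eq_add_one, haltProb_seq]
    exact ((hp o (q :: l) T).2).trans (hq o l T).2

theorem ExecRand.seq {A : Type*} {p q : RamProg} {τ₁ τ₂ : ℕ} {μ : PMF A}
    {Q : A → RamState → Prop} (h : G.ExecRand p s τ₁ μ fun a s' => Exec q s' τ₂ (Q a)) :
    G.ExecRand (seq p q) s (τ₁ + τ₂ + 1) μ Q := by
  obtain ⟨f, hf, hp⟩ := h
  choose g hg hq using fun a => G.haltProb_exec (hf a)
  refine ⟨g, hg, fun o l T => ⟨?_, ?_⟩⟩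
  · rw [show T + (τ₁ + τ₂ + 1) = T + τ₂ + τ₁ + 1 by omega, haltProb_seq]
    exact (expect_mono fun a _ => (hq a o l T).1).trans (hp o (q :: l) (T + τ₂)).1
  · refine (haltProb_mono o (Nat.le_succ T) _).trans ?_
    rw [Nat.succ_eq_add_one, haltProb_seq]
    exact ((hp o (q :: l) T).2).trans (expect_mono fun a _ => (hq a o l T).2)

theorem ExecRand.mono {A : Type*} {p : RamProg} {τ τ' : ℕ} {μ : PMF A}
    {Q Q' : A → RamState → Prop} (h : G.ExecRand p s τ μ Q) (hτ : τ ≤ τ')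
    (hQ : ∀ a s', Q a s' → Q' a s') : G.ExecRand p s τ' μ Q' := by
  obtain ⟨f, hf, hp⟩ := h
  exact ⟨f, fun a => hQ a _ (hf a), fun o l T =>
    ⟨(hp o l T).1.trans (haltProb_mono o (by omega) _), (hp o l T).2⟩⟩

/-- One iteration takes ten steps. They are unrolled by hand because `Exec` describes deterministic
runs only. -/
theorem haltProb_fillRandom_succ (o : Option (Word n)) (A N k T : ℕ) (l : List RamProg)
    (h2 : s.reg 2 = 1) (h11 : s.reg 11 = k + 1) :
    G.haltProb o (T + 10) (fillRandom A N :: l, s) =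
      expect (PMF.uniformOfFintype (Fin (N + 1))) fun j => G.haltProb o T (fillRandom A N :: l,
        ((s.setReg 11 k).setReg 9 j).setCell A k j) := by
  have hcond : (1 : ℝ) * (s.reg 2 : ℝ) ≤ (s.reg 11 : ℝ) := one_mul_cast_le.2 (by omega)
  have hk : s.reg 11 - s.reg 2 = k := by omega
  have hblock : block [sub 11 11 2, block [rand 9 N, store A 11 9]] =
    RamProg.seq (sub 11 11 2)
      (RamProg.seq (RamProg.seq (rand 9 N) (RamProg.seq (store A 11 9) skip)) skip) := rfl
  unfold fillRandom forDown
  rw [hblock]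
  rw [haltProb_succ, step, expect_pure, if_pos hcond]
  rw [haltProb_succ, step, expect_pure, haltProb_succ, step, expect_pure, hk]
  rw [haltProb_succ, step, expect_pure, haltProb_succ, step, expect_pure]
  rw [haltProb_succ, step, expect_map]
  refine (expect_bind (PMF.uniformOfFintype (Fin (N + 1))) (fun a => PMF.pure (a : ℕ)) _).trans ?_
  refine congrArg _ (funext fun j => ?_)
  rw [expect_pure, Function.comp_apply, haltProb_succ, step, expect_pure, haltProb_succ, step, expect_pure,
    haltProb_succ, step, expect_pure, haltProb_succ, step, expect_pure]
  simp

theorem haltProb_fillRandom_zero (o : Option (Word n)) (A N T : ℕ) (l : List RamProg)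
    (h2 : s.reg 2 = 1) (h11 : s.reg 11 = 0) :
    G.haltProb o (T + 1) (fillRandom A N :: l, s) = G.haltProb o T (l, s) := by
  have hcond : ¬ (1 : ℝ) * (s.reg 2 : ℝ) ≤ (s.reg 11 : ℝ) := fun h => by
    have := one_mul_cast_le.1 h
    omega
  rw [haltProb_succ, fillRandom, forDown, step, expect_pure, if_neg hcond]

theorem execRand_fillRandom {A N k : ℕ} (h2 : s.reg 2 = 1) (h11 : s.reg 11 = k) :
    G.ExecRand (fillRandom A N) s (k * 10 + 1) (draws N k) fun f s' => s' = fillState A f k s := by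
  have key : ∀ o l T, G.haltProb o (T + (k * 10 + 1)) (fillRandom A N :: l, s) =
      expect (draws N k) fun f => G.haltProb o T (l, fillState A f k s) := by
    intro o l T
    induction k generalizing s with
    | zero => rw [zero_mul, zero_add, haltProb_fillRandom_zero o A N T l h2 h11, draws, expect_pure]; rfl
    | succ k ih =>
      rw [show T + ((k + 1) * 10 + 1) = T + (k * 10 + 1) + 10 by ring,
        haltProb_fillRandom_succ o A N k _ l h2 h11, draws, expect_bind]
      refine congrArg _ (funext fun j => ?_)
      rw [ih (by simpa using h2) (by simp), expect_map]
      refine congrArg _ (funext fun f => ?_)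
      rw [Function.comp_apply, fillState, Function.update_self]
      congr 2
      exact fillState_congr (fun i hi => by rw [Function.update_of_ne (by omega)]) _
  refine ⟨fun f => fillState A f k s, fun f => rfl, fun o l T => ⟨(key o l T).ge, ?_⟩⟩
  rw [← key]
  exact haltProb_mono o (by omega) _

theorem Rep.fillState (h : G.Rep σ s) (f : ℕ → ℕ) (k : ℕ) :
    G.Rep σ (RamProg.fillState (c + d + 7) f k s) := by
  induction k generalizing s with
  | zero => exact h
  | succ k ih =>
    exact ih (((h.setTemp _ (by omega) (by omega)).setTemp _ (by omega) (by omega)).setScratch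
      (Or.inr rfl) _ _)

end TannerGraph

theorem decides_testLess (c d : ℕ) (F : ℕ → ℕ) :
    Decides c d (fun w k => decide (F k < w)) F (testLess c d) := by
  intro s p τ Q h2 hF h
  refine exec_block_load (exec_block_add (Exec.intro_state fun s₁ e₁ => ?_))
  have h' := h s₁ (by rw [e₁]; rfl) fun i hi => by rw [e₁]; simp [hi]
  have r10 : s₁.reg 10 = F (s.reg 11) + 1 := by simp [e₁, hF, h2]
  have r9 : s₁.reg 9 = s.reg 9 := by simp [e₁]
  refine exec_block_cons' (τ + 1) 1 (by omega) (exec_branch (fun h1 => ?_) fun h1 => ?_)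
  · rw [if_pos (by simp; omega)] at h'
    exact h'.mono le_rfl fun _ => exec_block_nil
  · rw [if_neg (by simp; omega)] at h'
    exact h'.mono (by omega) fun _ => exec_block_nil

namespace TannerGraph

variable {c d n m : ℕ} {G : TannerGraph c d n m} {σ : DecoderData n m} {s : RamState}
  {C₀ : Submodule (ZMod 2) (Word d)} {d₀ : ℕ}

/-- A uniform number among `c d₀` values is smaller than `flipNum` with exactly the probability of
the flip; the argument `c * d₀ - 1` is the largest value drawn. -/
theorem randFlip_eq (hc : 0 < c) (hd₀ : 0 < d₀) (x : Word n) {C : List (Fin n)}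
    (hC : Tallied C (G.flipNum C₀ d₀ x)) :
    (draws (c * d₀ - 1) C.length).map
      (fun f => flipsBy (fun w i => decide (f i < w)) (G.flipNum C₀ d₀ x) C x) =
      G.randFlip C₀ d₀ x := by
  have hpos : 0 < c * d₀ := Nat.mul_pos hc hd₀
  rw [draws_map_flipsBy (c * d₀ - 1) (fun u => by
    rw [Nat.sub_add_cancel hpos]; exact G.flipNum_le C₀ d₀ x u)]
  rw [← foldlM_finRange hC.1 fun u hu => ?_]
  · unfold randFlip
    simp only [flipProb_eq G C₀ hd₀]
    rw [Nat.sub_add_cancel hpos]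
    push_cast
    rfl
  · rw [hC.2] at hu
    rw [Nat.eq_zero_of_not_pos hu]
    simp

/-- Here `μ` is the law of the drawn numbers and `g` maps them to the resulting word. For fixed
numbers the rest of the round is deterministic. -/
theorem Rep.exec_randRound (hc : 0 < c) (hd₀ : 0 < d₀) (h : G.Rep σ s) (hs : G.Settled C₀ σ) :
    ∃ (μ : PMF (ℕ → ℕ)) (g : (ℕ → ℕ) → Word n), μ.map g = G.randFlip C₀ d₀ σ.word ∧
      G.ExecRand (randRound c C₀ d₀) s
        (((c + 1) * (14 * d + c * 17 + 160)) * (σ.active.length + 1)) μ fun f s' => ∃ A T,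
          let σ' : DecoderData n m := { σ with word := g f, active := A, trail := T }
          G.Rep σ' s' ∧ G.Settled C₀ σ' := by
  -- The deterministic part is run first, because the law `μ` depends on the number of candidates it
  -- finds.
  obtain ⟨k, hk, s₁, hrun, C, h₁, ht, hC⟩ := h.exec_collectVotes (d₀ := d₀) hs.covers hs.cand hs.votes
  refine ⟨_, _, randFlip_eq hc hd₀ σ.word ht, ?_⟩
  unfold randRound
  set a := σ.active.length with ha
  have hca : c * C.length ≤ c * a := Nat.mul_le_mul_left c hC
  refine ExecRand.mono (τ := (a * (7 * d + 30) + 10) + (1 + (1 + ((a * 10 + 1) +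
    ((a * (c * 17 + 40) + 20) + (((a + c * a) * (7 * d + 50) + 20) + 1 + 1) + 1) + 1) + 1) + 1) + 1)
    (execRand_seq ⟨k, hk, s₁, hrun, execRand_seq (exec_const (τ := 0)
      (execRand_seq (exec_add (τ := 0) (ExecRand.seq ((execRand_fillRandom (k := C.length)
        ?_ ?_).mono (by omega) ?_)))))⟩)
    (by nlinarith [Nat.zero_le (a * c * c), Nat.zero_le (a * c * d), Nat.zero_le (a * c),
        Nat.zero_le (c * c), Nat.zero_le (c * d)]) (fun _ _ => id)
  · simpa using h₁.one
  · simpa using h₁.candLen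
  rintro f s₂ rfl
  have h₂ := (((h₁.setTemp (i := 10) 0 (by omega) (by omega)).setTemp (i := 11)
    ((s₁.setReg 10 0).reg 4 + (s₁.setReg 10 0).reg 10) (by omega) (by omega)).fillState f C.length)
  refine exec_block_cons' (a * (c * 17 + 40) + 20) ((a + c * a) * (7 * d + 50) + 20 + 1 + 1) le_rfl ?_
  refine (h₂.exec_flipCands hs.covers ht rfl (decides_testLess c d _)).mono (by gcongr) ?_
  rintro s₃ ⟨A, T, h₃, hc₃, hA, hT, hfold⟩
  refine exec_block_cons' ((a + c * a) * (7 * d + 50) + 20) 1 le_rfl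
    ((h₃.exec_compress hc₃).mono ?_ ?_)
  · simp only at hA
    refine Nat.add_le_add_right (Nat.mul_le_mul_right _ (?_ : A.length ≤ a + c * a)) _
    omega
  rintro s₄ ⟨A', h₄, hA₄, hlen⟩
  -- Cells beyond the number of candidates may hold remnants of earlier rounds, but they are never
  -- read.
  have hword : ∀ x, flipsBy (fun w k => decide ((RamProg.fillState (c + d + 7) f C.length
      ((s₁.setReg 10 0).setReg 11 ((s₁.setReg 10 0).reg 4 + (s₁.setReg 10 0).reg 10))).arr
        (c + d + 7) k < w)) (G.flipNum C₀ d₀ σ.word) C x =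
      flipsBy (fun w k => decide (f k < w)) (G.flipNum C₀ d₀ σ.word) C x := fun x =>
    flipsBy_congr (fun w i hi => by rw [fillState_arr f _ hi]) x
  simp only [hword] at h₄ hA₄ hlen
  refine exec_block_nil ⟨A', T, ?_, ⟨hs.cand, hs.votes, hA₄, hlen⟩⟩
  have h1 := hs.cand
  have h2 := hs.votes
  rcases σ
  simp only at h1 h2
  subst h1 h2
  exact h₄

end TannerGraph

/-! ### The program for the randomized decoder -/

namespace RamProg

/-- Compute the list of unsatisfied checks. -/
def refresh (c : ℕ) {d : ℕ} (C₀ : Submodule (ZMod 2) (Word d)) : RamProg :=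
  block [const 10 0, add 11 1 10, forDown (block [const 10 0, add 7 11 10, pushCheck c d]),
    compress c C₀]

/-- The loop of `RandDecode`. -/
def randLoop (c : ℕ) {d : ℕ} (C₀ : Submodule (ZMod 2) (Word d)) (d₀ : ℕ) : RamProg :=
  loop 1 2 3 (randRound c C₀ d₀)

/-- A program for `RandDecode`. -/
def randProgram (c : ℕ) {d : ℕ} (C₀ : Submodule (ZMod 2) (Word d)) (d₀ : ℕ) : RamProg :=
  seq (block [const 2 1, refresh c C₀]) (seq (randLoop c C₀ d₀) skip)

end RamProg

namespace TannerGraph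

variable {c d n m : ℕ} {G : TannerGraph c d n m} {σ : DecoderData n m} {s : RamState}
  {C₀ : Submodule (ZMod 2) (Word d)} {d₀ : ℕ}

/-- The data at the start of the decoders. -/
def initData (m : ℕ) (x : Word n) : DecoderData n m where
  word := x
  active := []
  cand := []
  votes := 0
  trail := []
  saved := 0
  ctl := 0

theorem rep_initState (G : TannerGraph c d n m) (x : Word n) :
    G.Rep (initData m x) ((G.initState x).setReg 2 1) := by
  constructor
  · simp [initState]
  · simp [initState]
  · simp
  · intro j u
    simp [initState]
  · intro i v
    simp [initState]
  · intro u
    simp [initState, initData]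
  · trivial
  · simp [initState, initData]
  · intro v
    simp only [RamState.setReg_arr, initState, initData, List.not_mem_nil, if_false]
    rw [dif_neg (by omega), dif_neg (by omega), dif_neg (by omega)]
  · exact List.nodup_nil
  · intro u
    simp only [RamState.setReg_arr, initState, initData, Pi.zero_apply]
    rw [dif_neg (by omega), dif_neg (by omega), dif_neg (by omega)]
  · trivial
  · simp [initState, initData]
  · trivial
  · simp [initState, initData]
  · intro u
    simp only [RamState.setReg_arr, initState, initData, Pi.zero_apply, ZMod.val_zero]
    rw [dif_neg (by omega), dif_neg (by omega), dif_neg (by omega)]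
  · intro i hi
    rw [RamState.setReg_reg, if_neg (by omega)]
    simp only [initState, initData, Pi.zero_apply]
    rw [if_neg (by omega), if_neg (by omega)]

theorem Rep.exec_refresh (h : G.Rep σ s) :
    Exec (refresh c C₀) s ((7 * d + 100) * (m + 1)) fun s' => ∃ A,
      G.Rep { σ with active := A } s' ∧ (∀ v, v ∈ A ↔ v ∈ G.unsat C₀ σ.word) ∧
        A.length = (G.unsat C₀ σ.word).card := by
  unfold refresh
  refine (exec_block_const (exec_block_add (Exec.intro_state fun s₁ e₁ => ?_)) :
    Exec _ _ (m * 23 + 1 + (m * (7 * d + 50) + 20 + 2) + 1 + 2 + 2) _).mono (by nlinarith) fun _ => id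
  have h₁ : G.Rep σ s₁ := e₁ ▸ (h.setTemp _ (by omega) (by omega)).setTemp _ (by omega) (by omega)
  have r11 : s₁.reg 11 = m := by simp [e₁, h.reg_m]
  refine exec_block_cons ?_
  refine (exec_forDown_nat (I := fun k s => s.reg 11 = k ∧ k ≤ m ∧ ∃ A,
    G.Rep { σ with active := A } s ∧ ∀ v : Fin m, k ≤ v → v ∈ A) 18 ?_ ?_
    ⟨r11, le_rfl, σ.active, h₁, fun v hv => absurd v.2 (by omega)⟩).mono le_rfl ?_
  · rintro k s ⟨h11, -, A, h, -⟩
    exact ⟨h.one, h11⟩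
  · rintro k s ⟨h11, hk, A, h, hA⟩
    refine exec_block_const (exec_block_add (Exec.intro_state fun s₂ e₂ => ?_))
    have h₂ : G.Rep { σ with active := A } s₂ := e₂ ▸ ((h.setTemp (i := 11) k (by omega)
      (by omega)).setTemp (i := 10) 0 (by omega) (by omega)).setTemp (i := 7) _ (by omega) (by omega)
    have r7 : s₂.reg 7 = (⟨k, hk⟩ : Fin m) := by simp [e₂]
    have r11 : s₂.reg 11 = k := by simp [e₂]
    refine exec_block_cons' 12 1 le_rfl ((h₂.exec_pushCheck r7).mono le_rfl ?_)
    rintro s₃ ⟨h₃, f₃⟩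
    refine exec_block_nil ⟨by rw [f₃.reg11, r11], by omega, _, h₃, fun v hv => ?_⟩
    by_cases hvk : v = ⟨k, hk⟩
    · subst hvk
      simp only
      split_ifs with hmem
      · exact hmem
      · simp
    · have hv' : v ∈ A := hA v (by
        have : (v : ℕ) ≠ k := fun hcon => hvk (Fin.ext hcon)
        omega)
      simp only
      split_ifs
      · exact hv'
      · exact List.mem_cons_of_mem _ hv'
  · rintro s₂ ⟨-, -, A, h₂, hA⟩
    have hlen : A.length ≤ m := by simpa using h₂.nodup.length_le_card
    refine exec_block_cons' (m * (7 * d + 50) + 20) 1 le_rfl ((h₂.exec_compress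
      fun v _ => hA v (Nat.zero_le _)).mono (by gcongr) ?_)
    rintro s₃ ⟨A', h₃, hA', hlen'⟩
    exact exec_block_nil ⟨A', h₃, hA', hlen'⟩

/-- The result of the initialization. -/
theorem exec_init (G : TannerGraph c d n m) (C₀ : Submodule (ZMod 2) (Word d)) (x : Word n) :
    Exec (block [const 2 1, refresh c C₀]) (G.initState x) ((7 * d + 110) * (m + 1)) fun s => ∃ A,
      G.Rep { initData m x with active := A } s ∧ G.Settled C₀ { initData m x with active := A } := by
  refine (exec_block_const (exec_block_cons ((G.rep_initState x).exec_refresh.mono le_rfl ?_)) :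
    Exec _ _ ((7 * d + 100) * (m + 1) + 1 + 1 + 2) _).mono (by nlinarith) fun _ => id
  rintro s ⟨A, h, hA, hlen⟩
  exact exec_block_nil ⟨A, h, rfl, rfl, hA, hlen⟩

theorem Rep.ramOutput (h : G.Rep σ s) (hn : 0 < n) : G.ramOutput ([], s) = some (some σ.word) := by
  rw [TannerGraph.ramOutput, h.reg_n, if_neg (by omega)]
  congr 2
  ext u
  rw [h.word, ZMod.natCast_zmod_val]

theorem Rep.haltProb_skip (h : G.Rep σ s) (hn : 0 < n) (o : Option (Word n)) (T : ℕ) :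
    G.haltProb o (T + 1) ([skip], s) = if o = some σ.word then 1 else 0 := by
  have hrun : ∀ T, run T ([], s) = PMF.pure ([], s) := by
    intro T
    induction T with
    | zero => rfl
    | succ T ih => rw [run, step, PMF.pure_bind, ih]
  rw [haltProb_succ, step, expect_pure, haltProb, hrun, PMF.pure_map, h.ramOutput hn, PMF.pure_apply]
  simp

theorem Rep.haltProb_randLoop_zero (h : G.Rep σ s) (hs : G.Settled C₀ σ) (hn : 0 < n)
    (h0 : (G.unsat C₀ σ.word).card = 0) (o : Option (Word n)) (T : ℕ) :
    G.haltProb o (T + 2) ([randLoop c C₀ d₀, skip], s) = if o = some σ.word then 1 else 0 := by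
  have hcond : ¬ (1 : ℝ) * (s.reg 2 : ℝ) ≤ (s.reg 3 : ℝ) := fun hle => by
    have := one_mul_cast_le.1 hle
    rw [h.one, h.activeLen, hs.length] at this
    omega
  rw [haltProb_succ, randLoop, step, expect_pure, if_neg hcond, h.haltProb_skip hn]

/-- The constant in the running time of a round of `RandDecode`. -/
def roundCost (c d : ℕ) : ℕ := (c + 1) * (14 * d + c * 17 + 160)

theorem Rep.haltProb_randLoop_succ (hc : 0 < c) (hd₀ : 0 < d₀) (h : G.Rep σ s)
    (hs : G.Settled C₀ σ) (h0 : 0 < (G.unsat C₀ σ.word).card) :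
    ∃ (μ : PMF (ℕ → ℕ)) (g : (ℕ → ℕ) → Word n) (f : (ℕ → ℕ) → RamState),
      μ.map g = G.randFlip C₀ d₀ σ.word ∧
      (∀ a, ∃ σ' : DecoderData n m, σ'.word = g a ∧ G.Rep σ' (f a) ∧ G.Settled C₀ σ') ∧
      ∀ o T, expect μ (fun a => G.haltProb o T ([randLoop c C₀ d₀, skip], f a)) ≤
          G.haltProb o (T + (roundCost c d * ((G.unsat C₀ σ.word).card + 1) + 1))
            ([randLoop c C₀ d₀, skip], s) ∧
        G.haltProb o (T + 1) ([randLoop c C₀ d₀, skip], s) ≤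
          expect μ fun a => G.haltProb o T ([randLoop c C₀ d₀, skip], f a) := by
  have hcond : (1 : ℝ) * (s.reg 2 : ℝ) ≤ (s.reg 3 : ℝ) := by
    rw [one_mul_cast_le, h.one, h.activeLen, hs.length]
    exact h0
  have hstep : ∀ o T, G.haltProb o (T + 1) ([randLoop c C₀ d₀, skip], s) =
      G.haltProb o T ([randRound c C₀ d₀, randLoop c C₀ d₀, skip], s) := by
    intro o T
    rw [haltProb_succ, randLoop, step, expect_pure, if_pos hcond]
  obtain ⟨μ, g, hμ, f, hf, hp⟩ := h.exec_randRound hc hd₀ hs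
  refine ⟨μ, g, f, hμ, fun a => ?_, fun o T => ⟨?_, ?_⟩⟩
  · obtain ⟨A, T, h1, h2⟩ := hf a
    exact ⟨_, rfl, h1, h2⟩
  · rw [← add_assoc, hstep]
    rw [← hs.length]
    exact (hp o _ T).1
  · rw [hstep]
    exact (hp o _ T).2

/-- Each round takes at least one step, so `T` steps of the machine cannot achieve more than `T`
loop tests. -/
theorem Rep.haltProb_randLoop_le (hc : 0 < c) (hd₀ : 0 < d₀) (hn : 0 < n) (z : Word n) (T : ℕ) :
    ∀ {σ : DecoderData n m} {s : RamState}, G.Rep σ s → G.Settled C₀ σ →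
      G.haltProb (some z) T ([randLoop c C₀ d₀, skip], s) ≤
        G.randDecodeWithin C₀ d₀ T σ.word (some z) := by
  induction T with
  | zero => intro σ s _ _; rw [haltProb_zero]; exact zero_le
  | succ T ih =>
    intro σ s h hs
    rw [randDecodeWithin]
    split_ifs with h0
    · obtain ⟨μ, g, f, hμ, hf, hp⟩ := h.haltProb_randLoop_succ hc hd₀ hs h0
      rw [← hμ, bind_apply_eq_expect, expect_map]
      refine (hp _ _).2.trans (expect_mono fun a _ => ?_)
      obtain ⟨σ', hw, h', hs'⟩ := hf a
      rw [Function.comp_apply, ← hw]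
      exact ih h' hs'
    · refine (haltProb_mono (some z) (Nat.le_succ (T + 1)) _).trans ?_
      rw [Nat.succ_eq_add_one, h.haltProb_randLoop_zero hs hn (by omega), PMF.pure_apply]
      exact le_of_eq (by congr)

/-- Conversely each round fits into a time that depends on `m` only. For the output distribution
this crude bound suffices; the running time is estimated separately. -/
theorem Rep.le_haltProb_randLoop (hc : 0 < c) (hd₀ : 0 < d₀) (hn : 0 < n) (z : Word n) (N : ℕ) :
    ∀ {σ : DecoderData n m} {s : RamState}, G.Rep σ s → G.Settled C₀ σ →
      G.randDecodeWithin C₀ d₀ N σ.word (some z) ≤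
        G.haltProb (some z) (2 + N * (roundCost c d * (m + 1) + 1)) ([randLoop c C₀ d₀, skip], s) := by
  induction N with
  | zero => intro σ s _ _; simp [randDecodeWithin]
  | succ N ih =>
    intro σ s h hs
    rw [randDecodeWithin]
    split_ifs with h0
    · obtain ⟨μ, g, f, hμ, hf, hp⟩ := h.haltProb_randLoop_succ hc hd₀ hs h0
      rw [← hμ, bind_apply_eq_expect, expect_map]
      have hm : (G.unsat C₀ σ.word).card ≤ m := (Finset.card_le_univ _).trans_eq (by simp)
      have hcost : roundCost c d * ((G.unsat C₀ σ.word).card + 1) + 1 ≤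
          roundCost c d * (m + 1) + 1 := by gcongr
      rw [add_mul, one_mul, ← add_assoc]
      refine (expect_mono fun a _ => ?_).trans ((hp _ _).1.trans
        (haltProb_mono _ (Nat.add_le_add_left hcost _) _))
      obtain ⟨σ', hw, h', hs'⟩ := hf a
      rw [Function.comp_apply, ← hw]
      exact ih h' hs'
    · rw [add_comm 2, h.haltProb_randLoop_zero hs hn (by omega), PMF.pure_apply]
      exact le_of_eq (by congr)

theorem haltProb_randProgram (x : Word n) :
    ∃ s A, G.Rep { initData m x with active := A } s ∧
      G.Settled C₀ { initData m x with active := A } ∧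
      ∀ o T, G.haltProb o T ([randLoop c C₀ d₀, skip], s) ≤
          G.ramProb (randProgram c C₀ d₀) (T + ((7 * d + 110) * (m + 1) + 2)) x o ∧
        G.ramProb (randProgram c C₀ d₀) T x o ≤ G.haltProb o T ([randLoop c C₀ d₀, skip], s) := by
  obtain ⟨s, ⟨A, h, hs⟩, hp⟩ := G.haltProb_exec (G.exec_init C₀ x)
  refine ⟨s, A, h, hs, fun o T => ⟨?_, ?_⟩⟩
  · have h1 := (hp o [seq (randLoop c C₀ d₀) skip] (T + 1)).1
    rw [haltProb_seq] at h1
    refine h1.trans ?_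
    rw [← haltProb_seq]
    exact haltProb_mono o (by omega) _
  · refine (haltProb_mono o (Nat.le_add_right T 2) _).trans ?_
    rw [show T + 2 = T + 1 + 1 from rfl]
    refine (haltProb_seq o _ _ _ _).le.trans ?_
    refine (hp o [seq (randLoop c C₀ d₀) skip] (T + 1)).2.trans ?_
    rw [haltProb_seq]

theorem implementsRandDecode_randProgram (hc : 0 < c) (hd₀ : 0 < d₀) (hn : 0 < n) :
    G.ImplementsRandDecode C₀ d₀ (randProgram c C₀ d₀) := by
  intro x z
  obtain ⟨s, A, h, hs, hp⟩ := G.haltProb_randProgram (C₀ := C₀) (d₀ := d₀) x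
  refine le_antisymm (iSup_le fun T => ?_) (iSup_le fun N => ?_)
  · exact ((hp _ T).2.trans (Rep.haltProb_randLoop_le hc hd₀ hn z T h hs)).trans
      (le_iSup (fun T => G.randDecodeWithin C₀ d₀ T x (some z)) T)
  · exact ((Rep.le_haltProb_randLoop hc hd₀ hn z N h hs).trans (hp _ _).1).trans
      (le_iSup (fun T => G.ramProb (randProgram c C₀ d₀) T x (some z)) _)

/-- One round of `RandDecode`, if the codeword `y` is not too far away. -/
theorem Rep.randLoop_cases {a b κ K' : ℝ} (hc : 0 < c) (hn : 0 < n)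
    (hd₀ : IsMinDist C₀ d₀) (hd₀' : 0 < d₀) (hG : G.IsExpander a b) (hκ0 : 0 < κ) (hκ1 : κ ≤ 1)
    (hκ : κ = b - 2 / d₀) {y : Word n} (hy : y ∈ G.tannerCode C₀)
    (hK' : K' = roundCost c d * 2 * c + 1) (h : G.Rep σ s) (hs : G.Settled C₀ σ)
    (hX : (hammingDist σ.word y : ℝ) ≤ a * n) :
    (∀ T, 2 ≤ T → G.haltProb (some y) T ([randLoop c C₀ d₀, skip], s) = 1) ∨
    ∃ cost : ℕ, 0 < cost ∧ (cost : ℝ) ≤ K' * hammingDist σ.word y ∧ ∀ T r,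
      (∀ (σ' : DecoderData n m) s', G.Rep σ' s' → G.Settled C₀ σ' →
        1 ≤ G.haltProb (some y) T ([randLoop c C₀ d₀, skip], s') +
          ENNReal.ofReal (Real.exp (κ / 2 * hammingDist σ'.word y)) * r) →
      1 ≤ G.haltProb (some y) (T + cost) ([randLoop c C₀ d₀, skip], s) + ENNReal.ofReal
        (Real.exp (κ / 2 * hammingDist σ.word y - κ ^ 2 / 4 * hammingDist σ.word y)) * r := by
  set X := hammingDist σ.word y with hXdef
  have hexp := expect_exp_randFlip hc hd₀ hd₀' hG hκ0 hκ1 hκ hy hX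
  have hF := card_unsat_le (G := G) (C₀ := C₀) (x := σ.word) hy
  rcases Nat.eq_zero_or_pos (G.unsat C₀ σ.word).card with h0 | h0
  · left
    have hz : X = 0 := by
      -- Without unsatisfied checks RandFlip does nothing. The exponential moment must nevertheless
      -- decrease unless no bit is corrupt, so the word is already `y`.
      have hflip : G.randFlip C₀ d₀ σ.word = PMF.pure σ.word := by
        refine foldlM_eq_pure (p := G.flipProb C₀ d₀ σ.word) (fun u _ => ?_) _
        have := G.sum_flipNum_le C₀ d₀ σ.word
        rw [h0, mul_zero] at this
        have h1 := Finset.sum_eq_zero_iff.1 (Nat.le_zero.1 this) u (Finset.mem_univ u)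
        rw [flipProb_eq G C₀ hd₀', h1]
        simp
      rw [hflip, expect_pure, ENNReal.ofReal_le_ofReal_iff (Real.exp_pos _).le, Real.exp_le_exp,
        ← hXdef] at hexp
      by_contra hcon
      have : (0 : ℝ) < X := by positivity
      have : 0 < κ ^ 2 / 4 * X := by positivity
      linarith
    intro T hT
    obtain ⟨T', rfl⟩ := Nat.exists_eq_add_of_le' hT
    rw [h.haltProb_randLoop_zero hs hn h0, if_pos (by rw [eq_of_hammingDist_eq_zero hz])]
  · right
    have hX1 : 1 ≤ X := by
      by_contra hcon
      rw [show hammingDist σ.word y = 0 by omega, mul_zero] at hF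
      omega
    obtain ⟨μ, g, f, hμ, hf, hp⟩ := h.haltProb_randLoop_succ hc hd₀' hs h0
    set F := (G.unsat C₀ σ.word).card with hFdef
    refine ⟨roundCost c d * (F + 1) + 1, by omega, ?_, fun T r hT => ?_⟩
    · have hF' : (F : ℝ) ≤ c * X := by exact_mod_cast hF
      have h0' : (1 : ℝ) ≤ F := by exact_mod_cast h0
      have hX1' : (1 : ℝ) ≤ X := by exact_mod_cast hX1
      have hr : (0 : ℝ) ≤ roundCost c d := by positivity
      rw [hK']
      push_cast
      nlinarith [mul_nonneg hr (sub_nonneg.2 hF'), mul_nonneg hr (sub_nonneg.2 h0')]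
    · have hrec : ∀ a', 1 ≤ G.haltProb (some y) T ([randLoop c C₀ d₀, skip], f a') +
          ENNReal.ofReal (Real.exp (κ / 2 * hammingDist (g a') y)) * r := by
        intro a'
        obtain ⟨σ', hw, h', hs'⟩ := hf a'
        rw [← hw]
        exact hT σ' _ h' hs'
      have hsum := expect_mono (μ := μ) fun a' _ => hrec a'
      rw [expect_const, expect_add, expect_mul_const] at hsum
      rw [← hμ, expect_map] at hexp
      exact hsum.trans (add_le_add (hp (some y) T).1 (mul_le_mul_left hexp _))

/-- The failure probability of `RandDecode` with a limited running time. -/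
theorem Rep.one_le_haltProb_randLoop_add {a b κ K' : ℝ} (hc : 0 < c) (hn : 0 < n)
    (hd₀ : IsMinDist C₀ d₀) (hd₀' : 0 < d₀) (hG : G.IsExpander a b) (hκ0 : 0 < κ) (hκ1 : κ ≤ 1)
    (hκ : κ = b - 2 / d₀) {y : Word n} (hy : y ∈ G.tannerCode C₀)
    (hK' : K' = roundCost c d * 2 * c + 1) (T : ℕ) :
    ∀ {σ : DecoderData n m} {s : RamState}, G.Rep σ s → G.Settled C₀ σ → ∀ S : ℕ,
      K' * (2 * (a * n) / κ + a * n - S) + 2 ≤ T →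
      1 ≤ G.haltProb (some y) T ([randLoop c C₀ d₀, skip], s) +
        ENNReal.ofReal (Real.exp (κ / 2 * hammingDist σ.word y)) *
          ENNReal.ofReal (Real.exp (κ ^ 2 / 4 * S - κ / 2 * (a * n))) := by
  induction T using Nat.strong_induction_on with
  | _ T ih =>
    intro σ s h hs S hT
    rw [← ENNReal.ofReal_mul (Real.exp_pos _).le, ← Real.exp_add]
    set X := hammingDist σ.word y with hX
    -- Here `S` stands for the sum of the error counts of the earlier rounds, and the exponent is
    -- the logarithm of the supermartingale relative to the barrier `κ / 2 * (a * n)`. At or above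
    -- the barrier the claim is trivial. Below it, `X < a * n` keeps expansion available and `S < 2
    -- * (a * n) / κ` keeps the time budget large enough for a round of cost at most `K' * X`.
    rcases le_or_gt 0 (κ / 2 * X + (κ ^ 2 / 4 * S - κ / 2 * (a * n))) with hbig | hsmall
    · refine le_add_left ?_
      rw [← ENNReal.ofReal_one]
      exact ENNReal.ofReal_le_ofReal (Real.one_le_exp hbig)
    have hK0 : 0 < K' := by rw [hK']; positivity
    have hXM : (X : ℝ) < a * n := by
      have : 0 ≤ κ ^ 2 / 4 * S := by positivity
      nlinarith
    have hSM : (S : ℝ) < 2 * (a * n) / κ := by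
      rw [lt_div_iff₀ hκ0]
      have : 0 ≤ κ / 2 * X := by positivity
      nlinarith
    have hKX : K' * X ≤ K' * (2 * (a * n) / κ + a * n - S) :=
      mul_le_mul_of_nonneg_left (by linarith) hK0.le
    rcases h.randLoop_cases hc hn hd₀ hd₀' hG hκ0 hκ1 hκ hy hK' hs hXM.le with
      hone | ⟨cost, hcost0, hcost, hstep⟩
    · have hT2 : (2 : ℝ) ≤ T := by
        have : 0 ≤ K' * X := by positivity
        linarith
      rw [hone T (by exact_mod_cast hT2)]
      exact le_self_add
    · have hcostT : (cost : ℝ) ≤ T := by linarith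
      obtain ⟨T', rfl⟩ := Nat.exists_eq_add_of_le' (show cost ≤ T by exact_mod_cast hcostT)
      refine (hstep T' (ENNReal.ofReal (Real.exp (κ ^ 2 / 4 * (S + X : ℕ) - κ / 2 * (a * n))))
        fun σ' s' h' hs' => ih T' (by omega) h' hs' (S + X) ?_).trans (le_of_eq ?_)
      · push_cast at hT ⊢
        nlinarith
      · rw [← ENNReal.ofReal_mul (Real.exp_pos _).le, ← Real.exp_add]
        congr 3
        push_cast
        ring

/-- If `X = a * n`, the general bound starts at the barrier and says nothing. The first round is
therefore treated separately: its decrease by `κ ^ 2 / 4 * X` brings the exponent below the barrier,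
and `S` starts at zero afterwards. -/
theorem Rep.one_le_haltProb_randLoop_add_first {a b κ K' : ℝ} (hc : 0 < c) (hn : 0 < n)
    (hd₀ : IsMinDist C₀ d₀) (hd₀' : 0 < d₀) (hG : G.IsExpander a b) (hκ0 : 0 < κ) (hκ1 : κ ≤ 1)
    (hκ : κ = b - 2 / d₀) {y : Word n} (hy : y ∈ G.tannerCode C₀)
    (hK' : K' = roundCost c d * 2 * c + 1) (ha : 0 ≤ a) (h : G.Rep σ s) (hs : G.Settled C₀ σ)
    (hX : (hammingDist σ.word y : ℝ) ≤ a * n) {T : ℕ}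
    (hT : K' * (2 * (a * n) / κ + 2 * (a * n)) + 2 ≤ T) :
    1 ≤ G.haltProb (some y) T ([randLoop c C₀ d₀, skip], s) +
      ENNReal.ofReal (Real.exp (- (κ ^ 2 / 4 * (a * n)))) := by
  have hK0 : 0 < K' := by rw [hK']; positivity
  have hM : 0 ≤ a * n := by positivity
  have hM' : 0 ≤ 2 * (a * n) / κ := by positivity
  have hKX := mul_le_mul_of_nonneg_left hX hK0.le
  rcases h.randLoop_cases hc hn hd₀ hd₀' hG hκ0 hκ1 hκ hy hK' hs hX with
    hone | ⟨cost, hcost0, hcost, hstep⟩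
  · have hT2 : (2 : ℝ) ≤ T := by
      have : 0 ≤ K' * (2 * (a * n) / κ + 2 * (a * n)) := by positivity
      linarith
    rw [hone T (by exact_mod_cast hT2)]
    exact le_self_add
  · have hcostT : (cost : ℝ) ≤ T := by nlinarith
    obtain ⟨T', rfl⟩ := Nat.exists_eq_add_of_le' (show cost ≤ T by exact_mod_cast hcostT)
    refine (hstep T' (ENNReal.ofReal (Real.exp (κ ^ 2 / 4 * (0 : ℕ) - κ / 2 * (a * n))))
      fun σ' s' h' hs' => h'.one_le_haltProb_randLoop_add hc hn hd₀ hd₀' hG hκ0 hκ1 hκ hy hK' T' hs' 0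
        ?_).trans ?_
    · push_cast at hT ⊢
      nlinarith
    · refine add_le_add le_rfl ?_
      rw [← ENNReal.ofReal_mul (Real.exp_pos _).le, ← Real.exp_add]
      refine ENNReal.ofReal_le_ofReal (Real.exp_le_exp.2 ?_)
      have : 0 ≤ κ / 2 - κ ^ 2 / 4 := by nlinarith
      have := mul_le_mul_of_nonneg_left hX this
      push_cast
      nlinarith

/-- `RandDecode` runs in linear time. -/
theorem exists_ramProb_randProgram {a b κ : ℝ} (hc : 0 < c) (hd : 0 < d) (hd₀ : IsMinDist C₀ d₀)
    (hd₀' : 0 < d₀) (hκ0 : 0 < κ) (hκ1 : κ ≤ 1) (hκ : κ = b - 2 / d₀) (ha : 0 ≤ a) :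
    ∃ K : ℕ, ∀ (n m : ℕ) (G : TannerGraph c d n m), 0 < n → G.IsExpander a b →
      ∀ x y : Word n, y ∈ G.tannerCode C₀ → (hammingDist x y : ℝ) ≤ a * n →
        ENNReal.ofReal (1 - Real.exp (- (κ ^ 2 / 4 * (a * n)))) ≤
          G.ramProb (randProgram c C₀ d₀) (K * n) x (some y) := by
  obtain ⟨K', hK'⟩ : ∃ K' : ℝ, K' = roundCost c d * 2 * c + 1 := ⟨_, rfl⟩
  have hK0 : 0 < K' := by rw [hK']; positivity
  obtain ⟨K₁, hK₁⟩ := exists_nat_ge (K' * (2 * a / κ + 2 * a))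
  refine ⟨K₁ + 2 + ((7 * d + 110) * (c + 1) + 2), fun n m G hn hG x y hy hxy => ?_⟩
  obtain ⟨s, A, h, hs, hp⟩ := G.haltProb_randProgram (C₀ := C₀) (d₀ := d₀) x
  have hfirst := h.one_le_haltProb_randLoop_add_first hc hn hd₀ hd₀' hG hκ0 hκ1 hκ hy hK' ha hs hxy
    (T := (K₁ + 2) * n) (by
      have hn' : (1 : ℝ) ≤ n := by exact_mod_cast hn
      have := mul_le_mul_of_nonneg_right hK₁ (by positivity : (0 : ℝ) ≤ n)
      have heq : K' * (2 * (a * n) / κ + 2 * (a * n)) = K' * (2 * a / κ + 2 * a) * n := by ring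
      rw [heq]
      push_cast
      nlinarith)
  rw [ENNReal.ofReal_sub _ (Real.exp_pos _).le, ENNReal.ofReal_one, tsub_le_iff_right]
  refine hfirst.trans (add_le_add ((hp _ _).1.trans (haltProb_mono _ ?_ _)) le_rfl)
  have hm : m ≤ c * n := by
    rw [← G.mul_right_eq]
    exact Nat.le_mul_of_pos_left m hd
  have h1 : m + 1 ≤ (c + 1) * n := by nlinarith
  have h2 := Nat.mul_le_mul_left (7 * d + 110) h1
  nlinarith

end TannerGraph

/-! ### A program for `DeepFlip` -/

namespace RamProg

theorem exec_loop_of_not_le {r : ℝ} {a b : ℕ} {p : RamProg} {s : RamState} {τ : ℕ} {Q : RamState → Prop}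
    (hr : ¬ r * (s.reg a : ℝ) ≤ (s.reg b : ℝ)) (h : Q s) : Exec (loop r a b p) s (τ + 1) Q :=
  exec_of_step (fun l => by rw [step, if_neg hr]) h

theorem exec_loop_step {r : ℝ} {a b : ℕ} {p : RamProg} {s : RamState} {τ₁ τ₂ : ℕ}
    {Q : RamState → Prop} (hr : r * (s.reg a : ℝ) ≤ (s.reg b : ℝ))
    (h : Exec p s τ₁ fun s' => Exec (loop r a b p) s' τ₂ Q) :
    Exec (loop r a b p) s (τ₁ + τ₂ + 1) Q := by
  obtain ⟨k₁, hk₁, s₁, h₁, k₂, hk₂, s₂, h₂, hQ⟩ := h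
  refine ⟨k₂ + k₁ + 1, by omega, s₂, fun l T => ?_, hQ⟩
  rw [← add_assoc, ← add_assoc,
    run_succ_of_step (D := (p :: loop r a b p :: l, s)) (by rw [step, if_pos hr]), h₁, h₂]

end RamProg

/-- The guess with the number `j`. -/
def guess (c d₀ j : ℕ) : ℝ := ((j : ℝ) + 1) / ((c : ℝ) * d₀)

/-- The numbers of the guesses in the sequences of length `s`. -/
def natSeqs (L : ℕ) : ℕ → List (List ℕ)
  | 0 => [[]]
  | s + 1 => (List.range L).flatMap fun j => (natSeqs L s).map fun l => j :: l

theorem guessSeqs_eq_map (c d₀ s : ℕ) :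
    guessSeqs c d₀ s = (natSeqs (c * d₀) s).map fun l => l.map (guess c d₀) := by
  induction s with
  | zero => rfl
  | succ s ih =>
    rw [guessSeqs_succ, natSeqs, List.map_flatMap, ih]
    simp only [List.map_map]
    rfl

theorem length_of_mem_natSeqs {L s : ℕ} {l : List ℕ} (h : l ∈ natSeqs L s) : l.length = s := by
  induction s generalizing l with
  | zero => simp [natSeqs] at h; simp [h]
  | succ s ih =>
    rw [natSeqs, List.mem_flatMap] at h
    obtain ⟨j, -, h⟩ := h
    obtain ⟨l', hl', rfl⟩ := List.mem_map.1 h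
    simp [ih hl']

namespace RamProg

/-- The inner loop of `DeepFlip` with the guesses `js`; it sets register `20` to `1` if more than
`1 / r` times `n` checks are unsatisfied at some point. -/
def branchProg (c : ℕ) {d : ℕ} (C₀ : Submodule (ZMod 2) (Word d)) (d₀ : ℕ) (r : ℝ) :
    List ℕ → RamProg
  | [] => skip
  | j :: js => block [deterRound c C₀ d₀ j,
      branch r 3 0 (branchProg c C₀ d₀ r js) (const 20 1)]

/-- Compare the result of the inner loop of `DeepFlip` with the best one so far, whose number of
unsatisfied checks is in register `21`, and store `i` in register `22` if it is better. -/
def updateBest (i : ℕ) : RamProg :=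
  block [const 10 0, branch 1 20 10 (block [add 10 3 2,
    branch 1 10 21 (block [const 10 0, add 21 3 10, const 22 i]) skip]) skip]

/-- Try the guesses `js`, with the number `i`. -/
def tryBranch (c : ℕ) {d : ℕ} (C₀ : Submodule (ZMod 2) (Word d)) (d₀ : ℕ) (r : ℝ) (i : ℕ)
    (js : List ℕ) : RamProg :=
  block [const 20 0, branchProg c C₀ d₀ r js, updateBest i, undoTrail c d, compress c C₀]

/-- Try all sequences of guesses in a list. -/
def tryBranches (c : ℕ) {d : ℕ} (C₀ : Submodule (ZMod 2) (Word d)) (d₀ : ℕ) (r : ℝ) :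
    ℕ → List (List ℕ) → RamProg
  | _, [] => skip
  | i, js :: l => block [tryBranch c C₀ d₀ r (i + 1) js, tryBranches c C₀ d₀ r (i + 1) l]

/-- Execute the inner loop of `DeepFlip` with the sequence of guesses whose number is in register
`22`. -/
def replay (c : ℕ) {d : ℕ} (C₀ : Submodule (ZMod 2) (Word d)) (d₀ : ℕ) (r : ℝ) :
    ℕ → List (List ℕ) → RamProg
  | _, [] => skip
  | i, js :: l => block [const 10 (i + 1),
      branch 1 22 10 (branchProg c C₀ d₀ r js) (replay c C₀ d₀ r (i + 1) l)]

/-- A program for `DeepFlip`; it sets register `20` to `1` if there is no result. -/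
def deepProg (c : ℕ) {d : ℕ} (C₀ : Submodule (ZMod 2) (Word d)) (d₀ : ℕ) (r : ℝ)
    (l : List (List ℕ)) : RamProg :=
  block [add 21 1 2, const 22 0, tryBranches c C₀ d₀ r 0 l, const 10 0,
    branch 1 22 10 (const 20 1) (block [const 20 0, replay c C₀ d₀ r 0 l]), const 5 0]

/-- The constant in the running time of a round of `MainDecode`. -/
def deterCost (c d : ℕ) : ℕ := (c + 1) * (14 * d + c * 17 + 130)

/-- The constant in the running time of `k` rounds. -/
def branchCost (c d : ℕ) : ℕ → ℕ
  | 0 => 1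
  | k + 1 => deterCost c d + 10 + (c + 1) * branchCost c d k

theorem branchCost_pos (c d k : ℕ) : 0 < branchCost c d k := by
  cases k <;> simp [branchCost]

end RamProg

namespace TannerGraph

variable {c d n m : ℕ} {G : TannerGraph c d n m} {σ : DecoderData n m} {s : RamState}
  {C₀ : Submodule (ZMod 2) (Word d)} {d₀ : ℕ} {r B : ℝ}

/-- Register `3` holds `|U|` and is compared with the threshold through the real constant `r`. A
failure is signalled in register `20`; the trail is kept in either case, so the branch can be
undone. One round enlarges the list by a factor of at most `c + 1`, whence the recursion of
`branchCost`. -/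
theorem Rep.exec_branchProg (hc : 0 < c) (hd₀ : 0 < d₀) (hr : ∀ k : ℕ, r * k ≤ n ↔ (k : ℝ) ≤ B)
    (js : List ℕ) : ∀ {σ : DecoderData n m} {s : RamState}, G.Rep σ s → G.Settled C₀ σ →
    σ.ctl 20 = 0 →
    Exec (branchProg c C₀ d₀ r (js.map (· + 1))) s
      (branchCost c d js.length * (σ.active.length + 1)) fun s' =>
      ∃ σ', G.Rep σ' s' ∧ G.Settled C₀ σ' ∧ σ'.saved = σ.saved ∧
        (∀ i, i ≠ 20 → σ'.ctl i = σ.ctl i) ∧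
        G.deepBranch C₀ d₀ B (js.map (guess c d₀)) σ.word =
          (if σ'.ctl 20 = 0 then some σ'.word else none) ∧
        σ'.active.length ≤ branchCost c d js.length * (σ.active.length + 1) ∧
        σ'.trail.length ≤ σ.trail.length + branchCost c d js.length * (σ.active.length + 1) ∧
        σ'.trail.foldl flipBit σ'.word = σ.trail.foldl flipBit σ.word := by
  induction js with
  | nil =>
    intro σ s h hs h20
    exact (exec_skip ⟨σ, h, hs, rfl, fun _ _ => rfl, by simp [deepBranch, h20],
      by simp [branchCost], by omega, rfl⟩ : Exec _ _ (0 + 1) _).mono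
      (by simp [branchCost]) fun _ => id
  | cons j js ih =>
    intro σ s h hs h20
    rw [List.map_cons, branchProg, List.map_cons, deepBranch, List.length_cons, branchCost]
    set a := σ.active.length with ha
    have hcost : deterCost c d * (a + 1) + (branchCost c d js.length * ((c + 1) * a + 1) + 1 + 2) + 1 ≤
        (deterCost c d + 10 + (c + 1) * branchCost c d js.length) * (a + 1) := by
      nlinarith [Nat.zero_le (branchCost c d js.length * c)]
    refine exec_block_cons' _ _ hcost ((h.exec_deterRound hc hd₀ hs j).mono le_rfl ?_)
    rintro s₁ ⟨A, T, h₁, hs₁, hA, hT, hfold⟩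
    refine exec_block_cons' _ 1 le_rfl ?_
    have hreg : r * (s₁.reg 3 : ℝ) ≤ (s₁.reg 0 : ℝ) ↔
        ((G.unsat C₀ (G.deterFlip C₀ d₀ σ.word (guess c d₀ j))).card : ℝ) ≤ B := by
      rw [h₁.activeLen, h₁.reg_n, hr, hs₁.length]
      rfl
    by_cases hle : ((G.unsat C₀ (G.deterFlip C₀ d₀ σ.word (guess c d₀ j))).card : ℝ) ≤ B
    · rw [if_neg (not_lt.2 hle)]
      refine exec_branch_of_le (hreg.2 hle) ((ih h₁ hs₁ h20).mono ?_ ?_)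
      · simp only at hA ⊢
        gcongr
      rintro s₂ ⟨σ', h₂, hs₂, hsaved, hctl, hbr, hact, htr, hf⟩
      have hb : branchCost c d js.length * (A.length + 1) ≤
          branchCost c d js.length * ((c + 1) * a + 1) := by gcongr
      simp only at hact htr
      exact exec_block_nil ⟨σ', h₂, hs₂, hsaved, hctl, hbr, by nlinarith, by nlinarith, hf.trans hfold⟩
    · rw [if_pos (not_le.1 hle)]
      refine exec_branch_of_not_le (fun hcon => hle (hreg.1 hcon)) ?_
      refine (exec_const (τ := 0) (exec_block_nil ⟨_, h₁.setCtl (i := 20) 1 le_rfl,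
        ⟨hs₁.cand, hs₁.votes, hs₁.active, hs₁.length⟩, rfl, fun i hi => ?_, ?_, ?_, ?_, hfold⟩)).mono
        ?_ fun _ => id
      · exact Nat.mul_pos (branchCost_pos c d _) (Nat.succ_pos _)
      · exact Function.update_of_ne hi _ _
      · simp
      · have h1 := Nat.mul_le_mul (Nat.mul_le_mul_left (c + 1) (branchCost_pos c d js.length))
          (Nat.le_succ a)
        exact hA.trans (le_trans (by simpa using h1)
          (Nat.mul_le_mul_right _ (Nat.le_add_left _ _)))
      · simp only
        nlinarith [Nat.zero_le (branchCost c d js.length * c), Nat.zero_le (deterCost c d)]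

/-- The best result so far, as it is stored by `DeepFlip` with the sequences of guesses `l`. -/
def BestStored (G : TannerGraph c d n m) (C₀ : Submodule (ZMod 2) (Word d)) (d₀ : ℕ) (B : ℝ)
    (x : Word n) (l : List (List ℕ)) (best : ℕ × Option (Word n)) (k i : ℕ) : Prop :=
  best.1 = k ∧ ((i = 0 ∧ best.2 = none) ∨ ∃ i' js, i = i' + 1 ∧ l[i']? = some js ∧
    best.2 = G.deepBranch C₀ d₀ B (js.map (guess c d₀)) x ∧ best.2 ≠ none)

theorem Rep.exec_updateBest (h : G.Rep σ s) (i : ℕ) :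
    Exec (updateBest i) s 30 fun s' => ∃ ctl,
      G.Rep { σ with ctl := ctl } s' ∧ (∀ i, i ≠ 21 → i ≠ 22 → ctl i = σ.ctl i) ∧
        ((σ.ctl 20 = 0 ∧ σ.active.length < σ.ctl 21 ∧ ctl 21 = σ.active.length ∧ ctl 22 = i) ∨
          (¬ (σ.ctl 20 = 0 ∧ σ.active.length < σ.ctl 21) ∧ ctl = σ.ctl)) := by
  unfold updateBest
  refine exec_block_const (Exec.intro_state fun s₁ e₁ => ?_)
  have h₁ : G.Rep σ s₁ := e₁ ▸ h.setTemp _ (by omega) (by omega)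
  have r10 : s₁.reg 10 = 0 := by simp [e₁]
  refine exec_block_cons' 25 1 (by omega) (exec_branch (fun hle => ?_) fun hlt => ?_)
  · rw [r10, h₁.ctl 20 le_rfl] at hle
    refine exec_block_add (Exec.intro_state fun s₂ e₂ => ?_)
    have h₂ : G.Rep σ s₂ := e₂ ▸ h₁.setTemp _ (by omega) (by omega)
    have r10 : s₂.reg 10 = σ.active.length + 1 := by simp [e₂, h₁.activeLen, h₁.one]
    refine exec_block_cons' 17 2 (by omega) (exec_branch (fun hle' => ?_) fun hlt' => ?_)
    · rw [r10, h₂.ctl 21 (by omega)] at hle'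
      refine exec_block_const (exec_block_add (exec_block_const (exec_block_nil (exec_block_nil
        (exec_block_nil ⟨_, ((h₂.setTemp (i := 10) 0 (by omega) (by omega)).setCtl (i := 21) _
          (by omega)).setCtl (i := 22) i (by omega), ?_, Or.inl ⟨by omega, by omega, ?_, ?_⟩⟩)))))
      · intro i h1 h2
        simp [h1, h2]
      · simp [h₂.activeLen]
      · simp
    · rw [r10, h₂.ctl 21 (by omega)] at hlt'
      exact exec_skip (exec_block_nil (exec_block_nil
        ⟨σ.ctl, h₂, fun _ _ _ => rfl, Or.inr ⟨by omega, rfl⟩⟩))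
  · rw [r10, h₁.ctl 20 le_rfl] at hlt
    exact exec_skip (exec_block_nil ⟨σ.ctl, h₁, fun _ _ _ => rfl, Or.inr ⟨by omega, rfl⟩⟩)

/-- The constant in the running time of a try with `k` rounds. -/
def tryCost (c d k : ℕ) : ℕ := branchCost c d k * ((c + 2) * (7 * d + c * 17 + 100)) + 200

/-- Copying the best word would take `n` steps per attempt. Keeping only the number of its sequence
and undoing the recorded flips costs no more than the attempt itself, up to a constant. -/
theorem Rep.exec_tryBranch (hc : 0 < c) (hd₀ : 0 < d₀) (hr : ∀ k : ℕ, r * k ≤ n ↔ (k : ℝ) ≤ B)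
    {l : List (List ℕ)} {i : ℕ} {js : List ℕ} (hl : l[i]? = some js) (h : G.Rep σ s)
    (hs : G.Settled C₀ σ) (ht : σ.trail = []) {best : ℕ × Option (Word n)}
    (hb : G.BestStored C₀ d₀ B σ.word l best (σ.ctl 21) (σ.ctl 22)) :
    Exec (tryBranch c C₀ d₀ r (i + 1) (js.map (· + 1))) s
      (tryCost c d js.length * (σ.active.length + 1)) fun s' =>
      ∃ σ', G.Rep σ' s' ∧ G.Settled C₀ σ' ∧ σ'.trail = [] ∧ σ'.word = σ.word ∧ σ'.saved = σ.saved ∧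
        (∀ i, 23 ≤ i → σ'.ctl i = σ.ctl i) ∧
        G.BestStored C₀ d₀ B σ.word l
          (keepMin (fun js => G.deepBranch C₀ d₀ B (js.map (guess c d₀)) σ.word)
            (fun z => (G.unsat C₀ z).card) best js) (σ'.ctl 21) (σ'.ctl 22) := by
  unfold tryBranch
  set a := σ.active.length with ha
  set b := branchCost c d js.length with hbdef
  have hcost : b * (a + 1) + (30 + (b * (a + 1) * (c * 17 + 20) + 20 +
      (((c + 1) * (b * (a + 1))) * (7 * d + 50) + 20 + 2) + 1) + 1) + 1 + 2 ≤
      tryCost c d js.length * (a + 1) := by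
    unfold tryCost
    rw [← hbdef]
    generalize hq : b * (a + 1) = q
    have : (b * ((c + 2) * (7 * d + c * 17 + 100)) + 200) * (a + 1) =
      q * ((c + 2) * (7 * d + c * 17 + 100)) + 200 * (a + 1) := by rw [← hq]; ring
    rw [this]
    nlinarith [Nat.zero_le (q * c * c), Nat.zero_le (q * c * d), Nat.zero_le (q * c),
      Nat.zero_le (q * d)]
  refine Exec.mono (exec_block_const ?_) hcost fun _ => id
  have h₀ := h.setCtl (i := 20) 0 le_rfl
  refine exec_block_cons' _ _ le_rfl ((h₀.exec_branchProg hc hd₀ hr js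
    ⟨hs.cand, hs.votes, hs.active, hs.length⟩ (by simp)).mono le_rfl ?_)
  rintro s₁ ⟨σ₁, h₁, hs₁, hsaved, hctl, hbr, hact, htr, hf⟩
  simp only [ht, List.length_nil, zero_add, List.foldl_nil] at hact htr hf hbr hsaved
  refine exec_block_cons' _ _ le_rfl ((h₁.exec_updateBest (i + 1)).mono le_rfl ?_)
  rintro s₂ ⟨ctl, h₂, hctl', hupd⟩
  refine exec_block_cons' _ _ le_rfl ((h₂.exec_undoTrail hs₁.covers).mono (by gcongr) ?_)
  rintro s₃ ⟨A, h₃, hcov₃, hA⟩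
  simp only [hf] at h₃ hcov₃ hA
  refine exec_block_cons' _ 1 le_rfl ((h₃.exec_compress hcov₃).mono ?_ ?_)
  · simp only
    have h1 : A.length ≤ (c + 1) * (b * (a + 1)) := by nlinarith
    gcongr
  rintro s₄ ⟨A', h₄, hA', hlen⟩
  refine exec_block_nil ⟨_, h₄, ⟨hs₁.cand, hs₁.votes, hA', hlen⟩, rfl, rfl, hsaved, ?_, ?_⟩
  · intro i hi
    simp only
    rw [hctl' i (by omega) (by omega), hctl i (by omega)]
    simp [show i ≠ 20 by omega]
  · simp only
    rw [keepMin]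
    simp only [hbr]
    have h21 : σ₁.ctl 21 = σ.ctl 21 := by rw [hctl _ (by omega)]; simp
    have h22 : σ₁.ctl 22 = σ.ctl 22 := by rw [hctl _ (by omega)]; simp
    rw [hs₁.length, h21] at hupd
    by_cases h20 : σ₁.ctl 20 = 0
    · rw [if_pos h20]
      simp only
      rw [hb.1]
      rcases hupd with ⟨-, hlt, e1, e2⟩ | ⟨hnot, rfl⟩
      · rw [if_pos hlt, e1, e2]
        exact ⟨rfl, Or.inr ⟨i, js, rfl, hl, by rw [hbr, if_pos h20], by simp⟩⟩
      · rw [if_neg fun hcon => hnot ⟨h20, hcon⟩, h21, h22]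
        exact hb
    · rw [if_neg h20]
      simp only
      rcases hupd with ⟨hcon, -⟩ | ⟨-, rfl⟩
      · exact absurd hcon h20
      · rw [h21, h22]
        exact hb

theorem Rep.exec_tryBranches (hc : 0 < c) (hd₀ : 0 < d₀) (hr : ∀ k : ℕ, r * k ≤ n ↔ (k : ℝ) ≤ B)
    {l : List (List ℕ)} {k : ℕ} (hk : ∀ js ∈ l, js.length = k) {x : Word n} (l' : List (List ℕ)) :
    ∀ {i : ℕ}, l.drop i = l' → ∀ {σ : DecoderData n m} {s : RamState}, G.Rep σ s →
    G.Settled C₀ σ → σ.trail = [] → σ.word = x → ∀ {best : ℕ × Option (Word n)},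
    G.BestStored C₀ d₀ B x l best (σ.ctl 21) (σ.ctl 22) →
    Exec (tryBranches c C₀ d₀ r i (l'.map fun js => js.map (· + 1))) s
      (l'.length * ((tryCost c d k + 3) * ((G.unsat C₀ x).card + 1)) + 1) fun s' =>
      ∃ σ', G.Rep σ' s' ∧ G.Settled C₀ σ' ∧ σ'.trail = [] ∧ σ'.word = x ∧ σ'.saved = σ.saved ∧
        (∀ i, 23 ≤ i → σ'.ctl i = σ.ctl i) ∧
        G.BestStored C₀ d₀ B x l
          (l'.foldl (keepMin (fun js => G.deepBranch C₀ d₀ B (js.map (guess c d₀)) x)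
            (fun z => (G.unsat C₀ z).card)) best) (σ'.ctl 21) (σ'.ctl 22) := by
  induction l' with
  | nil =>
    intro i _ σ s h hs ht hx best hb
    exact exec_skip ⟨σ, h, hs, ht, hx, rfl, fun _ _ => rfl, hb⟩
  | cons js l' ih =>
    intro i hi σ s h hs ht hx best hb
    have hl : l[i]? = some js := by
      rw [← List.head?_drop, hi]
      rfl
    have hdrop : l.drop (i + 1) = l' := by
      rw [← List.tail_drop, hi]
      rfl
    rw [List.map_cons, tryBranches, List.length_cons, List.foldl_cons]
    subst hx
    have hjs : js.length = k := hk js (List.mem_of_getElem? hl)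
    refine exec_block_cons' (tryCost c d k * ((G.unsat C₀ σ.word).card + 1))
      (l'.length * ((tryCost c d k + 3) * ((G.unsat C₀ σ.word).card + 1)) + 1 + 1 + 1) ?_
      ((h.exec_tryBranch hc hd₀ hr hl hs ht hb).mono (by rw [hjs, hs.length]) ?_)
    · rw [add_mul l'.length, one_mul, add_mul (tryCost c d k)]
      omega
    rintro s₁ ⟨σ₁, h₁, hs₁, ht₁, hx₁, hsaved₁, hctl₁, hb₁⟩
    refine exec_block_cons' _ 1 le_rfl ((ih hdrop h₁ hs₁ ht₁ hx₁ hb₁).mono le_rfl ?_)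
    rintro s₂ ⟨σ₂, h₂, hs₂, ht₂, hx₂, hsaved₂, hctl₂, hb₂⟩
    exact exec_block_nil ⟨σ₂, h₂, hs₂, ht₂, hx₂, hsaved₂.trans hsaved₁,
      fun i hi => (hctl₂ i hi).trans (hctl₁ i hi), hb₂⟩

/-- The sequences are numbered from `1`, because `0` in register `22` means that none has survived.
-/
theorem Rep.exec_replay (hc : 0 < c) (hd₀ : 0 < d₀) (hr : ∀ k : ℕ, r * k ≤ n ↔ (k : ℝ) ≤ B)
    {k : ℕ} (l : List (List ℕ)) (hk : ∀ js ∈ l, js.length = k) :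
    ∀ {i i' : ℕ} {js : List ℕ}, l[i']? = some js → ∀ {s : RamState}, G.Rep σ s → G.Settled C₀ σ →
    σ.ctl 20 = 0 → σ.ctl 22 = i + i' + 1 →
    Exec (replay c C₀ d₀ r i (l.map fun js => js.map (· + 1))) s
      (l.length * 10 + branchCost c d k * (σ.active.length + 1)) fun s' =>
      ∃ σ', G.Rep σ' s' ∧ G.Settled C₀ σ' ∧ σ'.saved = σ.saved ∧
        (∀ i, i ≠ 20 → σ'.ctl i = σ.ctl i) ∧
        G.deepBranch C₀ d₀ B (js.map (guess c d₀)) σ.word =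
          (if σ'.ctl 20 = 0 then some σ'.word else none) ∧
        σ'.active.length ≤ branchCost c d k * (σ.active.length + 1) := by
  induction l with
  | nil => intro i i' js hjs; simp at hjs
  | cons js₀ l ih =>
    intro i i' js hjs s h hs h20 h22
    rw [List.map_cons, replay, List.length_cons]
    refine Exec.mono (τ := (l.length * 10 + branchCost c d k * (σ.active.length + 1)) + 1 + 1 + 1 + 2)
      (exec_block_const (Exec.intro_state fun s₁ e₁ => ?_)) (by omega) fun _ => id
    have h₁ : G.Rep σ s₁ := e₁ ▸ h.setTemp _ (by omega) (by omega)
    have r10 : s₁.reg 10 = i + 1 := by simp [e₁]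
    refine exec_block_cons' _ 1 le_rfl (exec_branch (fun hle => ?_) fun hlt => ?_)
    · rw [r10, h₁.ctl 22 (by omega), h22] at hle
      obtain rfl : i' = 0 := by omega
      simp only [List.getElem?_cons_zero, Option.some.injEq] at hjs
      subst hjs
      have hlen : js₀.length = k := hk js₀ (by simp)
      refine (h₁.exec_branchProg hc hd₀ hr js₀ hs h20).mono (by rw [hlen]; omega) ?_
      rintro s₂ ⟨σ', h₂, hs₂, hsaved, hctl, hbr, hact, -, -⟩
      exact exec_block_nil ⟨σ', h₂, hs₂, hsaved, hctl, hbr, by rwa [hlen] at hact⟩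
    · rw [r10, h₁.ctl 22 (by omega), h22] at hlt
      obtain ⟨i'', rfl⟩ : ∃ i'', i' = i'' + 1 := ⟨i' - 1, by omega⟩
      rw [List.getElem?_cons_succ] at hjs
      refine (ih (fun js hj => hk js (List.mem_cons_of_mem _ hj)) (i := i + 1) hjs h₁ hs h20
        (by omega)).mono le_rfl ?_
      rintro s₂ h₂
      exact exec_block_nil h₂

/-- The constant in the running time of `DeepFlip` with `N` sequences of length `k`. -/
def deepCost (c d k N : ℕ) : ℕ := N * (tryCost c d k + 13) + branchCost c d k + 30

theorem Rep.exec_deepProg (hc : 0 < c) (hd₀ : 0 < d₀) (hr : ∀ k : ℕ, r * k ≤ n ↔ (k : ℝ) ≤ B)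
    {l : List (List ℕ)} {k : ℕ} (hk : ∀ js ∈ l, js.length = k) (h : G.Rep σ s)
    (hs : G.Settled C₀ σ) (ht : σ.trail = []) :
    Exec (deepProg c C₀ d₀ r (l.map fun js => js.map (· + 1))) s
      (deepCost c d k l.length * (σ.active.length + 1)) fun s' =>
      ∃ σ', G.Rep σ' s' ∧ G.Settled C₀ σ' ∧ σ'.trail = [] ∧ σ'.saved = σ.saved ∧
        (∀ i, 23 ≤ i → σ'.ctl i = σ.ctl i) ∧
        (l.foldl (keepMin (fun js => G.deepBranch C₀ d₀ B (js.map (guess c d₀)) σ.word)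
          (fun z => (G.unsat C₀ z).card)) (m + 1, none)).2 =
            (if σ'.ctl 20 = 0 then some σ'.word else none) ∧
        σ'.active.length ≤ branchCost c d k * (σ.active.length + 1) := by
  unfold deepProg
  set a := σ.active.length with ha
  have hcost : (l.length * ((tryCost c d k + 3) * ((G.unsat C₀ σ.word).card + 1)) + 1) +
      ((((l.length * 10 + branchCost c d k * (a + 1)) + 1 + 1 + 2 + 1) + 3 + 1) + 2) + 1 + 2 + 2 ≤
      deepCost c d k l.length * (a + 1) := by
    rw [← hs.length, ← ha, deepCost]
    have h1 : l.length ≤ l.length * (a + 1) := Nat.le_mul_of_pos_right _ (Nat.succ_pos a)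
    nlinarith
  refine Exec.mono (exec_block_add (exec_block_const ?_)) hcost fun _ => id
  have h₀ := (h.setCtl (i := 21) (m + 1) (by omega)).setCtl (i := 22) 0 (by omega)
  rw [h.reg_m, h.one]
  refine exec_block_cons' _ _ le_rfl ((h₀.exec_tryBranches hc hd₀ hr hk l (i := 0) (x := σ.word) rfl
    ⟨hs.cand, hs.votes, hs.active, hs.length⟩ ht rfl (best := (m + 1, none))
    ⟨by simp, Or.inl ⟨by simp, rfl⟩⟩).mono le_rfl ?_)
  rintro s₁ ⟨σ₁, h₁, hs₁, ht₁, hx₁, hsaved₁, hctl₁, -, hb₁⟩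
  have hlen₁ : σ₁.active.length = a := by rw [hs₁.length, hx₁, ← hs.length]
  have hctl₁' : ∀ i, 23 ≤ i → σ₁.ctl i = σ.ctl i := by
    intro i hi
    rw [hctl₁ i hi]
    simp [show i ≠ 21 by omega, show i ≠ 22 by omega]
  refine exec_block_const (Exec.intro_state fun s₂ e₂ => ?_)
  have h₂ : G.Rep σ₁ s₂ := e₂ ▸ h₁.setTemp _ (by omega) (by omega)
  have r10 : s₂.reg 10 = 0 := by simp [e₂]
  refine exec_block_cons' _ 3 le_rfl (exec_branch (fun hle => ?_) fun hlt => ?_)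
  -- Register `22` is zero: every sequence was abandoned, which is the result `⊥`.
  · rw [r10, h₂.ctl 22 (by omega)] at hle
    have hnone : (l.foldl (keepMin (fun js => G.deepBranch C₀ d₀ B (js.map (guess c d₀)) σ.word)
          (fun z => (G.unsat C₀ z).card)) (m + 1, none)).2 = none := by
      rcases hb₁ with ⟨-, h⟩ | ⟨i', js, h, -⟩
      · exact h
      · omega
    refine (exec_const (τ := 0) (exec_block_const (exec_block_nil ⟨_,
      (h₂.setCtl (i := 20) 1 le_rfl).setTrail [] rfl trivial,
      ⟨hs₁.cand, hs₁.votes, hs₁.active, hs₁.length⟩, rfl, hsaved₁, ?_, ?_, ?_⟩))).mono (by omega)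
      fun _ => id
    · intro i hi
      simp only
      rw [Function.update_of_ne (by omega), hctl₁' i hi]
    · rw [hnone]
      simp
    · simp only [hlen₁]
      have := Nat.mul_le_mul_right (a + 1) (branchCost_pos c d k)
      omega
  · rw [r10, h₂.ctl 22 (by omega)] at hlt
    rcases hb₁ with ⟨h, -⟩ | ⟨i', js, hi', hjs, hbest, hne⟩
    · omega
    refine exec_block_const (exec_block_cons' _ 1 le_rfl (((h₂.setCtl (i := 20) 0
      le_rfl).exec_replay hc hd₀ hr l hk (i := 0) hjs ⟨hs₁.cand, hs₁.votes, hs₁.active, hs₁.length⟩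
      (by simp) (by simp [hi'])).mono (by simp only [hlen₁]; exact le_rfl) ?_))
    rintro s₃ ⟨σ₃, h₃, hs₃, hsaved₃, hctl₃, hbr, hact⟩
    refine exec_block_nil (exec_block_const (exec_block_nil ⟨_, h₃.setTrail [] rfl trivial,
      ⟨hs₃.cand, hs₃.votes, hs₃.active, hs₃.length⟩, rfl, hsaved₃.trans hsaved₁, ?_, ?_, ?_⟩))
    · intro i hi
      simp only
      rw [hctl₃ i (by omega)]
      simp only
      rw [Function.update_of_ne (by omega), hctl₁' i hi]
    · rw [hbest, ← hx₁]
      exact hbr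
    · simpa only [hlen₁] using hact

end TannerGraph

/-! ### A program for `MainDecode` -/

namespace RamProg

/-- Save a copy of the word. -/
def saveWord (c d : ℕ) : RamProg :=
  block [const 10 0, add 11 0 10, forDown (block [load 9 (c + d) 11, store (c + d + 8) 11 9])]

/-- Restore the saved word. -/
def restoreWord (c d : ℕ) : RamProg :=
  block [const 10 0, add 11 0 10, forDown (block [load 9 (c + d + 8) 11, store (c + d) 11 9])]

/-- Compute the distance between the word and the saved one. -/
def compareWords (c d : ℕ) : RamProg :=
  block [const 12 0, const 10 0, add 11 0 10,
    forDown (block [load 8 (c + d) 11, load 9 (c + d + 8) 11,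
      sub 10 8 9, add 12 12 10, sub 10 9 8, add 12 12 10])]

/-- Decide whether `DeepFlip` has to be executed once more. -/
def testGo (g : ℝ) : RamProg := branch g 0 23 (const 24 0) (const 24 1)

/-- One iteration of the second inner loop of `MainDecode`; register `23` holds the power of two. -/
def deepIter (c : ℕ) {d : ℕ} (C₀ : Submodule (ZMod 2) (Word d)) (d₀ : ℕ) (r g : ℝ)
    (l : List (List ℕ)) : RamProg :=
  block [deepProg c C₀ d₀ r l, const 10 0,
    branch 1 20 10
      (block [const 25 0, add 11 3 10, forDown (add 25 25 23),
        branch r 25 0 (block [add 23 23 23, testGo g]) (block [const 20 1, const 24 0])])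
      (const 24 0)]

/-- The second inner loop of `MainDecode`. -/
def deepLoopProg (c : ℕ) {d : ℕ} (C₀ : Submodule (ZMod 2) (Word d)) (d₀ : ℕ) (r g : ℝ)
    (l : List (List ℕ)) : RamProg :=
  block [const 20 0, const 23 2, testGo g, loop 1 2 24 (deepIter c C₀ d₀ r g l)]

/-- The first inner loop of `MainDecode`. -/
def guessRounds (c : ℕ) {d : ℕ} (C₀ : Submodule (ZMod 2) (Word d)) (d₀ : ℕ) : List ℕ → RamProg
  | [] => skip
  | j :: js => block [deterRound c C₀ d₀ j, guessRounds c C₀ d₀ js]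

/-- The final test of `MainDecode`. -/
def finalTest (c d : ℕ) (e : ℝ) : RamProg :=
  block [const 10 0, branch 1 20 10
    (branch 1 3 10 (block [compareWords c d, branch e 12 0 (const 26 1) skip]) skip) skip]

/-- `MainDecode` for one sequence of guesses. -/
def tryMain (c : ℕ) {d : ℕ} (C₀ : Submodule (ZMod 2) (Word d)) (d₀ : ℕ) (r g e : ℝ)
    (l : List (List ℕ)) (js : List ℕ) : RamProg :=
  block [restoreWord c d, refresh c C₀, guessRounds c C₀ d₀ js, const 5 0,
    deepLoopProg c C₀ d₀ r g l, finalTest c d e]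

/-- `MainDecode` for a list of sequences of guesses. -/
def tryMains (c : ℕ) {d : ℕ} (C₀ : Submodule (ZMod 2) (Word d)) (d₀ : ℕ) (r g e : ℝ)
    (l : List (List ℕ)) : List (List ℕ) → RamProg
  | [] => skip
  | js :: L => block [tryMain c C₀ d₀ r g e l js,
      branch 1 2 26 skip (tryMains c C₀ d₀ r g e l L)]

/-- A program for `MainDecode`. -/
def mainProgram (c : ℕ) {d : ℕ} (C₀ : Submodule (ZMod 2) (Word d)) (d₀ : ℕ) (r g e : ℝ)
    (l L : List (List ℕ)) : RamProg :=
  block [const 2 1, saveWord c d, tryMains c C₀ d₀ r g e l L, const 10 0, add 0 26 10]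

end RamProg

namespace TannerGraph

variable {c d n m : ℕ} {G : TannerGraph c d n m} {σ : DecoderData n m} {s : RamState}
  {C₀ : Submodule (ZMod 2) (Word d)} {d₀ : ℕ} {r B : ℝ}

theorem Rep.exec_saveWord (h : G.Rep σ s) :
    Exec (saveWord c d) s (n * 10 + 10) fun s' => G.Rep { σ with saved := σ.word } s' := by
  unfold saveWord
  refine exec_block_const (exec_block_add (Exec.intro_state fun s₁ e₁ => ?_))
  have h₁ : G.Rep σ s₁ := e₁ ▸ (h.setTemp _ (by omega) (by omega)).setTemp _ (by omega) (by omega)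
  have r11 : s₁.reg 11 = n := by simp [e₁, h.reg_n]
  refine exec_block_cons' (n * (5 + 5) + 1) 1 (by omega) ((exec_forDown_nat (I := fun k s =>
    s.reg 11 = k ∧ k ≤ n ∧ ∃ w, G.Rep { σ with saved := w } s ∧ ∀ u : Fin n, k ≤ u → w u = σ.word u)
    5 ?_ ?_ ⟨r11, le_rfl, σ.saved, h₁, fun u hu => absurd u.2 (by omega)⟩).mono le_rfl ?_)
  · rintro k s ⟨h11, -, w, h, -⟩
    exact ⟨h.one, h11⟩
  · rintro k s ⟨h11, hk, w, h, hw⟩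
    refine exec_block_load (exec_block_store (exec_block_nil ?_))
    have h₂ := ((h.setTemp (i := 11) k (by omega) (by omega)).setTemp (i := 9)
      (σ.word ⟨k, hk⟩).val (by omega) (by omega)).setSaved ⟨k, hk⟩
      (rfl : (σ.word ⟨k, hk⟩).val = _)
    have hword : s.arr (c + d) k = (σ.word ⟨k, hk⟩).val := h.word ⟨k, hk⟩
    refine ⟨by simp, by omega, Function.update w ⟨k, hk⟩ (σ.word ⟨k, hk⟩), ?_, fun u hu => ?_⟩
    · simpa [hword] using h₂
    · rw [Function.update_apply]
      split_ifs with huk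
      · rw [huk]
      · refine hw u ?_
        have : (u : ℕ) ≠ k := fun hcon => huk (Fin.ext hcon)
        omega
  · rintro s₂ ⟨-, -, w, h₂, hw⟩
    have : w = σ.word := funext fun u => hw u (Nat.zero_le _)
    subst this
    exact exec_block_nil h₂

theorem Rep.exec_restoreWord (h : G.Rep σ s) :
    Exec (restoreWord c d) s (n * 10 + 10) fun s' => G.Rep { σ with word := σ.saved } s' := by
  unfold restoreWord
  refine exec_block_const (exec_block_add (Exec.intro_state fun s₁ e₁ => ?_))
  have h₁ : G.Rep σ s₁ := e₁ ▸ (h.setTemp _ (by omega) (by omega)).setTemp _ (by omega) (by omega)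
  have r11 : s₁.reg 11 = n := by simp [e₁, h.reg_n]
  refine exec_block_cons' (n * (5 + 5) + 1) 1 (by omega) ((exec_forDown_nat (I := fun k s =>
    s.reg 11 = k ∧ k ≤ n ∧ ∃ w, G.Rep { σ with word := w } s ∧ ∀ u : Fin n, k ≤ u → w u = σ.saved u)
    5 ?_ ?_ ⟨r11, le_rfl, σ.word, h₁, fun u hu => absurd u.2 (by omega)⟩).mono le_rfl ?_)
  · rintro k s ⟨h11, -, w, h, -⟩
    exact ⟨h.one, h11⟩
  · rintro k s ⟨h11, hk, w, h, hw⟩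
    refine exec_block_load (exec_block_store (exec_block_nil ?_))
    have h₂ := ((h.setTemp (i := 11) k (by omega) (by omega)).setTemp (i := 9)
      (σ.saved ⟨k, hk⟩).val (by omega) (by omega)).setWord ⟨k, hk⟩
      (rfl : (σ.saved ⟨k, hk⟩).val = _)
    have hsaved : s.arr (c + d + 8) k = (σ.saved ⟨k, hk⟩).val := h.saved ⟨k, hk⟩
    refine ⟨by simp, by omega, Function.update w ⟨k, hk⟩ (σ.saved ⟨k, hk⟩), ?_, fun u hu => ?_⟩
    · simpa [hsaved] using h₂
    · rw [Function.update_apply]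
      split_ifs with huk
      · rw [huk]
      · refine hw u ?_
        have : (u : ℕ) ≠ k := fun hcon => huk (Fin.ext hcon)
        omega
  · rintro s₂ ⟨-, -, w, h₂, hw⟩
    have : w = σ.saved := funext fun u => hw u (Nat.zero_le _)
    subst this
    exact exec_block_nil h₂

theorem Rep.exec_compareWords (h : G.Rep σ s) :
    Exec (compareWords c d) s (n * 20 + 10) fun s' =>
      G.Rep σ s' ∧ s'.reg 12 = hammingDist σ.saved σ.word := by
  unfold compareWords
  refine exec_block_const (exec_block_const (exec_block_add (Exec.intro_state fun s₁ e₁ => ?_)))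
  have h₁ : G.Rep σ s₁ := e₁ ▸ ((h.setTemp _ (by omega) (by omega)).setTemp _ (by omega)
    (by omega)).setTemp _ (by omega) (by omega)
  have r11 : s₁.reg 11 = n := by simp [e₁, h.reg_n]
  have r12 : s₁.reg 12 = 0 := by simp [e₁]
  refine exec_block_cons' (n * (13 + 5) + 1) 1 (by omega) ((exec_forDown_nat (I := fun k s =>
    s.reg 11 = k ∧ k ≤ n ∧ G.Rep σ s ∧
    s.reg 12 = (Finset.univ.filter fun u : Fin n => k ≤ u ∧ σ.saved u ≠ σ.word u).card)
    13 ?_ ?_ ⟨r11, le_rfl, h₁, ?_⟩).mono le_rfl ?_)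
  · rintro k s ⟨h11, -, h, -⟩
    exact ⟨h.one, h11⟩
  · rintro k s ⟨h11, hk, h, h12⟩
    refine exec_block_load (exec_block_load (exec_block_sub (exec_block_add (exec_block_sub
      (exec_block_add (Exec.intro_state fun s₂ e₂ => exec_block_nil ⟨by simp [e₂], by omega,
        h.of_eq (by simp [e₂]) fun i hi => ?_, ?_⟩))))))
    · rw [e₂]
      simp [show i ≠ 8 by omega, show i ≠ 9 by omega, show i ≠ 10 by omega,
        show i ≠ 11 by omega, show i ≠ 12 by omega]
    · have hword : s.arr (c + d) k = (σ.word ⟨k, hk⟩).val := h.word ⟨k, hk⟩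
      have hsaved : s.arr (c + d + 8) k = (σ.saved ⟨k, hk⟩).val := h.saved ⟨k, hk⟩
      -- Of the two truncated differences at least one vanishes, so their sum is the absolute
      -- difference of the bits.
      have hval : ∀ a b : ZMod 2, a.val - b.val + (b.val - a.val) = if b ≠ a then 1 else 0 := by
        decide
      have hreg : s₂.reg 12 = s.reg 12 + ((σ.word ⟨k, hk⟩).val - (σ.saved ⟨k, hk⟩).val +
          ((σ.saved ⟨k, hk⟩).val - (σ.word ⟨k, hk⟩).val)) := by
        rw [← add_assoc]
        simp [e₂, hword, hsaved]
      rw [hreg, hval, h12]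
      have hset : (Finset.univ.filter fun u : Fin n => k ≤ u ∧ σ.saved u ≠ σ.word u) =
          (Finset.univ.filter fun u : Fin n => k + 1 ≤ u ∧ σ.saved u ≠ σ.word u) ∪
            if σ.saved ⟨k, hk⟩ ≠ σ.word ⟨k, hk⟩ then {⟨k, hk⟩} else ∅ := by
        ext u
        rw [Finset.mem_union, Finset.mem_filter, Finset.mem_filter]
        by_cases huk : u = ⟨k, hk⟩
        · subst huk
          split_ifs with hne <;> simp [hne]
        · have : (u : ℕ) ≠ k := fun hcon => huk (Fin.ext hcon)
          have hlt : k ≤ (u : ℕ) ↔ k + 1 ≤ (u : ℕ) := by omega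
          rw [hlt]
          split_ifs <;> simp [huk]
      rw [hset, Finset.card_union_of_disjoint]
      · congr 1
        split_ifs <;> simp
      · rw [Finset.disjoint_left]
        intro u hu
        rw [Finset.mem_filter] at hu
        split_ifs
        · rw [Finset.mem_singleton]
          rintro rfl
          simp at hu
        · simp
  · rw [r12, eq_comm, Finset.card_eq_zero, Finset.filter_eq_empty_iff]
    rintro u - ⟨hu, -⟩
    exact absurd u.2 (by omega)
  · rintro s₂ ⟨-, -, h₂, h12⟩
    refine exec_block_nil ⟨h₂, ?_⟩
    rw [h12]
    simp [hammingDist]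

theorem Rep.exec_testGo (h : G.Rep σ s) (g : ℝ) :
    Exec (testGo g) s 2 fun s' =>
      G.Rep { σ with ctl := Function.update σ.ctl 24 (if g * n ≤ σ.ctl 23 then 0 else 1) } s' := by
  have h0 := h.reg_n
  have h23 := h.ctl 23 (by omega)
  by_cases hg : g * n ≤ σ.ctl 23
  · rw [if_pos hg]
    exact exec_branch_of_le (by rwa [h0, h23]) (exec_const (τ := 0) (h.setCtl 0 (by omega)))
  · rw [if_neg hg]
    exact exec_branch_of_not_le (by rwa [h0, h23]) (exec_const (τ := 0) (h.setCtl 1 (by omega)))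

theorem Settled.setCtl (hs : G.Settled C₀ σ) (ctl : ℕ → ℕ) : G.Settled C₀ { σ with ctl := ctl } :=
  ⟨hs.cand, hs.votes, hs.active, hs.length⟩

/-- The constant in the running time of an iteration of the second inner loop of `MainDecode`. -/
def iterCost (c d k N : ℕ) : ℕ := deepCost c d k N + branchCost c d k * 6 + 50

/-- The specification of the second inner loop of `MainDecode`: the iterations that are left start
with number `i`. -/
theorem Rep.exec_deepLoop {a b g : ℝ} {J : ℕ} (hc : 0 < c) (hd₀ : 0 < d₀)
    (hr : ∀ k : ℕ, r * k ≤ n ↔ (k : ℝ) ≤ c * gammaConst c d₀ a b * n)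
    (hγ : gammaConst c d₀ a b ≤ 1)
    {l : List (List ℕ)} {k : ℕ} (hk : ∀ js ∈ l, js.length = k)
    (hdeep : ∀ x, G.deepFlip C₀ d₀ a b x = (l.foldl (keepMin
      (fun js => G.deepBranch C₀ d₀ (c * gammaConst c d₀ a b * n) (js.map (guess c d₀)) x)
      (fun z => (G.unsat C₀ z).card)) (m + 1, none)).2)
    (hg : ∀ i, 0 < i → (g * n ≤ (2 : ℝ) ^ i ↔ J < i)) (j : ℕ) :
    ∀ {i : ℕ}, 0 < i → i + j = J + 1 → ∀ {σ : DecoderData n m} {s : RamState}, G.Rep σ s →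
    G.Settled C₀ σ → σ.trail = [] → σ.ctl 20 = 0 → σ.ctl 23 = 2 ^ i →
    σ.ctl 24 = (if j = 0 then 0 else 1) →
    Exec (loop 1 2 24 (deepIter c C₀ d₀ r g (l.map fun js => js.map (· + 1)))) s
      (iterCost c d k l.length * (σ.active.length + 2 * (c * n) / 2 ^ i + j) + 1) fun s' =>
      ∃ σ', G.Rep σ' s' ∧ G.Settled C₀ σ' ∧ σ'.saved = σ.saved ∧ σ'.ctl 26 = σ.ctl 26 ∧
        G.deepLoop C₀ d₀ a b j i σ.word = if σ'.ctl 20 = 0 then some σ'.word else none := by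
  have hhalt : ∀ {σ' : DecoderData n m} {s' : RamState}, G.Rep σ' s' → σ'.ctl 24 = 0 →
      ¬ (1 : ℝ) * (s'.reg 2 : ℝ) ≤ (s'.reg 24 : ℝ) := by
    intro σ' s' h' h24
    rw [one_mul_cast_le, h'.one, h'.ctl 24 (by omega), h24]
    omega
  induction j with
  | zero =>
    intro i hi hij σ s h hs ht h20 h23 h24
    exact exec_loop_of_not_le (hhalt h (by simpa using h24))
      ⟨σ, h, hs, rfl, rfl, by rw [deepLoop, if_pos h20]⟩
  | succ j ih =>
    intro i hi hij σ s h hs ht h20 h23 h24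
    set q := σ.active.length with hq
    set IC := iterCost c d k l.length with hIC
    have hdiv : 2 * (c * n) / 2 ^ (i + 1) = c * n / 2 ^ i := by
      rw [pow_succ, mul_comm (2 ^ i) 2, Nat.mul_div_mul_left _ _ (by norm_num)]
    -- One half of the potential pays for the checks that are active after this iteration, the other
    -- half for all later ones.
    have hdiv2 : c * n / 2 ^ i + c * n / 2 ^ i ≤ 2 * (c * n) / 2 ^ i := by
      rw [Nat.le_div_iff_mul_le (by positivity), ← two_mul, mul_assoc]
      exact Nat.mul_le_mul_left 2 (Nat.div_mul_le_self _ _)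
    refine Exec.mono (τ := (deepCost c d k l.length + branchCost c d k * 6 + 40) * (q + 1) +
      (IC * (c * n / 2 ^ i + c * n / 2 ^ i + j) + 1) + 1) (exec_loop_step ?_ ?_) ?_ fun _ => id
    · rw [one_mul_cast_le, h.one, h.ctl 24 (by omega), h24, if_neg (by omega)]
    swap
    · have h1 : IC * (c * n / 2 ^ i + c * n / 2 ^ i) ≤ IC * (2 * (c * n) / 2 ^ i) :=
        Nat.mul_le_mul_left IC hdiv2
      have h2 : (deepCost c d k l.length + branchCost c d k * 6 + 40) * (q + 1) + 1 ≤
        IC * (q + 1) := by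
        rw [hIC, iterCost]
        nlinarith
      nlinarith
    have hτ : deepCost c d k l.length * (q + 1) + ((branchCost c d k * (q + 1) * 6 + 1 + 20) + 1 + 1 + 1
        + 2) + 1 ≤ (deepCost c d k l.length + branchCost c d k * 6 + 40) * (q + 1) := by nlinarith
    refine exec_block_cons' _ _ hτ ((h.exec_deepProg hc hd₀ hr hk hs ht).mono le_rfl ?_)
    rintro s₁ ⟨σ₁, h₁, hs₁, ht₁, hsaved₁, hctl₁, hres, hact⟩
    rw [← hdeep] at hres
    refine exec_block_const (Exec.intro_state fun s₂ e₂ => ?_)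
    have h₂ : G.Rep σ₁ s₂ := e₂ ▸ h₁.setTemp _ (by omega) (by omega)
    have r10 : s₂.reg 10 = 0 := by simp [e₂]
    refine exec_block_cons' _ 1 le_rfl (exec_branch (fun hle => ?_) fun hlt => ?_)
    swap
    · rw [r10, h₂.ctl 20 le_rfl] at hlt
      refine (exec_const (τ := 0) (exec_block_nil (exec_loop_of_not_le (hhalt (h₂.setCtl (i := 24) 0
        (by omega)) (by simp)) ⟨_, h₂.setCtl (i := 24) 0 (by omega), hs₁.setCtl _, hsaved₁, ?_,
        ?_⟩))).mono (by omega) fun _ => id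
      · simp [hctl₁ 26 (by omega)]
      · simp only
        rw [deepLoop, hres, if_neg (by omega), Function.update_of_ne (by omega), if_neg (by omega)]
    rw [r10, h₂.ctl 20 le_rfl] at hle
    have h20' : σ₁.ctl 20 = 0 := by omega
    rw [if_pos h20'] at hres
    refine exec_block_const (exec_block_add (Exec.intro_state fun s₃ e₃ => ?_))
    have h₃ : G.Rep { σ₁ with ctl := Function.update σ₁.ctl 25 0 } s₃ :=
      e₃ ▸ (h₂.setCtl (i := 25) 0 (by omega)).setTemp _ (by omega) (by omega)
    have r11 : s₃.reg 11 = σ₁.active.length := by simp [e₃, h₂.activeLen, r10]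
    have h23' : σ₁.ctl 23 = 2 ^ i := by rw [hctl₁ 23 le_rfl, h23]
    refine exec_block_cons' (branchCost c d k * (q + 1) * 6 + 1) 14 (by omega) ?_
    -- The test on `c 2^(-i) γ n` becomes one on `|U| * 2 ^ i`. Lacking multiplication, the machine
    -- computes it by adding register `23` once per active check.
    refine (exec_forDown_nat (I := fun k s => s.reg 11 = k ∧ ∃ acc,
      G.Rep { σ₁ with ctl := Function.update σ₁.ctl 25 acc } s ∧
      acc + k * 2 ^ i = σ₁.active.length * 2 ^ i) 1 ?_ ?_ ⟨r11, 0, h₃, by omega⟩).mono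
      (by gcongr) ?_
    · rintro k s ⟨h11, acc, h, -⟩
      exact ⟨h.one, h11⟩
    · rintro k s ⟨h11, acc, h, hacc⟩
      refine exec_add (τ := 0) ?_
      have h' := (h.setTemp (i := 11) k (by omega) (by omega)).setCtl (i := 25) (acc + 2 ^ i)
        (by omega)
      have r25 : s.reg 25 = acc := by rw [h.ctl 25 (by omega)]; simp
      have r23 : s.reg 23 = 2 ^ i := by rw [h.ctl 23 (by omega)]; simp [h23']
      refine ⟨by simp, acc + 2 ^ i, by simpa [r25, r23] using h', ?_⟩
      rw [add_mul, one_mul] at hacc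
      omega
    rintro s₄ ⟨-, acc, h₄, hacc⟩
    rw [zero_mul, add_zero] at hacc
    subst hacc
    have r25 : s₄.reg 25 = σ₁.active.length * 2 ^ i := by rw [h₄.ctl 25 (by omega)]; simp
    have htest : r * (s₄.reg 25 : ℝ) ≤ (s₄.reg 0 : ℝ) ↔
        ¬ c * (2 : ℝ)⁻¹ ^ i * gammaConst c d₀ a b * n < ((G.unsat C₀ σ₁.word).card : ℝ) := by
      rw [h₄.reg_n, r25, hr, ← hs₁.length, not_lt, inv_pow,
        show (c : ℝ) * ((2 : ℝ) ^ i)⁻¹ * gammaConst c d₀ a b * n =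
          c * gammaConst c d₀ a b * n / (2 : ℝ) ^ i by field_simp, le_div_iff₀ (by positivity)]
      push_cast
      rfl
    by_cases hle' : r * (s₄.reg 25 : ℝ) ≤ (s₄.reg 0 : ℝ)
    · have hle'' := htest.1 hle'
      -- The passed test bounds the work of the next iteration; these bounds form the geometric
      -- series behind the linear running time.
      have hU : σ₁.active.length ≤ c * n / 2 ^ i := by
        rw [Nat.le_div_iff_mul_le (by positivity)]
        have h1 := hle'
        rw [h₄.reg_n, r25, hr] at h1
        have h2 : (c : ℝ) * gammaConst c d₀ a b * n ≤ c * n := by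
          rw [mul_right_comm]
          exact mul_le_of_le_one_right (by positivity) hγ
        exact_mod_cast h1.trans h2
      refine exec_block_cons' 12 1 (by omega) (exec_branch_of_le (τ := 11) hle' (exec_block_add ?_))
      have h₅ := h₄.setCtl (i := 23) (2 ^ i + 2 ^ i) (by omega)
      have r23 : s₄.reg 23 = 2 ^ i := by rw [h₄.ctl 23 (by omega)]; simp [h23']
      rw [r23]
      refine exec_block_cons' 2 1 (by omega) ((h₅.exec_testGo g).mono le_rfl ?_)
      intro s₆ h₆
      have hgo : g * n ≤ ((2 ^ i + 2 ^ i : ℕ) : ℝ) ↔ j = 0 := by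
        have := hg (i + 1) (by omega)
        rw [pow_succ, mul_two] at this
        push_cast
        rw [this]
        omega
      refine exec_block_nil (exec_block_nil (exec_block_nil ?_))
      refine (ih (i := i + 1) (by omega) (by omega) h₆ (hs₁.setCtl _) ht₁ ?_ ?_ ?_).mono ?_ ?_
      · simp [h20']
      · simp [pow_succ, mul_two]
      · simp [← hgo]
      · simp only
        rw [hdiv]
        gcongr
      · rintro s₇ ⟨σ₇, h₇, hs₇, hsaved₇, h26, hloop⟩
        refine ⟨σ₇, h₇, hs₇, hsaved₇.trans hsaved₁, ?_, ?_⟩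
        · rw [h26]
          simp [hctl₁ 26 (by omega)]
        · rw [deepLoop, hres]
          simp only
          rw [if_neg hle'']
          exact hloop
    · have hlt' := not_not.1 fun hcon => hle' (htest.2 hcon)
      refine exec_block_cons' 12 1 (by omega) (exec_branch_of_not_le (τ := 11) hle' (exec_block_const
        (exec_block_const (exec_block_nil (exec_block_nil (exec_block_nil ?_))))))
      have h₅ := (h₄.setCtl (i := 20) 1 (by omega)).setCtl (i := 24) 0 (by omega)
      refine exec_loop_of_not_le (hhalt h₅ (by simp)) ⟨_, h₅, hs₁.setCtl _, hsaved₁, ?_, ?_⟩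
      · simp [hctl₁ 26 (by omega)]
      · rw [deepLoop, hres]
        simp only
        rw [if_pos hlt', if_neg (by simp)]

theorem Rep.exec_guessRounds (hc : 0 < c) (hd₀ : 0 < d₀) (js : List ℕ) :
    ∀ {σ : DecoderData n m} {s : RamState}, G.Rep σ s → G.Settled C₀ σ →
    Exec (guessRounds c C₀ d₀ (js.map (· + 1))) s (js.length * ((deterCost c d + 3) * (m + 1)) + 1)
      fun s' => ∃ σ', G.Rep σ' s' ∧ G.Settled C₀ σ' ∧ σ'.saved = σ.saved ∧ σ'.ctl = σ.ctl ∧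
        σ'.word = (js.map (guess c d₀)).foldl (G.deterFlip C₀ d₀) σ.word := by
  induction js with
  | nil =>
    intro σ s h hs
    exact exec_skip ⟨σ, h, hs, rfl, rfl, rfl⟩
  | cons j js ih =>
    intro σ s h hs
    rw [List.map_cons, guessRounds, List.length_cons, List.map_cons, List.foldl_cons]
    have hm : σ.active.length ≤ m := by simpa using h.nodup.length_le_card
    refine exec_block_cons' (deterCost c d * (m + 1))
      (js.length * ((deterCost c d + 3) * (m + 1)) + 1 + 2) (by nlinarith)
      ((h.exec_deterRound hc hd₀ hs j).mono (Nat.mul_le_mul_left _ (by omega)) ?_)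
    rintro s₁ ⟨A, T, h₁, hs₁, -⟩
    refine exec_block_cons' _ 1 le_rfl ((ih h₁ hs₁).mono le_rfl ?_)
    rintro s₂ h₂
    exact exec_block_nil h₂

theorem Rep.exec_finalTest {a e : ℝ} (he : ∀ k : ℕ, e * k ≤ n ↔ (k : ℝ) ≤ a * n) (h : G.Rep σ s)
    (hs : G.Settled C₀ σ) (h26 : σ.ctl 26 = 0) :
    Exec (finalTest c d e) s (n * 20 + 30) fun s' => ∃ ctl, G.Rep { σ with ctl := ctl } s' ∧
      ctl 26 = if σ.ctl 20 = 0 ∧ (G.unsat C₀ σ.word).card = 0 ∧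
        (hammingDist σ.saved σ.word : ℝ) ≤ a * n then 1 else 0 := by
  unfold finalTest
  refine exec_block_const (Exec.intro_state fun s₁ e₁ => ?_)
  have h₁ : G.Rep σ s₁ := e₁ ▸ h.setTemp _ (by omega) (by omega)
  have r10 : s₁.reg 10 = 0 := by simp [e₁]
  refine exec_block_cons' (n * 20 + 20) 1 (by omega) (exec_branch (fun h1 => exec_branch (fun h2 => ?_)
    fun h2 => ?_) fun h1 => ?_)
  · rw [r10, h₁.ctl 20 le_rfl] at h1
    rw [r10, h₁.activeLen, hs.length] at h2
    refine exec_block_cons' (n * 20 + 10) 5 (by omega) (h₁.exec_compareWords.mono le_rfl ?_)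
    rintro s₂ ⟨h₂, r12⟩
    by_cases hdist : e * (s₂.reg 12 : ℝ) ≤ (s₂.reg 0 : ℝ)
    · refine exec_block_cons' 2 1 (by omega) (exec_branch_of_le hdist (exec_const (τ := 0)
        (exec_block_nil (exec_block_nil ⟨_, h₂.setCtl (i := 26) 1 (by omega), ?_⟩))))
      rw [h₂.reg_n, r12, he] at hdist
      rw [Function.update_self, if_pos ⟨by omega, by omega, hdist⟩]
    · refine exec_block_cons' 2 1 (by omega) (exec_branch_of_not_le hdist (exec_skip (τ := 0)
        (exec_block_nil (exec_block_nil ⟨_, h₂, ?_⟩))))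
      rw [h₂.reg_n, r12, he] at hdist
      rw [h26, if_neg fun hcon => hdist hcon.2.2]
  · rw [r10, h₁.activeLen, hs.length] at h2
    exact exec_skip (exec_block_nil ⟨_, h₁, by rw [h26, if_neg (by omega)]⟩)
  · rw [r10, h₁.ctl 20 le_rfl] at h1
    exact exec_skip (exec_block_nil ⟨_, h₁, by rw [h26, if_neg (by omega)]⟩)

end TannerGraph

/-! ### Correctness and running time of the program for `MainDecode` -/

/-! ### The subroutines of MainDecode draw no random numbers -/

namespace RamProg

theorem deterministic_block {l : List RamProg} (h : ∀ p ∈ l, p.Deterministic) :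
    (block l).Deterministic := by
  induction l with
  | nil => trivial
  | cons p l ih => exact ⟨h p (by simp), ih fun q hq => h q (by simp [hq])⟩

theorem deterministic_forDown {p : RamProg} (h : p.Deterministic) : (forDown p).Deterministic :=
  deterministic_block (by simp [h, Deterministic])

theorem deterministic_caseBits {e k A : ℕ} {f : Word k → RamProg} (h : ∀ w, (f w).Deterministic) :
    (caseBits e k A f).Deterministic := by
  induction k generalizing A with
  | zero => exact h _
  | succ k ih =>
    refine deterministic_block ?_
    simp only [List.mem_cons, List.not_mem_nil, or_false, forall_eq_or_imp, forall_eq]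
    exact ⟨trivial, trivial, ih fun w => h _, ih fun w => h _⟩

theorem deterministic_pushCheck (c d : ℕ) : (pushCheck c d).Deterministic := by
  simp [pushCheck, block, Deterministic]

theorem deterministic_flipProg (c d : ℕ) : (flipProg c d).Deterministic := by
  refine deterministic_block ?_
  simp only [List.mem_cons, List.not_mem_nil, or_false, forall_eq_or_imp, forall_eq]
  refine ⟨trivial, trivial, trivial, deterministic_block fun p hp => ?_⟩
  obtain ⟨j, -, rfl⟩ := List.mem_map.1 hp
  exact ⟨trivial, deterministic_pushCheck c d, trivial⟩

theorem deterministic_compress (c : ℕ) {d : ℕ} (C₀ : Submodule (ZMod 2) (Word d)) :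
    (compress c C₀).Deterministic := by
  refine deterministic_block ?_
  simp only [List.mem_cons, List.not_mem_nil, or_false, forall_eq_or_imp, forall_eq]
  refine ⟨trivial, trivial, trivial, deterministic_forDown (deterministic_block ?_), trivial, trivial,
    deterministic_forDown ⟨trivial, deterministic_pushCheck c d, trivial⟩⟩
  simp only [List.mem_cons, List.not_mem_nil, or_false, forall_eq_or_imp, forall_eq]
  refine ⟨trivial, trivial, trivial, trivial, deterministic_caseBits fun w => ?_⟩
  split_ifs <;> simp [block, Deterministic]

theorem deterministic_deterRound (c : ℕ) {d : ℕ} (C₀ : Submodule (ZMod 2) (Word d)) (d₀ j : ℕ) :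
    (deterRound c C₀ d₀ j).Deterministic := by
  refine ⟨⟨trivial, trivial, deterministic_forDown ⟨trivial, deterministic_caseBits fun w => ?_,
    trivial⟩, trivial⟩, ⟨trivial, trivial, deterministic_forDown ⟨trivial, trivial, trivial, trivial,
    ⟨trivial, ⟨⟨⟨deterministic_flipProg c d, trivial, trivial, trivial⟩, trivial⟩, trivial⟩,
    trivial⟩, trivial⟩, trivial, trivial⟩, deterministic_compress c C₀, trivial⟩
  unfold voteLeaf
  rcases voteIndex C₀ w with _ | i
  · trivial
  · simp only
    split_ifs <;> simp [block, Deterministic]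

theorem deterministic_branchProg (c : ℕ) {d : ℕ} (C₀ : Submodule (ZMod 2) (Word d)) (d₀ : ℕ) (r : ℝ)
    (js : List ℕ) : (branchProg c C₀ d₀ r js).Deterministic := by
  induction js with
  | nil => trivial
  | cons j js ih => exact ⟨deterministic_deterRound c C₀ d₀ j, ⟨ih, trivial⟩, trivial⟩

theorem deterministic_tryBranches (c : ℕ) {d : ℕ} (C₀ : Submodule (ZMod 2) (Word d)) (d₀ : ℕ) (r : ℝ)
    (l : List (List ℕ)) (i : ℕ) : (tryBranches c C₀ d₀ r i l).Deterministic := by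
  induction l generalizing i with
  | nil => trivial
  | cons js l ih =>
    refine ⟨⟨trivial, deterministic_branchProg c C₀ d₀ r js, ?_, ⟨trivial, trivial,
      deterministic_forDown ⟨trivial, deterministic_flipProg c d, trivial⟩, trivial, trivial⟩,
      deterministic_compress c C₀, trivial⟩, ih _, trivial⟩
    simp [updateBest, block, Deterministic]

theorem deterministic_replay (c : ℕ) {d : ℕ} (C₀ : Submodule (ZMod 2) (Word d)) (d₀ : ℕ) (r : ℝ)
    (l : List (List ℕ)) (i : ℕ) : (replay c C₀ d₀ r i l).Deterministic := by
  induction l generalizing i with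
  | nil => trivial
  | cons js l ih => exact ⟨trivial, ⟨deterministic_branchProg c C₀ d₀ r js, ih _⟩, trivial⟩

theorem deterministic_deepIter (c : ℕ) {d : ℕ} (C₀ : Submodule (ZMod 2) (Word d)) (d₀ : ℕ) (r g : ℝ)
    (l : List (List ℕ)) : (deepIter c C₀ d₀ r g l).Deterministic :=
  ⟨⟨trivial, trivial, deterministic_tryBranches c C₀ d₀ r l 0, trivial,
    ⟨trivial, trivial, deterministic_replay c C₀ d₀ r l 0, trivial⟩, trivial, trivial⟩, trivial,
    ⟨⟨trivial, trivial, deterministic_forDown trivial,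
      ⟨⟨trivial, ⟨trivial, trivial⟩, trivial⟩, trivial, trivial, trivial⟩, trivial⟩, trivial⟩, trivial⟩

theorem deterministic_guessRounds (c : ℕ) {d : ℕ} (C₀ : Submodule (ZMod 2) (Word d)) (d₀ : ℕ)
    (js : List ℕ) : (guessRounds c C₀ d₀ js).Deterministic := by
  induction js with
  | nil => trivial
  | cons j js ih => exact ⟨deterministic_deterRound c C₀ d₀ j, ih, trivial⟩

theorem deterministic_tryMains (c : ℕ) {d : ℕ} (C₀ : Submodule (ZMod 2) (Word d)) (d₀ : ℕ)
    (r g e : ℝ) (l L : List (List ℕ)) : (tryMains c C₀ d₀ r g e l L).Deterministic := by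
  induction L with
  | nil => trivial
  | cons js L ih =>
    refine ⟨⟨⟨trivial, trivial, deterministic_forDown ⟨trivial, trivial, trivial⟩, trivial⟩,
      ⟨trivial, trivial, deterministic_forDown ⟨trivial, trivial, deterministic_pushCheck c d, trivial⟩,
        deterministic_compress c C₀, trivial⟩,
      deterministic_guessRounds c C₀ d₀ js, trivial,
      ⟨trivial, trivial, ⟨trivial, trivial⟩, deterministic_deepIter c C₀ d₀ r g l, trivial⟩,
      ⟨trivial, ⟨⟨⟨⟨trivial, trivial, trivial, deterministic_forDown ?_, trivial⟩,
        ⟨trivial, trivial⟩, trivial⟩, trivial⟩, trivial⟩, trivial⟩, trivial⟩, ⟨trivial, ih⟩, trivial⟩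
    simp [block, Deterministic]

theorem deterministic_mainProgram (c : ℕ) {d : ℕ} (C₀ : Submodule (ZMod 2) (Word d)) (d₀ : ℕ)
    (r g e : ℝ) (l L : List (List ℕ)) : (mainProgram c C₀ d₀ r g e l L).Deterministic :=
  ⟨trivial, ⟨trivial, trivial, deterministic_forDown ⟨trivial, trivial, trivial⟩, trivial⟩,
    deterministic_tryMains c C₀ d₀ r g e l L, trivial, trivial, trivial⟩

end RamProg

/-! ### Assembling MainDecode, and its constants -/

namespace TannerGraph

variable {c d n m : ℕ} {G : TannerGraph c d n m} {σ : DecoderData n m} {s : RamState}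
  {C₀ : Submodule (ZMod 2) (Word d)} {d₀ : ℕ} {r B : ℝ}

/-- The number of iterations of the second inner loop of `MainDecode`. -/
def deepIterations (c d₀ : ℕ) (a b : ℝ) (n : ℕ) : ℕ :=
  (⌈Real.logb 2 (gammaConst c d₀ a b * n)⌉ + 1).toNat

open Classical in
/-- `MainDecode` for one sequence of guesses. -/
def mainTry (G : TannerGraph c d n m) (C₀ : Submodule (ZMod 2) (Word d)) (d₀ : ℕ) (a b : ℝ)
    (x : Word n) (qs : List ℝ) : Option (Word n) :=
  match G.deepLoop C₀ d₀ a b (deepIterations c d₀ a b n) 1 (qs.foldl (G.deterFlip C₀ d₀) x) with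
  | none => none
  | some z => if (G.unsat C₀ z).card = 0 ∧ (hammingDist x z : ℝ) ≤ a * n then some z else none

/-- What the constants in the tests of the program for `MainDecode` have to satisfy. -/
structure Calibrated (c d₀ n : ℕ) (a b r g e : ℝ) : Prop where
  unsat : ∀ k : ℕ, r * k ≤ n ↔ (k : ℝ) ≤ c * gammaConst c d₀ a b * n
  gamma_le : gammaConst c d₀ a b ≤ 1
  go : ∀ i, 0 < i → (g * n ≤ (2 : ℝ) ^ i ↔ deepIterations c d₀ a b n < i)
  dist : ∀ k : ℕ, e * k ≤ n ↔ (k : ℝ) ≤ a * n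
  iterations_le : deepIterations c d₀ a b n ≤ n + 1

/-- The constant in the running time of `MainDecode` for one sequence of guesses. -/
def tryMainCost (c d k N k' : ℕ) : ℕ :=
  (7 * d + 200) + k' * (deterCost c d + 3) + iterCost c d k N * (c + 1)

theorem Rep.exec_tryMain {a b g e : ℝ} (hc : 0 < c) (hd₀ : 0 < d₀)
    (hcal : Calibrated c d₀ n a b r g e)
    {l : List (List ℕ)} {k : ℕ} (hk : ∀ js ∈ l, js.length = k)
    (hdeep : ∀ x, G.deepFlip C₀ d₀ a b x = (l.foldl (keepMin
      (fun js => G.deepBranch C₀ d₀ (c * gammaConst c d₀ a b * n) (js.map (guess c d₀)) x)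
      (fun z => (G.unsat C₀ z).card)) (m + 1, none)).2) (js : List ℕ)
    (h : G.Rep σ s) (hcand : σ.cand = []) (hvotes : σ.votes = 0) (h26 : σ.ctl 26 = 0) :
    Exec (tryMain c C₀ d₀ r g e (l.map fun js => js.map (· + 1)) (js.map (· + 1))) s
      (tryMainCost c d k l.length js.length * (2 * n + m + 2)) fun s' =>
      ∃ σ', G.Rep σ' s' ∧ σ'.cand = [] ∧ σ'.votes = 0 ∧ σ'.saved = σ.saved ∧
        ((σ'.ctl 26 = 1 ∧ G.mainTry C₀ d₀ a b σ.saved (js.map (guess c d₀)) = some σ'.word) ∨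
          (σ'.ctl 26 = 0 ∧ G.mainTry C₀ d₀ a b σ.saved (js.map (guess c d₀)) = none)) := by
  unfold tryMain
  set J := deepIterations c d₀ a b n with hJ
  set IC := iterCost c d k l.length with hIC
  have hcost : (n * 10 + 10) + ((7 * d + 100) * (m + 1) +
      (js.length * ((deterCost c d + 3) * (m + 1)) + 1 +
        (((IC * (m + 2 * (c * n) / 2 ^ 1 + J) + 1) + 1 + 1 + 3 + 2 + 2) + ((n * 20 + 30) + 1 + 1) + 1 + 2)
        + 1) + 1) + 1 ≤
      tryMainCost c d k l.length js.length * (2 * n + m + 2) := by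
    have h1 : 2 * (c * n) / 2 ^ 1 = c * n := by
      rw [pow_one, Nat.mul_div_cancel_left _ (by norm_num)]
    rw [h1, tryMainCost, ← hIC]
    have h2 : IC * (m + c * n + J) ≤ IC * (c + 1) * (2 * n + m + 2) := by
      rw [mul_assoc]
      refine Nat.mul_le_mul_left _ ?_
      have := hcal.iterations_le
      nlinarith [Nat.zero_le (c * n), Nat.zero_le (c * m)]
    have h3 : js.length * ((deterCost c d + 3) * (m + 1)) ≤
        js.length * (deterCost c d + 3) * (2 * n + m + 2) := by
      rw [← mul_assoc]
      exact Nat.mul_le_mul_left _ (by omega)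
    have h4 : 0 ≤ d * n := Nat.zero_le _
    nlinarith
  refine exec_block_cons' _ _ hcost (h.exec_restoreWord.mono le_rfl ?_)
  intro s₁ h₁
  refine exec_block_cons' _ _ le_rfl (h₁.exec_refresh.mono le_rfl ?_)
  rintro s₂ ⟨A, h₂, hA, hlen⟩
  refine exec_block_cons' _ _ le_rfl ((h₂.exec_guessRounds hc hd₀ js
    ⟨hcand, hvotes, hA, hlen⟩).mono le_rfl ?_)
  rintro s₃ ⟨σ₃, h₃, hs₃, hsaved₃, hctl₃, hword₃⟩
  refine exec_block_const ?_
  have h₄ := h₃.setTrail [] (k := 0) rfl trivial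
  have hs₄ : G.Settled C₀ { σ₃ with trail := [] } := ⟨hs₃.cand, hs₃.votes, hs₃.active, hs₃.length⟩
  refine exec_block_cons' _ _ le_rfl ?_
  refine exec_block_const (exec_block_const (exec_block_cons' 2 (IC * (m + 2 * (c * n) / 2 ^ 1 + J) + 1 + 1 + 1)
    (by omega) ((((h₄.setCtl (i := 20) 0 le_rfl).setCtl (i := 23) 2 (by omega)).exec_testGo g).mono le_rfl ?_)))
  intro s₅ h₅
  have hm : σ₃.active.length ≤ m := by simpa using h₃.nodup.length_le_card
  refine exec_block_cons' (IC * (m + 2 * (c * n) / 2 ^ 1 + J) + 1) 1 le_rfl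
    ((h₅.exec_deepLoop hc hd₀ hcal.unsat hcal.gamma_le hk hdeep hcal.go J (i := 1) one_pos
      (by omega) ((hs₄.setCtl _).setCtl _ |>.setCtl _) rfl (by simp) (by simp) ?_).mono ?_ ?_)
  -- The first test of `testGo`, with the power `2`, also covers the case that the loop has no
  -- iterations.
  · have := hcal.go 1 one_pos
    rw [pow_one, ← hJ] at this
    simp [this]
  · simp only
    gcongr
  rintro s₆ ⟨σ₆, h₆, hs₆, hsaved₆, h26', hloop⟩
  have h26'' : σ₆.ctl 26 = 0 := by
    rw [h26']
    simp [hctl₃, h26]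
  have hsaved : σ₆.saved = σ.saved := hsaved₆.trans hsaved₃
  simp only [hword₃] at hloop
  refine exec_block_nil (exec_block_cons' (n * 20 + 30) 1 le_rfl
    ((h₆.exec_finalTest hcal.dist hs₆ h26'').mono le_rfl ?_))
  rintro s₇ ⟨ctl, h₇, hctl⟩
  refine exec_block_nil ⟨_, h₇, hs₆.cand, hs₆.votes, hsaved, ?_⟩
  simp only [mainTry]
  rw [← hJ, hloop]
  rw [hsaved] at hctl
  split_ifs at hctl with hif
  · left
    rw [if_pos hif.1]
    simp only
    exact ⟨hctl, by rw [if_pos hif.2]⟩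
  · right
    refine ⟨hctl, ?_⟩
    by_cases h20 : σ₆.ctl 20 = 0
    · rw [if_pos h20]
      simp only
      rw [if_neg fun hcon => hif ⟨h20, hcon⟩]
    · rw [if_neg h20]

theorem Rep.exec_tryMains {a b g e : ℝ} (hc : 0 < c) (hd₀ : 0 < d₀)
    (hcal : Calibrated c d₀ n a b r g e)
    {l : List (List ℕ)} {k : ℕ} (hk : ∀ js ∈ l, js.length = k)
    (hdeep : ∀ x, G.deepFlip C₀ d₀ a b x = (l.foldl (keepMin
      (fun js => G.deepBranch C₀ d₀ (c * gammaConst c d₀ a b * n) (js.map (guess c d₀)) x)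
      (fun z => (G.unsat C₀ z).card)) (m + 1, none)).2) {k' : ℕ} (L : List (List ℕ))
    (hL : ∀ js ∈ L, js.length = k') : ∀ {σ : DecoderData n m} {s : RamState},
    G.Rep σ s → σ.cand = [] → σ.votes = 0 → σ.ctl 26 = 0 →
    Exec (tryMains c C₀ d₀ r g e (l.map fun js => js.map (· + 1)) (L.map fun js => js.map (· + 1))) s
      (L.length * (tryMainCost c d k l.length k' * (2 * n + m + 2) + 5) + 1) fun s' =>
      ∃ σ', G.Rep σ' s' ∧
        ((σ'.ctl 26 = 1 ∧ L.findSome? (fun js => G.mainTry C₀ d₀ a b σ.saved (js.map (guess c d₀))) =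
          some σ'.word) ∨
        (σ'.ctl 26 = 0 ∧ L.findSome? (fun js => G.mainTry C₀ d₀ a b σ.saved (js.map (guess c d₀))) =
          none)) := by
  induction L with
  | nil =>
    intro σ s h _ _ h26
    exact exec_skip ⟨σ, h, Or.inr ⟨h26, rfl⟩⟩
  | cons js L ih =>
    intro σ s h hcand hvotes h26
    rw [List.map_cons, tryMains, List.length_cons, List.findSome?_cons]
    have hlen : js.length = k' := hL js (by simp)
    refine exec_block_cons' (tryMainCost c d k l.length k' * (2 * n + m + 2))
      (L.length * (tryMainCost c d k l.length k' * (2 * n + m + 2) + 5) + 1 + 1 + 1 + 1)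
      (by rw [add_mul L.length, one_mul]; omega)
      ((h.exec_tryMain hc hd₀ hcal hk hdeep js hcand hvotes h26).mono (by rw [hlen]) ?_)
    rintro s₁ ⟨σ₁, h₁, hcand₁, hvotes₁, hsaved₁, hres⟩
    refine exec_block_cons' _ 1 le_rfl (exec_branch (fun hle => ?_) fun hlt => ?_)
    · rw [h₁.one, h₁.ctl 26 (by omega)] at hle
      rcases hres with ⟨h1, h2⟩ | ⟨h1, -⟩
      · refine exec_skip (exec_block_nil ⟨σ₁, h₁, Or.inl ⟨h1, ?_⟩⟩)
        rw [h2]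
      · omega
    · rw [h₁.one, h₁.ctl 26 (by omega)] at hlt
      rcases hres with ⟨h1, -⟩ | ⟨h1, h2⟩
      · omega
      · refine (ih (fun js hj => hL js (List.mem_cons_of_mem _ hj)) h₁ hcand₁ hvotes₁ h1).mono
          le_rfl ?_
        rintro s₂ h₂
        rw [h2, ← hsaved₁]
        exact exec_block_nil h₂

theorem exec_mainProgram {a b g e : ℝ} (hc : 0 < c) (hd₀ : 0 < d₀)
    (hcal : Calibrated c d₀ n a b r g e)
    {l : List (List ℕ)} {k : ℕ} (hk : ∀ js ∈ l, js.length = k)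
    (hdeep : ∀ x, G.deepFlip C₀ d₀ a b x = (l.foldl (keepMin
      (fun js => G.deepBranch C₀ d₀ (c * gammaConst c d₀ a b * n) (js.map (guess c d₀)) x)
      (fun z => (G.unsat C₀ z).card)) (m + 1, none)).2) {k' : ℕ} (L : List (List ℕ))
    (hL : ∀ js ∈ L, js.length = k') (x : Word n)
    (hmain : G.mainDecode C₀ d₀ a b x =
      L.findSome? fun js => G.mainTry C₀ d₀ a b x (js.map (guess c d₀))) :
    Exec (mainProgram c C₀ d₀ r g e (l.map fun js => js.map (· + 1))
      (L.map fun js => js.map (· + 1))) (G.initState x)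
      ((L.length * (tryMainCost c d k l.length k' + 5) + 30) * (2 * n + m + 2)) fun s' =>
      G.ramOutput ([], s') = some (G.mainDecode C₀ d₀ a b x) := by
  have hcost : (n * 10 + 10) + ((L.length * (tryMainCost c d k l.length k' * (2 * n + m + 2) + 5) + 1)
      + (1 + 2 + 2) + 1) + 1 + 2 ≤
      (L.length * (tryMainCost c d k l.length k' + 5) + 30) * (2 * n + m + 2) := by
    have : L.length * (tryMainCost c d k l.length k' * (2 * n + m + 2) + 5) ≤
        L.length * (tryMainCost c d k l.length k' + 5) * (2 * n + m + 2) := by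
      rw [mul_assoc]
      exact Nat.mul_le_mul_left _ (by nlinarith)
    nlinarith
  refine Exec.mono (exec_block_const (exec_block_cons' (n * 10 + 10)
    ((L.length * (tryMainCost c d k l.length k' * (2 * n + m + 2) + 5) + 1) + (1 + 2 + 2) + 1) le_rfl
    ((G.rep_initState x).exec_saveWord.mono le_rfl ?_))) hcost fun _ => id
  intro s₁ h₁
  refine exec_block_cons' (L.length * (tryMainCost c d k l.length k' * (2 * n + m + 2) + 5) + 1)
    (1 + 2 + 2) (by omega) ((h₁.exec_tryMains hc hd₀ hcal hk hdeep L hL rfl rfl rfl).mono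
    le_rfl ?_)
  rintro s₂ ⟨σ₂, h₂, hres⟩
  refine exec_block_const (exec_block_add (exec_block_nil ?_))
  simp only [initData] at hres
  rw [← hmain] at hres
  have h26 := h₂.ctl 26 (by omega)
  rcases hres with ⟨h1, hx⟩ | ⟨h1, hx⟩
  · rw [hx, TannerGraph.ramOutput, if_neg (by simp [h26, h1])]
    congr 2
    ext u
    rw [RamState.setReg_arr, RamState.setReg_arr, h₂.word, ZMod.natCast_zmod_val]
  · rw [hx, TannerGraph.ramOutput, if_pos (by simp [h26, h1])]

/-- A halted configuration does not change any more, so any time beyond the bound will do. -/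
theorem ramProb_of_exec {P : RamProg} {x : Word n} {τ : ℕ} {o : Option (Word n)}
    (h : Exec P (G.initState x) τ fun s => G.ramOutput ([], s) = some o) {T : ℕ} (hT : τ ≤ T) :
    G.ramProb P T x o = 1 := by
  obtain ⟨k, hk, s', hrun, hout⟩ := h
  have hhalt : ∀ T, run T ([], s') = PMF.pure ([], s') := by
    intro T
    induction T with
    | zero => rfl
    | succ T ih => rw [run, step, PMF.pure_bind, ih]
  have := hrun [] (T - k)
  rw [Nat.sub_add_cancel (hk.trans hT), hhalt] at this
  rw [ramProb, this, PMF.pure_map, hout, PMF.pure_apply, if_pos rfl]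

/-- The thresholds are linear in `n`, so each test compares a real multiple of a register with
another register. The factor `4` combines the `+ 1` in `r'` with the strict inequality: `⌈log₂ (γ
n)⌉ + 1 < i` means `log₂ (γ n) ≤ i - 2`. -/
theorem calibrated {a b : ℝ} (hc : 0 < c) (hn : 0 < n) (hγ0 : 0 < gammaConst c d₀ a b)
    (hγ1 : gammaConst c d₀ a b ≤ 1) (ha : 0 < a) :
    Calibrated c d₀ n a b (1 / (c * gammaConst c d₀ a b)) (4 * gammaConst c d₀ a b) (1 / a) := by
  set γ := gammaConst c d₀ a b with hγ
  have hn' : (0 : ℝ) < n := by exact_mod_cast hn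
  have hc' : (0 : ℝ) < c := by exact_mod_cast hc
  refine ⟨fun k => ?_, hγ1, fun i hi => ?_, fun k => ?_, ?_⟩
  · rw [one_div, inv_mul_le_iff₀ (by positivity)]
  · rw [deepIterations, ← hγ]
    have h1 : 4 * γ * n ≤ (2 : ℝ) ^ i ↔ Real.logb 2 (γ * n) ≤ ((i : ℤ) - 2 : ℤ) := by
      rw [Real.logb_le_iff_le_rpow (by norm_num) (by positivity), Real.rpow_intCast,
        zpow_sub₀ (by norm_num), zpow_natCast, le_div_iff₀ (by positivity)]
      norm_num
      constructor <;> intro h <;> linarith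
    rw [h1, ← Int.ceil_le]
    omega
  · rw [one_div, inv_mul_le_iff₀ ha]
  · rw [deepIterations, ← hγ]
    have h1 : Real.logb 2 (γ * n) ≤ (n : ℤ) := by
      rw [Real.logb_le_iff_le_rpow (by norm_num) (by positivity), Real.rpow_intCast, zpow_natCast]
      have h2 : (n : ℝ) ≤ 2 ^ n := by exact_mod_cast Nat.lt_two_pow_self.le
      nlinarith
    have := Int.ceil_le.2 h1
    omega

/-- `MainDecode` runs in linear time. -/
theorem exists_mainProgram {a b : ℝ} (hc : 0 < c) (hd : 0 < d) (hd₀ : 0 < d₀)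
    (hγ0 : 0 < gammaConst c d₀ a b) (hγ1 : gammaConst c d₀ a b ≤ 1) (ha : 0 < a)
    (C₀ : Submodule (ZMod 2) (Word d)) :
    ∃ (Q : RamProg) (K : ℕ), Q.Deterministic ∧ ∀ (n m : ℕ) (G : TannerGraph c d n m), 0 < n →
      ∀ x : Word n, G.ramProb Q (K * n) x (G.mainDecode C₀ d₀ a b x) = 1 := by
  set k := ⌈Real.log ((b * d₀ - 1) / (2 * (d₀ - 1))) / Real.log (1 - rateConst c d₀ b)⌉₊ with hk
  set k' := ⌈Real.log (gammaConst c d₀ a b) / Real.log (1 - rateConst c d₀ b)⌉₊ with hk'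
  set l := natSeqs (c * d₀) k with hl
  set L := natSeqs (c * d₀) k' with hL
  refine ⟨mainProgram c C₀ d₀ (1 / (c * gammaConst c d₀ a b)) (4 * gammaConst c d₀ a b) (1 / a)
      (l.map fun js => js.map (· + 1)) (L.map fun js => js.map (· + 1)),
    (L.length * (tryMainCost c d k l.length k' + 5) + 30) * (c + 4),
    deterministic_mainProgram _ _ _ _ _ _ _ _, fun n m G hn x => ?_⟩
  refine ramProb_of_exec (exec_mainProgram hc hd₀ (calibrated hc hn hγ0 hγ1 ha)
    (fun js hjs => length_of_mem_natSeqs hjs) (fun x => ?_) L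
    (fun js hjs => length_of_mem_natSeqs hjs) x ?_) ?_
  · rw [deepFlip_eq, ← hk, guessSeqs_eq_map, List.foldl_map]
    rfl
  · rw [mainDecode, ← hk', guessSeqs_eq_map, List.findSome?_map]
    rfl
  · have hm : m ≤ c * n := by
      rw [← G.mul_right_eq]
      exact Nat.le_mul_of_pos_left m hd
    rw [mul_assoc]
    exact Nat.mul_le_mul_left _ (by nlinarith)

end TannerGraph

/-! ### The main theorem -/

theorem mainTheorem5 (c d d₀ : ℕ) (α δ ε : ℝ) (C₀ : Submodule (ZMod 2) (Word d))
    (hc : 0 < c) (hd : 0 < d) (hα : 0 < α) (hα1 : α ≤ 1) (hδ : 0 < δ) (hδ1 : δ ≤ 1)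
    (hd₀ : IsMinDist C₀ d₀) (hδd₀ : 2 < δ * d₀)
    (hε : 0 < ε) (hε1 : ε < δ - 2 / d₀) :
    (δ < 1 → ∃! k : ℝ, 1 < k ∧ sizeExpansion δ k = 2 / d₀ + ε) ∧
    ∃ (P Q : RamProg) (K n₀ : ℕ) (η : ℕ → ℝ), Tendsto η atTop (𝓝 0) ∧
      ∀ n m : ℕ, n₀ ≤ n → ∀ G : TannerGraph c d n m, G.IsExpander α δ →
        G.ImplementsRandDecode C₀ d₀ P ∧
        G.ImplementsMainDecode C₀ d₀ (sizeExpansionInv δ (2 / d₀ + ε) * α) (2 / d₀ + ε) Q ∧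
        ∀ x y : Word n, y ∈ G.tannerCode C₀ →
          (hammingDist x y : ℝ) ≤ sizeExpansionInv δ (2 / d₀ + ε) * α * n →
            ENNReal.ofReal (1 - η n) ≤ G.ramProb P (K * n) x (some y) ∧
            G.mainDecode C₀ d₀ (sizeExpansionInv δ (2 / d₀ + ε) * α) (2 / d₀ + ε) x = some y ∧
            G.ramProb Q (K * n) x (some y) = 1 := by
  have hd₀' : 0 < d₀ := by
    rcases Nat.eq_zero_or_pos d₀ with h | h
    · simp [h] at hδd₀
      linarith
    · exact h
  have hd₀R : (0 : ℝ) < d₀ := by exact_mod_cast hd₀'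
  have hb0 : 0 < 2 / (d₀ : ℝ) + ε := by positivity
  have hbδ : 2 / (d₀ : ℝ) + ε < δ := by linarith
  have hb2 : 2 < (2 / (d₀ : ℝ) + ε) * d₀ := by
    rw [add_mul, div_mul_cancel₀ _ hd₀R.ne']
    linarith [mul_pos hε hd₀R]
  have hle : (d₀ : ℝ) ≤ d := by exact_mod_cast hd₀.le_length
  refine ⟨fun h => existsUnique_sizeExpansion hb0 hbδ h, ?_⟩
  -- If there are no large expanders with these parameters, any programs will do. Otherwise `δ = 1`
  -- and `a ≥ 1` can be refuted below.
  by_cases void : ∃ n₀ : ℕ, ∀ n m, n₀ ≤ n → ∀ G : TannerGraph c d n m, ¬ G.IsExpander α δ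
  · obtain ⟨n₀, h⟩ := void
    exact ⟨RamProg.skip, RamProg.skip, 0, n₀, 0, tendsto_const_nhds,
      fun n m hn G hG => absurd hG (h n m hn G)⟩
  rcases hδ1.eq_or_lt with rfl | hδ1
  · refine absurd ⟨⌈2 / α⌉₊ + 1, fun n m hn G => G.not_isExpander_one hc ?_ ?_ (by omega)⟩ void
    · rw [one_mul] at hδd₀
      exact_mod_cast (by linarith : (1 : ℝ) < d)
    · rw [mul_comm, ← div_le_iff₀ hα]
      exact (Nat.le_ceil _).trans (by exact_mod_cast (by omega : ⌈2 / α⌉₊ ≤ n))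
  have hk := (sizeExpansionInv_spec hb0 hbδ hδ1).1
  -- The decoder runs with `δ'`, but expansion of sets up to size `a n` is available only for `b' <
  -- δ'`; the analysis therefore uses `b'`.
  obtain ⟨b', hs⟩ := exists_isSlack (c := c) hc (hbδ.trans hδ1).le hb2
  obtain ⟨n₀, hexp⟩ := TannerGraph.isExpander_of_lt (c := c) (d := d) hα hs.pos' hs.lt hbδ hδ1
  set b := 2 / (d₀ : ℝ) + ε with hb
  set a := sizeExpansionInv δ b * α with ha
  have ha0 : 0 < a := mul_pos (one_pos.trans hk) hα
  have hb'd : 1 < b' * d := by nlinarith [hs.two_lt, hs.pos', mul_le_mul_of_nonneg_left hle hs.pos'.le]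
  -- Expansion of the whole left side is impossible because `b' d > 1`, so `a ≥ 1` contradicts the
  -- existence of large graphs.
  rcases le_or_gt 1 a with ha1 | ha1
  · exact absurd ⟨n₀ + 1, fun n m hn G hG =>
      ((hexp n m (by omega) G hG).lt_one hc (by omega) hb'd).not_ge ha1⟩ void
  have hκ0 : 0 < b' - 2 / d₀ := by
    rw [sub_pos, div_lt_iff₀ hd₀R]
    exact hs.two_lt
  have hκ1 : b' - 2 / d₀ ≤ 1 := by linarith [hs.lt, div_pos two_pos hd₀R]
  obtain ⟨Q, K₁, hQ, hQrun⟩ := TannerGraph.exists_mainProgram hc hd hd₀' (hs.gammaConst_pos ha0)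
    ((hs.gammaConst_le ha0).trans ha1.le) ha0 C₀
  obtain ⟨K₂, hP⟩ := TannerGraph.exists_ramProb_randProgram (c := c) (d := d) hc hd hd₀ hd₀' hκ0 hκ1
    rfl ha0.le
  refine ⟨RamProg.randProgram c C₀ d₀, Q, K₁ + K₂, n₀ + 1,
    fun n => Real.exp (-((b' - 2 / d₀) ^ 2 / 4 * (a * n))), ?_, fun n m hn G hG =>
    ⟨TannerGraph.implementsRandDecode_randProgram hc hd₀' (by omega),
      ⟨hQ, fun x => ⟨_, hQrun n m G (by omega) x⟩⟩, fun x y hy hxy => ?_⟩⟩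
  · refine Real.tendsto_exp_neg_atTop_nhds_zero.comp ?_
    exact (tendsto_natCast_atTop_atTop.const_mul_atTop ha0).const_mul_atTop (by positivity)
  · have hG' := hexp n m (by omega) G hG
    have hmain := TannerGraph.mainDecode_eq hs hd₀ hG' ha0 ha1 (by omega) hy hxy
    refine ⟨(hP n m G (by omega) hG' x y hy hxy).trans
      (G.haltProb_mono (some y) (Nat.mul_le_mul_right n (by omega)) _), hmain, ?_⟩
    refine le_antisymm (G.haltProb_le_one (some y) _ _) ?_
    rw [← hQrun n m G (by omega) x, hmain]
    exact G.haltProb_mono (some y) (Nat.mul_le_mul_right n (by omega)) _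

end
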